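/- **Definitions.** Let $\Sigma$ be a finite signature. A *singleton tree grammar* (STG) $G$ over $\Sigma$ has finitely many term nonterminals and context nonterminals and, for each nonterminal, exactly one production, of one of the forms $A\to f(A_1,\dots,A_m)$, $A\to CA'$, $A\to A'$ for term nonterminals, and $C\to[\cdot]$, $C\to C_1C_2$, $C\to f(A_1,\dots,A_{i-1},[\cdot],A_{i+1},\dots,A_m)$ for context nonterminals; it is non-cyclic, so every term nonterminal $A$ generates one ground term $\mathrm{val}(A)$ and every context nonterminal $C$ one context $\mathrm{val}(C)$ (a term with exactly one hole). The size $|G|$ is the number of productions. A term nonterminal *contributes* to $T$ if it can be reached from $T$ by passing from nonterminals to nonterminals in their right-hand sides. Positions are words over the positive integers; a *compressed position* is a nonterminal $P$ of a straight line program (a non-cyclic grammar with one production $P\to P_1P_2$ or $P\to a$ for each nonterminal), standing for the word $\mathrm{val}(P)$ that it generates. **Ground compressed term submatching.** Given two STGs $G_S$, $G_T$ over $\Sigma$ and term nonterminals $S$ of $G_S$ and $T$ of $G_T$, let $s=\mathrm{val}(S)$ and $t=\mathrm{val}(T)$. Compute 1. the list of all term nonterminals $N$ of $G_T$ that contribute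 to $T$ and satisfy $\mathrm{val}(N)=s$; 2. the list of all pairs $(N,P)$, where $N$ contributes to $T$ and has a production $N\to CN'$, and where $P$ is a compressed position such that $\mathrm{val}(P)$ is a proper non-empty prefix of the hole position of $\mathrm{val}(C)$ and the suffix context $c$ of $\mathrm{val}(C)$ at $\mathrm{val}(P)$ satisfies $c[\mathrm{val}(N')]=s$, with exactly one pair for each $N$ that admits such a position; together with a straight line program for the compressed positions. **Theorem.** There is a single word-RAM program (unit-cost addition, truncated subtraction, multiplication, division, indirect load and store, tests for zero) such that for every $r$ there is a constant $c$ with the following property. For every finite signature $\Sigma$ all of whose symbols have arity at most $r$, and all $G_S,S,G_T,T$ over $\Sigma$ as above, the program, run on the list of the productions of the two grammars with words of $O_r(|G_S|+|G_T|+\log|\Sigma|)$ bits and without overflow, solves ground compressed term submatching in at most $c\,|G_T|^2\,|G_S|$ steps. No nonterminal occurs more than once in the two output lists together, so that they have at most $|G_T|$ entries in total; the straight line program for the positions has at most $c\,|G_T|^2$ productions. The positions $q$ of $t$ with $t|_q=s$ are exactly the positions of the occurrences, in the derivation of $t$ from $T$, of the nonterminals $N$ of the first list, and the positions $q'\,\mathrm{val}(P)$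 where $(N,P)$ is in the second list and $q'$ is the position of an occurrence of $N$ in the derivation of $t$. -/

import Mathlib

/-! ### Signatures, ground terms, contexts, positions -/

/-- A finite signature; the function symbols are numbered. -/
structure Sig where
  card : ℕ
  arity : Fin card → ℕ

/-- Ground terms over a signature. -/
inductive Term (F : Sig) : Type
  | app (f : Fin F.card) (args : Fin (F.arity f) → Term F) : Term F

/-- Contexts: ground terms with exactly one hole, given along the path to the hole. In `app f i args c`
the hole lies in the `i`-th argument `c`, and `args` are the other arguments. -/
inductive Ctx (F : Sig) : Type
  | hole : Ctx F
  | app (f : Fin F.card) (i : Fin (F.arity f)) (args : {j // j ≠ i} → Term F) (c : Ctx F) : Ctx F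

namespace Ctx

variable {F : Sig}

/-- `c.fill t` is `c[t]`. -/
def fill : Ctx F → Term F → Term F
  | hole, t => t
  | app f i args c, t => Term.app f fun j => if h : j = i then c.fill t else args ⟨j, h⟩

/-- `c.comp d` is the context `c[d]`. -/
def comp : Ctx F → Ctx F → Ctx F
  | hole, d => d
  | app f i args c, d => app f i args (c.comp d)

/-- The position of the hole, a word over the positive integers. -/
def holePos : Ctx F → List ℕ
  | hole => []
  | app _ i _ c => (i.val + 1) :: c.holePos

end Ctx

/-- The subterm `t|_p` at the position `p` (a word over the positive integers), if `p` is a position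
of `t`. -/
def Term.subtermAt {F : Sig} : Term F → List ℕ → Option (Term F)
  | t, [] => some t
  | .app f args, i :: p =>
      if h : 1 ≤ i ∧ i - 1 < F.arity f then (args ⟨i - 1, h.2⟩).subtermAt p else none

/-! ### Singleton tree grammars -/

/-- Right-hand sides of the productions of term nonterminals: `f(A₁, …, Aₘ)`, `C A` and `A`. -/
inductive TermRhs (F : Sig) (nT nC : ℕ) : Type
  | app (f : Fin F.card) (args : Fin (F.arity f) → Fin nT) : TermRhs F nT nC
  | comp (C : Fin nC) (A : Fin nT) : TermRhs F nT nC
  | lam (A : Fin nT) : TermRhs F nT nC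

/-- Right-hand sides of the productions of context nonterminals: `[·]`, `C₁ C₂` and
`f(A₁, …, [·], …, Aₘ)` with the hole as `i`-th argument. -/
inductive CtxRhs (F : Sig) (nT nC : ℕ) : Type
  | hole : CtxRhs F nT nC
  | comp (C D : Fin nC) : CtxRhs F nT nC
  | app (f : Fin F.card) (i : Fin (F.arity f)) (args : {j // j ≠ i} → Fin nT) : CtxRhs F nT nC

/-- `x.Uses N`: the nonterminal `N` occurs in the right-hand side `x`. Term nonterminals are tagged
by `Sum.inl`, context nonterminals by `Sum.inr`. -/
inductive TermRhs.Uses {F : Sig} {nT nC : ℕ} : TermRhs F nT nC → Fin nT ⊕ Fin nC → Prop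
  | app (f : Fin F.card) (args : Fin (F.arity f) → Fin nT) (j : Fin (F.arity f)) :
      Uses (.app f args) (.inl (args j))
  | compCtx (C : Fin nC) (A : Fin nT) : Uses (.comp C A) (.inr C)
  | compTerm (C : Fin nC) (A : Fin nT) : Uses (.comp C A) (.inl A)
  | lam (A : Fin nT) : Uses (.lam A) (.inl A)

/-- `x.Uses N`: the nonterminal `N` occurs in the right-hand side `x`. -/
inductive CtxRhs.Uses {F : Sig} {nT nC : ℕ} : CtxRhs F nT nC → Fin nT ⊕ Fin nC → Prop
  | compFst (C D : Fin nC) : Uses (.comp C D) (.inr C)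
  | compSnd (C D : Fin nC) : Uses (.comp C D) (.inr D)
  | app (f : Fin F.card) (i : Fin (F.arity f)) (args : {j // j ≠ i} → Fin nT) (j : {j // j ≠ i}) :
      Uses (.app f i args) (.inl (args j))

/-- The relation `N₁ >_G N₂`: the nonterminal `N₂` occurs in the right-hand side of `N₁`. -/
def UsesRel {F : Sig} {nT nC : ℕ} (termProd : Fin nT → TermRhs F nT nC)
    (ctxProd : Fin nC → CtxRhs F nT nC) : Fin nT ⊕ Fin nC → Fin nT ⊕ Fin nC → Prop
  | .inl A, N => (termProd A).Uses N
  | .inr C, N => (ctxProd C).Uses N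

/-- Singleton tree grammars over the signature `F`: every nonterminal has exactly one production, and
the grammar is non-cyclic. -/
structure STG (F : Sig) where
  nT : ℕ
  nC : ℕ
  termProd : Fin nT → TermRhs F nT nC
  ctxProd : Fin nC → CtxRhs F nT nC
  acyclic : ∀ N, ¬ Relation.TransGen (UsesRel termProd ctxProd) N N

/-- A relation without cycles on a finite type is well-founded (in the direction of the recursion on
the right-hand sides). -/
theorem wellFounded_of_acyclic {α : Type} [Finite α] (r : α → α → Prop)
    (h : ∀ a, ¬ Relation.TransGen r a a) : WellFounded (fun a b => r b a) := by
  have hs : Std.Irrefl (fun a b => Relation.TransGen r b a) := ⟨fun a => h a⟩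
  have ht : IsTrans α (fun a b => Relation.TransGen r b a) := ⟨fun _ _ _ hab hbc => hbc.trans hab⟩
  exact Subrelation.wf (fun hab => Relation.TransGen.single hab)
    (Finite.wellFounded_of_trans_of_irrefl (fun a b => Relation.TransGen r b a))

namespace STG

variable {F : Sig}

/-- The nonterminals of `G`. -/
abbrev NT (G : STG F) : Type := Fin G.nT ⊕ Fin G.nC

/-- The relation `>_G` on the nonterminals. -/
def Uses (G : STG F) : G.NT → G.NT → Prop := UsesRel G.termProd G.ctxProd

/-- The size of a grammar: the number of its productions. -/
def size (G : STG F) : ℕ := G.nT + G.nC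

theorem wf (G : STG F) : WellFounded (fun N M : G.NT => G.Uses M N) :=
  wellFounded_of_acyclic _ G.acyclic

mutual

/-- The term `val_G(A)` generated by a term nonterminal. -/
def valT (G : STG F) (A : Fin G.nT) : Term F :=
  match h : G.termProd A with
  | .app f args => .app f fun j => G.valT (args j)
  | .comp C B => (G.valC C).fill (G.valT B)
  | .lam B => G.valT B
termination_by G.wf.wrap (Sum.inl A : G.NT)
decreasing_by
  all_goals
    change (G.termProd A).Uses _
    rw [h]
    constructor

/-- The context `val_G(C)` generated by a context nonterminal. -/
def valC (G : STG F) (C : Fin G.nC) : Ctx F :=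
  match h : G.ctxProd C with
  | .hole => .hole
  | .comp C₁ C₂ => (G.valC C₁).comp (G.valC C₂)
  | .app f i args => .app f i (fun j => G.valT (args j)) .hole
termination_by G.wf.wrap (Sum.inr C : G.NT)
decreasing_by
  all_goals
    change (G.ctxProd C).Uses _
    rw [h]
    constructor

end

/-- The term nonterminal `N` contributes to the term nonterminal `T`. -/
def Contributes (G : STG F) (T N : Fin G.nT) : Prop :=
  Relation.ReflTransGen G.Uses (Sum.inl T) (Sum.inl N)

/-- `G.OccursAt X q N`: in the derivation of the value of the nonterminal `X`, an occurrence of the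
term nonterminal `N` is expanded at the position `q`. -/
inductive OccursAt (G : STG F) : G.NT → List ℕ → Fin G.nT → Prop
  | refl (A : Fin G.nT) : OccursAt G (.inl A) [] A
  | app {A : Fin G.nT} {f : Fin F.card} {args : Fin (F.arity f) → Fin G.nT} (j : Fin (F.arity f))
      {q : List ℕ} {N : Fin G.nT} : G.termProd A = .app f args →
      OccursAt G (.inl (args j)) q N → OccursAt G (.inl A) ((j.val + 1) :: q) N
  | compCtx {A B : Fin G.nT} {C : Fin G.nC} {q : List ℕ} {N : Fin G.nT} :
      G.termProd A = .comp C B → OccursAt G (.inr C) q N → OccursAt G (.inl A) q N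
  | compTerm {A B : Fin G.nT} {C : Fin G.nC} {q : List ℕ} {N : Fin G.nT} :
      G.termProd A = .comp C B → OccursAt G (.inl B) q N →
      OccursAt G (.inl A) ((G.valC C).holePos ++ q) N
  | lam {A B : Fin G.nT} {q : List ℕ} {N : Fin G.nT} :
      G.termProd A = .lam B → OccursAt G (.inl B) q N → OccursAt G (.inl A) q N
  | ctxFst {C C₁ C₂ : Fin G.nC} {q : List ℕ} {N : Fin G.nT} :
      G.ctxProd C = .comp C₁ C₂ → OccursAt G (.inr C₁) q N → OccursAt G (.inr C) q N
  | ctxSnd {C C₁ C₂ : Fin G.nC} {q : List ℕ} {N : Fin G.nT} :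
      G.ctxProd C = .comp C₁ C₂ → OccursAt G (.inr C₂) q N →
      OccursAt G (.inr C) ((G.valC C₁).holePos ++ q) N
  | ctxApp {C : Fin G.nC} {f : Fin F.card} {i : Fin (F.arity f)} {args : {j // j ≠ i} → Fin G.nT}
      (j : {j // j ≠ i}) {q : List ℕ} {N : Fin G.nT} : G.ctxProd C = .app f i args →
      OccursAt G (.inl (args j)) q N → OccursAt G (.inr C) ((j.val.val + 1) :: q) N

end STG

/-! ### Straight line programs -/

/-- Right-hand sides of straight line programs: a letter, or two nonterminals. -/
inductive SLPRhs (α : Type) (n : ℕ) : Type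
  | letter (a : α) : SLPRhs α n
  | pair (A B : Fin n) : SLPRhs α n

/-- `x.Uses N`: the nonterminal `N` occurs in the right-hand side `x`. -/
inductive SLPRhs.Uses {α : Type} {n : ℕ} : SLPRhs α n → Fin n → Prop
  | fst (A B : Fin n) : Uses (.pair A B) A
  | snd (A B : Fin n) : Uses (.pair A B) B

/-- Straight line programs over the alphabet `α`, with `n` productions, one for each nonterminal. -/
structure SLP (α : Type) where
  n : ℕ
  prod : Fin n → SLPRhs α n
  acyclic : ∀ A, ¬ Relation.TransGen (fun A B => (prod A).Uses B) A A

/-- The word generated by a nonterminal of a straight line program. -/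
def SLP.val {α : Type} (P : SLP α) (A : Fin P.n) : List α :=
  match h : P.prod A with
  | .letter a => [a]
  | .pair B C => P.val B ++ P.val C
termination_by (wellFounded_of_acyclic _ P.acyclic).wrap A
decreasing_by
  all_goals
    change (P.prod A).Uses _
    rw [h]
    constructor

/-! ### The output of ground compressed submatching -/

/-- The format of the output: a list `full` of term nonterminals, a list `split` of pairs of a term
nonterminal and a compressed position, and the straight line program `pos` over the positive integers
whose nonterminals are the compressed positions. -/
structure SubmatchOutput {F : Sig} (G : STG F) where
  pos : SLP ℕ
  full : List (Fin G.nT)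
  split : List (Fin G.nT × Fin pos.n)

/-- `O` is the complete solution of the submatching problem for the ground pattern `s` and the text
`val_G(T)`. -/
structure SubmatchOutput.Correct {F : Sig} {G : STG F} (O : SubmatchOutput G) (s : Term F)
    (T : Fin G.nT) : Prop where
  /-- Every nonterminal is listed at most once. -/
  nodup : (O.full ++ O.split.map Prod.fst).Nodup
  /-- `full` lists the contributing term nonterminals that generate `s`. -/
  mem_full : ∀ N, N ∈ O.full ↔ G.Contributes T N ∧ G.valT N = s
  /-- `split` lists the pairs of a contributing term nonterminal `N` with a production `N → C N'` and
  a position `p` such that `c₂[val(N')] = s` for the suffix context `c₂` of `val(C)` at `p`, where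
  `p` is neither the root nor the hole of `val(C)`. -/
  mem_split : ∀ N p, (∃ P, (N, P) ∈ O.split ∧ O.pos.val P = p) ↔
    G.Contributes T N ∧ ∃ C N', G.termProd N = .comp C N' ∧
      ∃ c₁ c₂ : Ctx F, G.valC C = c₁.comp c₂ ∧ c₁ ≠ .hole ∧ c₂ ≠ .hole ∧ c₁.holePos = p ∧
        c₂.fill (G.valT N') = s
  /-- The positions at which `s` is a subterm are those that the two lists represent. -/
  positions : ∀ q, (G.valT T).subtermAt q = some s ↔
    (∃ N ∈ O.full, G.OccursAt (.inl T) q N) ∨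
      ∃ x ∈ O.split, ∃ q', G.OccursAt (.inl T) q' x.1 ∧ q = q' ++ O.pos.val x.2

/-! ### Word random access machines -/

/-- The arithmetic instructions (subtraction is truncated, division is rounded down). -/
inductive RAMOp : Type
  | add | sub | mul | div

def RAMOp.eval : RAMOp → ℕ → ℕ → ℕ
  | add, a, b => a + b
  | sub, a, b => a - b
  | mul, a, b => a * b
  | div, a, b => a / b

/-- Programs of a random access machine, with structured control. Registers are numbered. -/
inductive RAMProg : Type
  | skip : RAMProg
  | const (x : ℕ) (v : ℕ) : RAMProg
  | op (o : RAMOp) (x y z : ℕ) : RAMProg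
  | load (x a : ℕ) : RAMProg
  | store (a x : ℕ) : RAMProg
  | seq (p q : RAMProg) : RAMProg
  | ite (x : ℕ) (p q : RAMProg) : RAMProg
  | while (x : ℕ) (p : RAMProg) : RAMProg

/-- A state: the contents of the registers and of the memory cells. -/
structure RAMState where
  reg : ℕ → ℕ
  mem : ℕ → ℕ

def RAMState.setReg (σ : RAMState) (x v : ℕ) : RAMState := ⟨Function.update σ.reg x v, σ.mem⟩

def RAMState.setMem (σ : RAMState) (a v : ℕ) : RAMState := ⟨σ.reg, Function.update σ.mem a v⟩

/-- `RAMExec w p σ t σ'`: on words of `w` bits, the program `p` started in the state `σ` halts after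
`t` steps in the state `σ'`. Every instruction and every test counts as one step. A program gets stuck
when it computes a number that does not fit into a word. -/
inductive RAMExec (w : ℕ) : RAMProg → RAMState → ℕ → RAMState → Prop
  | skip (σ : RAMState) : RAMExec w .skip σ 1 σ
  | const (x v : ℕ) (σ : RAMState) : v < 2 ^ w → RAMExec w (.const x v) σ 1 (σ.setReg x v)
  | op (o : RAMOp) (x y z : ℕ) (σ : RAMState) : o.eval (σ.reg y) (σ.reg z) < 2 ^ w →
      RAMExec w (.op o x y z) σ 1 (σ.setReg x (o.eval (σ.reg y) (σ.reg z)))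
  | load (x a : ℕ) (σ : RAMState) : RAMExec w (.load x a) σ 1 (σ.setReg x (σ.mem (σ.reg a)))
  | store (a x : ℕ) (σ : RAMState) : RAMExec w (.store a x) σ 1 (σ.setMem (σ.reg a) (σ.reg x))
  | seq {p q : RAMProg} {σ σ₁ σ₂ : RAMState} {t₁ t₂ : ℕ} :
      RAMExec w p σ t₁ σ₁ → RAMExec w q σ₁ t₂ σ₂ → RAMExec w (.seq p q) σ (t₁ + t₂) σ₂
  | iteTrue {x : ℕ} {p q : RAMProg} {σ σ' : RAMState} {t : ℕ} :
      σ.reg x ≠ 0 → RAMExec w p σ t σ' → RAMExec w (.ite x p q) σ (t + 1) σ'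
  | iteFalse {x : ℕ} {p q : RAMProg} {σ σ' : RAMState} {t : ℕ} :
      σ.reg x = 0 → RAMExec w q σ t σ' → RAMExec w (.ite x p q) σ (t + 1) σ'
  | whileFalse {x : ℕ} {p : RAMProg} {σ : RAMState} :
      σ.reg x = 0 → RAMExec w (.while x p) σ 1 σ
  | whileTrue {x : ℕ} {p : RAMProg} {σ σ₁ σ₂ : RAMState} {t₁ t₂ : ℕ} :
      σ.reg x ≠ 0 → RAMExec w p σ t₁ σ₁ → RAMExec w (.while x p) σ₁ t₂ σ₂ →
      RAMExec w (.while x p) σ (t₁ + t₂ + 1) σ₂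

/-- The initial state: the input is in the first memory cells, everything else is zero. -/
def RAMState.init (input : List ℕ) : RAMState := ⟨fun _ => 0, fun a => input.getD a 0⟩

/-- In the state `σ` the list `L` is stored in consecutive memory cells, from the address in
register `0` on. -/
def RAMState.HasOutput (σ : RAMState) (L : List ℕ) : Prop :=
  ∀ i (h : i < L.length), σ.mem (σ.reg 0 + i) = L[i]

/-! ### Encodings of the input and the output as lists of words -/

def TermRhs.encode {F : Sig} {nT nC : ℕ} : TermRhs F nT nC → List ℕ
  | app f args => 0 :: f.val :: F.arity f :: List.ofFn fun j => (args j).val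
  | comp C A => [1, C.val, A.val]
  | lam A => [2, A.val]

/-- In the last case the hole is the `i`-th argument; its entry in the list of arguments is `0`. -/
def CtxRhs.encode {F : Sig} {nT nC : ℕ} : CtxRhs F nT nC → List ℕ
  | hole => [0]
  | comp C D => [1, C.val, D.val]
  | app f i args => 2 :: f.val :: F.arity f :: i.val ::
      List.ofFn fun j => if h : j = i then 0 else (args ⟨j, h⟩).val

/-- A grammar together with one of its term nonterminals: the latter, the numbers of nonterminals, and
all productions. -/
def STG.encode {F : Sig} (G : STG F) (A : Fin G.nT) : List ℕ :=
  A.val :: G.nT :: G.nC :: ((List.ofFn fun B => (G.termProd B).encode).flatten ++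
    (List.ofFn fun C => (G.ctxProd C).encode).flatten)

def SLPRhs.encode {n : ℕ} : SLPRhs ℕ n → List ℕ
  | letter a => [0, a]
  | pair A B => [1, A.val, B.val]

/-- The lengths of the two lists, the number of productions of the straight line program, the two
lists, and the productions. -/
def SubmatchOutput.encode {F : Sig} {G : STG F} (O : SubmatchOutput G) : List ℕ :=
  O.full.length :: O.split.length :: O.pos.n ::
    (O.full.map Fin.val ++ (O.split.map fun x => [x.1.val, x.2.val]).flatten ++
      (List.ofFn fun P => (O.pos.prod P).encode).flatten)

/-!
A term is determined by its preorder word, because the arities are known; hence `t|_q = s` holds iff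
the preorder word of `s` occurs in that of `t` at the offset that belongs to `q`. A grammar yields a
straight line program for the preorder words: a term nonterminal stands for one word, a context
nonterminal for the two words before and behind its hole. All words are nodes of one pool, in which a
node is a letter or a pair of earlier nodes (`wd`). A node has as many letters as a term has function
symbols, which may be exponential in the size of the grammar, so that a length needs
`O(|G_S| + |G_T|)` bits.

For a pattern node `u` and a text node `k`, the occurrences of the word of `u` in the word of `k` across
the cut between the two children of `k` form an arithmetic progression (`cross_step`, a consequence of
the theorem of Fine and Wilf). The table of these progressions is filled row by row (`table_spec`).
If `u` has the children `a` and `b`, an occurrence of `u` consists of adjacent occurrences of `a` and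
`b`, and one of the two, or the point where they meet, lies across the cut. Suppose that it is
the occurrence of `a`. The candidates come from the row of `a`, and have to be filtered by the condition
that `b` occurs behind them (`filter`). The text between the candidates has their gap as its period, so
that all candidates with `b` on one side of a pivot are tested by one query. The occurrences of `b`
across the pivot form a second progression (`search`); if it has the same gap, again one query is
enough, and otherwise only its two extremal members can be adjacent to a candidate (`crossing_left`,
`crossing_right`). Each entry takes `O(|G_T|)` steps, so that the table costs `O(|G_T|² |G_S|)`. The
filled table answers in `O(|G_T|)` steps whether a word occurs in another one at a given offset
(`occ_spec`).

Every occurrence of `s` in `t` is represented by a nonterminal `N` that generates `s` or whose production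
`N → C N'` splits the context of `C` (`exists_represents`, `correct_of_lists`). For the former,
`val N = s` is a comparison of words. For the latter, the number of function symbols of `s` determines
the position in `C` at which the suffix context must start: a descent in the productions of `C` finds it
and builds its compressed position (`descend_spec`), and a query to the table decides whether it splits
off `s` (`reportAll_spec`).

The program is written in a small language with variables and arrays. Its runs are simulated by the
machine with a constant factor (`Run.compile`), and its commands are specified by weakest
preconditions (`WP`). The specification of the whole program is `main_spec`.
-/

set_option linter.constructorNameAsVariable false

/-! ### A structured language over variables and arrays, and its compilation -/

namespace Submatch

/-- The program variables. -/
inductive Var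
  | ret | sz | p | g | go | tEnd | gEnd | root | tag | kd | sy | nlv | nc | b | o1 | o2 | ln | q | j
  | sp | x | u | v | res | nn | np | l | r | c1 | c2
  | cf | cl | cc | cp | lo | hi | k1 | k2 | off
  | af | al | ac | rf | rl | rc | zp
  | m | pu | tj | py | k | yr | d | ok | xr | bx | sh | qf | qp | qc | xp
  | i | jj | pa | pb | sR | ps | row | xf | xl | xc | cut
  | nf | ns | w | kk | cur | path | oo
  deriving DecidableEq

/-- The arrays. The array `inp` holds the input. -/
inductive Arr
  | inp | kind | sym | nl | nch | chp | ch | st | stk | L | R | len | WL | WR | hp | PL | PR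
  | X0 | X1 | XC | full | spN | spP | out
  deriving DecidableEq

/-- The register of a variable. -/
def Var.idx (x : Var) : ℕ := x.ctorIdx

/-- The number of the memory block of an array. -/
def Arr.idx (a : Arr) : ℕ := a.ctorIdx

theorem Var.idx_inj {x y : Var} (h : x.idx = y.idx) : x = y := by
  have h1 : ∀ z : Var, Var.ofNat z.idx = z := by intro z; cases z <;> rfl
  rw [← h1 x, ← h1 y, h]

theorem Arr.idx_inj {x y : Arr} (h : x.idx = y.idx) : x = y := by
  have h1 : ∀ z : Arr, Arr.ofNat z.idx = z := by intro z; cases z <;> rfl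
  rw [← h1 x, ← h1 y, h]

theorem Var.idx_lt (x : Var) : x.idx < 128 := by cases x <;> decide

theorem Arr.idx_lt (x : Arr) : x.idx < 32 := by cases x <;> decide

/-- Expressions. -/
inductive Ex
  | lit (n : ℕ)
  | var (x : Var)
  | get (a : Arr) (e : Ex)
  | bin (o : RAMOp) (e f : Ex)

instance : Coe Var Ex := ⟨Ex.var⟩
instance : CoeFun Arr fun _ => Ex → Ex := ⟨Ex.get⟩
instance (n : ℕ) : OfNat Ex n := ⟨Ex.lit n⟩
instance : Add Ex := ⟨Ex.bin .add⟩
instance : Sub Ex := ⟨Ex.bin .sub⟩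
instance : Mul Ex := ⟨Ex.bin .mul⟩
instance : Div Ex := ⟨Ex.bin .div⟩

/-- Commands: assignment, assignment to an array cell, and structured control. -/
inductive Cmd
  | skip
  | assign (x : Var) (e : Ex)
  | store (a : Arr) (e f : Ex)
  | seq (c d : Cmd)
  | ite (e : Ex) (c d : Cmd)
  | while (e : Ex) (c : Cmd)

infixr:60 " ;; " => Cmd.seq
infix:62 " ≔ " => Cmd.assign

/-- States of the structured language. -/
structure St where
  v : Var → ℕ
  A : Arr → ℕ → ℕ

/-- Assignment to a variable. -/
def St.set (σ : St) (x : Var) (n : ℕ) : St := ⟨fun y => if y = x then n else σ.v y, σ.A⟩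

/-- Assignment to an array cell. -/
def St.put (σ : St) (a : Arr) (k n : ℕ) : St :=
  ⟨σ.v, fun b m => if b = a then (if m = k then n else σ.A a m) else σ.A b m⟩

@[simp] theorem St.set_v (σ : St) (x y : Var) (n : ℕ) :
    (σ.set x n).v y = if y = x then n else σ.v y := rfl
@[simp] theorem St.set_A (σ : St) (x : Var) (n : ℕ) : (σ.set x n).A = σ.A := rfl
@[simp] theorem St.set_set (σ : St) (x : Var) (m n : ℕ) : (σ.set x m).set x n = σ.set x n := by
  simp only [St.set]; congr 1; funext y; split_ifs <;> rfl
theorem St.put_A (σ : St) (a b : Arr) (k n : ℕ) :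
    (σ.put a k n).A b = if b = a then Function.update (σ.A a) k n else σ.A b := by
  funext m; simp only [St.put]; split_ifs <;> simp [*]
@[simp] theorem St.put_A_same (σ : St) (a : Arr) (k n : ℕ) :
    (σ.put a k n).A a = Function.update (σ.A a) k n := by simp [St.put_A]
@[simp] theorem St.put_A_ne (σ : St) {a b : Arr} (k n : ℕ) (h : b ≠ a) :
    (σ.put a k n).A b = σ.A b := by simp [St.put_A, h]

/-- The parameters of an execution: the word length `w`, the number `M = 2 ^ w` of words, and the
length `SZ` of the memory block of an array. -/
structure Env where
  w : ℕ
  SZ : ℕ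
  M : ℕ
  hM : M = 2 ^ w
  hw : 32 < M
  hSZ : 32 * SZ ≤ M

/-- The value of an expression. -/
def Ex.ev (σ : St) : Ex → ℕ
  | lit n => n
  | var x => σ.v x
  | get a e => σ.A a (e.ev σ)
  | bin o e f => o.eval (e.ev σ) (f.ev σ)

/-- The evaluation of the expression neither overflows nor leaves the array blocks. The base
addresses are computed from the variable `sz`; the input is readable before `sz` is set. -/
def Ex.ok (E : Env) (σ : St) : Ex → Prop
  | lit n => n < E.M
  | var _ => True
  | get a e => e.ok E σ ∧ e.ev σ < E.SZ ∧ (a = .inp ∨ σ.v .sz = E.SZ)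
  | bin o e f => e.ok E σ ∧ f.ok E σ ∧ o.eval (e.ev σ) (f.ev σ) < E.M

/-- `Run E c σ t σ'`: the command `c` leads from `σ` to `σ'` in `t` elementary steps. -/
inductive Run (E : Env) : Cmd → St → ℕ → St → Prop
  | skip (σ : St) : Run E .skip σ 1 σ
  | assign {x : Var} {e : Ex} {σ : St} : e.ok E σ → Run E (.assign x e) σ 1 (σ.set x (e.ev σ))
  | store {a : Arr} {e f : Ex} {σ : St} : e.ok E σ → f.ok E σ → e.ev σ < E.SZ → σ.v .sz = E.SZ →
      Run E (.store a e f) σ 1 (σ.put a (e.ev σ) (f.ev σ))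
  | seq {c d : Cmd} {σ σ1 σ2 : St} {t1 t2 : ℕ} : Run E c σ t1 σ1 → Run E d σ1 t2 σ2 →
      Run E (.seq c d) σ (t1 + t2) σ2
  | iteTrue {e : Ex} {c d : Cmd} {σ σ' : St} {t : ℕ} : e.ok E σ → e.ev σ ≠ 0 → Run E c σ t σ' →
      Run E (.ite e c d) σ (t + 1) σ'
  | iteFalse {e : Ex} {c d : Cmd} {σ σ' : St} {t : ℕ} : e.ok E σ → e.ev σ = 0 → Run E d σ t σ' →
      Run E (.ite e c d) σ (t + 1) σ'
  | whileFalse {e : Ex} {c : Cmd} {σ : St} : e.ok E σ → e.ev σ = 0 → Run E (.while e c) σ 1 σ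
  | whileTrue {e : Ex} {c : Cmd} {σ σ1 σ2 : St} {t1 t2 : ℕ} : e.ok E σ → e.ev σ ≠ 0 →
      Run E c σ t1 σ1 → Run E (.while e c) σ1 t2 σ2 → Run E (.while e c) σ (t1 + t2 + 1) σ2

/-! ### Compilation -/

/-- Code that evaluates an expression into the register `d`, using only registers from `d` on as
scratch registers. -/
def Ex.compile : Ex → ℕ → RAMProg
  | lit n, d => .const d n
  | var x, d => .seq (.const d 0) (.op .add d x.idx d)
  | get a e, d => .seq (e.compile d) (.seq (.const (d + 1) a.idx)
      (.seq (.op .mul (d + 1) (d + 1) Var.sz.idx) (.seq (.op .add d d (d + 1)) (.load d d))))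
  | bin o e f, d => .seq (e.compile d) (.seq (f.compile (d + 1)) (.op o d d (d + 1)))

/-- The running time of the code of an expression. -/
def Ex.cost : Ex → ℕ
  | lit _ => 1
  | var _ => 2
  | get _ e => e.cost + 4
  | bin _ e f => e.cost + f.cost + 1

/-- The code of a command. -/
def Cmd.compile : Cmd → RAMProg
  | skip => .skip
  | assign x e => .seq (e.compile 128) (.seq (.const 129 0) (.op .add x.idx 128 129))
  | store a e f => .seq (e.compile 128) (.seq (.const 129 a.idx)
      (.seq (.op .mul 129 129 Var.sz.idx) (.seq (.op .add 128 128 129)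
        (.seq (f.compile 129) (.store 128 129)))))
  | seq c d => .seq c.compile d.compile
  | ite e c d => .seq (e.compile 128) (.ite 128 c.compile d.compile)
  | .while e c => .seq (e.compile 128) (.while 128 (.seq c.compile (e.compile 128)))

/-- A bound for the number of machine steps per elementary step. -/
def Cmd.cost : Cmd → ℕ
  | skip => 1
  | assign _ e => e.cost + 2
  | store _ e f => e.cost + f.cost + 4
  | seq c d => c.cost + d.cost
  | ite e c d => e.cost + c.cost + d.cost + 1
  | .while e c => e.cost + c.cost + 1

/-- The machine state `ρ` represents the state `σ`. -/
structure Rel (E : Env) (ρ : RAMState) (σ : St) : Prop where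
  reg : ∀ x : Var, ρ.reg x.idx = σ.v x
  mem : ∀ (a : Arr) (k : ℕ), k < E.SZ → ρ.mem (a.idx * E.SZ + k) = σ.A a k
  reg_lt : ∀ x : Var, σ.v x < E.M
  mem_lt : ∀ (a : Arr) (k : ℕ), k < E.SZ → σ.A a k < E.M

variable {E : Env}

theorem Arr.base_lt (a : Arr) : a.idx * E.SZ + E.SZ ≤ E.M := by
  have := Nat.mul_le_mul_right E.SZ (show a.idx + 1 ≤ 32 from a.idx_lt)
  have := E.hSZ
  linarith

theorem Ex.ev_lt {e : Ex} {ρ : RAMState} {σ : St} (hR : Rel E ρ σ) (h : e.ok E σ) :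
    e.ev σ < E.M := by
  cases e with
  | lit n => exact h
  | var x => exact hR.reg_lt x
  | get a e => exact hR.mem_lt a _ h.2.1
  | bin o e f => exact h.2.2

theorem Rel.setReg {ρ : RAMState} {σ : St} (hR : Rel E ρ σ) {d : ℕ} (hd : 128 ≤ d) (v : ℕ) :
    Rel E (ρ.setReg d v) σ := by
  refine ⟨fun x => ?_, hR.mem, hR.reg_lt, hR.mem_lt⟩
  have := x.idx_lt
  simp only [RAMState.setReg]
  rw [Function.update_of_ne (by omega)]
  exact hR.reg x

theorem setReg_same (ρ : RAMState) (d v : ℕ) : (ρ.setReg d v).reg d = v := by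
  simp [RAMState.setReg]

theorem setReg_ne (ρ : RAMState) {d y : ℕ} (v : ℕ) (h : y ≠ d) :
    (ρ.setReg d v).reg y = ρ.reg y := by
  simp [RAMState.setReg, h]

theorem exec_const {x v : ℕ} {σ : RAMState} (h : v < E.M) :
    RAMExec E.w (.const x v) σ 1 (σ.setReg x v) := .const x v σ (by rw [← E.hM]; exact h)

theorem exec_op {o : RAMOp} {x y z v : ℕ} {σ : RAMState} (hv : o.eval (σ.reg y) (σ.reg z) = v)
    (h : v < E.M) : RAMExec E.w (.op o x y z) σ 1 (σ.setReg x v) := by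
  subst hv
  exact .op o x y z σ (by rw [← E.hM]; exact h)

theorem exec_load {x a v : ℕ} {σ : RAMState} (hv : σ.mem (σ.reg a) = v) :
    RAMExec E.w (.load x a) σ 1 (σ.setReg x v) := by
  subst hv
  exact .load x a σ

/-- The code of `e` puts the value of `e` into the register `d` and leaves the lower registers alone. -/
theorem Ex.compile_correct (e : Ex) : ∀ (d : ℕ) (ρ : RAMState) (σ : St), 128 ≤ d → Rel E ρ σ →
    e.ok E σ → ∃ ρ', RAMExec E.w (e.compile d) ρ e.cost ρ' ∧ Rel E ρ' σ ∧ ρ'.reg d = e.ev σ ∧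
      (∀ y, y < d → ρ'.reg y = ρ.reg y) := by
  induction e with
  | lit n =>
    intro d ρ σ hd hR hok
    exact ⟨_, exec_const hok, hR.setReg hd _, setReg_same .., fun y hy => setReg_ne _ _ hy.ne⟩
  | var x =>
    intro d ρ σ hd hR hok
    have hx := x.idx_lt
    have hw := E.hw
    have h1 : RAMExec E.w (.op .add d x.idx d) (ρ.setReg d 0) 1 _ :=
      exec_op (v := σ.v x) (by
        rw [setReg_same, setReg_ne _ _ (by omega), hR.reg]; rfl) (hR.reg_lt x)
    refine ⟨_, .seq (exec_const (by omega)) h1, (hR.setReg hd _).setReg hd _, setReg_same .., ?_⟩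
    intro y hy
    rw [setReg_ne _ _ hy.ne, setReg_ne _ _ hy.ne]
  | get a e ih =>
    intro d ρ σ hd hR hok
    obtain ⟨hok, hlt, hsz⟩ := hok
    obtain ⟨ρ1, he, hR1, hv, hy⟩ := ih d ρ σ hd hR hok
    have ha := a.base_lt (E := E)
    have hw := E.hw
    have ha32 := a.idx_lt
    have hz := Var.idx_lt .sz
    have hmul : a.idx * ρ1.reg Var.sz.idx = a.idx * E.SZ := by
      rcases hsz with rfl | h
      · simp [Arr.idx, Arr.ctorIdx]
      · rw [hR1.reg, h]
    have h1 : RAMExec E.w (.op .mul (d + 1) (d + 1) Var.sz.idx) (ρ1.setReg (d + 1) a.idx) 1 _ :=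
      exec_op (v := a.idx * E.SZ) (by
        rw [setReg_same, setReg_ne _ _ (by omega)]; exact hmul) (by omega)
    have h2 : RAMExec E.w (.op .add d d (d + 1))
        ((ρ1.setReg (d + 1) a.idx).setReg (d + 1) (a.idx * E.SZ)) 1 _ :=
      exec_op (v := a.idx * E.SZ + e.ev σ) (by
        rw [setReg_same, setReg_ne _ _ (by omega), setReg_ne _ _ (by omega), hv]
        exact Nat.add_comm ..) (by omega)
    have h3 : RAMExec E.w (.load d d) (((ρ1.setReg (d + 1) a.idx).setReg (d + 1)
        (a.idx * E.SZ)).setReg d (a.idx * E.SZ + e.ev σ)) 1 _ :=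
      exec_load (v := σ.A a (e.ev σ)) (by
        rw [setReg_same]; exact hR1.mem a _ hlt)
    refine ⟨_, .seq he (.seq (exec_const (by omega)) (.seq h1 (.seq h2 h3))),
      (((hR1.setReg (by omega) _).setReg (by omega) _).setReg hd _).setReg hd _,
      setReg_same .., ?_⟩
    intro y hy'
    rw [setReg_ne _ _ (by omega), setReg_ne _ _ (by omega), setReg_ne _ _ (by omega),
      setReg_ne _ _ (by omega), hy y hy']
  | bin o e f ihe ihf =>
    intro d ρ σ hd hR hok
    obtain ⟨hoke, hokf, hlt⟩ := hok
    obtain ⟨ρ1, he, hR1, hv1, hy1⟩ := ihe d ρ σ hd hR hoke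
    obtain ⟨ρ2, hf, hR2, hv2, hy2⟩ := ihf (d + 1) ρ1 σ (by omega) hR1 hokf
    have h1 : RAMExec E.w (.op o d d (d + 1)) ρ2 1 _ :=
      exec_op (v := o.eval (e.ev σ) (f.ev σ)) (by rw [hv2, hy2 d (by omega), hv1]) hlt
    have h2 := RAMExec.seq he (.seq hf h1)
    rw [← Nat.add_assoc] at h2
    refine ⟨_, h2, hR2.setReg hd _, setReg_same .., ?_⟩
    intro y hy
    rw [setReg_ne _ _ hy.ne, hy2 y (by omega), hy1 y hy]

theorem Rel.assign {ρ : RAMState} {σ : St} (hR : Rel E ρ σ) (x : Var) {v : ℕ} (hv : v < E.M) :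
    Rel E (ρ.setReg x.idx v) (σ.set x v) := by
  refine ⟨fun y => ?_, hR.mem, fun y => ?_, hR.mem_lt⟩
  · rw [St.set_v]
    split_ifs with h
    · rw [h, setReg_same]
    · rw [setReg_ne _ _ (fun h' => h (Var.idx_inj h')), hR.reg]
  · rw [St.set_v]
    split_ifs with h
    · exact hv
    · exact hR.reg_lt y

theorem Rel.put {ρ : RAMState} {σ : St} (hR : Rel E ρ σ) (a : Arr) {k v : ℕ} (hk : k < E.SZ)
    (hv : v < E.M) : Rel E (ρ.setMem (a.idx * E.SZ + k) v) (σ.put a k v) := by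
  refine ⟨hR.reg, fun b m hm => ?_, hR.reg_lt, fun b m hm => ?_⟩
  · rw [St.put_A, RAMState.setMem]
    split_ifs with h
    · subst h
      by_cases h : m = k
      · simp [h]
      · simp [h, hR.mem b m hm]
    · have h' : b.idx ≠ a.idx := fun h' => h (Arr.idx_inj h')
      have : b.idx * E.SZ + m ≠ a.idx * E.SZ + k := by
        rcases lt_or_gt_of_ne h' with h1 | h1
        · have := Nat.mul_le_mul_right E.SZ (Nat.succ_le_of_lt h1)
          rw [Nat.succ_mul] at this
          omega
        · have := Nat.mul_le_mul_right E.SZ (Nat.succ_le_of_lt h1)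
          rw [Nat.succ_mul] at this
          omega
      simp [this, hR.mem b m hm]
  · rw [St.put_A]
    split_ifs with h
    · by_cases h : m = k
      · simpa [h] using hv
      · simpa [h] using hR.mem_lt a m hm
    · exact hR.mem_lt b m hm

/-- A run of a command is simulated by its code. -/
theorem Run.compile {c : Cmd} {σ σ' : St} {t : ℕ} (h : Run E c σ t σ') :
    ∀ ρ, Rel E ρ σ → ∃ t' ρ', RAMExec E.w c.compile ρ t' ρ' ∧ Rel E ρ' σ' ∧ t' ≤ c.cost * t := by
  have hw := E.hw
  -- the loop of a compiled `while`, started after the evaluation of its condition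
  suffices H : ∀ ρ, Rel E ρ σ → (∃ t' ρ', RAMExec E.w c.compile ρ t' ρ' ∧ Rel E ρ' σ' ∧
      t' ≤ c.cost * t) ∧ ∀ e d, c = .while e d → ∀ ρ, Rel E ρ σ → ρ.reg 128 = e.ev σ →
      ∃ t' ρ', RAMExec E.w (.while 128 (.seq d.compile (e.compile 128))) ρ t' ρ' ∧ Rel E ρ' σ' ∧
        t' + e.cost ≤ c.cost * t from fun ρ hρ => (H ρ hρ).1
  induction h with
  | skip σ => exact fun ρ hR => ⟨⟨1, ρ, .skip _, hR, le_rfl⟩, by simp⟩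
  | @assign x e σ hok =>
    refine fun ρ hR => ⟨?_, by simp⟩
    obtain ⟨ρ1, he, hR1, hv1, hy1⟩ := e.compile_correct 128 ρ σ le_rfl hR hok
    have hlt := Ex.ev_lt hR hok
    have h1 : RAMExec E.w (.op .add x.idx 128 129) (ρ1.setReg 129 0) 1 _ :=
      exec_op (v := e.ev σ) (by rw [setReg_same, setReg_ne _ _ (by omega), hv1]; rfl) hlt
    exact ⟨_, _, .seq he (.seq (exec_const (by omega)) h1),
      (hR1.setReg (by omega) _).assign x hlt, by simp [Cmd.cost]⟩
  | @store a e f σ hoke hokf hlt hsz =>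
    refine fun ρ hR => ⟨?_, by simp⟩
    obtain ⟨ρ1, he, hR1, hv1, hy1⟩ := e.compile_correct 128 ρ σ le_rfl hR hoke
    have ha := a.base_lt (E := E)
    have ha32 := a.idx_lt
    have hz := Var.idx_lt .sz
    have h1 : RAMExec E.w (.op .mul 129 129 Var.sz.idx) (ρ1.setReg 129 a.idx) 1 _ :=
      exec_op (v := a.idx * E.SZ) (by
        rw [setReg_same, setReg_ne _ _ (by omega), hR1.reg, hsz]; rfl) (by omega)
    have h2 : RAMExec E.w (.op .add 128 128 129)
        ((ρ1.setReg 129 a.idx).setReg 129 (a.idx * E.SZ)) 1 _ :=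
      exec_op (v := a.idx * E.SZ + e.ev σ) (by
        rw [setReg_same, setReg_ne _ _ (by omega), setReg_ne _ _ (by omega), hv1]
        exact Nat.add_comm ..) (by omega)
    obtain ⟨ρ2, hf, hR2, hv2, hy2⟩ := f.compile_correct 129 (((ρ1.setReg 129 a.idx).setReg 129
      (a.idx * E.SZ)).setReg 128 (a.idx * E.SZ + e.ev σ)) σ (by omega)
      (((hR1.setReg (by omega) _).setReg (by omega) _).setReg le_rfl _) hokf
    have h3 : RAMExec E.w (.store 128 129) ρ2 1 (ρ2.setMem (a.idx * E.SZ + e.ev σ) (f.ev σ)) := by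
      have := RAMExec.store (w := E.w) 128 129 ρ2
      rwa [hv2, hy2 128 (by omega), setReg_same] at this
    refine ⟨_, _, .seq he (.seq (exec_const (by omega)) (.seq h1 (.seq h2 (.seq hf h3)))),
      hR2.put a hlt (Ex.ev_lt hR hokf), ?_⟩
    simp only [Cmd.cost]; omega
  | @seq c d σ σ1 σ2 t1 t2 _ _ ih1 ih2 =>
    refine fun ρ hR => ⟨?_, by simp⟩
    obtain ⟨⟨s1, ρ1, h1, hR1, hs1⟩, -⟩ := ih1 ρ hR
    obtain ⟨⟨s2, ρ2, h2, hR2, hs2⟩, -⟩ := ih2 ρ1 hR1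
    refine ⟨_, _, .seq h1 h2, hR2, ?_⟩
    simp only [Cmd.cost]; nlinarith
  | @iteTrue e c d σ σ' t hok hne _ ih =>
    refine fun ρ hR => ⟨?_, by simp⟩
    obtain ⟨ρ1, he, hR1, hv1, hy1⟩ := e.compile_correct 128 ρ σ le_rfl hR hok
    obtain ⟨⟨s1, ρ2, h1, hR2, hs1⟩, -⟩ := ih ρ1 hR1
    refine ⟨_, _, .seq he (.iteTrue (by rw [hv1]; exact hne) h1), hR2, ?_⟩
    simp only [Cmd.cost]; nlinarith
  | @iteFalse e c d σ σ' t hok hne _ ih =>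
    refine fun ρ hR => ⟨?_, by simp⟩
    obtain ⟨ρ1, he, hR1, hv1, hy1⟩ := e.compile_correct 128 ρ σ le_rfl hR hok
    obtain ⟨⟨s1, ρ2, h1, hR2, hs1⟩, -⟩ := ih ρ1 hR1
    refine ⟨_, _, .seq he (.iteFalse (by rw [hv1]; exact hne) h1), hR2, ?_⟩
    simp only [Cmd.cost]; nlinarith
  | @whileFalse e c σ hok h0 =>
    refine fun ρ hR => ⟨?_, ?_⟩
    · obtain ⟨ρ1, he, hR1, hv1, hy1⟩ := e.compile_correct 128 ρ σ le_rfl hR hok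
      refine ⟨_, _, .seq he (.whileFalse (by rw [hv1]; exact h0)), hR1, ?_⟩
      simp only [Cmd.cost]; omega
    · rintro _ _ ⟨rfl, rfl⟩ ρ hR hv
      refine ⟨_, _, .whileFalse (by rw [hv]; exact h0), hR, ?_⟩
      simp only [Cmd.cost]; omega
  | @whileTrue e c σ σ1 σ2 t1 t2 hok hne _ hloop ih1 ih2 =>
    have key : ∀ ρ, Rel E ρ σ → ρ.reg 128 = e.ev σ → ∃ t' ρ',
        RAMExec E.w (.while 128 (.seq c.compile (e.compile 128))) ρ t' ρ' ∧ Rel E ρ' σ2 ∧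
        t' + e.cost ≤ (Cmd.while e c).cost * (t1 + t2 + 1) := by
      intro ρ hR hv
      obtain ⟨⟨s1, ρ1, h1, hR1, hs1⟩, -⟩ := ih1 ρ hR
      have hok1 : e.ok E σ1 := by cases hloop <;> assumption
      obtain ⟨ρ2, he, hR2, hv2, hy2⟩ := e.compile_correct 128 ρ1 σ1 le_rfl hR1 hok1
      obtain ⟨-, h3⟩ := ih2 ρ2 hR2
      obtain ⟨s2, ρ3, h3, hR3, hs2⟩ := h3 e c rfl ρ2 hR2 hv2
      refine ⟨_, _, .whileTrue (by rw [hv]; exact hne) (.seq h1 he) h3, hR3, ?_⟩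
      simp only [Cmd.cost] at hs2 ⊢; nlinarith
    refine fun ρ hR => ⟨?_, ?_⟩
    · obtain ⟨ρ1, he, hR1, hv1, hy1⟩ := e.compile_correct 128 ρ σ le_rfl hR hok
      obtain ⟨s, ρ2, h1, hR2, hs⟩ := key ρ1 hR1 hv1
      refine ⟨_, _, .seq he h1, hR2, ?_⟩
      omega
    · rintro _ _ ⟨rfl, rfl⟩ ρ hR hv
      exact key ρ hR hv

/-! ### Weakest preconditions -/

/-- The command, started in `σ`, halts in a state and after a number of steps with the property
`Q`. -/
def WP (E : Env) (c : Cmd) (σ : St) (Q : St → ℕ → Prop) : Prop := ∃ t σ', Run E c σ t σ' ∧ Q σ' t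

theorem WP.mono {c : Cmd} {σ : St} {Q Q' : St → ℕ → Prop} (h : WP E c σ Q)
    (hQ : ∀ σ' t, Q σ' t → Q' σ' t) : WP E c σ Q' := by
  obtain ⟨t, σ', hr, hq⟩ := h
  exact ⟨t, σ', hr, hQ _ _ hq⟩

theorem WP_skip {σ : St} {Q : St → ℕ → Prop} : WP E .skip σ Q ↔ Q σ 1 :=
  ⟨fun ⟨_, _, h, hq⟩ => by cases h; exact hq, fun h => ⟨_, _, .skip σ, h⟩⟩

theorem WP_assign {x : Var} {e : Ex} {σ : St} {Q : St → ℕ → Prop} :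
    WP E (x ≔ e) σ Q ↔ e.ok E σ ∧ Q (σ.set x (e.ev σ)) 1 :=
  ⟨fun ⟨_, _, h, hq⟩ => by cases h; exact ⟨‹_›, hq⟩, fun h => ⟨_, _, .assign h.1, h.2⟩⟩

theorem WP_store {a : Arr} {e f : Ex} {σ : St} {Q : St → ℕ → Prop} :
    WP E (.store a e f) σ Q ↔ (e.ok E σ ∧ f.ok E σ ∧ e.ev σ < E.SZ ∧ σ.v .sz = E.SZ) ∧
      Q (σ.put a (e.ev σ) (f.ev σ)) 1 :=
  ⟨fun ⟨_, _, h, hq⟩ => by cases h; exact ⟨⟨‹_›, ‹_›, ‹_›, ‹_›⟩, hq⟩,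
    fun ⟨⟨h1, h2, h3, h4⟩, h⟩ => ⟨_, _, .store h1 h2 h3 h4, h⟩⟩

theorem WP_seq {c d : Cmd} {σ : St} {Q : St → ℕ → Prop} :
    WP E (c ;; d) σ Q ↔ WP E c σ fun σ1 t1 => WP E d σ1 fun σ2 t2 => Q σ2 (t1 + t2) :=
  ⟨fun ⟨_, _, h, hq⟩ => by cases h with | seq h1 h2 => exact ⟨_, _, h1, _, _, h2, hq⟩,
    fun ⟨_, _, h1, _, _, h2, hq⟩ => ⟨_, _, .seq h1 h2, hq⟩⟩

theorem WP_ite {e : Ex} {c d : Cmd} {σ : St} {Q : St → ℕ → Prop} :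
    WP E (.ite e c d) σ Q ↔ e.ok E σ ∧ (e.ev σ ≠ 0 → WP E c σ fun σ' t => Q σ' (t + 1)) ∧
      (e.ev σ = 0 → WP E d σ fun σ' t => Q σ' (t + 1)) := by
  constructor
  · rintro ⟨_, _, h, hq⟩
    cases h with
    | iteTrue hok hne h => exact ⟨hok, fun _ => ⟨_, _, h, hq⟩, fun h => absurd h hne⟩
    | iteFalse hok h0 h => exact ⟨hok, fun h => absurd h0 h, fun _ => ⟨_, _, h, hq⟩⟩
  · rintro ⟨hok, h1, h2⟩
    by_cases h0 : e.ev σ = 0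
    · obtain ⟨_, _, h, hq⟩ := h2 h0
      exact ⟨_, _, .iteFalse hok h0 h, hq⟩
    · obtain ⟨_, _, h, hq⟩ := h1 h0
      exact ⟨_, _, .iteTrue hok h0 h, hq⟩

/-- Trivial simplifications that keep the shape of the remaining goals. -/
theorem tf :
    (∀ p, (True ∧ p) = p) ∧ (∀ p, (p ∧ True) = p) ∧ (∀ p, (True ∨ p) = True) ∧ (∀ p, (p ∨ True) = True) ∧
    (∀ (α : Type) (h : Decidable False) (a b : α), @ite α False h a b = b) ∧
    ∀ (α : Type) (h : Decidable True) (a b : α), @ite α True h a b = a := by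
  simp

/-- The values of expressions and states, collected for the simplifier. -/
@[simp] theorem evs (σ : St) :
    (∀ x y n, (σ.set x n).v y = if y = x then n else σ.v y) ∧ (∀ x n, (σ.set x n).A = σ.A) ∧
    (∀ a k n, (σ.put a k n).v = σ.v) ∧ (∀ n, (Ex.lit n).ev σ = n) ∧ (0 : Ex).ev σ = 0 ∧
    (1 : Ex).ev σ = 1 ∧ (2 : Ex).ev σ = 2 ∧ (3 : Ex).ev σ = 3 ∧ (4 : Ex).ev σ = 4 ∧
    (∀ x, (Ex.var x).ev σ = σ.v x) ∧ (∀ a e, (Ex.get a e).ev σ = σ.A a (e.ev σ)) ∧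
    (∀ e f : Ex, (e + f).ev σ = e.ev σ + f.ev σ) ∧ (∀ e f : Ex, (e - f).ev σ = e.ev σ - f.ev σ) ∧
    (∀ e f : Ex, (e * f).ev σ = e.ev σ * f.ev σ) ∧ ∀ e f : Ex, (e / f).ev σ = e.ev σ / f.ev σ :=
  ⟨fun _ _ _ => rfl, fun _ _ => rfl, fun _ _ _ => rfl, fun _ => rfl,
    rfl, rfl, rfl, rfl, rfl, fun _ => rfl, fun _ _ => rfl, fun _ _ => rfl, fun _ _ => rfl, fun _ _ => rfl,
    fun _ _ => rfl⟩

/-- The rules for symbolic execution, collected for the simplifier. -/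
@[simp] theorem wp (E : Env) (σ : St) :
    (∀ n, (Ex.lit n).ok E σ = (n < E.M)) ∧ (0 : Ex).ok E σ = True ∧ (1 : Ex).ok E σ = True ∧
    (2 : Ex).ok E σ = True ∧ (3 : Ex).ok E σ = True ∧ (4 : Ex).ok E σ = True ∧
    (∀ x, (Ex.var x).ok E σ = True) ∧
    (∀ a e, (Ex.get a e).ok E σ = (e.ok E σ ∧ e.ev σ < E.SZ ∧ (a = .inp ∨ σ.v .sz = E.SZ))) ∧
    (∀ e f : Ex, (e + f).ok E σ = (e.ok E σ ∧ f.ok E σ ∧ e.ev σ + f.ev σ < E.M)) ∧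
    (∀ e f : Ex, (e - f).ok E σ = (e.ok E σ ∧ f.ok E σ ∧ e.ev σ - f.ev σ < E.M)) ∧
    (∀ e f : Ex, (e * f).ok E σ = (e.ok E σ ∧ f.ok E σ ∧ e.ev σ * f.ev σ < E.M)) ∧
    (∀ e f : Ex, (e / f).ok E σ = (e.ok E σ ∧ f.ok E σ ∧ e.ev σ / f.ev σ < E.M)) ∧
    ∀ Q : St → ℕ → Prop, (WP E .skip σ Q ↔ Q σ 1) ∧
    (∀ x e, WP E (x ≔ e) σ Q ↔ e.ok E σ ∧ Q (σ.set x (e.ev σ)) 1) ∧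
    (∀ x e d, WP E (x ≔ e ;; d) σ Q ↔
      e.ok E σ ∧ WP E d (σ.set x (e.ev σ)) fun σ2 t2 => Q σ2 (1 + t2)) ∧
    (∀ a e f, WP E (.store a e f) σ Q ↔
      (e.ok E σ ∧ f.ok E σ ∧ e.ev σ < E.SZ ∧ σ.v .sz = E.SZ) ∧ Q (σ.put a (e.ev σ) (f.ev σ)) 1) ∧
    (∀ a e f d, WP E (.store a e f ;; d) σ Q ↔
      (e.ok E σ ∧ f.ok E σ ∧ e.ev σ < E.SZ ∧ σ.v .sz = E.SZ) ∧
      WP E d (σ.put a (e.ev σ) (f.ev σ)) fun σ2 t2 => Q σ2 (1 + t2)) ∧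
    ∀ e c d, WP E (.ite e c d) σ Q ↔ e.ok E σ ∧ (e.ev σ ≠ 0 → WP E c σ fun σ' t => Q σ' (t + 1)) ∧
        (e.ev σ = 0 → WP E d σ fun σ' t => Q σ' (t + 1)) := by
  have hw := E.hw
  have h : ∀ n, n ≤ 4 → (Ex.lit n).ok E σ = True := fun n hn => eq_true (by change n < E.M; omega)
  exact ⟨fun _ => rfl, h 0 (by omega), h 1 (by omega), h 2 (by omega), h 3 (by omega), h 4 (by omega),
    fun _ => rfl, fun _ _ => rfl, fun _ _ => rfl, fun _ _ => rfl, fun _ _ => rfl, fun _ _ => rfl,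
    fun _ => ⟨WP_skip, fun _ _ => WP_assign, fun _ _ _ => by rw [WP_seq, WP_assign], fun _ _ _ => WP_store,
    fun _ _ _ _ => by rw [WP_seq, WP_store], fun _ _ _ => WP_ite⟩⟩

/-- The rule for sequences with an intermediate assertion. -/
theorem WP_cut {c d : Cmd} {σ : St} {Q : St → ℕ → Prop} (Q1 : St → ℕ → Prop) (h1 : WP E c σ Q1)
    (h2 : ∀ σ1 t1, Q1 σ1 t1 → WP E d σ1 fun σ2 t2 => Q σ2 (t1 + t2)) : WP E (c ;; d) σ Q :=
  WP_seq.2 (h1.mono h2)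

/-- The rule for loops: `I n` is the invariant when at most `n` iterations are left, and `k` bounds
the number of steps of the body. -/
theorem WP_while {e : Ex} {c : Cmd} (I : ℕ → St → Prop) (k : ℕ)
    (hok : ∀ n σ, I n σ → e.ok E σ)
    (hstep : ∀ n σ, I n σ → e.ev σ ≠ 0 → WP E c σ fun σ' t => t ≤ k ∧ ∃ m < n, I m σ')
    {n : ℕ} {σ : St} (h : I n σ) {Q : St → ℕ → Prop}
    (hQ : ∀ m σ' t, I m σ' → e.ev σ' = 0 → t ≤ (k + 1) * n + 1 → Q σ' t) :
    WP E (.while e c) σ Q := by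
  induction n using Nat.strong_induction_on generalizing σ Q with
  | _ n ih =>
    by_cases h0 : e.ev σ = 0
    · exact ⟨_, _, .whileFalse (hok _ _ h) h0, hQ _ _ _ h h0 (by omega)⟩
    · obtain ⟨t1, σ1, hr, ht, m, hm, hI⟩ := hstep n σ h h0
      obtain ⟨t2, σ2, hr2, m', hI2, h02, ht2⟩ := ih m hm hI
        (Q := fun σ' t => ∃ m, I m σ' ∧ e.ev σ' = 0 ∧ t ≤ _) fun m σ' t h1 h2 h3 => ⟨m, h1, h2, h3⟩
      refine ⟨_, _, .whileTrue (hok _ _ h) h0 hr hr2, hQ _ _ _ hI2 h02 ?_⟩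
      have := Nat.mul_le_mul_left (k + 1) (Nat.succ_le_of_lt hm)
      rw [Nat.mul_succ] at this
      omega

/-- The variables that a command may change. -/
def Cmd.modV : Cmd → Var → Bool
  | skip, _ => false
  | assign x _, y => decide (y = x)
  | store _ _ _, _ => false
  | seq c d, y => c.modV y || d.modV y
  | ite _ c d, y => c.modV y || d.modV y
  | .while _ c, y => c.modV y

/-- The arrays that a command may change. -/
def Cmd.modA : Cmd → Arr → Bool
  | skip, _ => false
  | assign _ _, _ => false
  | store a _ _, b => decide (b = a)
  | seq c d, y => c.modA y || d.modA y
  | ite _ c d, y => c.modA y || d.modA y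
  | .while _ c, y => c.modA y

/-- The command leaves all variables and arrays alone that it does not assign to. -/
structure Frame (c : Cmd) (σ σ' : St) : Prop where
  v : ∀ x, c.modV x = false → σ'.v x = σ.v x
  A : ∀ a, c.modA a = false → σ'.A a = σ.A a

/-- This lets a specification speak only of the data that a command is about. -/
theorem Run.frame {c : Cmd} {σ σ' : St} {t : ℕ} (h : Run E c σ t σ') : Frame c σ σ' := by
  induction h with
  | skip σ => exact ⟨fun _ _ => rfl, fun _ _ => rfl⟩
  | assign _ => exact ⟨fun y hy => by simp_all [Cmd.modV], fun _ _ => rfl⟩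
  | store _ _ _ _ =>
    exact ⟨fun _ _ => rfl, fun b hb => St.put_A_ne _ _ _ (by simpa [Cmd.modA] using hb)⟩
  | seq _ _ ih1 ih2 =>
    refine ⟨fun y hy => ?_, fun y hy => ?_⟩
    · simp only [Cmd.modV, Bool.or_eq_false_iff] at hy
      rw [ih2.v y hy.2, ih1.v y hy.1]
    · simp only [Cmd.modA, Bool.or_eq_false_iff] at hy
      rw [ih2.A y hy.2, ih1.A y hy.1]
  | iteTrue _ _ _ ih =>
    refine ⟨fun y hy => ?_, fun y hy => ?_⟩
    · simp only [Cmd.modV, Bool.or_eq_false_iff] at hy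
      exact ih.v y hy.1
    · simp only [Cmd.modA, Bool.or_eq_false_iff] at hy
      exact ih.A y hy.1
  | iteFalse _ _ _ ih =>
    refine ⟨fun y hy => ?_, fun y hy => ?_⟩
    · simp only [Cmd.modV, Bool.or_eq_false_iff] at hy
      exact ih.v y hy.2
    · simp only [Cmd.modA, Bool.or_eq_false_iff] at hy
      exact ih.A y hy.2
  | whileFalse _ _ => exact ⟨fun _ _ => rfl, fun _ _ => rfl⟩
  | whileTrue _ _ _ _ ih1 ih2 =>
    exact ⟨fun y hy => by rw [ih2.v y hy, ih1.v y hy], fun y hy => by rw [ih2.A y hy, ih1.A y hy]⟩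

theorem WP.frame {c : Cmd} {σ : St} {Q : St → ℕ → Prop} (h : WP E c σ Q) :
    WP E c σ fun σ' t => Q σ' t ∧ Frame c σ σ' := by
  obtain ⟨t, σ', hr, hq⟩ := h
  exact ⟨t, σ', hr, hq, hr.frame⟩

end Submatch

namespace Submatch

/-! ### Periods and occurrences -/

section Periods

variable {β : Type} {t u v : ℕ → β}

/-- The function `u`, restricted to the first `m` arguments, occurs in `t` at `x`. -/
def OccF (t u : ℕ → β) (m x : ℕ) : Prop := ∀ i < m, t (x + i) = u i

/-- The function `t` has the period `p` on the interval `[a, b)`. -/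
def Per (t : ℕ → β) (p a b : ℕ) : Prop := ∀ i, a ≤ i → i + p < b → t i = t (i + p)

theorem Per.mono {p a b a' b' : ℕ} (h : Per t p a b) (ha : a ≤ a') (hb : b' ≤ b) :
    Per t p a' b' := fun i h1 h2 => h i (by omega) (by omega)

theorem Per.mul {p a b : ℕ} (h : Per t p a b) (k i : ℕ) (hi : a ≤ i) (hk : i + k * p < b) :
    t i = t (i + k * p) := by
  induction k with
  | zero => simp
  | succ k ih =>
    rw [Nat.succ_mul] at hk ⊢
    rw [ih (by omega), h (i + k * p) (by omega) (by omega), Nat.add_assoc]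

/-- The theorem of Fine and Wilf (with a slightly larger bound). -/
theorem Per.gcd {p q a b : ℕ} (hp : Per t p a b) (hq : Per t q a b) (h : a + p + q ≤ b) :
    Per t (Nat.gcd p q) a b := by
  induction hn : p + q using Nat.strong_induction_on generalizing p q with
  | _ n ih =>
    subst hn
    wlog hpq : p ≤ q generalizing p q
    · rw [Nat.gcd_comm]
      exact this hq hp (by omega) (fun m hm => by
        intro p' q' h1 h2 h3 h4; exact ih m (by omega) h1 h2 h3 h4) (by omega)
    rcases Nat.eq_zero_or_pos p with rfl | hp0
    · simpa using hq
    have hd : Per t (q - p) a b := by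
      intro i h1 h2
      by_cases h3 : i + q < b
      · rw [hq i h1 h3, hp (i + (q - p)) (by omega) (by omega)]
        congr 1; omega
      · have h4 := hp (i - p) (by omega) (by omega)
        have h5 := hq (i - p) (by omega) (by omega)
        grind
    have := ih (p + (q - p)) (by omega) hp hd (by omega) rfl
    rwa [Nat.gcd_sub_self_right hpq] at this

/-- A period of a sufficiently long part of a periodic interval is a period of the whole interval. -/
theorem Per.extend {q g c d a b : ℕ} (hq : Per t q c d) (hg : Per t g a b) (hq0 : 0 < q) (hca : c ≤ a) (hbd : b ≤ d) (hl : a + q + g ≤ b) : Per t g c d := by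
  intro i h1 h2
  -- both points are shifted by multiples of `q` into the interval `[a, b)`
  obtain ⟨i', h3, h4, h5, h6⟩ : ∃ i', a ≤ i' ∧ i' < a + q ∧ t i = t i' ∧
      t (i + g) = t (i' + g) := by
    rcases le_or_gt a i with h | h
    · refine ⟨a + (i - a) % q, by omega, by have := Nat.mod_lt (i - a) hq0; omega, ?_, ?_⟩
      · have h7 := Nat.mod_add_div (i - a) q
        have := hq.mul ((i - a) / q) (a + (i - a) % q) (by omega) (by
          rw [Nat.mul_comm]; omega)
        rw [this]; congr 1; rw [Nat.mul_comm]; omega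
      · have h7 := Nat.mod_add_div (i - a) q
        have := hq.mul ((i - a) / q) (a + (i - a) % q + g) (by omega) (by
          rw [Nat.mul_comm]; omega)
        rw [this]; congr 1; rw [Nat.mul_comm]; omega
    · have h7 := Nat.mod_add_div (a - i + (q - 1)) q
      have h8 := Nat.mod_lt (a - i + (q - 1)) hq0
      refine ⟨i + (a - i + (q - 1)) / q * q, ?_, ?_, ?_, ?_⟩
      · rw [Nat.mul_comm]; omega
      · rw [Nat.mul_comm]; omega
      · exact hq.mul _ _ h1 (by rw [Nat.mul_comm]; omega)
      · have := hq.mul ((a - i + (q - 1)) / q) (i + g) (by omega) (by rw [Nat.mul_comm]; omega)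
        rw [this]; congr 1; omega
  rw [h5, h6]
  exact hg i' h3 (by omega)

theorem per_of_occ {m x q : ℕ} (h1 : OccF t u m x) (h2 : OccF t u m (x + q)) :
    Per t q x (x + q + m) := by
  intro i hi hj
  have a := h1 (i - x) (by omega)
  have b := h2 (i - x) (by omega)
  grind

theorem OccF.shift {m x g : ℕ} (h : OccF t u m x) (hp : Per t g x (x + g + m)) :
    OccF t u m (x + g) := by
  intro i hi
  rw [← h i hi, show x + g + i = x + i + g by omega]
  exact (hp (x + i) (by omega) (by omega)).symm

/-- In a periodic part, occurrences can be shifted by multiples of the period. -/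
theorem Per.occ_iff {p a b m x k : ℕ} (hp : Per t p a b) (ha : a ≤ x) (hb : x + k * p + m ≤ b) :
    OccF t u m (x + k * p) ↔ OccF t u m x := by
  have : ∀ i < m, t (x + i) = t (x + k * p + i) := by
    intro i hi
    rw [hp.mul k (x + i) (by omega) (by omega)]
    congr 1; omega
  constructor
  · intro h i hi; rw [this i hi, h i hi]
  · intro h i hi; rw [← this i hi, h i hi]

open Classical in
/-- The occurrences that contain the letters on both sides of the point `y`. -/
noncomputable def cross (t u : ℕ → β) (m y : ℕ) : Finset ℕ :=
  (Finset.range y).filter fun x => y < x + m ∧ OccF t u m x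

theorem mem_cross {m y x : ℕ} : x ∈ cross t u m y ↔ x < y ∧ y < x + m ∧ OccF t u m x := by
  simp [cross]

/-- From every element of `S` but the greatest one, the next one is at distance `q`. -/
def StepProp (S : Finset ℕ) (q : ℕ) : Prop :=
  0 < q ∧ ∀ z ∈ S, ∀ z' ∈ S, z < z' → z + q ∈ S ∧ z + q ≤ z'

/-- The occurrences across a point form an arithmetic progression. -/
theorem cross_step (t u : ℕ → β) (m y : ℕ) : ∃ q, StepProp (cross t u m y) q := by
  classical
  by_cases hex : ∃ d, 0 < d ∧ ∃ z ∈ cross t u m y, z + d ∈ cross t u m y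
  swap
  · refine ⟨1, one_pos, fun z hz z' hz' h => absurd ⟨z' - z, by omega, z, hz, ?_⟩ hex⟩
    rwa [show z + (z' - z) = z' by omega]
  obtain ⟨hq0, zs, hzs, hzq⟩ := Nat.find_spec hex
  have hmin : ∀ d, 0 < d → ∀ z ∈ cross t u m y, z + d ∈ cross t u m y → Nat.find hex ≤ d :=
    fun d h0 z hz hzd => Nat.find_min' hex ⟨h0, z, hz, hzd⟩
  generalize Nat.find hex = q at *
  refine ⟨q, hq0, fun z hz z' hz' hlt => ?_⟩
  have hge : ∀ z' ∈ cross t u m y, z < z' → z + q ≤ z' := by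
    intro z' hz' h
    have := hmin (z' - z) (by omega) z hz (by rwa [show z + (z' - z) = z' by omega])
    omega
  refine ⟨?_, hge z' hz' hlt⟩
  -- the successor of `z`
  have hex' : ∃ z', z' ∈ cross t u m y ∧ z < z' := ⟨z', hz', hlt⟩
  obtain ⟨hn, hzn⟩ := Nat.find_spec hex'
  have hsucc : ∀ a ∈ cross t u m y, z < a → Nat.find hex' ≤ a := fun a h1 h2 =>
    Nat.find_min' hex' ⟨h1, h2⟩
  generalize Nat.find hex' = s at *
  have hqs := hge s hn hzn
  by_cases heq : zs = z
  · rwa [heq] at hzq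
  have h1 := mem_cross.1 hz
  have h2 := mem_cross.1 hn
  have h3 := mem_cross.1 hzs
  have h4 := mem_cross.1 hzq
  have hm : q + (s - z) ≤ m := by grind
  -- the word `u` has the periods `q` and `s - z`
  have pu : ∀ a d, a ∈ cross t u m y → a + d ∈ cross t u m y → Per u d 0 m := by
    intro a d ha hd i _ hi
    have e1 := (mem_cross.1 ha).2.2 (i + d) hi
    have e2 := (mem_cross.1 hd).2.2 i (by omega)
    rw [← e1, ← e2]; congr 1; omega
  have p1 := pu zs q hzs hzq
  have p2 := pu z (s - z) hz (by rwa [show z + (s - z) = s by omega])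
  have pg := p1.gcd p2 (by omega)
  have hdvd : Nat.gcd q (s - z) ∣ s - z - q :=
    Nat.dvd_sub (Nat.gcd_dvd_right _ _) (Nat.gcd_dvd_left _ _)
  refine mem_cross.2 ⟨by omega, by omega, fun i hi => ?_⟩
  rcases lt_or_ge (q + i) m with h | h
  · rw [show z + q + i = z + (q + i) by omega, h1.2.2 _ h, Nat.add_comm q i,
      ← p1 i (by omega) (by omega)]
  · obtain ⟨k, hk⟩ := hdvd
    have e := h2.2.2 (i + q - (s - z)) (by omega)
    rw [show z + q + i = s + (i + q - (s - z)) by omega, e,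
      pg.mul k (i + q - (s - z)) (by omega) (by rw [Nat.mul_comm, ← hk]; omega), Nat.mul_comm, ← hk]
    congr 1; omega

theorem StepProp.add_mul {S : Finset ℕ} {q : ℕ} (h : StepProp S q) {z z' : ℕ} (hz : z ∈ S)
    (hz' : z' ∈ S) (k : ℕ) (hk : z + k * q ≤ z') : z + k * q ∈ S := by
  induction k with
  | zero => simpa using hz
  | succ k ih =>
    have := h.1
    rw [Nat.succ_mul, ← Nat.add_assoc] at hk ⊢
    exact (h.2 _ (ih (by omega)) _ hz' (by omega)).1

theorem StepProp.exists_mul {S : Finset ℕ} {q : ℕ} (h : StepProp S q) {z z' : ℕ} (hz : z ∈ S)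
    (hz' : z' ∈ S) (hle : z ≤ z') : ∃ k, z' = z + k * q := by
  induction hn : z' - z using Nat.strong_induction_on generalizing z with
  | _ n ih =>
    rcases hle.eq_or_lt with rfl | hlt
    · exact ⟨0, by simp⟩
    · obtain ⟨h1, h2⟩ := h.2 z hz z' hz' hlt
      have := h.1
      obtain ⟨k, hk⟩ := ih (z' - (z + q)) (by omega) h1 h2 rfl
      exact ⟨k + 1, by rw [Nat.succ_mul]; omega⟩

/-- Three numbers that represent a finite set of numbers with constant gaps: the least and the
greatest element and the cardinality. -/
def Summ (S : Finset ℕ) (f l c : ℕ) : Prop :=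
  c = S.card ∧ (0 < c → f ∈ S ∧ l ∈ S ∧ ∀ x ∈ S, f ≤ x ∧ x ≤ l)

/-- The gap of the progression with the given least and greatest element and cardinality (zero for
at most one element). -/
def gap (f l c : ℕ) : ℕ := (l - f) / (c - 1)

theorem Summ.spec {S : Finset ℕ} {f l c q : ℕ} (h : Summ S f l c) (hq : StepProp S q) :
    (∀ x, x ∈ S ↔ ∃ k < c, x = f + k * gap f l c) ∧ (0 < c → l = f + (c - 1) * gap f l c) ∧
      (1 < c → gap f l c = q) := by
  obtain ⟨hc, hs⟩ := h
  rcases Nat.eq_zero_or_pos c with h0 | h0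
  · grind
  obtain ⟨hf, hl, hle⟩ := hs h0
  obtain ⟨K, hK⟩ := hq.exists_mul hf hl (hle _ hl).1
  have hq0 := hq.1
  have hS : S = (Finset.range (K + 1)).image fun k => f + k * q := by
    ext x
    simp only [Finset.mem_image, Finset.mem_range]
    constructor
    · intro hx
      obtain ⟨k, hk⟩ := hq.exists_mul hf hx (hle _ hx).1
      refine ⟨k, ?_, hk.symm⟩
      have := (hle _ hx).2
      by_contra hcon
      have := Nat.mul_le_mul_right q (show K + 1 ≤ k by omega)
      rw [Nat.succ_mul] at this
      omega
    · rintro ⟨k, hk, rfl⟩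
      refine hq.add_mul hf hl k ?_
      simp_all
  have hcard : c = K + 1 := by
    rw [hc, hS, Finset.card_image_of_injective, Finset.card_range]
    intro a b hab
    exact Nat.eq_of_mul_eq_mul_right hq0 (by simpa using hab)
  have hgap : 1 < c → gap f l c = q := by
    intro h1
    rw [gap, hK, hcard, Nat.add_sub_cancel_left, Nat.add_sub_cancel]
    exact Nat.mul_div_cancel_left _ (by omega)
  refine ⟨fun x => ?_, fun _ => ?_, hgap⟩
  · rw [hS]
    simp only [Finset.mem_image, Finset.mem_range]
    rcases Nat.eq_or_lt_of_le (show 1 ≤ c from h0) with h1 | h1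
    · rw [show K = 0 by omega, ← h1]; simp [eq_comm]
    · rw [hgap h1, hcard]; simp only [eq_comm]
  · grind

theorem Summ.of_eq {S S' : Finset ℕ} {f l c : ℕ} (h : Summ S f l c) (he : S = S') :
    Summ S' f l c := he ▸ h

theorem summ_empty {f l : ℕ} : Summ ∅ f l 0 := ⟨by simp, by simp⟩

theorem Summ.eq_empty {S : Finset ℕ} {f l : ℕ} (h : Summ S f l 0) : S = ∅ :=
  Finset.card_eq_zero.1 h.1.symm

/-- The part covered by several occurrences across a point is periodic. -/
theorem per_of_cross {m y p a b : ℕ} (hp : StepProp (cross t u m y) p) (ha : a ∈ cross t u m y)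
    (hb : b ∈ cross t u m y) (hab : a < b) : Per t p a (b + m) := by
  have hp0 := hp.1
  have h1 := mem_cross.1 ha
  induction hn : b - a using Nat.strong_induction_on generalizing b with
  | _ n ih =>
    have h2 := mem_cross.1 hb
    obtain ⟨k, hk⟩ := hp.exists_mul ha hb hab.le
    rcases k with _ | _ | k
    · omega
    · rw [hk, Nat.one_mul]
      exact per_of_occ h1.2.2 (by rw [hk, Nat.one_mul] at h2; exact h2.2.2)
    · rw [Nat.succ_mul, ← Nat.add_assoc] at hk
      have hmul : 0 < (k + 1) * p := by positivity
      have h3 : b - p ∈ cross t u m y := by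
        rw [hk, Nat.add_sub_cancel]
        exact hp.add_mul ha hb _ (by omega)
      have h4 := mem_cross.1 h3
      have h5 := ih (b - p - a) (by omega) h3 (by omega) rfl
      have h6 : Per t p (b - p) (b - p + p + m) := per_of_occ h4.2.2 (by
        rw [show b - p + p = b by omega]; exact h2.2.2)
      intro i hi hj
      by_cases h7 : i + p < b - p + m
      · exact h5 i hi h7
      · exact h6 i (by omega) (by omega)

theorem StepProp.pred {S : Finset ℕ} {q z z' : ℕ} (h : StepProp S q) (hz : z ∈ S) (hz' : z' ∈ S)
    (hlt : z < z') : q ≤ z' ∧ z' - q ∈ S ∧ z ≤ z' - q := by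
  obtain ⟨k, hk⟩ := h.exists_mul hz hz' hlt.le
  cases k with
  | zero => omega
  | succ k =>
    rw [Nat.succ_mul, ← Nat.add_assoc] at hk
    refine ⟨by omega, ?_, by omega⟩
    rw [hk, Nat.add_sub_cancel]
    exact h.add_mul hz hz' k (by omega)

/-- If the periods of two sets of occurrences live on long overlapping intervals, they agree. -/
theorem step_eq_of_overlap {mu mv y y' p q x z a b c d A B : ℕ}
    (hp : StepProp (cross t v mv y') p) (hq : StepProp (cross t u mu y) q)
    (hz : z ∈ cross t v mv y') (hzp : z + p ∈ cross t v mv y')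
    (hx : x ∈ cross t u mu y) (hxq : x + q ∈ cross t u mu y)
    (pq : Per t q a b) (pp : Per t p c d) (hAB : A + p + q ≤ B)
    (ha : a ≤ A) (hb : B ≤ b) (hc : c ≤ A) (hd : B ≤ d)
    (hax : a ≤ x) (hxb : x + q + mu ≤ b) (hcz : c ≤ z) (hzd : z + p + mv ≤ d) : p = q := by
  have hp0 := hp.1
  have hq0 := hq.1
  have hg := (pp.mono hc hd).gcd (pq.mono ha hb) hAB
  have g1 := Nat.gcd_dvd_left p q
  have g2 := Nat.gcd_dvd_right p q
  generalize Nat.gcd p q = g at *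
  have l1 := Nat.le_of_dvd hp0 g1
  have l2 := Nat.le_of_dvd hq0 g2
  have g0 : 0 < g := Nat.pos_of_dvd_of_pos g1 hp0
  have e1 := pq.extend hg hq0 ha hb (by omega)
  have e2 := pp.extend hg hp0 hc hd (by omega)
  have m1 := mem_cross.1 hx
  have m2 := mem_cross.1 hxq
  have m3 := mem_cross.1 hz
  have m4 := mem_cross.1 hzp
  have n1 : x + g ∈ cross t u mu y :=
    mem_cross.2 ⟨by omega, by omega, m1.2.2.shift (e1.mono hax (by omega))⟩
  have n2 : z + g ∈ cross t v mv y' :=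
    mem_cross.2 ⟨by omega, by omega, m3.2.2.shift (e2.mono hcz (by omega))⟩
  have := (hq.2 x hx _ n1 (by omega)).2
  have := (hp.2 z hz _ n2 (by omega)).2
  omega

/-- The occurrences of `u` across `f` that end where an occurrence of `v` across `y'` starts are
extremal, unless the two sets of occurrences have the same gap. -/
theorem crossing_left {mu mv f y' p q x zf zl : ℕ}
    (hp : StepProp (cross t v mv y') p) (hq : StepProp (cross t u mu f) q)
    (hf : f ∈ cross t v mv y') (hx : x ∈ cross t u mu f) (hxv : x + mu ∈ cross t v mv y')
    (hzf : zf ∈ cross t u mu f) (hzl : zl ∈ cross t u mu f)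
    (hle : ∀ z ∈ cross t u mu f, zf ≤ z ∧ z ≤ zl) : x = zf ∨ x = zl ∨ p = q := by
  by_contra! hcon
  obtain ⟨hc1, hc2, hc3⟩ := hcon
  have h1 := hle x hx
  have m1 := mem_cross.1 hx
  have m2 := mem_cross.1 hf
  have m3 := mem_cross.1 hxv
  obtain ⟨s1, s2⟩ := hq.2 x hx zl hzl (by omega)
  obtain ⟨s3, s4, s5⟩ := hq.pred hzf hx (by omega)
  obtain ⟨s6, s7⟩ := hp.2 f hf _ hxv (by omega)
  have m4 := mem_cross.1 s4
  have m5 := mem_cross.1 s1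
  rcases lt_or_ge mv q with h | h
  · omega
  · exact hc3 (step_eq_of_overlap (A := f) (B := x + q + mu) hp hq hf s6 hx s1
      (per_of_occ m1.2.2 m5.2.2) (per_of_cross hp hf hxv (by omega)) (by omega) (by omega) (by omega)
      (by omega) (by omega) (by omega) (by omega) (by omega) (by omega))

/-- The occurrences of `u` across `y` that start where an occurrence of `v` across `y'` ends are
extremal, where `y` is the end of the occurrence `l` of `v`, unless the two sets of occurrences have
the same gap. -/
theorem crossing_right {mu mv l y' p q x e zf zl : ℕ}
    (hp : StepProp (cross t v mv y') p) (hq : StepProp (cross t u mu (l + mv)) q)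
    (hl : l ∈ cross t v mv y') (hx : x ∈ cross t u mu (l + mv)) (hxe : x = e + mv)
    (he : e ∈ cross t v mv y')
    (hzf : zf ∈ cross t u mu (l + mv)) (hzl : zl ∈ cross t u mu (l + mv))
    (hle : ∀ z ∈ cross t u mu (l + mv), zf ≤ z ∧ z ≤ zl) : x = zf ∨ x = zl ∨ p = q := by
  by_contra! hcon
  obtain ⟨hc1, hc2, hc3⟩ := hcon
  have h1 := hle x hx
  have m1 := mem_cross.1 hx
  have m2 := mem_cross.1 hl
  have m3 := mem_cross.1 he
  obtain ⟨s1, s2⟩ := hq.2 x hx zl hzl (by omega)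
  obtain ⟨s3, s4, s5⟩ := hq.pred hzf hx (by omega)
  obtain ⟨s6, s7⟩ := hp.2 e he _ hl (by omega)
  have m4 := mem_cross.1 s4
  have m5 := mem_cross.1 s1
  rcases lt_or_ge mv q with h | h
  · omega
  · exact hc3 (step_eq_of_overlap (A := x - q) (B := l + mv) (x := x - q) hp hq he s6 s4
      (by rwa [show x - q + q = x by omega])
      (per_of_occ (x := x - q) (q := q) m4.2.2 (by
        rw [show x - q + q = x by omega]; exact m1.2.2))
      (per_of_cross hp he hl (by omega)) (by omega) (by omega) (by omega)
      (by omega) (by omega) (by omega) (by omega) (by omega) (by omega))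

end Periods

/-! ### Occurrences in lists -/

/-- The word `u` occurs in the word `t` at `x`. -/
def Occ (t u : List ℕ) (x : ℕ) : Prop := ∀ i < u.length, t[x + i]? = u[i]?

theorem Occ.le {t u : List ℕ} {x : ℕ} (hu : 0 < u.length) (h : Occ t u x) :
    x + u.length ≤ t.length := by
  have := h (u.length - 1) (by omega)
  grind

theorem occ_append {t a b : List ℕ} {x : ℕ} :
    Occ t (a ++ b) x ↔ Occ t a x ∧ Occ t b (x + a.length) := by
  constructor
  · refine fun h => ⟨fun i hi => ?_, fun i hi => ?_⟩
    · rw [h i (by rw [List.length_append]; omega), List.getElem?_append_left hi]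
    · rw [Nat.add_assoc, h _ (by rw [List.length_append]; omega),
        List.getElem?_append_right (by omega), Nat.add_sub_cancel_left]
  · rintro ⟨h1, h2⟩ i hi
    rw [List.length_append] at hi
    rcases lt_or_ge i a.length with h | h
    · rw [h1 i h, List.getElem?_append_left h]
    · have := h2 (i - a.length) (by omega)
      grind

theorem occ_left {a b u : List ℕ} {x : ℕ} (h : x + u.length ≤ a.length) :
    Occ (a ++ b) u x ↔ Occ a u x := by
  refine forall₂_congr fun i hi => ?_
  rw [List.getElem?_append_left (by omega)]

theorem occ_right {a b u : List ℕ} {x : ℕ} (h : a.length ≤ x) :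
    Occ (a ++ b) u x ↔ Occ b u (x - a.length) := by
  refine forall₂_congr fun i hi => ?_
  grind

theorem occ_iff_eq {a m b u : List ℕ} (h : m.length = u.length) :
    Occ (a ++ m ++ b) u a.length ↔ m = u := by
  rw [List.append_assoc, occ_right le_rfl, Nat.sub_self, occ_left (by omega)]
  constructor
  · intro hh
    refine List.ext_getElem? fun i => ?_
    rcases lt_or_ge i u.length with h1 | h1
    · simpa using hh i h1
    · grind
  · rintro rfl i _; simp

/-- The occurrences of the word `u` in the word `t` across the point `y`. -/
noncomputable def crossL (t u : List ℕ) (y : ℕ) : Finset ℕ :=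
  cross (fun i => t[i]?) (fun i => u[i]?) u.length y

theorem mem_crossL {t u : List ℕ} {x y : ℕ} :
    x ∈ crossL t u y ↔ x < y ∧ y < x + u.length ∧ Occ t u x := mem_cross

/-- The occurrences across `y` in a concatenation: those across the cut, and those in the part that
contains `y`. -/
theorem mem_crossL_append {a b u : List ℕ} {x y : ℕ} (hu : 0 < u.length) :
    x ∈ crossL (a ++ b) u y ↔ (x ∈ crossL (a ++ b) u a.length ∧ x < y ∧ y < x + u.length) ∨
      (y < a.length ∧ x ∈ crossL a u y) ∨
      (a.length < y ∧ a.length ≤ x ∧ x - a.length ∈ crossL b u (y - a.length)) := by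
  simp only [mem_crossL]
  constructor
  · rintro ⟨h1, h2, h3⟩
    by_cases h4 : x + u.length ≤ a.length
    · exact .inr (.inl ⟨by omega, h1, h2, (occ_left h4).1 h3⟩)
    by_cases h5 : a.length ≤ x
    · exact .inr (.inr ⟨by omega, h5, by omega, by omega, (occ_right h5).1 h3⟩)
    · exact .inl ⟨⟨by omega, by omega, h3⟩, h1, h2⟩
  · rintro (⟨⟨_, _, h⟩, h1, h2⟩ | ⟨h0, h1, h2, h3⟩ | ⟨h0, h4, h1, h2, h3⟩)
    · exact ⟨h1, h2, h⟩
    · exact ⟨h1, h2, (occ_left (h3.le hu)).2 h3⟩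
    · exact ⟨by omega, by omega, (occ_right h4).2 h3⟩

end Submatch

namespace Submatch

/-! ### Arithmetic progressions -/

/-- Membership in the progression with first element `f`, gap `p` and `c` elements. -/
def AP (f p c x : ℕ) : Prop := ∃ k < c, x = f + k * p

open Var Arr in
/-- Restricts the progression `(cf, cp, cc)` to the window `[lo, hi)` and computes its last element
`cl`. -/
def clip : Cmd :=
  .ite (lo - cf) (k1 ≔ (lo - cf - 1) / cp + 1) (k1 ≔ 0) ;;
  .ite (hi - cf) (k2 ≔ (hi - 1 - cf) / cp + 1 ;; .ite (k2 - cc) (k2 ≔ cc) .skip) (k2 ≔ 0) ;;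
  cc ≔ k2 - k1 ;;
  .ite cc (cl ≔ cf + (k2 - 1) * cp ;; cf ≔ cf + k1 * cp) .skip

variable {E : Env}

/-- The numbers that `clip` computes: the elements in the window `[lo, hi)` are those with the numbers
from `k1` to `k2 - 1`. -/
theorem ap_window {f p c lo hi k1 k2 : ℕ} (hp : c ≤ 1 ∨ 0 < p)
    (h1 : k1 = if lo - f = 0 then 0 else (lo - f - 1) / p + 1)
    (h2 : k2 = if hi - f = 0 then 0 else min ((hi - 1 - f) / p + 1) c) (k : ℕ) (hk : k < c) :
    lo ≤ f + k * p ∧ f + k * p < hi ↔ k1 ≤ k ∧ k < k2 := by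
  rcases Nat.eq_zero_or_pos p with rfl | hp0
  · grind
  have e1 : lo ≤ f + k * p ↔ k1 ≤ k := by
    rw [h1]
    split_ifs with h
    · simp only [Nat.zero_le, iff_true]; omega
    · rw [Nat.succ_le_iff, Nat.div_lt_iff_lt_mul hp0]; omega
  have e2 : f + k * p < hi ↔ k < k2 := by
    rw [h2]
    split_ifs with h
    · simp only [Nat.not_lt_zero, iff_false]; omega
    · rw [lt_min_iff, Nat.lt_succ_iff, Nat.le_div_iff_mul_le hp0]; omega
  rw [e1, e2]

/-- With `cc ≤ 1` the gap is irrelevant and may be `0`. -/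
theorem clip_spec (σ : St) {B : ℕ} (hp : σ.v .cc ≤ 1 ∨ 0 < σ.v .cp)
    (hlo : σ.v .lo ≤ B) (hhi : σ.v .hi ≤ B) (hcc : σ.v .cc ≤ B)
    (hcf : σ.v .cf ≤ B) (hB : 4 * B + 4 < E.M) :
    WP E clip σ fun σ' t => t ≤ 12 ∧ σ'.v .cc ≤ σ.v .cc ∧
      (∀ x, AP (σ'.v .cf) (σ.v .cp) (σ'.v .cc) x ↔
        AP (σ.v .cf) (σ.v .cp) (σ.v .cc) x ∧ σ.v .lo ≤ x ∧ x < σ.v .hi) ∧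
      (0 < σ'.v .cc → σ'.v .cl = σ'.v .cf + (σ'.v .cc - 1) * σ.v .cp ∧ σ'.v .cl < σ.v .hi) ∧
      σ'.v .cf ≤ B := by
  obtain ⟨n1, hn1⟩ : ∃ n, n = if σ.v .lo - σ.v .cf = 0 then 0 else
    (σ.v .lo - σ.v .cf - 1) / σ.v .cp + 1 := ⟨_, rfl⟩
  obtain ⟨n2, hn2⟩ : ∃ n, n = if σ.v .hi - σ.v .cf = 0 then 0 else
    min ((σ.v .hi - 1 - σ.v .cf) / σ.v .cp + 1) (σ.v .cc) := ⟨_, rfl⟩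
  have d1 := Nat.div_le_self (σ.v .lo - σ.v .cf - 1) (σ.v .cp)
  have d2 := Nat.div_le_self (σ.v .hi - 1 - σ.v .cf) (σ.v .cp)
  have hw := ap_window hp hn1 hn2
  refine WP_cut (fun σ' t => t ≤ 2 ∧ σ' = σ.set .k1 n1) ?_ ?_
  · simp [hn1]
    grind
  rintro _ t1 ⟨ht1, rfl⟩
  refine WP_cut (fun σ' t => t ≤ 4 ∧ σ' = (σ.set .k1 n1).set .k2 n2) ?_ ?_
  · simp [hn2]
    refine ⟨by omega, fun h => ⟨by omega, by omega, fun h1 => ?_, fun h1 => ?_⟩, fun h => ?_⟩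
    · rw [if_neg (by omega), min_eq_right (by omega)]
    · rw [if_neg (by omega), min_eq_left (by omega)]
    · rw [if_pos (by omega)]
  rintro _ t2 ⟨ht2, rfl⟩
  simp
  have hc2 : n2 ≤ σ.v .cc := by rw [hn2]; split_ifs <;> omega
  have hap : ∀ x, AP (σ.v .cf + n1 * σ.v .cp) (σ.v .cp) (n2 - n1) x ↔
      AP (σ.v .cf) (σ.v .cp) (σ.v .cc) x ∧ σ.v .lo ≤ x ∧ x < σ.v .hi := by
    intro x
    constructor
    · rintro ⟨k, hk, rfl⟩
      have := (hw (n1 + k) (by omega)).2 (by omega)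
      rw [Nat.add_mul, ← Nat.add_assoc] at this
      exact ⟨⟨n1 + k, by omega, by rw [Nat.add_mul, ← Nat.add_assoc]⟩, this⟩
    · rintro ⟨⟨k, hk, rfl⟩, h⟩
      have := (hw k hk).1 h
      refine ⟨k - n1, by omega, ?_⟩
      rw [Nat.add_assoc, ← Nat.add_mul, Nat.add_sub_cancel' this.1]
  refine ⟨by omega, fun h => ?_, fun h => ?_⟩
  · have h1 := (hw n1 (by omega)).2 ⟨le_rfl, by omega⟩
    have h2 := (hw (n2 - 1) (by omega)).2 (by omega)
    refine ⟨by omega, by omega, by omega, by omega, hap, fun _ => ⟨?_, by omega⟩, by omega⟩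
    rw [Nat.add_assoc, ← Nat.add_mul]
    congr 2; omega
  · refine ⟨by omega, by omega, fun x => ?_, fun _ => by omega, hcf⟩
    rw [← hap, h]
    simp [AP]

/-- Adds the `cc` elements from `e1` to `e2` to the set represented by `(f, l, c)`. -/
def acc (f l c : Var) (e1 e2 e3 : Ex) : Cmd :=
  .ite c (.ite (f - e1) (f ≔ e1) .skip ;; .ite (e2 - l) (l ≔ e2) .skip) (f ≔ e1 ;; l ≔ e2) ;;
  c ≔ c + e3

theorem Summ.union {S S' : Finset ℕ} {f l c f' l' c' f'' l'' : ℕ} (h : Summ S f l c)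
    (h' : Summ S' f' l' c') (hd : ∀ x ∈ S, x ∉ S') (hc' : 0 < c')
    (hf : f'' = if c = 0 then f' else min f f') (hl : l'' = if c = 0 then l' else max l l') :
    Summ (S ∪ S') f'' l'' (c + c') := by
  refine ⟨?_, fun _ => ?_⟩
  · rw [Finset.card_union_of_disjoint (Finset.disjoint_left.2 hd), h.1, h'.1]
  obtain ⟨h1, h2, h3⟩ := h'.2 hc'
  simp only [Finset.mem_union]
  rcases Nat.eq_zero_or_pos c with rfl | h0
  · rw [h.eq_empty]
    grind
  obtain ⟨g1, g2, g3⟩ := h.2 h0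
  grind

/-- The values of the three expressions must not depend on the variables `f`, `l`, `c`, as these are
assigned to one after the other. -/
theorem acc_spec (σ : St) {f l c : Var} {e1 e2 e3 : Ex} {a1 a2 a3 : ℕ} (hfl : f ≠ l) (hfc : f ≠ c)
    (hlc : l ≠ c) (he : ∀ σ', (∀ y, y ≠ f → y ≠ l → y ≠ c → σ'.v y = σ.v y) → σ'.A = σ.A →
      (e1.ok E σ' ∧ e1.ev σ' = a1) ∧ (e2.ok E σ' ∧ e2.ev σ' = a2) ∧ (e3.ok E σ' ∧ e3.ev σ' = a3))
    (h2 : a2 < E.M) (h3 : σ.v c + a3 < E.M) (hf : σ.v f < E.M)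
    {S S' : Finset ℕ} (hS : Summ S (σ.v f) (σ.v l) (σ.v c)) (hS' : Summ S' a1 a2 a3)
    (h0 : 0 < a3) (hd : ∀ x ∈ S, x ∉ S') :
    WP E (acc f l c e1 e2 e3) σ fun σ' t => t ≤ 10 ∧
      Summ (S ∪ S') (σ'.v f) (σ'.v l) (σ'.v c) := by
  obtain ⟨n1, hn1⟩ : ∃ n, n = if σ.v c = 0 then a1 else min (σ.v f) a1 := ⟨_, rfl⟩
  obtain ⟨n2, hn2⟩ : ∃ n, n = if σ.v c = 0 then a2 else max (σ.v l) a2 := ⟨_, rfl⟩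
  refine WP_cut (fun σ' t => t ≤ 6 ∧ σ'.v f = n1 ∧ σ'.v l = n2 ∧ σ'.v c = σ.v c ∧
    (∀ y, y ≠ f → y ≠ l → y ≠ c → σ'.v y = σ.v y) ∧ σ'.A = σ.A) ?_ ?_
  · have k1 := he σ (fun _ _ _ _ => rfl) rfl
    have k2 := fun n => he (σ.set f n) (fun y hy _ _ => by simp [hy]) (by simp)
    by_cases c0 : σ.v c = 0
    · simp [WP_seq, k1, k2, c0, hn1, hn2, hfl, hfl.symm, hfc.symm, hlc.symm]
      intro y y1 y2 y3; simp [y1, y2]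
    · simp [WP_seq, k1, c0, hfl, hfl.symm, hfc.symm, hlc.symm]
      refine ⟨by omega, fun f1 => ?_, fun f1 => ?_⟩
      · grind
      · grind
  · rintro σ1 t1 ⟨ht, g1, g2, g3, g4, g5⟩
    obtain ⟨-, -, h4, h5⟩ := he σ1 g4 g5
    simp [h4, h5, hfc, hlc, g1, g2, g3, h3]
    exact ⟨by omega, hS.union hS' hd h0 hn1 hn2⟩

end Submatch

namespace Submatch

/-! ### Straight line programs in arrays -/

open Var Arr in
/-- Adds the occurrences of the word of `pu` across both the cut of the node `k` and the point `yr` to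
the set represented by `(af, al, ac)`, shifted by `off`. -/
def collect : Cmd :=
  d ≔ len (L k) ;;
  cf ≔ X0 (row + k) ;; cl ≔ X1 (row + k) ;; cc ≔ XC (row + k) ;; cp ≔ (cl - cf) / (cc - 1) ;;
  lo ≔ yr + 1 - m ;; hi ≔ yr ;; clip ;;
  .ite cc (acc af al ac (cf + off) (cl + off) cc) .skip

open Var Arr in
/-- One step of the search. -/
def searchStep : Cmd :=
  collect ;;
  .ite (d - yr) (k ≔ L k) (.ite (yr - d) (k ≔ R k ;; yr ≔ yr - d ;; off ≔ off + d) (k ≔ 0))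

open Var Arr in
/-- Computes the least and the greatest element and the number of the occurrences of the word of the
node `pu` in the word of the node `tj` across the point `py`. -/
def search : Cmd :=
  row ≔ pu * (nn + 1) ;; m ≔ len pu ;; k ≔ tj ;; yr ≔ py ;; off ≔ 0 ;;
  af ≔ 0 ;; al ≔ 0 ;; ac ≔ 0 ;;
  .while (L k) searchStep

/-- The word of the node `k`, where a node `k > 0` stands for the letter `R k` if `L k = 0`, and for
the concatenation of its children `L k` and `R k` otherwise. The node `0` stands for the empty
word. -/
def wd (L R : ℕ → ℕ) : ℕ → List ℕ
  | 0 => []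
  | k + 1 => if h : 0 < L (k + 1) ∧ L (k + 1) < k + 1 ∧ R (k + 1) < k + 1 then
      wd L R (L (k + 1)) ++ wd L R (R (k + 1)) else [R (k + 1)]
termination_by k => k
decreasing_by
  · exact h.2.1
  · exact h.2.2

/-- The nodes after `lo`, up to `n`, are letters or have children among the earlier ones of them. -/
def Pool (lo : ℕ) (L R : ℕ → ℕ) (n : ℕ) : Prop :=
  ∀ k, lo < k → k ≤ n → L k = 0 ∨ (lo < L k ∧ L k < k ∧ lo < R k ∧ R k < k)

variable {L R : ℕ → ℕ}

@[simp] theorem wd_zero : wd L R 0 = [] := by rw [wd]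

theorem wd_letter {k : ℕ} (hk : 0 < k) (h : L k = 0) : wd L R k = [R k] := by
  obtain ⟨k, rfl⟩ := Nat.exists_eq_succ_of_ne_zero hk.ne'
  rw [wd, dif_neg (fun h' => by rw [Nat.succ_eq_add_one] at h; omega)]

theorem wd_pair {k : ℕ} (h0 : 0 < L k) (h1 : L k < k) (h2 : R k < k) :
    wd L R k = wd L R (L k) ++ wd L R (R k) := by
  obtain ⟨k, rfl⟩ := Nat.exists_eq_succ_of_ne_zero (show k ≠ 0 by omega)
  rw [wd, dif_pos ⟨h0, h1, h2⟩]

theorem Pool.wd_pair {lo n k : ℕ} (h : Pool lo L R n) (h1 : lo < k) (h2 : k ≤ n) (hL : L k ≠ 0) :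
    wd L R k = wd L R (L k) ++ wd L R (R k) := by
  rcases h k h1 h2 with h | h
  · exact absurd h hL
  · exact Submatch.wd_pair (by omega) h.2.1 h.2.2.2

theorem wd_congr {L' R' : ℕ → ℕ} {n : ℕ} (h : ∀ k, 0 < k → k ≤ n → L' k = L k ∧ R' k = R k)
    (k : ℕ) (hk : k ≤ n) : wd L' R' k = wd L R k := by
  induction k using Nat.strong_induction_on with
  | _ k ih =>
    rcases k with _ | k
    · simp
    rw [wd, wd]
    obtain ⟨h1, h2⟩ := h (k + 1) (by omega) hk
    simp only [h1, h2]
    split_ifs with h3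
    · rw [ih _ h3.2.1 (by omega), ih _ h3.2.2 (by omega)]
    · rfl

theorem wd_length_pos {lo n k : ℕ} (h : Pool lo L R n) (h1 : lo < k) (h2 : k ≤ n) :
    0 < (wd L R k).length := by
  induction k using Nat.strong_induction_on with
  | _ k ih =>
    by_cases hL : L k = 0
    · rw [wd_letter (by omega) hL]; simp
    · rw [h.wd_pair h1 h2 hL, List.length_append]
      have h3 := (h k h1 h2).resolve_left hL
      have := ih (L k) h3.2.1 h3.1 (by omega)
      omega

theorem wd_length_le (k : ℕ) : (wd L R k).length ≤ 2 ^ k := by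
  induction k using Nat.strong_induction_on with
  | _ k ih =>
    rcases k with _ | k
    · simp
    rw [wd]
    split_ifs with h
    · have h1 := ih _ h.2.1
      have h2 := ih _ h.2.2
      have h3 : 2 ^ L (k + 1) ≤ 2 ^ k := Nat.pow_le_pow_right (by omega) (by omega)
      have h4 : 2 ^ R (k + 1) ≤ 2 ^ k := Nat.pow_le_pow_right (by omega) (by omega)
      rw [List.length_append, pow_succ]; omega
    · simpa using Nat.one_le_two_pow

/-! ### Search in the table of crossing occurrences -/

/-- The occurrences of the word of the node `u` in the word of the node `k` across the cut of the
latter. -/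
noncomputable def xset (L R : ℕ → ℕ) (u k : ℕ) : Finset ℕ :=
  if L k = 0 then ∅ else crossL (wd L R k) (wd L R u) (wd L R (L k)).length

theorem crossL_step (t u : List ℕ) (y : ℕ) : ∃ q, StepProp (crossL t u y) q :=
  cross_step _ _ _ y

theorem xset_step (L R : ℕ → ℕ) (u k : ℕ) : ∃ q, StepProp (xset L R u k) q := by
  rw [xset]
  split_ifs
  · exact ⟨1, one_pos, by simp⟩
  · exact crossL_step _ _ _

theorem crossL_lt {t u : List ℕ} {y x : ℕ} (h : x ∈ crossL t u y) :
    x + u.length ≤ t.length ∧ x < t.length := by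
  obtain ⟨h1, h2, h3⟩ := mem_crossL.1 h
  have := h3.le (by omega)
  omega

theorem card_le_of_lt {S : Finset ℕ} {n : ℕ} (h : ∀ x ∈ S, x < n) : S.card ≤ n := by
  have : S ⊆ Finset.range n := fun x hx => Finset.mem_range.2 (h x hx)
  simpa using Finset.card_le_card this

/-- The numerical facts about the nodes that the table and the searches in it depend on: the
pattern nodes are `1, …, ps`, the text nodes are `ps + 1, …, nn`, and `V` bounds the lengths of the
words. -/
structure TabC (E : Env) (L R len : ℕ → ℕ) (ps nn V : ℕ) : Prop where
  L0 : L 0 = 0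
  poolS : Pool 0 L R ps
  poolT : Pool ps L R nn
  ps_le : ps ≤ nn
  len : ∀ k ≤ nn, len k = (wd L R k).length
  lenV : ∀ k ≤ nn, (wd L R k).length ≤ V
  hV : 16 * V + 16 < E.M
  hSZ : (nn + 1) * (nn + 1) ≤ E.SZ
  hR : ∀ k ≤ nn, R k < E.M

/-- The state holds the given nodes. -/
structure Agree (E : Env) (L R len : ℕ → ℕ) (ps nn : ℕ) (σ : St) : Prop where
  sz : σ.v .sz = E.SZ
  ps : σ.v .ps = ps
  nn : σ.v .nn = nn
  L : σ.A .L = L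
  R : σ.A .R = R
  len : σ.A .len = len

/-- The row `u` of the table is filled. -/
def RowOK (L R : ℕ → ℕ) (ps nn V u : ℕ) (σ : St) : Prop :=
  ∀ k, ps < k → k ≤ nn → Summ (xset L R u k) (σ.A .X0 (u * (nn + 1) + k))
    (σ.A .X1 (u * (nn + 1) + k)) (σ.A .XC (u * (nn + 1) + k)) ∧
    σ.A .X0 (u * (nn + 1) + k) ≤ V ∧ σ.A .X1 (u * (nn + 1) + k) ≤ V ∧
    σ.A .XC (u * (nn + 1) + k) ≤ V

variable {E : Env} {len : ℕ → ℕ} {ps nn V : ℕ}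

theorem Agree.frame {c : Cmd} {σ σ' : St} (h : Agree E L R len ps nn σ) (hf : Frame c σ σ')
    (hv : (c.modV .sz || c.modV .ps || c.modV .nn || c.modA .L || c.modA .R || c.modA .len) = false) :
    Agree E L R len ps nn σ' := by
  simp only [Bool.or_eq_false_iff] at hv
  obtain ⟨⟨⟨⟨⟨h1, h2⟩, h3⟩, h4⟩, h5⟩, h6⟩ := hv
  exact ⟨by rw [hf.v _ h1, h.sz], by rw [hf.v _ h2, h.ps], by rw [hf.v _ h3, h.nn],
    by rw [hf.A _ h4, h.L], by rw [hf.A _ h5, h.R], by rw [hf.A _ h6, h.len]⟩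

theorem RowOK.congr {u : ℕ} {σ σ' : St} (h : RowOK L R ps nn V u σ) (h0 : σ'.A .X0 = σ.A .X0)
    (h1 : σ'.A .X1 = σ.A .X1) (h2 : σ'.A .XC = σ.A .XC) : RowOK L R ps nn V u σ' := by
  intro k hk hn
  rw [h0, h1, h2]
  exact h k hk hn

theorem TabC.idx_lt (h : TabC E L R len ps nn V) {u k : ℕ} (hu : u ≤ nn) (hk : k ≤ nn) :
    u * (nn + 1) + k < E.SZ := by
  have := Nat.mul_le_mul_right (nn + 1) hu
  have := h.hSZ
  rw [Nat.succ_mul] at this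
  omega

theorem TabC.SZ_lt (h : TabC E L R len ps nn V) : E.SZ < E.M := by
  have := E.hSZ
  have := h.hSZ
  have : 0 < (nn + 1) * (nn + 1) := by positivity
  omega

theorem TabC.bounds (h : TabC E L R len ps nn V) :
    ps ≤ nn ∧ E.SZ < E.M ∧ nn < E.SZ ∧ 16 * V + 16 < E.M :=
  ⟨h.ps_le, h.SZ_lt, by have := h.idx_lt (Nat.zero_le _) (le_refl nn); omega, h.hV⟩

theorem summ_of_ap {S : Finset ℕ} {f p c : ℕ} (h : ∀ x, x ∈ S ↔ AP f p c x) (hp : c ≤ 1 ∨ 0 < p) :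
    Summ S f (f + (c - 1) * p) c := by
  have hS : S = (Finset.range c).image fun k => f + k * p := by
    ext x; rw [h]; simp [AP, eq_comm]
  refine ⟨?_, fun hc => ⟨(h _).2 ⟨0, hc, by simp⟩, (h _).2 ⟨c - 1, by omega, rfl⟩, fun x hx => ?_⟩⟩
  · rw [hS, Finset.card_image_of_injOn, Finset.card_range]
    intro a ha b hb hab
    simp only [Finset.coe_range, Set.mem_Iio] at ha hb
    rcases hp with hp | hp
    · omega
    · exact Nat.eq_of_mul_eq_mul_right hp (by simpa using hab)
  · obtain ⟨k, hk, rfl⟩ := (h x).1 hx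
    have := Nat.mul_le_mul_right p (show k ≤ c - 1 by omega)
    omega

theorem AP.add {f p c x o : ℕ} : AP (f + o) p c x ↔ o ≤ x ∧ AP f p c (x - o) := by
  constructor
  · rintro ⟨k, hk, rfl⟩; exact ⟨by omega, k, hk, by omega⟩
  · rintro ⟨h, k, hk, h2⟩; exact ⟨k, hk, by omega⟩

/-- The elements of a table entry, as an arithmetic progression. -/
theorem xset_ap {u k f l c : ℕ} (h : Summ (xset L R u k) f l c) :
    (∀ x, x ∈ xset L R u k ↔ AP f (gap f l c) c x) ∧ (0 < c → l = f + (c - 1) * gap f l c) ∧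
      (c ≤ 1 ∨ 0 < gap f l c) := by
  obtain ⟨q, hq⟩ := xset_step L R u k
  obtain ⟨h1, h2, h3⟩ := h.spec hq
  refine ⟨h1, h2, ?_⟩
  rcases Nat.lt_or_ge 1 c with h4 | h4
  · exact .inr (by rw [h3 h4]; exact hq.1)
  · exact .inl h4

/-- The elements of the entry for `k` across its cut that are also across `yr` are those in a window,
and again form a progression. -/
theorem collect_spec (hC : TabC E L R len ps nn V) (σ : St) (hA : Agree E L R len ps nn σ) {u : ℕ}
    (hrow : RowOK L R ps nn V u σ) (hu : u ≤ nn) (hr : σ.v .row = u * (nn + 1))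
    (hm : σ.v .m = (wd L R u).length) (hk0 : ps < σ.v .k) (hk1 : σ.v .k ≤ nn)
    (hL : L (σ.v .k) ≠ 0)
    (hoff : σ.v .off ≤ V) (hyr : σ.v .yr ≤ 2 * V) (haf : σ.v .af ≤ V) (hac : σ.v .ac ≤ V)
    {S S' : Finset ℕ} (hS : Summ S (σ.v .af) (σ.v .al) (σ.v .ac))
    (hS' : ∀ x, x ∈ S' ↔ σ.v .off ≤ x ∧ x - σ.v .off ∈ xset L R u (σ.v .k) ∧
      x - σ.v .off < σ.v .yr ∧ σ.v .yr < x - σ.v .off + σ.v .m)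
    (hd : ∀ x ∈ S, x ∉ S') :
    WP E collect σ fun σ' t => t ≤ 40 ∧ σ'.v .d = (wd L R (L (σ.v .k))).length ∧
      Summ (S ∪ S') (σ'.v .af) (σ'.v .al) (σ'.v .ac) ∧
      (σ'.v .ac = 0 → σ'.v .af = σ.v .af ∧ σ'.v .al = σ.v .al) := by
  obtain ⟨h_sz, h_ps, h_nn, h_L, h_R, h_len⟩ := hA
  obtain ⟨hps, hSZ, hnS, hV⟩ := hC.bounds
  have hidx := hC.idx_lt hu hk1
  obtain ⟨hs, hx0, hx1, hxc⟩ := hrow _ hk0 hk1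
  obtain ⟨a1, a2, a3⟩ := xset_ap hs
  obtain ⟨l1, l2, l3, l4⟩ := (hC.poolT _ hk0 hk1).resolve_left hL
  unfold collect
  simp [h_sz, h_L, h_len, hr, hm]
  generalize hf : σ.A Arr.X0 (u * (nn + 1) + σ.v Var.k) = f at *
  generalize hl : σ.A Arr.X1 (u * (nn + 1) + σ.v Var.k) = l at *
  generalize hc : σ.A Arr.XC (u * (nn + 1) + σ.v Var.k) = c at *
  have hg : (l - f) / (c - 1) = gap f l c := rfl
  have hgl : gap f l c ≤ V := (Nat.div_le_self _ _).trans (by omega)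
  rw [hg]
  refine ⟨by omega, by omega, by omega, ?_⟩
  refine ⟨by omega, ?_⟩
  refine WP_cut _ (clip_spec (B := 2 * V + 1) _ (by simpa using a3) (by simp; omega)
    (by simp; omega) (by simp; omega) (by simp; omega) (by omega)).frame ?_
  rintro σ1 t1 ⟨⟨ht, hc1, hap, hcl, hcf⟩, hF⟩
  have f1 : σ1.v .off = σ.v .off := by rw [hF.v _ rfl]; simp
  have f2 : σ1.v .af = σ.v .af := by rw [hF.v _ rfl]; simp
  have f3 : σ1.v .al = σ.v .al := by rw [hF.v _ rfl]; simp
  have f4 : σ1.v .ac = σ.v .ac := by rw [hF.v _ rfl]; simp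
  have f5 : σ1.v .d = len (L (σ.v .k)) := by rw [hF.v _ rfl]; simp
  simp at hc1 hap hcl hcf
  have hS2 : ∀ x, x ∈ S' ↔ AP (σ1.v .cf + σ.v .off) (gap f l c) (σ1.v .cc) x := by
    intro x
    rw [hS', a1, AP.add, hap, hm]
    constructor
    · rintro ⟨b1, b2, b3, b4⟩; exact ⟨b1, b2, by omega, b3⟩
    · rintro ⟨b1, b2, b3, b4⟩; exact ⟨b1, b2, b4, by omega⟩
  refine WP_ite.2 ⟨by simp, fun h0 => ?_, fun h0 => ?_⟩
  · simp at h0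
    refine (acc_spec (E := E) σ1 (a1 := σ1.v .cf + σ.v .off) (a2 := σ1.v .cl + σ.v .off)
      (a3 := σ1.v .cc) (S := S) (S' := S') (by decide) (by decide) (by decide) ?_
      (by have := (hcl (by omega)).2; omega) (by omega) (by omega) (by rwa [f2, f3, f4]) ?_ (by omega)
      hd).frame.mono ?_
    · intro σ' h1 h2
      simp [h1, f1]
      have := (hcl (by omega)).2
      exact by omega
    · rw [(hcl (by omega)).1, Nat.add_right_comm]
      exact summ_of_ap hS2 (by omega)
    · rintro σ' t ⟨⟨g1, g2⟩, hF'⟩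
      refine ⟨by omega, ?_, g2, fun h => ?_⟩
      · rw [hF'.v _ rfl, f5, hC.len _ (by omega)]
      · rw [h] at g2
        have := (hS2 (σ1.v .cf + σ.v .off)).2 ⟨0, by omega, by simp⟩
        have h3 : σ1.v .cf + σ.v .off ∈ S ∪ S' := Finset.mem_union_right _ this
        simp [g2.eq_empty] at h3
  · simp at h0 ⊢
    refine ⟨by omega, by rw [f5, hC.len _ (by omega)], ?_, fun _ => ⟨f2, f3⟩⟩
    have : S' = ∅ := by
      ext x; rw [hS2, h0]; simp [AP]
    rw [f2, f3, f4, this, Finset.union_empty]; exact hS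

/-- The part of the occurrences across a point that the search below the node `k` has still to find,
where the word of `k` starts at `off` and the point has the distance `yr` from there. -/
def Rest (L R : ℕ → ℕ) (u k off yr x : ℕ) : Prop :=
  k ≠ 0 ∧ off ≤ x ∧ x - off ∈ crossL (wd L R k) (wd L R u) yr

/-- The occurrences across a point of the word of `k` are those across the cut as well, which the table
contains, and those in the child that the point belongs to. -/
theorem rest_pair {u k off yr : ℕ} (hu : 0 < (wd L R u).length) (hL : L k ≠ 0)
    (hk : wd L R k = wd L R (L k) ++ wd L R (R k)) (hR : R k ≠ 0) (h0 : k ≠ 0) (x : ℕ) :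
    Rest L R u k off yr x ↔ (off ≤ x ∧ x - off ∈ xset L R u k ∧ x - off < yr ∧
      yr < x - off + (wd L R u).length) ∨
      (yr < (wd L R (L k)).length ∧ Rest L R u (L k) off yr x) ∨
      ((wd L R (L k)).length < yr ∧ Rest L R u (R k) (off + (wd L R (L k)).length)
        (yr - (wd L R (L k)).length) x) := by
  simp only [Rest, xset, if_neg hL]
  rw [hk, mem_crossL_append hu]
  have : x - (off + (wd L R (L k)).length) = x - off - (wd L R (L k)).length := by omega
  rw [this]
  constructor
  · grind
  · grind

/-- The invariant of the search for the occurrences of the word of `u` across the point `y` of the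
word of `T`. -/
structure SearchInv (E : Env) (L R len : ℕ → ℕ) (ps nn V u T y : ℕ) (S : Finset ℕ) (σ : St) :
    Prop where
  agree : Agree E L R len ps nn σ
  rowOK : RowOK L R ps nn V u σ
  row : σ.v .row = u * (nn + 1)
  m : σ.v .m = (wd L R u).length
  k : σ.v .k = 0 ∨ (ps < σ.v .k ∧ σ.v .k ≤ nn ∧
    σ.v .off + (wd L R (σ.v .k)).length ≤ (wd L R T).length)
  yr : σ.v .yr ≤ 2 * V
  summ : Summ S (σ.v .af) (σ.v .al) (σ.v .ac)
  af : σ.v .af ≤ V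
  al : σ.v .al ≤ V
  mem : ∀ x, x ∈ crossL (wd L R T) (wd L R u) y ↔ x ∈ S ∨ Rest L R u (σ.v .k) (σ.v .off) (σ.v .yr) x
  disj : ∀ x ∈ S, ¬ Rest L R u (σ.v .k) (σ.v .off) (σ.v .yr) x

/-- Children are smaller than their parent, so that the number of the node bounds the depth of the
search. -/
theorem searchStep_spec (hC : TabC E L R len ps nn V) {u T y : ℕ} (hu : 0 < u) (hups : u ≤ ps)
    (hT : T ≤ nn) {S : Finset ℕ} {σ1 : St} (hI : SearchInv E L R len ps nn V u T y S σ1)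
    (h0 : L (σ1.v .k) ≠ 0) :
    WP E searchStep σ1 fun σ3 t => t ≤ 50 ∧ σ3.v .k - ps < σ1.v .k - ps ∧
      ∃ S', SearchInv E L R len ps nn V u T y S' σ3 := by
  obtain ⟨hA, hrow, hr, hm, hk, hyr, hS, haf, hal, hS1, hS2⟩ := hI
  obtain ⟨hps, hSZ, hnS, hV⟩ := hC.bounds
  have hupos := wd_length_pos hC.poolS hu (by omega)
  have hL0 := hC.L0
  have hk0 : σ1.v .k ≠ 0 := fun h => by rw [h] at h0; exact h0 hL0
  obtain ⟨k0, k1, k2⟩ := hk.resolve_left hk0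
  have hlT := hC.lenV T (by omega)
  have hpair := hC.poolT.wd_pair k0 k1 h0
  obtain ⟨l1, l2, l3, l4⟩ := (hC.poolT _ k0 k1).resolve_left h0
  have hlen : (wd L R (σ1.v .k)).length = (wd L R (L (σ1.v .k))).length +
    (wd L R (R (σ1.v .k))).length := by rw [hpair, List.length_append]
  have hsplit := rest_pair (off := σ1.v .off) (yr := σ1.v .yr) hupos h0 hpair (by omega) hk0
  classical
  obtain ⟨S', hS'⟩ : ∃ S' : Finset ℕ, ∀ x, x ∈ S' ↔ σ1.v .off ≤ x ∧
      x - σ1.v .off ∈ xset L R u (σ1.v .k) ∧ x - σ1.v .off < σ1.v .yr ∧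
      σ1.v .yr < x - σ1.v .off + σ1.v .m := by
    refine ⟨(Finset.range (σ1.v .off + σ1.v .yr)).filter fun x => σ1.v .off ≤ x ∧
      x - σ1.v .off ∈ xset L R u (σ1.v .k) ∧ x - σ1.v .off < σ1.v .yr ∧
      σ1.v .yr < x - σ1.v .off + σ1.v .m, fun x => ?_⟩
    rw [Finset.mem_filter, Finset.mem_range, and_iff_right_iff_imp]
    omega
  have hacV : σ1.v .ac ≤ V := by
    rw [hS.1]
    refine (card_le_of_lt fun x hx => ?_).trans hlT
    exact (crossL_lt ((hS1 x).2 (.inl hx))).2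
  refine WP_cut _ (collect_spec hC σ1 hA hrow (by omega) hr hm k0 k1 h0 (by omega) hyr haf
    hacV hS hS' ?_).frame ?_
  · grind
  rintro σ2 t ⟨⟨ht, hd, hS3, hS4⟩, hF⟩
  have hA2 := hA.frame hF rfl
  have hrow2 := hrow.congr (hF.A _ rfl) (hF.A _ rfl) (hF.A _ rfl)
  have e1 : σ2.v .k = σ1.v .k := hF.v _ rfl
  have e2 : σ2.v .yr = σ1.v .yr := hF.v _ rfl
  have e3 : σ2.v .off = σ1.v .off := hF.v _ rfl
  have e4 : σ2.v .row = σ1.v .row := hF.v _ rfl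
  have e5 : σ2.v .m = σ1.v .m := hF.v _ rfl
  have hnew : ∀ x, x ∈ S ∪ S' → x ∈ crossL (wd L R T) (wd L R u) (y) := by grind
  have hbd : σ2.v .af ≤ V ∧ σ2.v .al ≤ V := by
    by_cases hc : 0 < σ2.v .ac
    · have h1 := crossL_lt (hnew _ (hS3.2 hc).1)
      have h2 := crossL_lt (hnew _ (hS3.2 hc).2.1)
      omega
    · have := hS4 (by omega); omega
  simp only [wp, evs, tf]
  simp only [tf, reduceCtorEq, e1, e2, e3, hA2.sz, hA2.L, hA2.R, hd]
  generalize hdd : (wd L R (L (σ1.v .k))).length = D at *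
  have fin : ∀ σ3 : St, (∀ c, c ≠ .k → c ≠ .yr → c ≠ .off → σ3.v c = σ2.v c) → σ3.A = σ2.A →
      σ3.v .k < σ1.v .k → (σ3.v .k = 0 ∨ (ps < σ3.v .k ∧ σ3.v .k ≤ nn ∧
        σ3.v .off + (wd L R (σ3.v .k)).length ≤ (wd L R T).length)) → σ3.v .yr ≤ 2 * V →
      (∀ x, Rest L R u (σ3.v .k) (σ3.v .off) (σ3.v .yr) x ↔
        (σ1.v .yr < D ∧ Rest L R u (L (σ1.v .k)) (σ1.v .off) (σ1.v .yr) x) ∨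
        (D < σ1.v .yr ∧ Rest L R u (R (σ1.v .k)) (σ1.v .off + D) (σ1.v .yr - D) x)) →
      σ3.v .k - ps < σ1.v .k - ps ∧ ∃ S', SearchInv E L R len ps nn V u T y S' σ3 := by
    intro σ3 hv hA3 hlt hk3 hy3 hR3
    refine ⟨by omega, S ∪ S', ⟨by rw [hv _ (by decide) (by decide) (by decide), hA2.sz],
      by rw [hv _ (by decide) (by decide) (by decide), hA2.ps],
      by rw [hv _ (by decide) (by decide) (by decide), hA2.nn],
      by rw [hA3, hA2.L], by rw [hA3, hA2.R], by rw [hA3, hA2.len]⟩,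
      hrow2.congr (by rw [hA3]) (by rw [hA3]) (by rw [hA3]),
      by rw [hv _ (by decide) (by decide) (by decide), e4, hr],
      by rw [hv _ (by decide) (by decide) (by decide), e5, hm], hk3, hy3, ?_, ?_, ?_,
      fun x => ?_, fun x hx => ?_⟩
    · grind
    · rw [hv .af (by decide) (by decide) (by decide)]; exact hbd.1
    · rw [hv .al (by decide) (by decide) (by decide)]; exact hbd.2
    · grind
    · rw [hR3]
      rcases Finset.mem_union.1 hx with h | h
      · grind
      · have b1 := (hS' x).1 h
        have b2 := b1.2.1
        rw [xset, if_neg h0, mem_crossL, hdd] at b2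
        rintro (⟨c1, c2, c3, c4⟩ | ⟨c1, c2, c3, c4⟩)
        · have c5 := (crossL_lt c4).1
          rw [hdd] at c5
          clear hsplit hpair hS1 hS2 hS3 hnew
          omega
        · clear hsplit hpair hS1 hS2 hS3 hnew
          omega
  have hLV := hC.lenV (L (σ1.v .k)) (by omega)
  refine ⟨by omega, fun hlt => ⟨by omega, by omega, ?_⟩, fun hge =>
    ⟨by omega, fun hgt => ⟨by omega, by omega, by omega, by omega, ?_⟩, fun heq => ⟨by omega, ?_⟩⟩⟩
  · refine fin (σ2.set .k (L (σ1.v .k))) (fun c c1 _ _ => by simp [c1]) (by simp) (by simp; omega) (.inr ?_)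
      (by simp; omega) (fun x => ?_)
    · simp [e3]; omega
    · simp [e2, e3, show σ1.v .yr < D by omega, show ¬ D < σ1.v .yr by omega]
  · refine fin (((σ2.set .k (R (σ1.v .k))).set .yr (σ1.v .yr - D)).set .off (σ1.v .off + D))
      (fun c c1 c2 c3 => by simp [c1, c2, c3]) (by simp) (by simp; omega) (.inr ?_)
      (by simp; omega) (fun x => ?_)
    · simp; omega
    · simp [show D < σ1.v .yr by omega, show ¬ σ1.v .yr < D by omega]
  · refine fin (σ2.set .k 0) (fun c c1 _ _ => by simp [c1]) (by simp) (by simp; omega) (.inl (by simp))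
      (by simp; omega) (fun x => ?_)
    simp [Rest, show ¬ D < σ1.v .yr by omega, show ¬ σ1.v .yr < D by omega]

/-- The occurrences across a point form a progression, so that their extremes and their number determine
them. -/
theorem search_spec (hC : TabC E L R len ps nn V) (σ : St) (hA : Agree E L R len ps nn σ)
    (hrow : RowOK L R ps nn V (σ.v .pu) σ) (hu0 : 0 < σ.v .pu) (hu1 : σ.v .pu ≤ ps)
    (ht0 : ps < σ.v .tj) (ht1 : σ.v .tj ≤ nn) (hy : σ.v .py ≤ 2 * V) :
    WP E search σ fun σ' t => t ≤ 60 * (nn - ps) + 60 ∧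
      Summ (crossL (wd L R (σ.v .tj)) (wd L R (σ.v .pu)) (σ.v .py)) (σ'.v .af) (σ'.v .al) (σ'.v .ac) ∧
      σ'.v .af ≤ V ∧ σ'.v .al ≤ V ∧ σ'.v .ac ≤ V ∧ σ'.v .m = (wd L R (σ.v .pu)).length := by
  obtain ⟨h_sz, h_ps, h_nn, h_L, h_R, h_len⟩ := hA
  obtain ⟨u, hu⟩ : ∃ u, u = σ.v .pu := ⟨_, rfl⟩
  obtain ⟨T, hT⟩ : ∃ T, T = σ.v .tj := ⟨_, rfl⟩
  obtain ⟨hps, hSZ, hnS, hV⟩ := hC.bounds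
  have hidx := fun k hk => hC.idx_lt (u := u) (k := k) (by omega) hk
  have hidx0 := hidx 0 (by omega)
  have hidn := hidx nn le_rfl
  unfold search
  simp [h_sz, h_nn, h_len, ← hu, ← hT]
  refine ⟨by omega, by omega, ?_⟩
  refine WP_while (fun n σ' => n = σ'.v .k - ps ∧
    ∃ S, SearchInv E L R len ps nn V u T (σ.v .py) S σ') 50 ?_ ?_ (n := T - ps) ?_ ?_
  · rintro n σ' ⟨-, S, hI⟩
    have := hI.k
    simp [hI.agree.sz]
    omega
  · rintro n σ' ⟨rfl, S, hI⟩ h0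
    simp [hI.agree.L] at h0
    exact (searchStep_spec hC (by omega) (by omega) (by omega) hI h0).mono
      fun σ3 t ⟨h1, h2, h3⟩ => ⟨h1, _, h2, rfl, h3⟩
  · refine ⟨by simp, ∅, ⟨by simp [h_sz], by simp [h_ps], by simp [h_nn], by simp [h_L], by simp [h_R],
      by simp [h_len]⟩, ?_, by simp, ?_, ?_, ?_, ?_, by simp, by simp, ?_, by simp⟩
    · rw [← hu] at hrow; exact hrow
    · simp [hC.len u (by omega)]
    · simp; omega
    · simp; omega
    · simp; exact summ_empty
    · intro x
      have : T ≠ 0 := by omega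
      simp [Rest, this]
  · rintro m σ' t ⟨-, S, hA, -, -, hm, hk, -, hS, h1, h2, h3, h4⟩ h0 ht
    simp [hA.L] at h0
    have hS' : S = crossL (wd L R T) (wd L R u) (σ.v .py) := by
      ext x
      rw [h3, or_iff_left]
      rintro ⟨c1, c2, c3⟩
      rw [wd_letter (by omega) h0] at c3
      have := crossL_lt c3
      have := mem_crossL.1 c3
      simp at *
      omega
    refine ⟨by omega, hS.of_eq hS', h1, h2, ?_, hm⟩
    rw [hS.1]
    refine (card_le_of_lt fun x hx => ?_).trans (hC.lenV T (by omega))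
    rw [hS'] at hx
    exact (crossL_lt hx).2

end Submatch

namespace Submatch

/-! ### Testing a position for an occurrence -/

/-- The number `n` is the truth value of `P`. -/
def Flag (n : ℕ) (P : Prop) : Prop := (n = 1 ∧ P) ∨ (n = 0 ∧ ¬ P)

theorem Flag.congr {n : ℕ} {P Q : Prop} (h : Flag n P) (hPQ : P ↔ Q) : Flag n Q :=
  (propext hPQ) ▸ h

theorem Flag.ne_zero {n : ℕ} {P : Prop} (h : Flag n P) : n ≠ 0 ↔ P := by
  rcases h with ⟨h1, h2⟩ | ⟨h1, h2⟩ <;> simp [h1, h2]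

theorem Flag.eq_zero {n : ℕ} {P : Prop} (h : Flag n P) : n = 0 ↔ ¬ P := by
  rw [← h.ne_zero, not_not]

open Var Arr in
/-- Tests whether `x` belongs to the progression with first element `f`, last element `l`, gap `p` and
`c` elements. -/
def memb (x f l c p : Var) : Cmd :=
  .ite c (.ite (f - x) (ok ≔ 0) (.ite (x - l) (ok ≔ 0)
    (.ite (x - f - (x - f) / p * p) (ok ≔ 0) (ok ≔ 1)))) (ok ≔ 0)

open Var Arr in
/-- One step of the descent to a node whose word contains the occurrence in question across its
cut. -/
def occStep : Cmd :=
  d ≔ len (L k) ;;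
  .ite (xr + m - d)
    (.ite (d - xr)
      (xf ≔ X0 (row + k) ;; xl ≔ X1 (row + k) ;; xc ≔ XC (row + k) ;; xp ≔ (xl - xf) / (xc - 1) ;;
        memb xr xf xl xc xp ;; k ≔ 0)
      (k ≔ R k ;; xr ≔ xr - d))
    (k ≔ L k)

open Var Arr in
/-- Tests whether the word of the node `pu` occurs in the word of the node `tj` at `bx`. -/
def occ : Cmd :=
  row ≔ pu * (nn + 1) ;; m ≔ len pu ;; k ≔ tj ;; xr ≔ bx ;; ok ≔ 0 ;;
  .ite (xr + m - len k) .skip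
    (.while (L k) occStep ;;
      .ite k (.ite (R pu - R k) .skip (.ite (R k - R pu) .skip (ok ≔ 1))) .skip)

variable {E : Env}

/-- The last condition says that `p` divides `x - f`; it is vacuous for `p = 0`. -/
theorem ap_iff_dvd {f p c x : ℕ} (hc : 0 < c) (hp : c ≤ 1 ∨ 0 < p) :
    AP f p c x ↔ f ≤ x ∧ x ≤ f + (c - 1) * p ∧ x - f - (x - f) / p * p = 0 := by
  constructor
  · rintro ⟨k, hk, rfl⟩
    have := Nat.mul_le_mul_right p (show k ≤ c - 1 by omega)
    refine ⟨by omega, by omega, ?_⟩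
    rcases Nat.eq_zero_or_pos p with h0 | h0
    · simp [h0]
    · simp_all
  · rintro ⟨h1, h2, h3⟩
    have := Nat.div_mul_le_self (x - f) p
    rcases Nat.eq_zero_or_pos p with h0 | h0
    · subst h0
      exact ⟨0, hc, by omega⟩
    · refine ⟨(x - f) / p, ?_, by omega⟩
      by_contra hcon
      have := Nat.mul_le_mul_right p (show c ≤ (x - f) / p by omega)
      obtain ⟨c, rfl⟩ := Nat.exists_eq_succ_of_ne_zero hc.ne'
      rw [Nat.succ_mul] at this
      simp at h2
      omega

theorem memb_spec (σ : St) {x f l c p : Var} (hf : σ.v f < E.M)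
    (hx : σ.v x < E.M) (hl : 0 < σ.v c → σ.v l = σ.v f + (σ.v c - 1) * σ.v p)
    (hp : σ.v c ≤ 1 ∨ 0 < σ.v p) :
    WP E (memb x f l c p) σ fun σ' t => t ≤ 5 ∧
      Flag (σ'.v .ok) (AP (σ.v f) (σ.v p) (σ.v c) (σ.v x)) := by
  have d1 := Nat.div_le_self (σ.v x - σ.v f) (σ.v p)
  have d2 := Nat.div_mul_le_self (σ.v x - σ.v f) (σ.v p)
  by_cases hc : σ.v c = 0
  · simp [memb, hc, Flag, AP]
  · have hl := hl (by omega)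
    simp [memb, hc, Flag, ap_iff_dvd (f := σ.v f) (x := σ.v x) (p := σ.v p) (by omega : 0 < σ.v c) hp]
    omega

variable {L R len : ℕ → ℕ} {ps nn V : ℕ}

/-- The invariant of the test whether the word of `u` occurs at `x` in the word of `T`. -/
structure OccInv (E : Env) (L R len : ℕ → ℕ) (ps nn V u T x : ℕ) (σ : St) : Prop where
  agree : Agree E L R len ps nn σ
  rowOK : RowOK L R ps nn V u σ
  pu : σ.v .pu = u
  row : σ.v .row = u * (nn + 1)
  m : σ.v .m = (wd L R u).length
  run : (σ.v .k = 0 ∧ Flag (σ.v .ok) (Occ (wd L R T) (wd L R u) x)) ∨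
    (ps < σ.v .k ∧ σ.v .k ≤ nn ∧ σ.v .ok = 0 ∧
      σ.v .xr + (wd L R u).length ≤ (wd L R (σ.v .k)).length ∧
      (Occ (wd L R T) (wd L R u) x ↔ Occ (wd L R (σ.v .k)) (wd L R u) (σ.v .xr)))

/-- An occurrence that is not across the cut belongs to one of the children, where the test goes on;
otherwise the table decides. -/
theorem occStep_spec (hC : TabC E L R len ps nn V) {u T x : ℕ} (hu : u ≤ ps)
    {σ : St} (hI : OccInv E L R len ps nn V u T x σ) (h0 : L (σ.v .k) ≠ 0) :
    WP E occStep σ fun σ' t => t ≤ 20 ∧ σ'.v .k - ps < σ.v .k - ps ∧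
      OccInv E L R len ps nn V u T x σ' := by
  obtain ⟨hA, hrow, hpu, hr, hm, hrun⟩ := hI
  obtain ⟨hps, hSZ, hnS, hV⟩ := hC.bounds
  have hL0 := hC.L0
  rcases hrun with ⟨h, -⟩ | ⟨k0, k1, kok, k2, k3⟩
  · rw [h] at h0; exact absurd hL0 h0
  have hidx := hC.idx_lt (show u ≤ nn by omega) k1
  have hkV := hC.lenV _ k1
  have hpair := hC.poolT.wd_pair k0 k1 h0
  obtain ⟨l1, l2, l3, l4⟩ := (hC.poolT _ k0 k1).resolve_left h0
  have hlen : (wd L R (σ.v .k)).length = (wd L R (L (σ.v .k))).length +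
    (wd L R (R (σ.v .k))).length := by rw [hpair, List.length_append]
  have hl := hC.len (L (σ.v .k)) (by omega)
  have mk : ∀ σ' : St, (∀ c, c ≠ .k → c ≠ .xr → c ≠ .d → c ≠ .ok → c ≠ .xf → c ≠ .xl → c ≠ .xc →
      c ≠ .xp → σ'.v c = σ.v c) → σ'.A = σ.A → ((σ'.v .k = 0 ∧
        Flag (σ'.v .ok) (Occ (wd L R T) (wd L R u) x)) ∨
      (ps < σ'.v .k ∧ σ'.v .k ≤ nn ∧ σ'.v .ok = 0 ∧
      σ'.v .xr + (wd L R u).length ≤ (wd L R (σ'.v .k)).length ∧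
      (Occ (wd L R T) (wd L R u) x ↔ Occ (wd L R (σ'.v .k)) (wd L R u) (σ'.v .xr)))) →
      OccInv E L R len ps nn V u T x σ' := by
    intro σ' hv hA' hrun
    have hv' : ∀ c, (decide (c ≠ .k ∧ c ≠ .xr ∧ c ≠ .d ∧ c ≠ .ok ∧ c ≠ .xf ∧ c ≠ .xl ∧ c ≠ .xc ∧
      c ≠ .xp)) = true → σ'.v c = σ.v c := fun c hc => by
        obtain ⟨h1, h2, h3, h4, h5, h6, h7, h8⟩ := of_decide_eq_true hc
        exact hv c h1 h2 h3 h4 h5 h6 h7 h8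
    exact ⟨⟨by rw [hv' _ rfl, hA.sz], by rw [hv' _ rfl, hA.ps], by rw [hv' _ rfl, hA.nn],
      by rw [hA', hA.L], by rw [hA', hA.R], by rw [hA', hA.len]⟩,
      hrow.congr (by rw [hA']) (by rw [hA']) (by rw [hA']), by rw [hv' _ rfl, hpu],
      by rw [hv' _ rfl, hr], by rw [hv' _ rfl, hm], hrun⟩
  unfold occStep
  simp [hA.sz, hA.L, hA.len, hm, hA.R]
  refine ⟨by omega, by omega, fun hgt => ⟨by omega, fun h1 => ?_, fun h1 => ?_⟩,
    fun hle => ⟨by omega, by omega, ?_⟩⟩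
  · simp [hr]
    refine ⟨by omega, ?_⟩
    obtain ⟨hs, hx0, hx1, hxc⟩ := hrow _ k0 k1
    obtain ⟨a1, a2, a3⟩ := xset_ap hs
    have hg : gap (σ.A .X0 (u * (nn + 1) + σ.v .k)) (σ.A .X1 (u * (nn + 1) + σ.v .k))
      (σ.A .XC (u * (nn + 1) + σ.v .k)) ≤ V := (Nat.div_le_self _ _).trans (by omega)
    refine ⟨⟨by omega, by omega, by change gap _ _ _ < _; omega⟩, ?_⟩
    refine WP_cut _ (memb_spec _ (by simp; omega) (by simp; omega) (by simp; exact a2)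
      a3).frame ?_
    rintro σ1 t ⟨⟨ht, hf⟩, hF⟩
    simp at hf ⊢
    refine ⟨by omega, by omega, mk _ (fun c c1 c2 c3 c4 c5 c6 c7 c8 => ?_) ?_ (.inl ⟨by simp, ?_⟩)⟩
    · simp [c1]
      rw [hF.v _ (by simp [memb, Cmd.modV, c4])]; simp [*]
    · simp; funext a; rw [hF.A _ rfl]; simp
    · simp
      refine hf.congr ((a1 _).symm.trans ?_)
      rw [xset, if_neg h0, mem_crossL, k3]
      refine ⟨fun h => h.2.2, fun h => ⟨by omega, by omega, h⟩⟩
  · refine ⟨by omega, by omega, by omega, mk _ (fun c c1 c2 c3 c4 c5 c6 c7 c8 => by simp [*]) (by simp)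
      (.inr ⟨by simp; omega, by simp; omega, by simp [kok], by simp; omega, ?_⟩)⟩
    simp [k3, hl]
    rw [hpair, occ_right (by omega)]
  · refine mk _ (fun c c1 c2 c3 c4 c5 c6 c7 c8 => by simp [*]) (by simp)
      (.inr ⟨by simp; omega, by simp; omega, by simp [kok], by simp; omega, ?_⟩)
    simp [k3]
    rw [hpair, occ_left (by omega)]

/-- If the descent ends at a letter, the pattern is a letter as well, since it is not longer. -/
theorem occ_spec (hC : TabC E L R len ps nn V) (σ : St) (hA : Agree E L R len ps nn σ)
    (hrow : RowOK L R ps nn V (σ.v .pu) σ) (hu0 : 0 < σ.v .pu) (hu1 : σ.v .pu ≤ ps)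
    (ht0 : ps < σ.v .tj) (ht1 : σ.v .tj ≤ nn) (hx : σ.v .bx ≤ 8 * V + 8) :
    WP E occ σ fun σ' t => t ≤ 21 * (nn - ps) + 20 ∧
      Flag (σ'.v .ok) (Occ (wd L R (σ.v .tj)) (wd L R (σ.v .pu)) (σ.v .bx)) := by
  obtain ⟨h_sz, h_ps, h_nn, h_L, h_R, h_len⟩ := hA
  obtain ⟨u, hu⟩ : ∃ u, u = σ.v .pu := ⟨_, rfl⟩
  obtain ⟨T, hT⟩ : ∃ T, T = σ.v .tj := ⟨_, rfl⟩
  obtain ⟨hps, hSZ, hnS, hV⟩ := hC.bounds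
  have hidx := fun k hk => hC.idx_lt (u := u) (k := k) (by omega) hk
  have hidx0 := hidx 0 (by omega)
  have hidn := hidx nn le_rfl
  have hupos := wd_length_pos hC.poolS (show 0 < u by omega) (by omega)
  have hul := hC.len u (by omega)
  have hTl := hC.len T (by omega)
  have huV := hC.lenV u (by omega)
  unfold occ
  simp [h_sz, h_nn, h_len, ← hu, ← hT]
  refine ⟨by omega, by omega, by omega, fun h => .inr ⟨rfl, fun ho => ?_⟩, fun h => ?_⟩
  · have := ho.le hupos; omega
  refine WP_cut (fun σ' t => t ≤ 21 * (T - ps) + 1 ∧ OccInv E L R len ps nn V u T (σ.v .bx) σ' ∧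
      L (σ'.v .k) = 0) ?_ ?_
  · refine WP_while (fun n σ' => n = σ'.v .k - ps ∧ OccInv E L R len ps nn V u T (σ.v .bx) σ') 20
      ?_ ?_ (n := T - ps) ?_ ?_
    · rintro n σ' ⟨-, hI⟩
      have := hI.run
      simp [hI.agree.sz]
      omega
    · rintro n σ' ⟨rfl, hI⟩ h0
      simp [hI.agree.L] at h0
      exact (occStep_spec hC (by omega) hI h0).mono fun σ3 t ⟨h1, h2, h3⟩ => ⟨h1, _, h2, rfl, h3⟩
    · refine ⟨by simp, ⟨by simp [h_sz], by simp [h_ps], by simp [h_nn], by simp [h_L], by simp [h_R],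
        by simp [h_len]⟩, ?_, by simp [hu], by simp, by simp [hul], .inr ⟨by simp; omega,
        by simp; omega, by simp, by simp; omega, by simp⟩⟩
      rw [← hu] at hrow; exact hrow
    · rintro n σ' t ⟨-, hI⟩ h0 ht
      exact ⟨ht, hI, by simpa [hI.agree.L] using h0⟩
  rintro σ1 t ⟨ht, ⟨hA, -, hpu, -, -, hrun⟩, hk⟩
  have hRu := hC.hR u (by omega)
  rcases hrun with ⟨hk0, hf⟩ | ⟨k0, k1, kok, k2, k3⟩
  · simp [hk0]
    exact ⟨by omega, hf⟩
  have hRk := hC.hR _ k1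
  have hw1 := wd_letter (R := R) (by omega : 0 < σ1.v .k) hk
  -- the pattern fits into a text of length 1
  have hLu : L u = 0 := by
    by_contra hLu
    have h1 := (hC.poolS u (by omega) (by omega)).resolve_left hLu
    have h2 := hC.poolS.wd_pair (show 0 < u by omega) (by omega) hLu
    have h3 := wd_length_pos hC.poolS h1.1 (by omega)
    have h4 := wd_length_pos hC.poolS h1.2.2.1 (by omega)
    rw [h2, List.length_append] at k2
    simp [hw1] at k2
    omega
  have hw2 := wd_letter (R := R) (show 0 < u by omega) hLu
  have hocc : Occ (wd L R T) (wd L R u) (σ.v .bx) ↔ R (σ1.v .k) = R u := by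
    rw [k3, hw1, hw2]
    rw [hw1, hw2] at k2
    have : σ1.v .xr = 0 := by simpa using k2
    rw [this]
    refine ⟨fun h => by simpa using h 0 (by simp), fun h i hi => ?_⟩
    have : i = 0 := by simpa using hi
    simp [this, h]
  simp [hA.sz, hA.R, hpu, hocc, Flag]
  refine ⟨fun _ => ⟨by omega, by omega, ?_⟩, by omega⟩
  intro h1
  refine ⟨by omega, fun h2 => ⟨by omega, .inr ⟨kok, by omega⟩⟩, by omega⟩

end Submatch

namespace Submatch

/-! ### Filtering a progression by occurrences -/

open Var Arr in
/-- Restricts the progression `(cf, cp, cc)` to the window `[lo, hi)` and, if the word of `pu` occurs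
in the word of `tj` at its first element, adds it, shifted back by `sh`, to the set represented by
`(rf, rl, rc)`. -/
def part : Cmd :=
  clip ;;
  .ite cc (bx ≔ cf ;; occ ;; .ite ok (acc rf rl rc (cf - sh) (cl - sh) cc) .skip) .skip

open Var Arr in
/-- Adds `cand`, shifted back by `sh`, to the set represented by `(rf, rl, rc)` if it belongs to the
progression `(cf, cl, cp, cc)`. -/
def candidate (cand : Var) : Cmd :=
  memb cand cf cl cc cp ;; .ite ok (acc rf rl rc (cand - sh) (cand - sh) 1) .skip

open Var Arr in
/-- The elements of the progression `(cf, cp, cc)` where an occurrence goes across the point `py`. -/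
def crossPart : Cmd :=
  lo ≔ py + 1 - m ;; hi ≔ py ;; clip ;;
  .ite (cc - 1)
    (.ite ac
      (zp ≔ (al - af) / (ac - 1) ;;
        .ite ((zp - cp) + (cp - zp)) (candidate af ;; .ite (al - af) (candidate al) .skip)
          (lo ≔ af ;; hi ≔ al + 1 ;; part))
      .skip)
    part

open Var Arr in
/-- Adds the elements of the progression `(qf, qp, qc)` at which the word of `pu` occurs in the word of
`tj`, shifted back by `sh`, to the set represented by `(rf, rl, rc)`. The occurrences before and behind
the pivot `py` are tested together. -/
def filter : Cmd :=
  cf ≔ qf ;; cp ≔ qp ;; cc ≔ qc ;; lo ≔ 0 ;; hi ≔ py + 1 - len pu ;; part ;;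
  cf ≔ qf ;; cc ≔ qc ;; lo ≔ py ;; hi ≔ qf + qc * qp + 1 ;; part ;;
  search ;;
  cf ≔ qf ;; cp ≔ qp ;; cc ≔ qc ;; crossPart

/-- The numbers `f`, `l`, `c` represent a set of numbers below `V`. -/
structure AccS (V : ℕ) (S : Finset ℕ) (f l c : ℕ) : Prop where
  summ : Summ S f l c
  fV : f ≤ V
  lV : l ≤ V
  lt : ∀ x ∈ S, x < V

theorem AccS.cV {V : ℕ} {S : Finset ℕ} {f l c : ℕ} (h : AccS V S f l c) : c ≤ V := by
  rw [h.summ.1]; exact card_le_of_lt h.lt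

theorem AccS.of_eq {V : ℕ} {S S' : Finset ℕ} {f l c : ℕ} (h : AccS V S f l c) (he : S = S') :
    AccS V S' f l c := he ▸ h

variable {E : Env} {L R len : ℕ → ℕ} {ps nn V : ℕ}

/-- The rule for an addition to the set of results. -/
theorem accR_spec (hV : 16 * V + 16 < E.M) (σ : St) {e1 e2 e3 : Ex} {a1 a2 a3 : ℕ}
    (he : ∀ σ', (∀ y, y ≠ .rf → y ≠ .rl → y ≠ .rc → σ'.v y = σ.v y) → σ'.A = σ.A →
      (e1.ok E σ' ∧ e1.ev σ' = a1) ∧ (e2.ok E σ' ∧ e2.ev σ' = a2) ∧ (e3.ok E σ' ∧ e3.ev σ' = a3))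
    {S S' : Finset ℕ} (hS : AccS V S (σ.v .rf) (σ.v .rl) (σ.v .rc)) (hS' : Summ S' a1 a2 a3)
    (h0 : 0 < a3) (hd : ∀ x ∈ S, x ∉ S') (hlt : ∀ x ∈ S', x < V) :
    WP E (acc .rf .rl .rc e1 e2 e3) σ fun σ' t => t ≤ 10 ∧
      AccS V (S ∪ S') (σ'.v .rf) (σ'.v .rl) (σ'.v .rc) := by
  have hc := hS.cV
  have hf := hS.fV
  have h2 := hS'.2 h0
  have h3 := hlt _ h2.1
  have h4 := hlt _ h2.2.1
  have h5 : a3 ≤ V := by rw [hS'.1]; exact card_le_of_lt hlt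
  refine (acc_spec (E := E) σ (by decide) (by decide) (by decide) he (by omega) (by omega)
    (by omega) hS.summ hS' h0 hd).mono fun σ' t ⟨ht, hs⟩ => ⟨ht, hs, ?_, ?_, ?_⟩
  all_goals have hlt' : ∀ x ∈ S ∪ S', x < V := fun x hx => (Finset.mem_union.1 hx).elim (hS.lt x) (hlt x)
  · have hne : 0 < σ'.v .rc := by
      rw [hs.1, Finset.card_pos]; exact ⟨a1, Finset.mem_union_right _ h2.1⟩
    exact (hlt' _ (hs.2 hne).1).le
  · have hne : 0 < σ'.v .rc := by
      rw [hs.1, Finset.card_pos]; exact ⟨a1, Finset.mem_union_right _ h2.1⟩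
    exact (hlt' _ (hs.2 hne).2.1).le
  · exact hlt'

/-- The requirements of the tests for occurrences. -/
structure OccReq (E : Env) (L R len : ℕ → ℕ) (ps nn V u T : ℕ) (σ : St) : Prop where
  agree : Agree E L R len ps nn σ
  rowOK : RowOK L R ps nn V u σ
  pu : σ.v .pu = u
  tj : σ.v .tj = T

theorem OccReq.frame {c : Cmd} {σ σ' : St} {u T : ℕ} (h : OccReq E L R len ps nn V u T σ)
    (hf : Frame c σ σ')
    (hv : (c.modV .sz || c.modV .ps || c.modV .nn || c.modA .L || c.modA .R || c.modA .len) = false)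
    (hx : (c.modA .X0 || c.modA .X1 || c.modA .XC || c.modV .pu || c.modV .tj) = false) :
    OccReq E L R len ps nn V u T σ' := by
  simp only [Bool.or_eq_false_iff] at hx
  obtain ⟨⟨⟨⟨h1, h2⟩, h3⟩, h4⟩, h5⟩ := hx
  exact ⟨h.agree.frame hf hv, h.rowOK.congr (hf.A _ h1) (hf.A _ h2) (hf.A _ h3),
    by rw [hf.v _ h4, h.pu], by rw [hf.v _ h5, h.tj]⟩

theorem OccReq.set {σ : St} {u T : ℕ} (h : OccReq E L R len ps nn V u T σ) {x : Var} (n : ℕ)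
    (hx : (decide (x = .sz ∨ x = .ps ∨ x = .nn ∨ x = .pu ∨ x = .tj)) = false) :
    OccReq E L R len ps nn V u T (σ.set x n) := by
  have hx := of_decide_eq_false hx
  simp only [not_or] at hx
  obtain ⟨h1, h2, h3, h4, h5⟩ := hx
  refine ⟨⟨?_, ?_, ?_, h.agree.L, h.agree.R, h.agree.len⟩, h.rowOK.congr rfl rfl rfl, ?_, ?_⟩
  · simp [Ne.symm h1, h.agree.sz]
  · simp [Ne.symm h2, h.agree.ps]
  · simp [Ne.symm h3, h.agree.nn]
  · simp [Ne.symm h4, h.pu]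
  · simp [Ne.symm h5, h.tj]

theorem OccReq.occ {σ : St} {u T : ℕ} (hC : TabC E L R len ps nn V)
    (h : OccReq E L R len ps nn V u T σ) (hu0 : 0 < u) (hu1 : u ≤ ps) (ht0 : ps < T) (ht1 : T ≤ nn)
    (hx : σ.v .bx ≤ 8 * V + 8) :
    WP E occ σ fun σ' t => t ≤ 21 * (nn - ps) + 20 ∧
      Flag (σ'.v .ok) (Occ (wd L R T) (wd L R u) (σ.v .bx)) := by
  have := occ_spec hC σ h.agree (by rw [h.pu]; exact h.rowOK) (by rw [h.pu]; exact hu0)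
    (by rw [h.pu]; exact hu1) (by rw [h.tj]; exact ht0) (by rw [h.tj]; exact ht1) hx
  rwa [h.pu, h.tj] at this

/-- By `hall` the occurrence at one element of the part decides on all of them. -/
theorem part_spec (hC : TabC E L R len ps nn V) {u T : ℕ} (hu0 : 0 < u) (hu1 : u ≤ ps)
    (ht0 : ps < T) (ht1 : T ≤ nn) (σ : St) (hR : OccReq E L R len ps nn V u T σ)
    {f p c a b s : ℕ} (hf : σ.v .cf = f) (hp : σ.v .cp = p) (hc : σ.v .cc = c) (ha : σ.v .lo = a)
    (hb : σ.v .hi = b) (hs : σ.v .sh = s)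
    (hfB : f ≤ 4 * V + 2) (hpB : p ≤ 4 * V + 2) (hcB : c ≤ 4 * V + 2) (haB : a ≤ 4 * V + 2)
    (hbB : b ≤ 4 * V + 2) (hcp : c ≤ 1 ∨ 0 < p) (hsf : s ≤ f)
    (hall : ∀ x y, AP f p c x → a ≤ x → x < b → AP f p c y → a ≤ y → y < b →
      Occ (wd L R T) (wd L R u) x → Occ (wd L R T) (wd L R u) y)
    {S S' : Finset ℕ} (hS : AccS V S (σ.v .rf) (σ.v .rl) (σ.v .rc))
    (hS' : ∀ z, z ∈ S' ↔ AP f p c (z + s) ∧ a ≤ z + s ∧ z + s < b ∧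
      Occ (wd L R T) (wd L R u) (z + s)) (hd : ∀ x ∈ S, x ∉ S') :
    WP E part σ fun σ' t => t ≤ 21 * (nn - ps) + 50 ∧
      AccS V (S ∪ S') (σ'.v .rf) (σ'.v .rl) (σ'.v .rc) := by
  subst hf hp hc ha hb hs
  obtain ⟨hps, hSZ, hnS, hV⟩ := hC.bounds
  have hupos := wd_length_pos hC.poolS hu0 (by omega)
  have hTV := hC.lenV T (by omega)
  refine WP_cut _ (clip_spec (B := 4 * V + 2) σ hcp haB hbB hcB hfB (by omega)).frame ?_
  rintro σ1 t1 ⟨⟨ht, hc1, hap, hcl, hcf⟩, hF⟩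
  have hR1 := hR.frame hF rfl rfl
  have f1 : σ1.v .sh = σ.v .sh := hF.v _ rfl
  have f2 : σ1.v .rf = σ.v .rf := hF.v _ rfl
  have f3 : σ1.v .rl = σ.v .rl := hF.v _ rfl
  have f4 : σ1.v .rc = σ.v .rc := hF.v _ rfl
  refine WP_ite.2 ⟨by simp, fun h0 => ?_, fun h0 => ?_⟩
  swap
  · simp at h0 ⊢
    refine ⟨by omega, ?_⟩
    rw [f2, f3, f4]
    refine hS.of_eq ?_
    have : S' = ∅ := by
      ext z
      rw [hS', ← and_assoc, ← and_assoc, and_assoc (a := AP _ _ _ _), ← hap, h0]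
      simp [AP]
    rw [this, Finset.union_empty]
  · simp at h0
    simp only [wp, evs, tf]
    refine WP_cut _ ((hR1.set (x := .bx) _ rfl).occ hC hu0 hu1 ht0 ht1
      (by simp; omega)).frame ?_
    rintro σ2 t2 ⟨⟨ht2, hfl⟩, hF2⟩
    simp at hfl
    have g0 : σ2.v .cf = σ1.v .cf := by rw [hF2.v _ rfl]; simp
    have g1 : σ2.v .cl = σ1.v .cl := by rw [hF2.v _ rfl]; simp
    have g2 : σ2.v .cc = σ1.v .cc := by rw [hF2.v _ rfl]; simp
    have g3 : σ2.v .sh = σ.v .sh := by rw [hF2.v _ rfl]; simp [f1]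
    have g4 : σ2.v .rf = σ.v .rf := by rw [hF2.v _ rfl]; simp [f2]
    have g5 : σ2.v .rl = σ.v .rl := by rw [hF2.v _ rfl]; simp [f3]
    have g6 : σ2.v .rc = σ.v .rc := by rw [hF2.v _ rfl]; simp [f4]
    have hmem := (hap (σ1.v .cf)).1 ⟨0, by omega, by simp⟩
    refine WP_ite.2 ⟨by simp, fun h1 => ?_, fun h1 => ?_⟩
    swap
    · simp at h1 ⊢
      refine ⟨by omega, ?_⟩
      rw [g4, g5, g6]
      refine hS.of_eq ?_
      have : S' = ∅ := by
        ext z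
        simp only [hS', Finset.notMem_empty, iff_false, not_and]
        intro z1 z2 z3 z4
        exact (hfl.eq_zero.1 h1) (hall _ _ z1 z2 z3 hmem.1 hmem.2.1 hmem.2.2 z4)
      rw [this, Finset.union_empty]
    · simp at h1
      have h1 := hfl.ne_zero.1 h1
      obtain ⟨hcl1, hcl2⟩ := hcl (by omega)
      have hcf0 : σ.v .sh ≤ σ1.v .cf := by
        obtain ⟨k, _, hk⟩ := hmem.1
        rw [hk]; exact hsf.trans (Nat.le_add_right _ _)
      have hS2 : ∀ z, z ∈ S' ↔ AP (σ1.v .cf - σ.v .sh) (σ.v .cp) (σ1.v .cc) z := by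
        intro z
        have e := AP.add (f := σ1.v .cf - σ.v .sh) (p := σ.v .cp) (c := σ1.v .cc) (o := σ.v .sh)
          (x := z + σ.v .sh)
        rw [Nat.sub_add_cancel hcf0, Nat.add_sub_cancel] at e
        rw [hS', ← and_iff_right (a := σ.v .sh ≤ z + σ.v .sh) (Nat.le_add_left _ _) (b := AP _ _ _ z),
          ← e, hap]
        exact ⟨fun h => ⟨h.1, h.2.1, h.2.2.1⟩, fun h => ⟨h.1, h.2.1, h.2.2,
          hall _ _ hmem.1 hmem.2.1 hmem.2.2 h.1 h.2.1 h.2.2 h1⟩⟩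
      refine (accR_spec hV σ2 (a1 := σ1.v .cf - σ.v .sh) (a2 := σ1.v .cl - σ.v .sh) (a3 := σ1.v .cc)
        (S := S) (S' := S') ?_ (by rwa [g4, g5, g6]) ?_ (by omega) hd ?_).mono ?_
      · intro σ' h1 h2
        simp [h1, g0, g1, g2, g3]
        omega
      · have := summ_of_ap hS2 (by omega)
        rwa [show σ1.v .cl - σ.v .sh = σ1.v .cf - σ.v .sh + (σ1.v .cc - 1) * σ.v .cp by omega]
      · intro x hx
        have := ((hS' x).1 hx).2.2.2.le hupos
        omega
      · rintro σ' t ⟨b1, b2⟩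
        exact ⟨by omega, b2⟩

theorem summ_singleton (n : ℕ) : Summ {n} n n 1 :=
  ⟨by simp, fun _ => ⟨Finset.mem_singleton_self _, Finset.mem_singleton_self _, fun x hx => by
    rw [Finset.mem_singleton.1 hx]; exact ⟨le_rfl, le_rfl⟩⟩⟩

theorem AP.eq_of_le_one {f p c x y : ℕ} (hx : AP f p c x) (hy : AP f p c y) (hc : c ≤ 1) :
    x = y := by
  obtain ⟨k, hk, rfl⟩ := hx
  obtain ⟨k', hk', rfl⟩ := hy
  rw [show k = k' by omega]

/-- Two progressions with the same gap and a common element agree on their common range. -/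
theorem AP.transfer {f p c f' c' x y : ℕ} (hp : 0 < p) (hx : AP f p c x) (hy : AP f p c y)
    (hx' : AP f' p c' x) (h1 : f' ≤ y) (h2 : y ≤ f' + (c' - 1) * p) : AP f' p c' y := by
  obtain ⟨k, hk, rfl⟩ := hx
  obtain ⟨k', hk', rfl⟩ := hy
  obtain ⟨i, hi, h⟩ := hx'
  obtain ⟨j, hj⟩ : ∃ j, f + k' * p = f' + j * p := by
    rcases le_total k k' with h3 | h3
    · obtain ⟨d, rfl⟩ := Nat.exists_eq_add_of_le h3
      exact ⟨i + d, by rw [Nat.add_mul, Nat.add_mul]; omega⟩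
    · obtain ⟨d, rfl⟩ := Nat.exists_eq_add_of_le h3
      rw [Nat.add_mul] at h
      have h4 : d * p ≤ i * p := by omega
      have h5 := Nat.le_of_mul_le_mul_right h4 hp
      obtain ⟨e, rfl⟩ := Nat.exists_eq_add_of_le h5
      rw [Nat.add_mul] at h
      exact ⟨e, by omega⟩
  refine ⟨j, ?_, hj⟩
  have h3 : j * p ≤ (c' - 1) * p := by omega
  have := Nat.le_of_mul_le_mul_right h3 hp
  omega

/-- At a candidate from the set of occurrences across the pivot, only the membership in the progression
has to be tested. -/
theorem candidate_spec (hC : TabC E L R len ps nn V) {cand : Var} (hne : cand ≠ .ok ∧ cand ≠ .rf ∧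
    cand ≠ .rl ∧ cand ≠ .rc) (σ : St) {f p c s : ℕ} (hf : σ.v .cf = f) (hp : σ.v .cp = p)
    (hc : σ.v .cc = c) (hs : σ.v .sh = s) (hl : 0 < c → σ.v .cl = f + (c - 1) * p)
    (hcp : c ≤ 1 ∨ 0 < p) (hsf : s ≤ f) (hfB : f ≤ 4 * V + 2) (hcand : σ.v cand < V)
    {S S' : Finset ℕ} (hS : AccS V S (σ.v .rf) (σ.v .rl) (σ.v .rc))
    (hS' : ∀ z, z ∈ S' ↔ AP f p c (z + s) ∧ z + s = σ.v cand) (hd : ∀ x ∈ S, x ∉ S') :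
    WP E (candidate cand) σ fun σ' t => t ≤ 20 ∧
      AccS V (S ∪ S') (σ'.v .rf) (σ'.v .rl) (σ'.v .rc) := by
  subst hf hp hc hs
  have hV := hC.hV
  obtain ⟨n1, n2, n3, n4⟩ := hne
  refine WP_cut _ (memb_spec σ (by omega) (by omega) hl hcp).frame ?_
  rintro σ1 t ⟨⟨ht, hfl⟩, hF⟩
  have g0 : σ1.v cand = σ.v cand := hF.v _ (by simp [memb, Cmd.modV, n1])
  have g3 : σ1.v .sh = σ.v .sh := hF.v _ rfl
  have g4 : σ1.v .rf = σ.v .rf := hF.v _ rfl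
  have g5 : σ1.v .rl = σ.v .rl := hF.v _ rfl
  have g6 : σ1.v .rc = σ.v .rc := hF.v _ rfl
  refine WP_ite.2 ⟨by simp, fun h1 => ?_, fun h1 => ?_⟩
  · simp at h1
    have h1 := hfl.ne_zero.1 h1
    have hge : σ.v .sh ≤ σ.v cand := by
      obtain ⟨k, _, hk⟩ := h1
      rw [hk]; exact hsf.trans (Nat.le_add_right _ _)
    have hSe : S' = {σ.v cand - σ.v .sh} := by grind
    refine (accR_spec hV σ1 (a1 := σ.v cand - σ.v .sh) (a2 := σ.v cand - σ.v .sh) (a3 := 1)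
      (S := S) (S' := S') ?_ (by rwa [g4, g5, g6]) ?_ one_pos hd ?_).mono ?_
    · intro σ' h1 h2
      simp [h1, g0, g3, n2, n3, n4]
      omega
    · rw [hSe]; exact summ_singleton _
    · rw [hSe]; simp; omega
    · rintro σ' t ⟨b1, b2⟩
      exact ⟨by omega, b2⟩
  · simp at h1 ⊢
    refine ⟨by omega, ?_⟩
    rw [g4, g5, g6]
    refine hS.of_eq ?_
    have h1 := hfl.eq_zero.1 h1
    have : S' = ∅ := by grind
    rw [this, Finset.union_empty]

theorem mem_crossL_window {t u : List ℕ} {y x : ℕ} :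
    (y + 1 - u.length ≤ x ∧ x < y ∧ Occ t u x) ↔ x ∈ crossL t u y := by
  rw [mem_crossL]
  constructor
  · rintro ⟨h1, h2, h3⟩; exact ⟨h2, by omega, h3⟩
  · rintro ⟨h1, h2, h3⟩; exact ⟨by omega, h1, h3⟩

/-- Two progressions are intersected. If their gaps agree, they agree on their common range as soon as
they meet (`AP.transfer`), and one test is enough; otherwise `hcross` leaves only the extremal
occurrences. -/
theorem crossPart_spec (hC : TabC E L R len ps nn V) {u T : ℕ} (hu0 : 0 < u) (hu1 : u ≤ ps)
    (ht0 : ps < T) (ht1 : T ≤ nn) (σ : St) (hR : OccReq E L R len ps nn V u T σ)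
    {f p c y s : ℕ} (hf : σ.v .cf = f) (hp : σ.v .cp = p) (hc : σ.v .cc = c) (hy : σ.v .py = y)
    (hs : σ.v .sh = s) (hm : σ.v .m = (wd L R u).length)
    (hfB : f ≤ 4 * V + 1) (hpB : p ≤ 4 * V + 1) (hcB : c ≤ 4 * V + 1) (hyB : y ≤ 2 * V)
    (hcp : c ≤ 1 ∨ 0 < p) (hsf : s ≤ f)
    (hZ : Summ (crossL (wd L R T) (wd L R u) y) (σ.v .af) (σ.v .al) (σ.v .ac))
    (haf : σ.v .af ≤ V) (hal : σ.v .al ≤ V) (hac : σ.v .ac ≤ V)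
    (hcross : ∀ x q, 1 < c → AP f p c x → x ∈ crossL (wd L R T) (wd L R u) y →
      StepProp (crossL (wd L R T) (wd L R u) y) q → x = σ.v .af ∨ x = σ.v .al ∨ p = q)
    {S S' : Finset ℕ} (hS : AccS V S (σ.v .rf) (σ.v .rl) (σ.v .rc))
    (hS' : ∀ z, z ∈ S' ↔ AP f p c (z + s) ∧ z + s ∈ crossL (wd L R T) (wd L R u) y)
    (hd : ∀ x ∈ S, x ∉ S') :
    WP E crossPart σ fun σ' t => t ≤ 21 * (nn - ps) + 80 ∧
      AccS V (S ∪ S') (σ'.v .rf) (σ'.v .rl) (σ'.v .rc) := by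
  obtain ⟨hps, hSZ, hnS, hV⟩ := hC.bounds
  have hupos := wd_length_pos hC.poolS hu0 (by omega)
  have hTV := hC.lenV T (by omega)
  have hZV : ∀ x ∈ crossL (wd L R T) (wd L R u) y, x < V := fun x hx => by
    have := crossL_lt hx; omega
  have huV := hC.lenV u (by omega)
  simp only [wp, evs, tf, crossPart, hy, hm, reduceCtorEq]
  refine ⟨by omega, ?_⟩
  refine WP_cut _ (clip_spec (B := 4 * V + 1) _ (by simp [hc, hp]; omega) (by simp; omega)
    (by simp; omega) (by simp; omega) (by simp; omega) (by omega)).frame ?_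
  rintro σ1 t1 ⟨⟨ht, hc1, hap, hcl, hcf⟩, hF⟩
  simp [hc, hp, hf] at hc1 hap hcl hcf
  have hv : ∀ x, (decide (x ≠ .cf ∧ x ≠ .cl ∧ x ≠ .cc ∧ x ≠ .k1 ∧ x ≠ .k2 ∧ x ≠ .lo ∧ x ≠ .hi)) = true →
      σ1.v x = σ.v x := by
    intro x hx
    obtain ⟨h1, h2, h3, h4, h5, h6, h7⟩ := of_decide_eq_true hx
    rw [hF.v _ (by simp [clip, Cmd.modV, *])]; simp [*]
  have hR1 := ((hR.set (x := .lo) (y + 1 - (wd L R u).length) rfl).set (x := .hi) y rfl).frame hF rfl rfl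
  have e1 : σ1.v .lo = y + 1 - (wd L R u).length := by rw [hF.v _ rfl]; simp
  have e2 : σ1.v .hi = y := by rw [hF.v _ rfl]; simp
  have f1 := hv .sh rfl
  have f2 := hv .rf rfl
  have f3 := hv .rl rfl
  have f4 := hv .rc rfl
  have f5 := hv .af rfl
  have f6 := hv .al rfl
  have f7 := hv .ac rfl
  have f8 := hv .cp rfl
  clear hv
  have hS2 : ∀ z, z ∈ S' ↔ AP (σ1.v .cf) p (σ1.v .cc) (z + s) ∧
      z + s ∈ crossL (wd L R T) (wd L R u) y := by
    intro z
    rw [hS', hap, and_assoc]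
    refine and_congr_right fun _ => ⟨fun h => ⟨?_, h⟩, fun h => h.2⟩
    have := mem_crossL_window.2 h
    exact ⟨by omega, this.2.1⟩
  have hsf1 : 0 < σ1.v .cc → s ≤ σ1.v .cf := by
    intro h
    obtain ⟨⟨k, _, hk⟩, -⟩ := (hap (σ1.v .cf)).1 ⟨0, by omega, by simp⟩
    rw [hk]; exact hsf.trans (Nat.le_add_right _ _)
  refine WP_ite.2 ⟨by simp; omega, fun h0 => ?_, fun h0 => ?_⟩
  swap
  · simp at h0
    rcases Nat.eq_zero_or_pos (σ1.v .cc) with hz | hz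
    · -- the empty progression
      have : S' = ∅ := by
        ext z; rw [hS2, hz]; simp [AP]
      have hwp : WP E part σ1 fun σ' t => t ≤ 21 * (nn - ps) + 50 ∧
          AccS V (S ∪ S') (σ'.v .rf) (σ'.v .rl) (σ'.v .rc) := by
        refine WP_cut _ (clip_spec (B := 4 * V + 2) σ1 (by omega) (by omega) (by omega)
          (by omega) (by omega) (by omega)).frame ?_
        rintro σ2 t ⟨⟨h1, h2, -⟩, hF2⟩
        have : σ2.v .cc = 0 := by omega
        simp [this]
        refine ⟨by omega, ?_⟩
        rw [hF2.v _ rfl, hF2.v _ rfl, hF2.v _ rfl, f2, f3, f4]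
        simp_all
      exact hwp.mono fun σ' t h => ⟨by omega, h.2⟩
    · refine (part_spec hC hu0 hu1 ht0 ht1 σ1 hR1 rfl rfl rfl rfl rfl rfl (by omega) (by omega)
        (by omega) (by omega) (by omega) (by omega) (by have := hsf1 hz; omega) ?_
        (S := S) (S' := S') (by rwa [f2, f3, f4]) ?_ hd).mono fun σ' t h => ⟨by omega, h.2⟩
      · intro x x' h1 _ _ h2 _ _ h
        rwa [← h1.eq_of_le_one h2 (by omega)]
      · intro z
        rw [hS2, f8, hp, f1, hs, e1, e2, mem_crossL_window]
  simp at h0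
  have hacc : 0 < σ1.v .ac → σ1.v .af ∈ crossL (wd L R T) (wd L R u) y ∧
      σ1.v .al ∈ crossL (wd L R T) (wd L R u) y ∧ ∀ x ∈ crossL (wd L R T) (wd L R u) y,
      σ1.v .af ≤ x ∧ x ≤ σ1.v .al := by
    rw [f5, f6, f7]; exact hZ.2
  rw [← f5, ← f6, ← f7] at hZ
  rw [← f5, ← f6] at hcross
  refine WP_ite.2 ⟨by simp, fun h1 => ?_, fun h1 => ?_⟩
  swap
  · simp at h1 ⊢
    refine ⟨by omega, ?_⟩
    rw [f2, f3, f4]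
    rw [h1] at hZ
    refine hS.of_eq ?_
    have : S' = ∅ := by
      ext z; rw [hS2, hZ.eq_empty]; simp
    rw [this, Finset.union_empty]
  simp at h1
  obtain ⟨a1, a2, a3⟩ := hacc (by omega)
  obtain ⟨q, hq⟩ := crossL_step (wd L R T) (wd L R u) y
  obtain ⟨z1, z2, z3⟩ := hZ.spec hq
  have hg : (σ1.v .al - σ1.v .af) / (σ1.v .ac - 1) = gap (σ1.v .af) (σ1.v .al) (σ1.v .ac) := rfl
  have hgl : gap (σ1.v .af) (σ1.v .al) (σ1.v .ac) ≤ V := (Nat.div_le_self _ _).trans (by omega)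
  simp only [wp, evs, tf, reduceCtorEq, hg]
  generalize hgg : gap (σ1.v .af) (σ1.v .al) (σ1.v .ac) = g at *
  refine ⟨by omega, by omega, fun h2 => ?_, fun h2 => ?_⟩
  · -- only the extremal occurrences can belong to the progression
    obtain ⟨S1, hS1⟩ : ∃ S1, S1 = S'.filter fun z => z + s = σ1.v .af := ⟨_, rfl⟩
    obtain ⟨S2, hS3⟩ : ∃ S2, S2 = S'.filter fun z => z + s = σ1.v .al := ⟨_, rfl⟩
    have hm1 : ∀ z, z ∈ S1 ↔ AP (σ1.v .cf) p (σ1.v .cc) (z + s) ∧ z + s = σ1.v .af := by grind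
    have hm2 : ∀ z, z ∈ S2 ↔ AP (σ1.v .cf) p (σ1.v .cc) (z + s) ∧ z + s = σ1.v .al := by grind
    have hSS : S' = S1 ∪ S2 := by grind
    have hsub1 : ∀ x ∈ S, x ∉ S1 := fun x hx h => hd x hx (by rw [hSS]; exact Finset.mem_union_left _ h)
    refine WP_cut _ (candidate_spec hC (cand := .af) (by decide) (σ1.set .zp g)
      (f := σ1.v .cf) (p := p) (c := σ1.v .cc) (s := s) rfl
      (f8.trans hp) rfl (f1.trans hs) (by simpa using fun h => (hcl h).1) (by omega)
      (hsf1 (by omega)) (by omega)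
      (hZV _ a1) (S := S) (S' := S1) (by simp; rwa [f2, f3, f4]) hm1 hsub1).frame ?_
    rintro σ2 t2 ⟨⟨ht2, hS4⟩, hF2⟩
    have g1 : σ2.v .al = σ1.v .al := by rw [hF2.v _ rfl]; simp
    have g2 : σ2.v .af = σ1.v .af := by rw [hF2.v _ rfl]; simp
    have g3 : σ2.v .cf = σ1.v .cf := by rw [hF2.v _ rfl]; simp
    have g4 : σ2.v .cc = σ1.v .cc := by rw [hF2.v _ rfl]; simp
    have g5 : σ2.v .cp = p := by rw [hF2.v _ rfl]; simp [f8, hp]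
    have g6 : σ2.v .sh = s := by rw [hF2.v _ rfl]; simp [f1, hs]
    have g7 : σ2.v .cl = σ1.v .cl := by rw [hF2.v _ rfl]; simp
    refine WP_ite.2 ⟨by simp; omega, fun h3 => ?_, fun h3 => ?_⟩
    · simp [g1, g2] at h3
      refine (candidate_spec hC (cand := .al) (by decide) σ2 g3 g5 g4 g6
        (by rw [g7]; exact fun h => (hcl h).1) (by omega) (hsf1 (by omega)) (by omega)
        (by rw [g1]; exact hZV _ a2) (S := S ∪ S1) (S' := S2) hS4 (by rw [g1]; exact hm2) ?_).mono
        fun σ' t h => ⟨by omega, h.2.of_eq ?_⟩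
      · grind
      · rw [hSS, Finset.union_assoc]
    · simp [g1, g2] at h3 ⊢
      refine ⟨by omega, hS4.of_eq ?_⟩
      have h4 := (a3 _ a2).1
      have : S2 = S1 := by
        ext z; rw [hm1, hm2, show σ1.v .al = σ1.v .af by omega]
      rw [hSS, this, Finset.union_self]
  · -- both progressions have the same gap
    have hg0 : g = p := by omega
    subst hg0
    have hgpos : 0 < g := by omega
    have hac2 : 1 < σ1.v .ac := by grind
    refine ⟨by omega, ?_⟩
    refine (part_spec hC hu0 hu1 ht0 ht1 _ (((hR1.set (x := .zp) _ rfl).set (x := .lo) _ rfl).set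
      (x := .hi) _ rfl) (f := σ1.v .cf) (p := g) (c := σ1.v .cc) (a := σ1.v .af) (b := σ1.v .al + 1)
      (s := s) rfl (by simp [f8, hp]) rfl rfl rfl (by simp [f1, hs]) (by omega) (by omega)
        (by omega) (by omega) (by omega) (by omega) (hsf1 (by omega)) ?_
        (S := S) (S' := S') (by simp; rwa [f2, f3, f4]) ?_ hd).mono fun σ' t h => ⟨by omega, h.2⟩
    · intro x x' b1 b2 b3 b4 b5 b6 b7
      have b8 := (hap _).1 b1
      have b9 := mem_crossL_window.1 ⟨show y + 1 - _ ≤ x by omega, b8.2.2, b7⟩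
      have b10 := AP.transfer hgpos b1 b4 ((z1 _).1 b9) b5 (by have := z2 (by omega); omega)
      exact (mem_crossL_window.2 ((z1 _).2 b10)).2.2
    · intro z
      rw [hS2]
      refine and_congr_right fun h => ?_
      constructor
      · intro h3
        have := a3 _ h3
        exact ⟨this.1, by omega, (mem_crossL_window.2 h3).2.2⟩
      · rintro ⟨_, _, h3⟩
        have := (hap _).1 h
        exact mem_crossL_window.1 ⟨by omega, this.2.2, h3⟩

set_option maxHeartbeats 1600000 in
/-- The hypotheses `hleft`, `hright` and `hcross` say that the elements before the pivot behave alike,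
so do those behind it, and those across it are extremal among the occurrences across it unless the gaps
agree. -/
theorem filter_spec (hC : TabC E L R len ps nn V) {u T : ℕ} (hu0 : 0 < u) (hu1 : u ≤ ps)
    (ht0 : ps < T) (ht1 : T ≤ nn) (σ : St) (hR : OccReq E L R len ps nn V u T σ)
    {f p c y s : ℕ} (hf : σ.v .qf = f) (hp : σ.v .qp = p) (hc : σ.v .qc = c) (hy : σ.v .py = y)
    (hs : σ.v .sh = s) (hfB : f + c * p ≤ 4 * V) (hpB : p ≤ 4 * V) (hcB : c ≤ 4 * V)
    (hyB : y ≤ 2 * V) (hcp : c ≤ 1 ∨ 0 < p) (hsf : s ≤ f)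
    (hleft : ∀ x x', AP f p c x → x + (wd L R u).length ≤ y → AP f p c x' →
      x' + (wd L R u).length ≤ y → Occ (wd L R T) (wd L R u) x → Occ (wd L R T) (wd L R u) x')
    (hright : ∀ x x', AP f p c x → y ≤ x → AP f p c x' → y ≤ x' →
      Occ (wd L R T) (wd L R u) x → Occ (wd L R T) (wd L R u) x')
    (hcross : ∀ x q zf zl, 1 < c → AP f p c x → x ∈ crossL (wd L R T) (wd L R u) y →
      StepProp (crossL (wd L R T) (wd L R u) y) q → zf ∈ crossL (wd L R T) (wd L R u) y →
      zl ∈ crossL (wd L R T) (wd L R u) y →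
      (∀ z ∈ crossL (wd L R T) (wd L R u) y, zf ≤ z ∧ z ≤ zl) → x = zf ∨ x = zl ∨ p = q)
    {S S' : Finset ℕ} (hS : AccS V S (σ.v .rf) (σ.v .rl) (σ.v .rc))
    (hS' : ∀ z, z ∈ S' ↔ AP f p c (z + s) ∧ Occ (wd L R T) (wd L R u) (z + s))
    (hd : ∀ x ∈ S, x ∉ S') :
    WP E filter σ fun σ' t => t ≤ 130 * (nn - ps) + 300 ∧
      AccS V (S ∪ S') (σ'.v .rf) (σ'.v .rl) (σ'.v .rc) := by
  obtain ⟨hps, hSZ, hnS, hV⟩ := hC.bounds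
  have hupos := wd_length_pos hC.poolS hu0 (by omega)
  have hTV := hC.lenV T (by omega)
  have hul := hC.len u (by omega)
  obtain ⟨S1, hS1⟩ : ∃ S1, S1 = S'.filter fun z => z + s + (wd L R u).length ≤ y := ⟨_, rfl⟩
  obtain ⟨S2, hS2⟩ : ∃ S2, S2 = S'.filter fun z => y ≤ z + s := ⟨_, rfl⟩
  obtain ⟨S3, hS3⟩ : ∃ S3, S3 = S'.filter fun z => z + s < y ∧ y < z + s + (wd L R u).length := ⟨_, rfl⟩
  -- the results before, behind and across the pivot
  have hSS : S' = S1 ∪ S2 ∪ S3 := by grind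
  unfold filter
  simp only [wp, evs, tf, hR.agree.len, hR.agree.sz, hR.pu, hf, hp, hc, hy, reduceCtorEq]
  refine ⟨by omega, ?_⟩
  refine WP_cut _ (part_spec hC hu0 hu1 ht0 ht1 _ (((((hR.set (x := .cf) _ rfl).set (x := .cp) _ rfl).set
    (x := .cc) _ rfl).set (x := .lo) _ rfl).set (x := .hi) _ rfl) (f := f) (p := p) (c := c) (a := 0)
    (b := y + 1 - (wd L R u).length) (s := s) rfl rfl rfl rfl (by simp [hul]) hs (by omega) (by omega)
    (by omega) (by omega) (by omega) hcp hsf ?_ (S := S) (S' := S1) hS ?_ ?_).frame ?_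
  · grind
  · grind
  · grind
  rintro σ1 t1 ⟨⟨ht1', hA1⟩, hF1⟩
  have hR1 := (((((hR.set (x := .cf) f rfl).set (x := .cp) p rfl).set
    (x := .cc) c rfl).set (x := .lo) 0 rfl).set (x := .hi) (y + 1 - len u) rfl).frame hF1 rfl rfl
  have f1 : σ1.v .qf = f := by rw [hF1.v _ rfl]; simpa using hf
  have f2 : σ1.v .qp = p := by rw [hF1.v _ rfl]; simpa using hp
  have f3 : σ1.v .qc = c := by rw [hF1.v _ rfl]; simpa using hc
  have f4 : σ1.v .py = y := by rw [hF1.v _ rfl]; simpa using hy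
  have f5 : σ1.v .sh = s := by rw [hF1.v _ rfl]; simpa using hs
  have f6 : σ1.v .cp = p := by rw [hF1.v _ rfl]; simp
  clear hF1
  simp only [wp, evs, tf, f1, f2, f3, f4, reduceCtorEq]
  refine ⟨by omega, ?_⟩
  refine WP_cut _ (part_spec hC hu0 hu1 ht0 ht1 _ ((((hR1.set (x := .cf) _ rfl).set
    (x := .cc) _ rfl).set (x := .lo) _ rfl).set (x := .hi) _ rfl) (f := f) (p := p) (c := c) (a := y)
    (b := f + c * p + 1) (s := s) rfl f6 rfl rfl rfl f5 (by omega) (by omega)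
    (by omega) (by omega) (by omega) hcp hsf ?_ (S := S ∪ S1) (S' := S2) hA1 ?_ ?_).frame ?_
  · grind
  · intro z
    rw [hS2, Finset.mem_filter, hS', and_assoc]
    refine and_congr_right fun h => ?_
    rw [and_comm]
    refine ⟨fun h => ⟨h.1, ?_, h.2⟩, fun h => ⟨h.1, h.2.2⟩⟩
    obtain ⟨k, hk, hx⟩ := ‹AP _ _ _ _›
    have := Nat.mul_le_mul_right p hk.le
    omega
  · grind
  rintro σ2 t2 ⟨⟨ht2', hA2⟩, hF2⟩
  have hR2 := ((((hR1.set (x := .cf) f rfl).set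
    (x := .cc) c rfl).set (x := .lo) y rfl).set (x := .hi) (f + c * p + 1) rfl).frame hF2 rfl rfl
  have f1 : σ2.v .qf = f := by rw [hF2.v _ rfl]; simpa using f1
  have f2 : σ2.v .qp = p := by rw [hF2.v _ rfl]; simpa using f2
  have f3 : σ2.v .qc = c := by rw [hF2.v _ rfl]; simpa using f3
  have f4 : σ2.v .py = y := by rw [hF2.v _ rfl]; simpa using f4
  have f5 : σ2.v .sh = s := by rw [hF2.v _ rfl]; simpa using f5
  clear hF2
  have hse := search_spec hC σ2 hR2.agree (by rw [hR2.pu]; exact hR2.rowOK) (by rw [hR2.pu]; exact hu0)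
    (by rw [hR2.pu]; exact hu1) (by rw [hR2.tj]; exact ht0) (by rw [hR2.tj]; exact ht1)
    (by rw [f4]; exact hyB)
  rw [hR2.pu, hR2.tj, f4] at hse
  refine WP_cut _ hse.frame ?_
  rintro σ3 t3 ⟨⟨ht3', hZ, z1, z2, z3, z4⟩, hF3⟩
  have hR3 := hR2.frame hF3 rfl rfl
  have f1 : σ3.v .qf = f := by rw [hF3.v _ rfl]; exact f1
  have f2 : σ3.v .qp = p := by rw [hF3.v _ rfl]; exact f2
  have f3 : σ3.v .qc = c := by rw [hF3.v _ rfl]; exact f3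
  have f4 : σ3.v .py = y := by rw [hF3.v _ rfl]; exact f4
  have f5 : σ3.v .sh = s := by rw [hF3.v _ rfl]; exact f5
  have g1 : σ3.v .rf = σ2.v .rf := hF3.v _ rfl
  have g2 : σ3.v .rl = σ2.v .rl := hF3.v _ rfl
  have g3 : σ3.v .rc = σ2.v .rc := hF3.v _ rfl
  clear hF3
  simp only [wp, evs, tf, f1, f2, f3, reduceCtorEq]
  refine (crossPart_spec hC hu0 hu1 ht0 ht1 _ (((hR3.set (x := .cf) _ rfl).set (x := .cp) _ rfl).set
    (x := .cc) _ rfl) (f := f) (p := p) (c := c) (y := y) (s := s) rfl rfl rfl f4 f5 z4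
    (by omega) (by omega) (by omega) hyB hcp hsf hZ z1 z2 z3 ?_ (S := S ∪ S1 ∪ S2) (S' := S3)
    (by simpa [g1, g2, g3] using hA2) ?_ ?_).mono fun σ' t h => ⟨by omega, h.2.of_eq ?_⟩
  · intro x q h1 h2 h3 h4
    have h5 : 0 < σ3.v .ac := by rw [hZ.1, Finset.card_pos]; exact ⟨x, h3⟩
    have h6 := hZ.2 h5
    exact hcross x q _ _ h1 h2 h3 h4 h6.1 h6.2.1 h6.2.2
  · intro z
    rw [hS3, Finset.mem_filter, hS', mem_crossL, and_assoc]
    refine and_congr_right fun _ => ?_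
    rw [and_comm, and_assoc]
  · grind
  · rw [hSS]; simp only [Finset.union_assoc]

end Submatch

namespace Submatch

/-! ### The table of crossing occurrences -/

open Var Arr in
/-- Loads the entry of the table for the pattern node `u` and the text node `jj` as a progression. -/
def loadEntry (u : Var) : Cmd :=
  row ≔ u * (nn + 1) ;; cf ≔ X0 (row + jj) ;; cl ≔ X1 (row + jj) ;; cc ≔ XC (row + jj) ;;
  cp ≔ (cl - cf) / (cc - 1)

open Var Arr in
/-- The occurrences of a pattern `a b` across the cut of the text node whose part `b` goes across the
cut. -/
def entryL : Cmd :=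
  loadEntry pb ;; lo ≔ len pa ;; hi ≔ cl + 1 ;; clip ;;
  .ite cc (py ≔ cf ;; qf ≔ cf - len pa ;; qp ≔ cp ;; qc ≔ cc ;; sh ≔ 0 ;; pu ≔ pa ;; filter) .skip

open Var Arr in
/-- The occurrence of a pattern `a b` with the cut of the text node between `a` and `b`. -/
def entryM : Cmd :=
  .ite (len pa - cut) .skip
    (bx ≔ cut - len pa ;; pu ≔ pa ;; occ ;;
      .ite ok (bx ≔ cut ;; pu ≔ pb ;; occ ;;
        .ite ok (acc rf rl rc (cut - len pa) (cut - len pa) 1) .skip) .skip)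

open Var Arr in
/-- The occurrences of a pattern `a b` across the cut of the text node whose part `a` goes across the
cut. -/
def entryR : Cmd :=
  loadEntry pa ;;
  .ite cc (py ≔ cl + len pa ;; qf ≔ cf + len pa ;; qp ≔ cp ;; qc ≔ cc ;; sh ≔ len pa ;; pu ≔ pb ;;
    filter) .skip

open Var Arr in
/-- Computes the entry of the table for the pattern node `i` and the text node `jj`. -/
def entry : Cmd :=
  rf ≔ 0 ;; rl ≔ 0 ;; rc ≔ 0 ;;
  .ite (L i) (.ite (L jj)
    (pa ≔ L i ;; pb ≔ R i ;; cut ≔ len (L jj) ;; tj ≔ jj ;; entryL ;; entryM ;; entryR)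
    .skip) .skip ;;
  .store X0 (i * (nn + 1) + jj) rf ;; .store X1 (i * (nn + 1) + jj) rl ;;
  .store XC (i * (nn + 1) + jj) rc

open Var Arr in
/-- Fills the table. -/
def table : Cmd :=
  i ≔ 1 ;;
  .while (ps + 1 - i)
    (jj ≔ ps + 1 ;; .while (nn + 1 - jj) (entry ;; jj ≔ jj + 1) ;; i ≔ i + 1)

variable {E : Env} {L R len : ℕ → ℕ} {ps nn V : ℕ}

/-- At the elements of a progression in a part whose period is its gap, all occurrences of a word exist
or none does. -/
theorem wd_occ_all {t u : List ℕ} {p lo hi f c x x' : ℕ}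
    (hp : Per (fun i => t[i]?) p lo hi) (hx : AP f p c x) (hx' : AP f p c x') (h1 : lo ≤ x)
    (h2 : lo ≤ x') (h3 : x + u.length ≤ hi) (h4 : x' + u.length ≤ hi) (h : Occ t u x) :
    Occ t u x' := by
  obtain ⟨k, hk, rfl⟩ := hx
  obtain ⟨k', hk', rfl⟩ := hx'
  rcases le_total k k' with h5 | h5
  · obtain ⟨d, rfl⟩ := Nat.exists_eq_add_of_le h5
    rw [Nat.add_mul, ← Nat.add_assoc] at *
    exact (hp.occ_iff h1 h4).2 h
  · obtain ⟨d, rfl⟩ := Nat.exists_eq_add_of_le h5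
    rw [Nat.add_mul, ← Nat.add_assoc] at *
    exact (hp.occ_iff h2 h3).1 h

/-- The requirements of the computation of an entry for a pattern with the children `a` and `b`, and
the text node `T`. -/
structure EntReq (E : Env) (L R len : ℕ → ℕ) (ps nn V a b T : ℕ) (σ : St) : Prop where
  agree : Agree E L R len ps nn σ
  rowA : RowOK L R ps nn V a σ
  rowB : RowOK L R ps nn V b σ
  pa : σ.v .pa = a
  pb : σ.v .pb = b
  jj : σ.v .jj = T
  tj : σ.v .tj = T
  cut : σ.v .cut = (wd L R (L T)).length

theorem EntReq.frame {c : Cmd} {σ σ' : St} {a b T : ℕ} (h : EntReq E L R len ps nn V a b T σ)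
    (hf : Frame c σ σ')
    (hv : (c.modV .sz || c.modV .ps || c.modV .nn || c.modA .L || c.modA .R || c.modA .len) = false)
    (hx : (c.modA .X0 || c.modA .X1 || c.modA .XC || c.modV .pa || c.modV .pb || c.modV .jj ||
      c.modV .tj || c.modV .cut) = false) :
    EntReq E L R len ps nn V a b T σ' := by
  simp only [Bool.or_eq_false_iff] at hx
  obtain ⟨⟨⟨⟨⟨⟨⟨h1, h2⟩, h3⟩, h4⟩, h5⟩, h6⟩, h7⟩, h8⟩ := hx
  exact ⟨h.agree.frame hf hv, h.rowA.congr (hf.A _ h1) (hf.A _ h2) (hf.A _ h3),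
    h.rowB.congr (hf.A _ h1) (hf.A _ h2) (hf.A _ h3), by rw [hf.v _ h4, h.pa],
    by rw [hf.v _ h5, h.pb], by rw [hf.v _ h6, h.jj], by rw [hf.v _ h7, h.tj],
    by rw [hf.v _ h8, h.cut]⟩

theorem EntReq.reqA {σ σ' : St} {a b T : ℕ} (h : EntReq E L R len ps nn V a b T σ)
    (hA : σ'.A = σ.A) (hv : ∀ x, (decide (x = .sz ∨ x = .ps ∨ x = .nn ∨ x = .tj)) = true →
      σ'.v x = σ.v x) (hp : σ'.v .pu = a) : OccReq E L R len ps nn V a T σ' :=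
  ⟨⟨by rw [hv _ rfl, h.agree.sz], by rw [hv _ rfl, h.agree.ps], by rw [hv _ rfl, h.agree.nn],
    by rw [hA, h.agree.L], by rw [hA, h.agree.R], by rw [hA, h.agree.len]⟩,
    h.rowA.congr (by rw [hA]) (by rw [hA]) (by rw [hA]), hp, by rw [hv _ rfl, h.tj]⟩

theorem EntReq.reqB {σ σ' : St} {a b T : ℕ} (h : EntReq E L R len ps nn V a b T σ)
    (hA : σ'.A = σ.A) (hv : ∀ x, (decide (x = .sz ∨ x = .ps ∨ x = .nn ∨ x = .tj)) = true →
      σ'.v x = σ.v x) (hp : σ'.v .pu = b) : OccReq E L R len ps nn V b T σ' :=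
  ⟨⟨by rw [hv _ rfl, h.agree.sz], by rw [hv _ rfl, h.agree.ps], by rw [hv _ rfl, h.agree.nn],
    by rw [hA, h.agree.L], by rw [hA, h.agree.R], by rw [hA, h.agree.len]⟩,
    h.rowB.congr (by rw [hA]) (by rw [hA]) (by rw [hA]), hp, by rw [hv _ rfl, h.tj]⟩

theorem loadEntry_spec (hC : TabC E L R len ps nn V) {x : Var} {u T : ℕ} (σ : St)
    (hA : Agree E L R len ps nn σ) (hrow : RowOK L R ps nn V u σ) (hx : σ.v x = u) (hu : u ≤ ps)
    (hj : σ.v .jj = T) (ht0 : ps < T) (ht1 : T ≤ nn) :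
    WP E (loadEntry x) σ fun σ' t => t ≤ 5 ∧
      Summ (xset L R u T) (σ'.v .cf) (σ'.v .cl) (σ'.v .cc) ∧ σ'.v .cf ≤ V ∧ σ'.v .cl ≤ V ∧
      σ'.v .cc ≤ V ∧ σ'.v .cp = gap (σ'.v .cf) (σ'.v .cl) (σ'.v .cc) ∧ σ'.v .cp ≤ V := by
  obtain ⟨hps, hSZ, hnS, hV⟩ := hC.bounds
  have hidx := hC.idx_lt (show u ≤ nn by omega) ht1
  obtain ⟨hs, hx0, hx1, hxc⟩ := hrow _ ht0 ht1
  have hg : gap (σ.A .X0 (u * (nn + 1) + T)) (σ.A .X1 (u * (nn + 1) + T))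
    (σ.A .XC (u * (nn + 1) + T)) ≤ V := (Nat.div_le_self _ _).trans (by omega)
  unfold loadEntry
  simp [hA.sz, hA.nn, hx, hj]
  refine ⟨by omega, by omega, ⟨by omega, by omega, ?_⟩, hs, hx0, hx1, hxc, rfl, hg⟩
  change gap _ _ _ < _
  omega

/-- The pivot is the first occurrence of `b`: all occurrences of `b` are across the cut, hence the text
behind the pivot has their gap as its period. -/
theorem entryL_spec (hC : TabC E L R len ps nn V) {a b T : ℕ} (ha0 : 0 < a) (ha1 : a ≤ ps)
    (hb1 : b ≤ ps) (ht0 : ps < T) (ht1 : T ≤ nn) (hLT : L T ≠ 0) (σ : St)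
    (hR : EntReq E L R len ps nn V a b T σ)
    {S S' : Finset ℕ} (hS : AccS V S (σ.v .rf) (σ.v .rl) (σ.v .rc))
    (hS' : ∀ z, z ∈ S' ↔ z + (wd L R a).length ∈ xset L R b T ∧ Occ (wd L R T) (wd L R a) z)
    (hd : ∀ x ∈ S, x ∉ S') :
    WP E entryL σ fun σ' t => t ≤ 130 * (nn - ps) + 350 ∧
      AccS V (S ∪ S') (σ'.v .rf) (σ'.v .rl) (σ'.v .rc) := by
  obtain ⟨hps, hSZ, hnS, hV⟩ := hC.bounds
  have hapos := wd_length_pos hC.poolS ha0 (by omega)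
  have hal := hC.len a (by omega)
  have haV := hC.lenV a (by omega)
  have hxs : xset L R b T = crossL (wd L R T) (wd L R b) (wd L R (L T)).length := by
    rw [xset, if_neg hLT]
  refine WP_cut _ (loadEntry_spec hC σ hR.agree hR.rowB hR.pb hb1 hR.jj ht0 ht1).frame ?_
  rintro σ1 t1 ⟨⟨ht1', hs, b1, b2, b3, hg, b4⟩, hF⟩
  have hR1 := hR.frame hF rfl rfl
  have e1 : σ1.v .rf = σ.v .rf := hF.v _ rfl
  have e2 : σ1.v .rl = σ.v .rl := hF.v _ rfl
  have e3 : σ1.v .rc = σ.v .rc := hF.v _ rfl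
  clear hF
  obtain ⟨a1, a2, a3⟩ := xset_ap hs
  obtain ⟨q, hq⟩ := xset_step L R b T
  have hgq := (hs.spec hq).2.2
  rw [← hg] at a1 a2 a3 hgq
  simp only [wp, evs, tf, hR1.agree.len, hR1.agree.sz, hR1.pa, reduceCtorEq]
  refine ⟨by omega, by omega, ?_⟩
  refine WP_cut _ (clip_spec (B := 4 * V + 1) _ (by simpa using a3) (by simp; omega) (by simp; omega)
    (by simp; omega) (by simp; omega) (by omega)).frame ?_
  rintro σ2 t2 ⟨⟨ht2, hc1, hap, hcl, hcf⟩, hF⟩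
  simp [hal] at hc1 hap hcl hcf
  have hR2 : EntReq E L R len ps nn V a b T σ2 := by
    refine EntReq.frame (σ := (σ1.set .lo (len a)).set .hi (σ1.v .cl + 1)) ?_ hF rfl rfl
    exact ⟨⟨hR1.agree.1, hR1.agree.2, hR1.agree.3, hR1.agree.4, hR1.agree.5, hR1.agree.6⟩,
      hR1.rowA.congr rfl rfl rfl, hR1.rowB.congr rfl rfl rfl, hR1.pa, hR1.pb, hR1.jj, hR1.tj, hR1.cut⟩
  have g1 : σ2.v .rf = σ.v .rf := by rw [hF.v _ rfl]; simpa using e1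
  have g2 : σ2.v .rl = σ.v .rl := by rw [hF.v _ rfl]; simpa using e2
  have g3 : σ2.v .rc = σ.v .rc := by rw [hF.v _ rfl]; simpa using e3
  have g4 : σ2.v .cp = σ1.v .cp := by rw [hF.v _ rfl]; simp
  clear hF
  -- the clipped progression holds the relevant occurrences of `b`
  have hap2 : ∀ x, AP (σ2.v .cf) (σ1.v .cp) (σ2.v .cc) x ↔ x ∈ xset L R b T ∧ (wd L R a).length ≤ x := by
    intro x
    rw [hap, ← a1]
    refine and_congr_right fun h => and_iff_left ?_
    have := (hs.2 (by rw [hs.1, Finset.card_pos]; exact ⟨x, h⟩)).2.2 x h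
    omega
  generalize σ1.v .cp = p at *
  refine WP_ite.2 ⟨by simp, fun h0 => ?_, fun h0 => ?_⟩
  swap
  · simp at h0 ⊢
    refine ⟨by omega, ?_⟩
    rw [g1, g2, g3]
    refine hS.of_eq ?_
    have : S' = ∅ := by
      ext z
      simp only [hS', Finset.notMem_empty, iff_false, not_and]
      intro z1
      have := (hap2 _).2 ⟨z1, by omega⟩
      rw [h0] at this
      simp [AP] at this
    rw [this, Finset.union_empty]
  simp at h0
  obtain ⟨f, hf⟩ : ∃ f, f = σ2.v .cf := ⟨_, rfl⟩
  obtain ⟨c, hc⟩ : ∃ c, c = σ2.v .cc := ⟨_, rfl⟩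
  rw [← hf, ← hc] at hap2 hcl
  rw [← hf] at hcf
  rw [← hc] at hc1
  have hcl := hcl (by omega)
  have hff := (hap2 f).1 ⟨0, by omega, by simp⟩
  have hll := (hap2 (f + (c - 1) * p)).1 ⟨c - 1, by omega, rfl⟩
  have hap3 : ∀ x, AP (f - (wd L R a).length) p c x ↔ AP f p c (x + (wd L R a).length) := by
    intro x
    have e := AP.add (f := f - (wd L R a).length) (p := p) (c := c) (o := (wd L R a).length)
      (x := x + (wd L R a).length)
    rw [Nat.sub_add_cancel hff.2, Nat.add_sub_cancel] at e
    rw [e]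
    exact (and_iff_right (Nat.le_add_left _ _)).symm
  have hcp1 : c * p ≤ (c - 1) * p + p := by
    rw [← Nat.succ_mul]; exact Nat.mul_le_mul_right _ (by omega)
  simp only [wp, evs, tf, hR2.agree.len, hR2.agree.sz, hR2.pa, reduceCtorEq, g4, hal, ← hf, ←
    hc]
  refine ⟨by omega, ?_⟩
  refine (filter_spec hC ha0 ha1 ht0 ht1 _ (hR2.reqA (by simp) (fun x hx => ?_) (by simp))
    (f := f - (wd L R a).length) (p := p) (c := c) (y := f) (s := 0) (by simp) (by simp) (by simp)
    (by simp) (by simp) (by omega) (by omega) (by omega) (by omega) (by omega) (by omega) ?_ ?_ ?_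
    (S := S) (S' := S') (by simpa [g1, g2, g3] using hS) ?_ hd).mono fun σ' t h => ⟨by omega, h.2⟩
  · have hx := of_decide_eq_true hx
    rcases hx with rfl | rfl | rfl | rfl <;> simp
  · intro x x' h1 h2 h3 h4 h
    have key : ∀ x, AP (f - (wd L R a).length) p c x → x + (wd L R a).length ≤ f →
        x + (wd L R a).length = f := by
      intro x h1 h2
      obtain ⟨k, _, hk⟩ := (hap3 x).1 h1
      omega
    have := key x h1 h2
    have := key x' h3 h4
    rwa [show x' = x by omega]
  · intro x x' h1 h2 h3 h4 h
    rcases Nat.lt_or_ge 1 c with h5 | h5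
    swap
    · rwa [← h1.eq_of_le_one h3 h5]
    have hpq := hgq (by omega)
    have hq0 := hq.1
    have hlt : f < f + (c - 1) * p := by simp_all
    rw [hxs] at hff hll hq
    rw [hpq] at hll hlt
    have hper := per_of_cross hq hff.1 hll.1 hlt
    rw [← hpq] at hper
    have key : ∀ x, AP (f - (wd L R a).length) p c x → x + (wd L R a).length ≤ f + (c - 1) * p := by
      intro x h1
      obtain ⟨k, _, hk⟩ := (hap3 x).1 h1
      have := Nat.mul_le_mul_right p (show k ≤ c - 1 by omega)
      omega
    have := key x h1
    have := key x' h3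
    exact wd_occ_all hper h1 h3 h2 h4 (by omega) (by omega) h
  · intro x q' zf zl h1 h2 h3 h4 h5 h6 h7
    have hpq := hgq (by omega)
    have h8 := (hap2 _).1 ((hap3 x).1 h2)
    rw [hxs] at hff h8 hq
    rw [hpq]
    exact crossing_left hq h4 hff.1 h3 h8.1 h5 h6 h7
  · grind

/-- The pivot is the end of the last occurrence of `a`: the text before it, from the first occurrence of
`a` on, has the gap of the occurrences as its period. -/
theorem entryR_spec (hC : TabC E L R len ps nn V) {a b T : ℕ} (ha1 : a ≤ ps) (hb0 : 0 < b)
    (hb1 : b ≤ ps) (ht0 : ps < T) (ht1 : T ≤ nn) (hLT : L T ≠ 0) (σ : St)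
    (hR : EntReq E L R len ps nn V a b T σ)
    {S S' : Finset ℕ} (hS : AccS V S (σ.v .rf) (σ.v .rl) (σ.v .rc))
    (hS' : ∀ z, z ∈ S' ↔ z ∈ xset L R a T ∧ Occ (wd L R T) (wd L R b) (z + (wd L R a).length))
    (hd : ∀ x ∈ S, x ∉ S') :
    WP E entryR σ fun σ' t => t ≤ 130 * (nn - ps) + 350 ∧
      AccS V (S ∪ S') (σ'.v .rf) (σ'.v .rl) (σ'.v .rc) := by
  obtain ⟨hps, hSZ, hnS, hV⟩ := hC.bounds
  have hal := hC.len a (by omega)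
  have haV := hC.lenV a (by omega)
  have hxs : xset L R a T = crossL (wd L R T) (wd L R a) (wd L R (L T)).length := by
    rw [xset, if_neg hLT]
  refine WP_cut _ (loadEntry_spec hC σ hR.agree hR.rowA hR.pa ha1 hR.jj ht0 ht1).frame ?_
  rintro σ2 t1 ⟨⟨ht1', hs, b1, b2, b3, hg, b4⟩, hF⟩
  have hR2 := hR.frame hF rfl rfl
  have g1 : σ2.v .rf = σ.v .rf := hF.v _ rfl
  have g2 : σ2.v .rl = σ.v .rl := hF.v _ rfl
  have g3 : σ2.v .rc = σ.v .rc := hF.v _ rfl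
  clear hF
  obtain ⟨a1, a2, a3⟩ := xset_ap hs
  obtain ⟨q, hq⟩ := xset_step L R a T
  have hgq := (hs.spec hq).2.2
  rw [← hg] at a1 a2 a3 hgq
  refine WP_ite.2 ⟨by simp, fun h0 => ?_, fun h0 => ?_⟩
  swap
  · simp at h0 ⊢
    refine ⟨by omega, ?_⟩
    rw [g1, g2, g3]
    refine hS.of_eq ?_
    have : S' = ∅ := by
      ext z
      simp only [hS', Finset.notMem_empty, iff_false, not_and]
      intro z1
      have := (a1 _).1 z1
      rw [h0] at this
      simp [AP] at this
    rw [this, Finset.union_empty]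
  simp at h0
  have a2 := a2 (by omega)
  have hsl := hs.2 (by omega)
  obtain ⟨f, hf⟩ : ∃ f, f = σ2.v .cf := ⟨_, rfl⟩
  obtain ⟨l, hl⟩ : ∃ l, l = σ2.v .cl := ⟨_, rfl⟩
  obtain ⟨c, hc⟩ : ∃ c, c = σ2.v .cc := ⟨_, rfl⟩
  obtain ⟨p, hp⟩ : ∃ p, p = σ2.v .cp := ⟨_, rfl⟩
  have hcp1 : c * p ≤ (c - 1) * p + p := by
    rw [← Nat.succ_mul]; exact Nat.mul_le_mul_right _ (by omega)
  rw [← hf, ← hc, ← hp] at a1 a2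
  rw [← hl] at a2 hsl
  rw [← hf] at hsl
  rw [← hc, ← hp] at hgq
  have hap3 : ∀ x, AP (f + (wd L R a).length) p c x ↔
      (wd L R a).length ≤ x ∧ x - (wd L R a).length ∈ xset L R a T := by
    intro x
    rw [AP.add, a1]
  simp only [wp, evs, tf, hR2.agree.len, hR2.agree.sz, hR2.pa, hR2.pb, reduceCtorEq, hal, ←
    hf, ← hc, ← hl, ← hp]
  refine ⟨by omega, by omega, by omega, ?_⟩
  refine (filter_spec hC hb0 hb1 ht0 ht1 _ (hR2.reqB (by simp) (fun x hx => ?_) (by simp))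
    (f := f + (wd L R a).length) (p := p) (c := c) (y := l + (wd L R a).length)
    (s := (wd L R a).length) (by simp) (by simp) (by simp)
    (by simp) (by simp) (by omega) (by omega) (by omega) (by omega) (by omega) (by omega) ?_ ?_ ?_
    (S := S) (S' := S') (by simpa [g1, g2, g3] using hS) ?_ hd).mono fun σ' t h => ⟨by omega, h.2⟩
  · have hx := of_decide_eq_true hx
    rcases hx with rfl | rfl | rfl | rfl <;> simp
  · intro x x' h1 h2 h3 h4 h
    rcases Nat.lt_or_ge 1 c with h5 | h5
    swap
    · rwa [← h1.eq_of_le_one h3 h5]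
    have hpq := hgq (by omega)
    have hq0 := hq.1
    have hlt : f < l := by
      have : 0 < (c - 1) * p := Nat.mul_pos (by omega) (by omega)
      omega
    rw [hxs] at hsl hq
    have hper := per_of_cross hq hsl.1 hsl.2.1 hlt
    rw [← hpq] at hper
    have k1 : f ≤ x := by obtain ⟨k, _, hk⟩ := h1; omega
    have k2 : f ≤ x' := by obtain ⟨k, _, hk⟩ := h3; omega
    exact wd_occ_all hper h1 h3 k1 k2 h2 h4 h
  · intro x x' h1 h2 h3 h4 h
    have key : ∀ x, AP (f + (wd L R a).length) p c x → l + (wd L R a).length ≤ x →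
        x = l + (wd L R a).length := by grind
    rwa [key x' h3 h4, ← key x h1 h2]
  · intro x q' zf zl h1 h2 h3 h4 h5 h6 h7
    have hpq := hgq (by omega)
    have h8 := (hap3 x).1 h2
    rw [hxs] at hsl h8 hq
    rw [hpq]
    exact crossing_right hq h4 hsl.2.1 h3 (show x = x - (wd L R a).length + (wd L R a).length by omega)
      h8.2 h5 h6 h7
  · simp_all

theorem entryM_spec (hC : TabC E L R len ps nn V) {a b T : ℕ} (ha0 : 0 < a) (ha1 : a ≤ ps)
    (hb0 : 0 < b) (hb1 : b ≤ ps) (ht0 : ps < T) (ht1 : T ≤ nn) (hLT : L T ≠ 0) (σ : St)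
    (hR : EntReq E L R len ps nn V a b T σ)
    {S S' : Finset ℕ} (hS : AccS V S (σ.v .rf) (σ.v .rl) (σ.v .rc))
    (hS' : ∀ z, z ∈ S' ↔ z + (wd L R a).length = (wd L R (L T)).length ∧
      Occ (wd L R T) (wd L R a) z ∧ Occ (wd L R T) (wd L R b) (wd L R (L T)).length)
    (hd : ∀ x ∈ S, x ∉ S') :
    WP E entryM σ fun σ' t => t ≤ 42 * (nn - ps) + 70 ∧
      AccS V (S ∪ S') (σ'.v .rf) (σ'.v .rl) (σ'.v .rc) := by
  obtain ⟨hps, hSZ, hnS, hV⟩ := hC.bounds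
  have hapos := wd_length_pos hC.poolS ha0 (by omega)
  have hal := hC.len a (by omega)
  have haV := hC.lenV a (by omega)
  have hTV := hC.lenV T (by omega)
  have hLTl := (hC.poolT _ ht0 ht1).resolve_left hLT
  have hLV := hC.lenV (L T) (by omega)
  have hno : (¬ ((wd L R a).length ≤ (wd L R (L T)).length ∧
      Occ (wd L R T) (wd L R a) ((wd L R (L T)).length - (wd L R a).length) ∧
      Occ (wd L R T) (wd L R b) (wd L R (L T)).length)) → S ∪ S' = S := by grind
  unfold entryM
  simp only [wp, evs, tf, hR.agree.len, hR.agree.sz, hR.pa, hR.cut, reduceCtorEq, hal]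
  refine ⟨by omega, fun h0 => ⟨by omega, hS.of_eq (hno
    ?_).symm⟩,
    fun h0 => ⟨by omega, ?_⟩⟩
  · exact fun h => h0 (by omega)
  refine WP_cut _ ((hR.reqA (σ' := (σ.set .bx _).set .pu a) rfl (fun x hx => ?_) rfl).occ hC ha0 ha1
    ht0 ht1 (by simp; omega)).frame ?_
  · rcases of_decide_eq_true hx with rfl | rfl | rfl | rfl <;> simp
  rintro σ1 t1 ⟨⟨ht1', hfl⟩, hF⟩
  have hR1 : EntReq E L R len ps nn V a b T σ1 := by
    refine EntReq.frame (σ := (σ.set .bx _).set .pu a) ?_ hF rfl rfl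
    exact ⟨⟨hR.agree.1, hR.agree.2, hR.agree.3, hR.agree.4, hR.agree.5, hR.agree.6⟩,
      hR.rowA.congr rfl rfl rfl, hR.rowB.congr rfl rfl rfl, hR.pa, hR.pb, hR.jj, hR.tj, hR.cut⟩
  have g1 : σ1.v .rf = σ.v .rf := by rw [hF.v _ rfl]; simp
  have g2 : σ1.v .rl = σ.v .rl := by rw [hF.v _ rfl]; simp
  have g3 : σ1.v .rc = σ.v .rc := by rw [hF.v _ rfl]; simp
  clear hF
  simp at hfl
  refine WP_ite.2 ⟨by simp, fun h1 => ?_, fun h1 => ?_⟩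
  swap
  · simp at h1 ⊢
    refine ⟨by omega, ?_⟩
    rw [g1, g2, g3]
    exact hS.of_eq (hno fun h => hfl.eq_zero.1 h1 h.2.1).symm
  simp at h1
  have h1 := hfl.ne_zero.1 h1
  simp only [wp, evs, tf, hR1.cut, hR1.pb, reduceCtorEq]
  refine WP_cut _ ((hR1.reqB (σ' := (σ1.set .bx (wd L R (L T)).length).set .pu b) rfl
    (fun x hx => ?_) rfl).occ hC hb0 hb1 ht0 ht1 (by simp; omega)).frame ?_
  · rcases of_decide_eq_true hx with rfl | rfl | rfl | rfl <;> simp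
  rintro σ2 t2 ⟨⟨ht2, hfl2⟩, hF⟩
  have e1 : σ2.v .rf = σ.v .rf := by rw [hF.v _ rfl]; simpa using g1
  have e2 : σ2.v .rl = σ.v .rl := by rw [hF.v _ rfl]; simpa using g2
  have e3 : σ2.v .rc = σ.v .rc := by rw [hF.v _ rfl]; simpa using g3
  have e4 : σ2.v .cut = (wd L R (L T)).length := by rw [hF.v _ rfl]; simpa using hR1.cut
  have e5 : σ2.v .pa = a := by rw [hF.v _ rfl]; simpa using hR1.pa
  have e6 : σ2.v .sz = E.SZ := by rw [hF.v _ rfl]; simpa using hR1.agree.sz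
  have e7 : σ2.A .len = len := by rw [hF.A _ rfl]; simpa using hR1.agree.len
  clear hF
  simp at hfl2
  refine WP_ite.2 ⟨by simp, fun h2 => ?_, fun h2 => ?_⟩
  swap
  · simp at h2 ⊢
    refine ⟨by omega, ?_⟩
    rw [e1, e2, e3]
    exact hS.of_eq (hno fun h => hfl2.eq_zero.1 h2 h.2.2).symm
  simp at h2
  have h2 := hfl2.ne_zero.1 h2
  have hSe : S' = {(wd L R (L T)).length - (wd L R a).length} := by grind
  refine (accR_spec hV σ2 (a1 := (wd L R (L T)).length - (wd L R a).length)
    (a2 := (wd L R (L T)).length - (wd L R a).length) (a3 := 1)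
    (S := S) (S' := S') ?_ (by rwa [e1, e2, e3]) (by rw [hSe]; exact summ_singleton _) one_pos hd ?_).mono
    fun σ' t h => ⟨by omega, h.2⟩
  · intro σ' h1 h2
    simp [h1, h2, e4, e5, e6, e7, hal]
    omega
  · intro x hx
    have := ((hS' x).1 hx).2.1.le hapos
    omega

/-- The entry of the table for the pattern node `u` and the text node `k` is correct. -/
def CellOK (L R : ℕ → ℕ) (nn V u k : ℕ) (σ : St) : Prop :=
  Summ (xset L R u k) (σ.A .X0 (u * (nn + 1) + k)) (σ.A .X1 (u * (nn + 1) + k))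
    (σ.A .XC (u * (nn + 1) + k)) ∧
  σ.A .X0 (u * (nn + 1) + k) ≤ V ∧ σ.A .X1 (u * (nn + 1) + k) ≤ V ∧ σ.A .XC (u * (nn + 1) + k) ≤ V

/-- The occurrences of `a b` are divided according to the position of the cut relative to the point
where `a` and `b` meet. -/
theorem entry_mid (hC : TabC E L R len ps nn V) {u T : ℕ} (hu0 : 0 < u) (hu1 : u ≤ ps)
    (ht0 : ps < T) (ht1 : T ≤ nn) (hLT : L T ≠ 0) (hLu : L u ≠ 0) (σ : St)
    (hR : EntReq E L R len ps nn V (L u) (R u) T σ)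
    (hS : AccS V ∅ (σ.v .rf) (σ.v .rl) (σ.v .rc)) :
    WP E (entryL ;; entryM ;; entryR) σ fun σ' t => t ≤ 302 * (nn - ps) + 770 ∧
      AccS V (xset L R u T) (σ'.v .rf) (σ'.v .rl) (σ'.v .rc) := by
  obtain ⟨l1, l2, l3, l4⟩ := (hC.poolS u hu0 hu1).resolve_left hLu
  have hapos := wd_length_pos hC.poolS l1 (by omega)
  have hbpos := wd_length_pos hC.poolS l3 (by omega)
  have hpair := hC.poolS.wd_pair hu0 hu1 hLu
  generalize L u = a at *
  generalize R u = b at *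
  have hmem : ∀ z, z ∈ xset L R u T ↔ z < (wd L R (L T)).length ∧
      (wd L R (L T)).length < z + ((wd L R a).length + (wd L R b).length) ∧
      Occ (wd L R T) (wd L R a) z ∧ Occ (wd L R T) (wd L R b) (z + (wd L R a).length) := by
    intro z
    rw [xset, if_neg hLT, mem_crossL, hpair, occ_append, List.length_append]
  have hmA : ∀ z, z ∈ xset L R a T ↔ z < (wd L R (L T)).length ∧
      (wd L R (L T)).length < z + (wd L R a).length ∧ Occ (wd L R T) (wd L R a) z := by
    intro z
    rw [xset, if_neg hLT, mem_crossL]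
  have hmB : ∀ z, z ∈ xset L R b T ↔ z < (wd L R (L T)).length ∧
      (wd L R (L T)).length < z + (wd L R b).length ∧ Occ (wd L R T) (wd L R b) z := by
    intro z
    rw [xset, if_neg hLT, mem_crossL]
  obtain ⟨S1, hS1⟩ : ∃ S1, S1 = (xset L R u T).filter fun z =>
    z + (wd L R a).length < (wd L R (L T)).length := ⟨_, rfl⟩
  obtain ⟨S2, hS2⟩ : ∃ S2, S2 = (xset L R u T).filter fun z =>
    z + (wd L R a).length = (wd L R (L T)).length := ⟨_, rfl⟩
  obtain ⟨S3, hS3⟩ : ∃ S3, S3 = (xset L R u T).filter fun z =>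
    (wd L R (L T)).length < z + (wd L R a).length := ⟨_, rfl⟩
  have hSS : xset L R u T = ∅ ∪ S1 ∪ S2 ∪ S3 := by grind
  refine WP_cut _ (entryL_spec hC l1 (by omega) (by omega) ht0 ht1 hLT σ hR hS (S' := S1) ?_
    (by simp)).frame ?_
  · grind
  rintro σ1 t1 ⟨⟨g1, hA1⟩, hF⟩
  have hR1 := hR.frame hF rfl rfl
  refine WP_cut _ (entryM_spec hC l1 (by omega) l3 (by omega) ht0 ht1 hLT σ1 hR1 hA1 (S' := S2) ?_
    ?_).frame ?_
  · grind
  · grind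
  rintro σ2 t2 ⟨⟨g2, hA2⟩, hF2⟩
  have hR2 := hR1.frame hF2 rfl rfl
  refine (entryR_spec hC (by omega) l3 (by omega) ht0 ht1 hLT σ2 hR2 hA2 (S' := S3) ?_
    ?_).mono fun σ' t h => ⟨by omega, by rw [hSS]; exact h.2⟩
  · grind
  · grind

theorem accS_empty {V : ℕ} : AccS V ∅ 0 0 0 := ⟨summ_empty, by omega, by omega, by simp⟩

/-- A pattern or a text that is a letter has no occurrences across a cut, so that its entry is empty. -/
theorem entry_spec (hC : TabC E L R len ps nn V) {u T : ℕ} (hu0 : 0 < u) (hu1 : u ≤ ps)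
    (ht0 : ps < T) (ht1 : T ≤ nn) (σ : St) (hA : Agree E L R len ps nn σ) (hi : σ.v .i = u)
    (hj : σ.v .jj = T) (hrow : ∀ v, 0 < v → v < u → RowOK L R ps nn V v σ) :
    WP E entry σ fun σ' t => t ≤ 302 * (nn - ps) + 790 ∧ CellOK L R nn V u T σ' ∧
      ∀ k, k ≠ u * (nn + 1) + T → σ'.A .X0 k = σ.A .X0 k ∧ σ'.A .X1 k = σ.A .X1 k ∧
        σ'.A .XC k = σ.A .XC k := by
  obtain ⟨hps, hSZ, hnS, hV⟩ := hC.bounds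
  have hidx := hC.idx_lt (show u ≤ nn by omega) ht1
  unfold entry
  simp only [wp, evs, tf]
  have hmid : WP E (.ite (Arr.L Var.i) (.ite (Arr.L Var.jj)
    (.pa ≔ Arr.L Var.i ;; .pb ≔ Arr.R Var.i ;; .cut ≔ Arr.len (Arr.L Var.jj) ;; .tj ≔ Var.jj ;;
      entryL ;; entryM ;; entryR) .skip) .skip) (((σ.set .rf 0).set .rl 0).set .rc 0) fun σ' t =>
        t ≤ 302 * (nn - ps) + 780 ∧ AccS V (xset L R u T) (σ'.v .rf) (σ'.v .rl) (σ'.v .rc) := by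
    simp only [wp, evs, tf, hA.len, hA.sz, hA.L, hA.R, hi, hj, reduceCtorEq]
    -- a letter has no occurrence across a cut, and a letter has no cut
    have hemp : L u = 0 ∨ L T = 0 → AccS V (xset L R u T) 0 0 0 := by
      intro h
      refine accS_empty.of_eq ?_
      rw [xset]
      split_ifs with h1
      · rfl
      · have h2 := h.resolve_right h1
        symm
        rw [Finset.eq_empty_iff_forall_notMem]
        intro x hx
        rw [wd_letter hu0 h2, mem_crossL] at hx
        simp at hx
        omega
    refine ⟨by omega, fun h1 => ⟨by omega,
      fun h2 => ?_, fun h2 => ⟨by omega, hemp (.inr h2)⟩⟩, fun h1 => ⟨by omega, hemp (.inl h1)⟩⟩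
    obtain ⟨l1, l2, l3, l4⟩ := (hC.poolS u hu0 hu1).resolve_left h1
    have k1 := (hC.poolT T ht0 ht1).resolve_left h2
    refine ⟨by omega, by omega, by omega, ?_⟩
    refine (entry_mid hC hu0 hu1 ht0 ht1 h2 h1 (((((((σ.set .rf 0).set .rl 0).set .rc 0).set .pa
      (L u)).set .pb (R u)).set .cut (len (L T))).set .tj T) ⟨⟨hA.1, hA.2, hA.3, hA.4, hA.5, hA.6⟩,
      (hrow _ l1 l2).congr rfl rfl rfl, (hrow _ l3 l4).congr rfl rfl rfl, rfl, rfl, hj, rfl,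
      (by simp; exact hC.len _ (by omega))⟩ accS_empty).mono fun σ' t h => ⟨by omega, h.2⟩
  refine WP_cut _ hmid.frame ?_
  rintro σ1 t ⟨⟨ht, hS⟩, hF⟩
  have e1 : σ1.v .i = u := by rw [hF.v _ rfl]; simpa using hi
  have e2 : σ1.v .jj = T := by rw [hF.v _ rfl]; simpa using hj
  have e3 : σ1.v .nn = nn := by rw [hF.v _ rfl]; simpa using hA.nn
  have e4 : σ1.v .sz = E.SZ := by rw [hF.v _ rfl]; simpa using hA.sz
  have e5 : σ1.A .X0 = σ.A .X0 := by rw [hF.A _ rfl]; simp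
  have e6 : σ1.A .X1 = σ.A .X1 := by rw [hF.A _ rfl]; simp
  have e7 : σ1.A .XC = σ.A .XC := by rw [hF.A _ rfl]; simp
  have h1 := hS.fV
  have h2 := hS.lV
  have h3 := hS.cV
  simp [e1, e2, e3, e4, e5, e6, e7, CellOK]
  refine ⟨by omega, by omega, ⟨hS.summ, h1, h2, h3⟩, fun k hk => ?_⟩
  simp [hk]

/-- The invariant of the computation of the table. -/
structure TabInv (E : Env) (L R len : ℕ → ℕ) (ps nn V u T : ℕ) (σ : St) : Prop where
  agree : Agree E L R len ps nn σ
  i : σ.v .i = u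
  cells : ∀ v k, 0 < v → ps < k → k ≤ nn → v < u ∨ (v = u ∧ k < T) → CellOK L R nn V v k σ

/-- The row of a node depends only on the rows of its children, which are earlier nodes. -/
theorem table_spec (hC : TabC E L R len ps nn V) (σ : St) (hA : Agree E L R len ps nn σ) :
    WP E table σ fun σ' t => t ≤ ps * ((nn - ps) * (302 * (nn - ps) + 800) + 10) + 10 ∧
      ∀ u, 0 < u → u ≤ ps → RowOK L R ps nn V u σ' := by
  obtain ⟨hps, hSZ, hnS, hV⟩ := hC.bounds
  simp only [wp, evs, tf, table]
  refine WP_while (fun n σ' => ∃ u, 0 < u ∧ u ≤ ps + 1 ∧ n = ps + 1 - u ∧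
    TabInv E L R len ps nn V u (ps + 1) σ') ((nn - ps) * (302 * (nn - ps) + 800) + 9) ?_ ?_ (n := ps)
    ?_ ?_
  · rintro n σ' ⟨u, -, h1, h2, hI⟩
    simp [hI.agree.ps]; omega
  · rintro n σ' ⟨u, h0, h1, rfl, hI⟩ hne
    simp [hI.agree.ps, hI.i] at hne
    simp only [wp, evs, tf, hI.agree.ps]
    refine ⟨by omega, ?_⟩
    refine WP_cut (fun σ1 t => t ≤ (nn - ps) * (302 * (nn - ps) + 800) + 1 ∧
      TabInv E L R len ps nn V u (nn + 1) σ1) ?_ ?_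
    · refine WP_while (fun n σ' => ∃ T, ps < T ∧ T ≤ nn + 1 ∧ n = nn + 1 - T ∧ σ'.v .jj = T ∧
        TabInv E L R len ps nn V u T σ') (302 * (nn - ps) + 799) ?_ ?_ (n := nn - ps) ?_ ?_
      · rintro n σ' ⟨T, -, h1, h2, h3, hI⟩
        simp [hI.agree.nn]; omega
      · rintro n σ1 ⟨T, h2, h3, rfl, h4, hI⟩ hne
        simp [hI.agree.nn, h4] at hne
        refine WP_cut _ (entry_spec hC h0 (by omega) h2 (by omega) σ1 hI.agree hI.i h4
          (fun v v0 v1 k k0 k1 => hI.cells v k v0 k0 k1 (.inl v1))).frame ?_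
        rintro σ2 t ⟨⟨ht, hc, hc'⟩, hF⟩
        have e : σ2.v .jj = T := by rw [hF.v _ rfl, h4]
        have hA2 := hI.agree.frame hF rfl
        simp only [wp, evs, tf, e]
        refine ⟨by omega, by omega, nn + 1 - (T + 1), by omega, T + 1, by omega,
          by omega, rfl, by simp, ⟨hA2.1, hA2.2, hA2.3, hA2.4, hA2.5, hA2.6⟩, ?_, ?_⟩
        · have : σ2.v .i = u := by rw [hF.v _ rfl, hI.i]
          simpa using this
        · intro v k v0 k0 k1 hvk
          by_cases hcell : v = u ∧ k = T
          · obtain ⟨rfl, rfl⟩ := hcell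
            exact hc
          -- different entries have different addresses
          · have hne : v * (nn + 1) + k ≠ u * (nn + 1) + T := by
              intro h
              have h6 := congrArg (· / (nn + 1)) h
              have h7 := congrArg (· % (nn + 1)) h
              simp only [Nat.mul_comm _ (nn + 1), Nat.mul_add_mod, Nat.mul_add_div (Nat.succ_pos nn),
                Nat.div_eq_of_lt (Nat.lt_succ_of_le k1),
                Nat.div_eq_of_lt (show T < nn + 1 by omega), Nat.mod_eq_of_lt (Nat.lt_succ_of_le k1),
                Nat.mod_eq_of_lt (show T < nn + 1 by omega)] at h6 h7
              exact hcell ⟨by omega, h7⟩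
            have h8 := hI.cells v k v0 k0 k1 (by omega)
            obtain ⟨b1, b2, b3⟩ := hc' _ hne
            simp only [evs, CellOK, b1, b2, b3]
            exact h8
      · exact ⟨ps + 1, by omega, by omega, by omega, by simp,
          ⟨hI.agree.1, hI.agree.2, hI.agree.3, hI.agree.4, hI.agree.5, hI.agree.6⟩, hI.i, hI.cells⟩
      · rintro n σ1 t ⟨T, h2, h3, rfl, h4, hI⟩ hne ht
        simp [hI.agree.nn, h4] at hne
        refine ⟨?_, ?_⟩
        · rw [Nat.mul_comm]; exact ht
        · rwa [show nn + 1 = T by omega]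
    · rintro σ1 t ⟨ht, hI⟩
      simp only [wp, evs, tf, hI.i]
      refine ⟨by omega, by omega, ps + 1 - (u + 1), by omega, u + 1, by omega,
        by omega, rfl, ⟨hI.agree.1, hI.agree.2, hI.agree.3, hI.agree.4, hI.agree.5, hI.agree.6⟩,
        by simp, ?_⟩
      intro v k v0 k0 k1 hvk
      exact hI.cells v k v0 k0 k1 (by omega)
  · exact ⟨1, by omega, by omega, by omega, ⟨hA.1, hA.2, hA.3, hA.4, hA.5, hA.6⟩, by simp,
      fun v k v0 k0 k1 h => by omega⟩
  · rintro n σ' t ⟨u, h0, h1, rfl, hI⟩ hne ht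
    simp [hI.agree.ps, hI.i] at hne
    refine ⟨?_, fun v v0 v1 k k0 k1 => hI.cells v k v0 k0 k1 (by omega)⟩
    rw [Nat.mul_comm] at ht
    have ht : t ≤ ps * ((nn - ps) * (302 * (nn - ps) + 800) + 10) + 1 := ht
    omega

end Submatch

namespace Submatch

/-! ### Concatenation in node pools -/

open Var Arr in
/-- Sets `res` to a node for the concatenation of the words of the nodes `u` and `v`; the nodes are
stored in the arrays `a` and `b` and counted by `cnt`. -/
def cat (cnt : Var) (a b : Arr) : Cmd :=
  .ite u (.ite v (cnt ≔ cnt + 1 ;; .store a cnt u ;; .store b cnt v ;; res ≔ cnt) (res ≔ u)) (res ≔ v)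

open Var Arr in
/-- Concatenation of words. -/
def catW : Cmd := cat nn L R ;; .store len res (len u + len v)

open Var Arr in
/-- Concatenation of positions. -/
def catP : Cmd := cat np PL PR

open Var Arr in
/-- Sets `res` to a new node for the letter `sy`. -/
def letter (cnt : Var) (a b : Arr) (sy : Ex) : Cmd :=
  cnt ≔ cnt + 1 ;; .store a cnt 0 ;; .store b cnt sy ;; res ≔ cnt

/-- The node `k` is empty, or one of the nodes after `lo` up to `n`. -/
def Node (lo n k : ℕ) : Prop := k = 0 ∨ (lo < k ∧ k ≤ n)

theorem Node.mono {lo n n' k : ℕ} (h : Node lo n k) (hn : n ≤ n') : Node lo n' k := by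
  rcases h with h | h
  · exact .inl h
  · exact .inr ⟨h.1, by omega⟩

theorem Node.le {lo n k : ℕ} (h : Node lo n k) : k ≤ n := by
  rcases h with h | h <;> omega

/-- The pool `(L', R')` with `n'` nodes extends the pool `(L, R)` with `n` nodes. -/
structure Ext (L R : ℕ → ℕ) (n : ℕ) (L' R' : ℕ → ℕ) (n' : ℕ) : Prop where
  le : n ≤ n'
  L : ∀ k ≤ n, L' k = L k
  R : ∀ k ≤ n, R' k = R k

variable {E : Env}

theorem Ext.refl (L R : ℕ → ℕ) (n : ℕ) : Ext L R n L R n := ⟨le_rfl, by simp, by simp⟩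

theorem Ext.trans {L R L' R' L'' R'' : ℕ → ℕ} {n n' n'' : ℕ} (h : Ext L R n L' R' n')
    (h' : Ext L' R' n' L'' R'' n'') : Ext L R n L'' R'' n'' :=
  ⟨h.le.trans h'.le, fun k hk => by rw [h'.L k (hk.trans h.le), h.L k hk],
    fun k hk => by rw [h'.R k (hk.trans h.le), h.R k hk]⟩

theorem Ext.wd {L R L' R' : ℕ → ℕ} {n n' k : ℕ} (h : Ext L R n L' R' n') (hk : k ≤ n) :
    wd L' R' k = wd L R k := wd_congr (fun k _ hk => ⟨h.L k hk, h.R k hk⟩) k hk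

theorem ext_update (L R : ℕ → ℕ) (n a b : ℕ) :
    Ext L R n (Function.update L (n + 1) a) (Function.update R (n + 1) b) (n + 1) := by
  refine ⟨by omega, fun k hk => ?_, fun k hk => ?_⟩ <;>
  rw [Function.update_of_ne (by omega)]

theorem Pool.pair {L R : ℕ → ℕ} {lo n a b : ℕ} (h : Pool lo L R n) (ha : lo < a ∧ a ≤ n)
    (hb : lo < b ∧ b ≤ n) :
    Pool lo (Function.update L (n + 1) a) (Function.update R (n + 1) b) (n + 1) := by
  intro k h1 h2
  by_cases hk : k = n + 1
  · subst hk; simp; omega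
  · simp [hk]; exact h k h1 (by omega)

theorem Pool.letter {L R : ℕ → ℕ} {lo n b : ℕ} (h : Pool lo L R n) :
    Pool lo (Function.update L (n + 1) 0) (Function.update R (n + 1) b) (n + 1) := by
  intro k h1 h2
  by_cases hk : k = n + 1
  · subst hk; simp
  · simp [hk]; exact h k h1 (by omega)

/-- If one of the nodes is empty, no new node is made: the children of a pair must not be empty. -/
theorem cat_spec {cnt : Var} {a b : Arr} (hc : cnt ≠ .u ∧ cnt ≠ .v ∧ cnt ≠ .res ∧ cnt ≠ .sz)
    (hab : a ≠ b) {lo : ℕ} (σ : St) (hsz : σ.v .sz = E.SZ) (hM : E.SZ < E.M)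
    (hP : Pool lo (σ.A a) (σ.A b) (σ.v cnt)) (hu : Node lo (σ.v cnt) (σ.v .u))
    (hv : Node lo (σ.v cnt) (σ.v .v)) (hn : σ.v cnt + 1 < E.SZ) (hlo : lo ≤ σ.v cnt) :
    WP E (cat cnt a b) σ fun σ' t => t ≤ 6 ∧ Pool lo (σ'.A a) (σ'.A b) (σ'.v cnt) ∧
      Ext (σ.A a) (σ.A b) (σ.v cnt) (σ'.A a) (σ'.A b) (σ'.v cnt) ∧ σ'.v cnt ≤ σ.v cnt + 1 ∧
      Node lo (σ'.v cnt) (σ'.v .res) ∧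
      wd (σ'.A a) (σ'.A b) (σ'.v .res) = wd (σ.A a) (σ.A b) (σ.v .u) ++ wd (σ.A a) (σ.A b) (σ.v .v) ∧
      (σ'.v cnt = σ.v cnt + 1 → σ'.v .res = σ.v cnt + 1 ∧ σ'.A b (σ.v cnt + 1) = σ.v .v) := by
  obtain ⟨h1, h2, h3, h4⟩ := hc
  unfold cat
  simp only [wp, evs, tf, if_neg h1.symm, if_neg h2.symm, if_neg h4.symm, hsz, if_neg h3, if_neg h3.symm]
  refine ⟨fun hu0 => ⟨fun hv0 => ⟨by omega, by omega, by omega, ?_⟩, fun hv0 => ?_⟩, fun hu0 => ?_⟩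
  · have hu' := hu.resolve_left hu0
    have hv' := hv.resolve_left hv0
    simp only [evs, St.put_A_same, St.put_A_ne _ _ _ hab, St.put_A_ne _ _ _ hab.symm]
    refine ⟨by omega, hP.pair hu' hv', ext_update _ _ _ _ _, le_rfl, .inr ⟨by omega, le_rfl⟩, ?_,
      fun _ => by simp⟩
    rw [Submatch.wd_pair (by simp; omega) (by simp; omega) (by simp; omega)]
    have he := ext_update (σ.A a) (σ.A b) (σ.v cnt) (σ.v .u) (σ.v .v)
    simp only [Function.update_self]
    rw [he.wd hu'.2, he.wd hv'.2]
  · refine ⟨by omega, hP, Ext.refl _ _ _, by omega, hu, by simp [hv0], by omega⟩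
  · refine ⟨by omega, hP, Ext.refl _ _ _, by omega, hv, by simp [hu0], by omega⟩

theorem letter_spec {cnt : Var} {a b : Arr} (hc : cnt ≠ .res ∧ cnt ≠ .sz)
    (hab : a ≠ b) {lo m : ℕ} {sy : Ex} (σ : St) (hsz : σ.v .sz = E.SZ) (hM : E.SZ < E.M)
    (hP : Pool lo (σ.A a) (σ.A b) (σ.v cnt)) (hn : σ.v cnt + 1 < E.SZ)
    (hsy : ∀ σ', (∀ y, y ≠ cnt → σ'.v y = σ.v y) → (∀ c, c ≠ a → σ'.A c = σ.A c) →
      sy.ok E σ' ∧ sy.ev σ' = m) :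
    WP E (letter cnt a b sy) σ fun σ' t => t ≤ 6 ∧ Pool lo (σ'.A a) (σ'.A b) (σ'.v cnt) ∧
      Ext (σ.A a) (σ.A b) (σ.v cnt) (σ'.A a) (σ'.A b) (σ'.v cnt) ∧ σ'.v cnt = σ.v cnt + 1 ∧
      σ'.v .res = σ.v cnt + 1 ∧ wd (σ'.A a) (σ'.A b) (σ'.v .res) = [m] ∧
      σ'.A b (σ.v cnt + 1) = m := by
  obtain ⟨h3, h4⟩ := hc
  obtain ⟨k1, k2⟩ := hsy ((σ.set cnt (σ.v cnt + 1)).put a (σ.v cnt + 1) 0)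
    (fun y hy => by simp [hy]) (fun c hc => by simp [hc])
  unfold letter
  simp only [wp, evs, tf, if_neg h4.symm, hsz, if_neg h3, if_neg h3.symm, k1, k2]
  simp only [evs, St.put_A_same, St.put_A_ne _ _ _ hab, St.put_A_ne _ _ _ hab.symm]
  refine ⟨by omega, by omega, by omega, by omega, hP.letter, ext_update _ _ _ _ _, ?_, by simp⟩
  rw [wd_letter (by omega) (by simp)]
  simp

/-- The invariants of the two pools of nodes; `B` bounds their sizes. -/
structure Words (E : Env) (lo B : ℕ) (σ : St) : Prop where
  sz : σ.v .sz = E.SZ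
  SZ_lt : E.SZ < E.M
  B_lt : B < E.SZ
  pow : 2 ^ (B + 1) < E.M
  lo_le : lo ≤ σ.v .nn
  nn_le : σ.v .nn ≤ B
  np_le : σ.v .np ≤ B
  L0 : σ.A .L 0 = 0
  pool : Pool lo (σ.A .L) (σ.A .R) (σ.v .nn)
  len : ∀ k ≤ σ.v .nn, σ.A .len k = (wd (σ.A .L) (σ.A .R) k).length
  R_lt : ∀ k ≤ σ.v .nn, σ.A .R k < E.M
  ppool : Pool 0 (σ.A .PL) (σ.A .PR) (σ.v .np)

/-- The word of a node of a state. -/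
def St.wd (σ : St) (k : ℕ) : List ℕ := Submatch.wd (σ.A .L) (σ.A .R) k

/-- The position of a node of a state. -/
def St.pos (σ : St) (k : ℕ) : List ℕ := Submatch.wd (σ.A .PL) (σ.A .PR) k

/-- The pools of `σ'` extend those of `σ`. -/
structure ExtS (σ σ' : St) : Prop where
  w : Ext (σ.A .L) (σ.A .R) (σ.v .nn) (σ'.A .L) (σ'.A .R) (σ'.v .nn)
  p : Ext (σ.A .PL) (σ.A .PR) (σ.v .np) (σ'.A .PL) (σ'.A .PR) (σ'.v .np)

theorem ExtS.refl (σ : St) : ExtS σ σ := ⟨Ext.refl _ _ _, Ext.refl _ _ _⟩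

theorem ExtS.trans {σ σ' σ'' : St} (h : ExtS σ σ') (h' : ExtS σ' σ'') : ExtS σ σ'' :=
  ⟨h.w.trans h'.w, h.p.trans h'.p⟩

/-- The pools of two states agree. -/
structure SameP (σ σ' : St) : Prop where
  sz : σ'.v .sz = σ.v .sz
  nn : σ'.v .nn = σ.v .nn
  np : σ'.v .np = σ.v .np
  L : σ'.A .L = σ.A .L
  R : σ'.A .R = σ.A .R
  len : σ'.A .len = σ.A .len
  PL : σ'.A .PL = σ.A .PL
  PR : σ'.A .PR = σ.A .PR

theorem SameP.words {σ σ' : St} (h : SameP σ σ') {lo B : ℕ} (hW : Words E lo B σ) :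
    Words E lo B σ' := by
  obtain ⟨h1, h2, h3, h4, h5, h6, h7, h8⟩ := h
  obtain ⟨g1, g2, g3, g4, g5, g6, g7, g8, g9, g10, g11, g12⟩ := hW
  exact ⟨by rw [h1, g1], g2, g3, g4, by rw [h2]; exact g5, by rw [h2]; exact g6, by rw [h3]; exact g7,
    by rw [h4, g8], by rw [h4, h5, h2]; exact g9, by rw [h2, h4, h5, h6]; exact g10,
    by rw [h2, h5]; exact g11, by rw [h3, h7, h8]; exact g12⟩

theorem SameP.ext {σ σ' : St} (h : SameP σ σ') : ExtS σ σ' := by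
  obtain ⟨h1, h2, h3, h4, h5, h6, h7, h8⟩ := h
  constructor <;> simp only [h2, h3, h4, h5, h7, h8] <;> exact Ext.refl _ _ _

theorem SameP.frame {σ σ' : St} {c : Cmd} (hF : Frame c σ σ')
    (h : (c.modV .sz || c.modV .nn || c.modV .np || c.modA .L || c.modA .R || c.modA .len ||
      c.modA .PL || c.modA .PR) = false) : SameP σ σ' := by
  simp only [Bool.or_eq_false_iff] at h
  obtain ⟨⟨⟨⟨⟨⟨⟨h1, h2⟩, h3⟩, h4⟩, h5⟩, h6⟩, h7⟩, h8⟩ := h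
  exact ⟨hF.v _ h1, hF.v _ h2, hF.v _ h3, hF.A _ h4, hF.A _ h5, hF.A _ h6, hF.A _ h7, hF.A _ h8⟩

theorem Words.length_le {lo B : ℕ} {σ : St} (hW : Words E lo B σ) {k : ℕ} (hk : k ≤ σ.v .nn) :
    (σ.wd k).length ≤ 2 ^ B :=
  (wd_length_le k).trans (Nat.pow_le_pow_right (by omega) (hk.trans hW.nn_le))

theorem catW_spec {lo B : ℕ} (σ : St) (hW : Words E lo B σ) (hu : Node lo (σ.v .nn) (σ.v .u))
    (hv : Node lo (σ.v .nn) (σ.v .v)) (hn : σ.v .nn + 1 ≤ B) :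
    WP E catW σ fun σ' t => t ≤ 7 ∧ Words E lo B σ' ∧ ExtS σ σ' ∧ σ'.v .nn ≤ σ.v .nn + 1 ∧
      σ'.v .np = σ.v .np ∧ Node lo (σ'.v .nn) (σ'.v .res) ∧
      σ'.wd (σ'.v .res) = σ.wd (σ.v .u) ++ σ.wd (σ.v .v) := by
  have hB := hW.B_lt
  have hSZ := hW.SZ_lt
  refine WP_cut _ (cat_spec (E := E) (by decide) (by decide) σ hW.sz hW.SZ_lt hW.pool hu hv
    (by omega) hW.lo_le).frame ?_
  rintro σ1 t ⟨⟨ht, hP, hE, hnn, hr, hw, hR⟩, hF⟩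
  have e1 : σ1.v .u = σ.v .u := hF.v _ rfl
  have e2 : σ1.v .v = σ.v .v := hF.v _ rfl
  have e3 : σ1.v .np = σ.v .np := hF.v _ rfl
  have e4 : σ1.v .sz = E.SZ := by rw [hF.v _ rfl, hW.sz]
  have e5 : σ1.A .len = σ.A .len := hF.A _ rfl
  have e6 : σ1.A .PL = σ.A .PL := hF.A _ rfl
  have e7 : σ1.A .PR = σ.A .PR := hF.A _ rfl
  have l1 := hW.length_le hu.le
  have l2 := hW.length_le hv.le
  have l3 := hW.len _ hu.le
  have l4 := hW.len _ hv.le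
  have hpow := hW.pow
  rw [pow_succ] at hpow
  have l5 := hr.le
  have l6 := hu.le
  have l7 := hv.le
  change σ.A .len (σ.v .u) = (σ.wd _).length at l3
  change σ.A .len (σ.v .v) = (σ.wd _).length at l4
  simp only [wp, evs, tf, e1, e2, e4, e5]
  refine ⟨by omega, by omega, ⟨by simpa using e4, hW.SZ_lt, hB, hW.pow, ?_, ?_, ?_, ?_, ?_, ?_, ?_, ?_⟩,
    ⟨by simpa using hE, ?_⟩, by simpa using hnn, by simpa using e3, by simpa using hr, ?_⟩
  · have := hE.le; have := hW.lo_le; simp; omega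
  · simp; omega
  · simp [e3]; exact hW.np_le
  · simp; rw [hE.L _ (by omega), hW.L0]
  · simpa using hP
  · intro k hk
    simp at hk ⊢
    by_cases hkr : k = σ1.v .res
    · subst hkr
      rw [hw]
      simp [l3, l4]; rfl
    · simp [hkr]
      rcases Nat.lt_or_ge (σ.v .nn) k with h | h
      · omega
      · rw [e5, hE.wd h, hW.len k h]
  · intro k hk
    simp at hk ⊢
    rcases Nat.lt_or_ge (σ.v .nn) k with h | h
    · grind
    · rw [hE.R k h]; exact hW.R_lt k h
  · simp [e3, e6, e7]; exact hW.ppool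
  · simp [e3, e6, e7]; exact Ext.refl _ _ _
  · simpa [St.wd] using hw

end Submatch

namespace Submatch

/-! ### The words of the nonterminals -/

open Var Arr in
/-- Appends the words of the children of `g` from number `j` on, up to the number `n`, to the word of
the node `x`. -/
def appendKids (x : Var) (n : Ex) : Cmd :=
  .while (n - j) (u ≔ x ;; v ≔ WL (ch (chp g + j)) ;; catW ;; x ≔ res ;; j ≔ j + 1)

open Var Arr in
/-- The words of `g`, for the composition of two earlier nonterminals. -/
def finishPair : Cmd :=
  c1 ≔ ch (chp g) ;; c2 ≔ ch (chp g + 1) ;;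
  u ≔ WL c1 ;; v ≔ WL c2 ;; catW ;; l ≔ res ;;
  u ≔ WR c2 ;; v ≔ WR c1 ;; catW ;; r ≔ res ;;
  .ite (kind g - 2) (u ≔ hp c1 ;; v ≔ hp c2 ;; catP ;; x ≔ res)
    (u ≔ l ;; v ≔ r ;; catW ;; l ≔ res ;; r ≔ 0 ;; x ≔ 0)

open Var Arr in
/-- The words of `g`, for an application of a function symbol and the trivial productions. -/
def finishApp : Cmd :=
  l ≔ 0 ;; r ≔ 0 ;; x ≔ 0 ;; j ≔ 0 ;;
  .ite (kind g)
    (letter nn L R (sym g) ;; .store len nn 1 ;; l ≔ res ;; letter np PL PR (nl g + 1) ;; x ≔ res)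
    .skip ;;
  appendKids l (nl g) ;; appendKids r (nch g)

open Var Arr in
/-- Computes nodes for the words and the hole position of `g`. -/
def finish : Cmd :=
  .ite (kind g - 1) finishPair finishApp ;;
  .store WL g l ;; .store WR g r ;; .store hp g x

/-- The concatenation of `f a, …, f (a + n - 1)`. -/
def seg (f : ℕ → List ℕ) (a : ℕ) : ℕ → List ℕ
  | 0 => []
  | n + 1 => seg f a n ++ f (a + n)

/-- A grammar in uniform format, with its nonterminals numbered from `lo` to `hi - 1`. A nonterminal
of kind 1 is an application of `sym`, the kinds 2 and 3 are compositions that result in a term or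
context, and kind 0 is for the remaining productions. The children are `kid g 0, …`; the first `nl g`
of them are to the left of the hole. The words `lw g` and `rw g` are the preorder words of the parts
before and behind the hole, and `hw g` is the position of the hole. -/
structure Gr where
  lo : ℕ
  hi : ℕ
  kind : ℕ → ℕ
  sym : ℕ → ℕ
  nl : ℕ → ℕ
  nch : ℕ → ℕ
  kid : ℕ → ℕ → ℕ
  rk : ℕ → ℕ
  lw : ℕ → List ℕ
  rw : ℕ → List ℕ
  hw : ℕ → List ℕ

/-- The conditions on a grammar in uniform format. -/
structure Gr.Ok (Γ : Gr) : Prop where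
  kid_mem : ∀ g, Γ.lo ≤ g → g < Γ.hi → ∀ j < Γ.nch g, Γ.lo ≤ Γ.kid g j ∧ Γ.kid g j < Γ.hi
  rk_lt : ∀ g, Γ.lo ≤ g → g < Γ.hi → ∀ j < Γ.nch g, Γ.rk (Γ.kid g j) < Γ.rk g
  nl_le : ∀ g, Γ.lo ≤ g → g < Γ.hi → Γ.nl g ≤ Γ.nch g
  kind_le : ∀ g, Γ.lo ≤ g → g < Γ.hi → Γ.kind g ≤ 3
  two : ∀ g, Γ.lo ≤ g → g < Γ.hi → 2 ≤ Γ.kind g → Γ.nch g = 2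
  lw_app : ∀ g, Γ.lo ≤ g → g < Γ.hi → Γ.kind g ≤ 1 →
    Γ.lw g = (if Γ.kind g = 1 then [Γ.sym g] else []) ++ seg (fun j => Γ.lw (Γ.kid g j)) 0 (Γ.nl g)
  rw_app : ∀ g, Γ.lo ≤ g → g < Γ.hi → Γ.kind g ≤ 1 →
    Γ.rw g = seg (fun j => Γ.lw (Γ.kid g j)) (Γ.nl g) (Γ.nch g - Γ.nl g)
  hw_app : ∀ g, Γ.lo ≤ g → g < Γ.hi → Γ.kind g ≤ 1 →
    Γ.hw g = if Γ.kind g = 1 then [Γ.nl g + 1] else []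
  lw_two : ∀ g, Γ.lo ≤ g → g < Γ.hi → Γ.kind g = 2 →
    Γ.lw g = (Γ.lw (Γ.kid g 0) ++ Γ.lw (Γ.kid g 1)) ++ (Γ.rw (Γ.kid g 1) ++ Γ.rw (Γ.kid g 0))
  rw_two : ∀ g, Γ.lo ≤ g → g < Γ.hi → Γ.kind g = 2 → Γ.rw g = []
  hw_two : ∀ g, Γ.lo ≤ g → g < Γ.hi → Γ.kind g = 2 → Γ.hw g = []
  lw_three : ∀ g, Γ.lo ≤ g → g < Γ.hi → Γ.kind g = 3 → Γ.lw g = Γ.lw (Γ.kid g 0) ++ Γ.lw (Γ.kid g 1)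
  rw_three : ∀ g, Γ.lo ≤ g → g < Γ.hi → Γ.kind g = 3 → Γ.rw g = Γ.rw (Γ.kid g 1) ++ Γ.rw (Γ.kid g 0)
  hw_three : ∀ g, Γ.lo ≤ g → g < Γ.hi → Γ.kind g = 3 → Γ.hw g = Γ.hw (Γ.kid g 0) ++ Γ.hw (Γ.kid g 1)

/-- The state holds the production of `g`. -/
structure Holds (E : Env) (Γ : Gr) (σ : St) (g : ℕ) : Prop where
  kind : σ.A .kind g = Γ.kind g
  sym : σ.A .sym g = Γ.sym g
  nl : σ.A .nl g = Γ.nl g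
  nch : σ.A .nch g = Γ.nch g
  kid : ∀ j < Γ.nch g, σ.A .ch (σ.A .chp g + j) = Γ.kid g j
  g_lt : g < E.SZ
  chp_lt : σ.A .chp g + Γ.nch g < E.SZ
  sym_lt : Γ.sym g < E.M
  nl_lt : Γ.nl g < E.SZ

/-- The words of `g` have been computed. -/
structure Done (Γ : Gr) (lo : ℕ) (σ : St) (g : ℕ) : Prop where
  l : Node lo (σ.v .nn) (σ.A .WL g)
  lw : σ.wd (σ.A .WL g) = Γ.lw g
  r : Node lo (σ.v .nn) (σ.A .WR g)
  rw : σ.wd (σ.A .WR g) = Γ.rw g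
  h : Node 0 (σ.v .np) (σ.A .hp g)
  hw : σ.pos (σ.A .hp g) = Γ.hw g

variable {E : Env} {Γ : Gr} {lo B : ℕ}

theorem Done.ext {σ σ' : St} {g : ℕ} (h : Done Γ lo σ g) (hE : ExtS σ σ')
    (h1 : σ'.A .WL g = σ.A .WL g) (h2 : σ'.A .WR g = σ.A .WR g) (h3 : σ'.A .hp g = σ.A .hp g) :
    Done Γ lo σ' g :=
  ⟨by rw [h1]; exact h.l.mono hE.w.le,
    by rw [h1, ← h.lw]; exact hE.w.wd h.l.le, by rw [h2]; exact h.r.mono hE.w.le,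
    by rw [h2, ← h.rw]; exact hE.w.wd h.r.le, by rw [h3]; exact h.h.mono hE.p.le,
    by rw [h3, ← h.hw]; exact hE.p.wd h.h.le⟩

theorem Holds.congr {σ σ' : St} {g : ℕ} (h : Holds E Γ σ g)
    (hA : ∀ a, (decide (a = .kind ∨ a = .sym ∨ a = .nl ∨ a = .nch ∨ a = .chp ∨ a = .ch)) = true →
      σ'.A a = σ.A a) : Holds E Γ σ' g :=
  ⟨by rw [hA _ rfl, h.kind], by rw [hA _ rfl, h.sym], by rw [hA _ rfl, h.nl], by rw [hA _ rfl, h.nch],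
    by rw [hA _ rfl, hA _ rfl]; exact h.kid, h.g_lt, by rw [hA _ rfl]; exact h.chp_lt, h.sym_lt, h.nl_lt⟩

theorem Holds.frame {σ σ' : St} {g : ℕ} {c : Cmd} (h : Holds E Γ σ g) (hF : Frame c σ σ')
    (hc : (c.modA .kind || c.modA .sym || c.modA .nl || c.modA .nch || c.modA .chp || c.modA .ch) = false) :
    Holds E Γ σ' g := by
  simp only [Bool.or_eq_false_iff] at hc
  obtain ⟨⟨⟨⟨⟨h1, h2⟩, h3⟩, h4⟩, h5⟩, h6⟩ := hc
  refine h.congr fun a ha => ?_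
  rcases of_decide_eq_true ha with rfl | rfl | rfl | rfl | rfl | rfl <;> exact hF.A _ ‹_›

theorem ExtS.wd {σ σ' : St} (h : ExtS σ σ') {k : ℕ} (hk : k ≤ σ.v .nn) : σ'.wd k = σ.wd k :=
  h.w.wd hk

theorem ExtS.pos {σ σ' : St} (h : ExtS σ σ') {k : ℕ} (hk : k ≤ σ.v .np) : σ'.pos k = σ.pos k :=
  h.p.wd hk

theorem catP_spec (σ : St) (hW : Words E lo B σ) (hu : Node 0 (σ.v .np) (σ.v .u))
    (hv : Node 0 (σ.v .np) (σ.v .v)) (hn : σ.v .np + 1 ≤ B) :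
    WP E catP σ fun σ' t => t ≤ 7 ∧ Words E lo B σ' ∧ ExtS σ σ' ∧ σ'.v .nn = σ.v .nn ∧
      σ'.v .np ≤ σ.v .np + 1 ∧ Node 0 (σ'.v .np) (σ'.v .res) ∧
      σ'.pos (σ'.v .res) = σ.pos (σ.v .u) ++ σ.pos (σ.v .v) := by
  have hB := hW.B_lt
  have hSZ := hW.SZ_lt
  refine (cat_spec (E := E) (by decide) (by decide) σ hW.sz hW.SZ_lt hW.ppool hu hv
    (by omega) (by omega)).frame.mono ?_
  rintro σ1 t ⟨⟨ht, hP, hE, hnn, hr, hw, hR⟩, hF⟩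
  have e3 : σ1.v .nn = σ.v .nn := hF.v _ rfl
  have e4 : σ1.v .sz = E.SZ := by rw [hF.v _ rfl, hW.sz]
  have e5 : σ1.A .len = σ.A .len := hF.A _ rfl
  have e6 : σ1.A .L = σ.A .L := hF.A _ rfl
  have e7 : σ1.A .R = σ.A .R := hF.A _ rfl
  refine ⟨by omega, ⟨e4, hSZ, hB, hW.pow, by rw [e3]; exact hW.lo_le, by rw [e3]; exact hW.nn_le,
    by omega, by rw [e6, hW.L0], by rw [e3, e6, e7]; exact hW.pool,
    by rw [e3, e5, e6, e7]; exact hW.len, by rw [e3, e7]; exact hW.R_lt, hP⟩,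
    ⟨by rw [e3, e6, e7]; exact Ext.refl _ _ _, hE⟩, e3, hnn, hr, hw⟩

theorem letterW_spec {sy : Ex} {m : ℕ} (σ : St) (hW : Words E lo B σ) (hn : σ.v .nn + 1 ≤ B)
    (hm : m < E.M)
    (hsy : ∀ σ', (∀ y, y ≠ .nn → σ'.v y = σ.v y) → (∀ c, c ≠ .L → σ'.A c = σ.A c) →
      sy.ok E σ' ∧ sy.ev σ' = m) :
    WP E (letter .nn .L .R sy ;; .store .len Var.nn 1) σ fun σ' t => t ≤ 7 ∧ Words E lo B σ' ∧
      ExtS σ σ' ∧ σ'.v .nn = σ.v .nn + 1 ∧ σ'.v .np = σ.v .np ∧ Node lo (σ'.v .nn) (σ'.v .res) ∧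
      σ'.wd (σ'.v .res) = [m] := by
  have hB := hW.B_lt
  have hSZ := hW.SZ_lt
  refine WP_cut _ (letter_spec (E := E) (by decide) (by decide) σ hW.sz hW.SZ_lt hW.pool
    (by omega) hsy).frame ?_
  rintro σ1 t ⟨⟨ht, hP, hE, hnn, hr, hw, hR⟩, hF⟩
  have e3 : σ1.v .np = σ.v .np := hF.v _ rfl
  have e4 : σ1.v .sz = E.SZ := by rw [hF.v _ rfl, hW.sz]
  have e5 : σ1.A .len = σ.A .len := hF.A _ rfl
  have e6 : σ1.A .PL = σ.A .PL := hF.A _ rfl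
  have e7 : σ1.A .PR = σ.A .PR := hF.A _ rfl
  have hlo := hW.lo_le
  have hnp := hW.np_le
  simp only [wp, evs, tf, e4, hnn]
  refine ⟨by omega, by omega, ⟨by simpa using e4, hSZ, hB, hW.pow, ?_, ?_,
    ?_, ?_, by simpa using hP, ?_, ?_, by simp [e3, e6, e7]; exact hW.ppool⟩, ⟨by simpa using hE, ?_⟩,
    e3, .inr ?_, by simpa [St.wd] using hw⟩
  · simp; omega
  · simp; omega
  · simp; omega
  · simp; rw [hE.L _ (by omega), hW.L0]
  · intro k hk
    simp [hnn] at hk ⊢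
    by_cases hkr : k = σ.v .nn + 1
    · subst hkr; simp; rw [← hr, hw]; simp
    · simp [hkr]; rw [e5, hE.wd (by omega), hW.len k (by omega)]
  · intro k hk
    simp [hnn] at hk ⊢
    rcases Nat.lt_or_ge (σ.v .nn) k with h | h
    · rw [show k = σ.v .nn + 1 by omega, hR]; exact hm
    · rw [hE.R k h]; exact hW.R_lt k h
  · simp [e3, e6, e7]; exact Ext.refl _ _ _
  · simp [hr]; omega

theorem letterP_spec {sy : Ex} {m : ℕ} (σ : St) (hW : Words E lo B σ) (hn : σ.v .np + 1 ≤ B)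
    (hsy : ∀ σ', (∀ y, y ≠ .np → σ'.v y = σ.v y) → (∀ c, c ≠ .PL → σ'.A c = σ.A c) →
      sy.ok E σ' ∧ sy.ev σ' = m) :
    WP E (letter .np .PL .PR sy) σ fun σ' t => t ≤ 6 ∧ Words E lo B σ' ∧
      ExtS σ σ' ∧ σ'.v .nn = σ.v .nn ∧ σ'.v .np = σ.v .np + 1 ∧ Node 0 (σ'.v .np) (σ'.v .res) ∧
      σ'.pos (σ'.v .res) = [m] := by
  have hB := hW.B_lt
  have hSZ := hW.SZ_lt
  refine (letter_spec (E := E) (by decide) (by decide) σ hW.sz hW.SZ_lt hW.ppool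
    (by omega) hsy).frame.mono ?_
  rintro σ1 t ⟨⟨ht, hP, hE, hnn, hr, hw, hR⟩, hF⟩
  have e3 : σ1.v .nn = σ.v .nn := hF.v _ rfl
  have e4 : σ1.v .sz = E.SZ := by rw [hF.v _ rfl, hW.sz]
  have e5 : σ1.A .len = σ.A .len := hF.A _ rfl
  have e6 : σ1.A .L = σ.A .L := hF.A _ rfl
  have e7 : σ1.A .R = σ.A .R := hF.A _ rfl
  refine ⟨by omega, ⟨e4, hSZ, hB, hW.pow, by rw [e3]; exact hW.lo_le, by rw [e3]; exact hW.nn_le,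
    by omega, by rw [e6, hW.L0], by rw [e3, e6, e7]; exact hW.pool,
    by rw [e3, e5, e6, e7]; exact hW.len, by rw [e3, e7]; exact hW.R_lt, hP⟩,
    ⟨by rw [e3, e6, e7]; exact Ext.refl _ _ _, hE⟩, e3, hnn, .inr (by omega), hw⟩

theorem seg_succ' (f : ℕ → List ℕ) (a n : ℕ) : seg f a (n + 1) = f a ++ seg f (a + 1) n := by
  induction n with
  | zero => simp [seg]
  | succ n ih => rw [seg, ih, seg, List.append_assoc, Nat.add_assoc, Nat.add_comm 1 n]

/-- The invariant of the concatenation of the words of the children of `g`. -/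
structure AppInv (E : Env) (Γ : Gr) (lo B g : ℕ) (x : Var) (σ0 σ : St) (a b : ℕ) : Prop where
  words : Words E lo B σ
  ext : ExtS σ0 σ
  holds : Holds E Γ σ g
  vg : σ.v .g = g
  fin : ∀ j < Γ.nch g, Done Γ lo σ (Γ.kid g j)
  a_le : a ≤ σ.v .j
  j_le : σ.v .j ≤ b
  node : Node lo (σ.v .nn) (σ.v x)
  wd : σ.wd (σ.v x) = σ0.wd (σ0.v x) ++ seg (fun j => Γ.lw (Γ.kid g j)) a (σ.v .j - a)
  nn : σ.v .nn ≤ σ0.v .nn + (σ.v .j - a)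
  np : σ.v .np = σ0.v .np

theorem appendKids_spec (hΓ : Γ.Ok) {g : ℕ} (h1 : Γ.lo ≤ g) (h2 : g < Γ.hi) {x : Var}
    (hx : x = .l ∨ x = .r) (hi : Γ.hi ≤ E.SZ) {n : Ex} {b : ℕ} (hb : b ≤ Γ.nch g) (σ : St)
    (hn : ∀ σ', Holds E Γ σ' g → σ'.v .g = g → σ'.v .sz = E.SZ → n.ok E σ' ∧ n.ev σ' = b)
    (hW : Words E lo B σ) (hH : Holds E Γ σ g) (hg : σ.v .g = g)
    (hfin : ∀ j < Γ.nch g, Done Γ lo σ (Γ.kid g j)) (hj : σ.v .j ≤ b)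
    (hnode : Node lo (σ.v .nn) (σ.v x)) (hB : σ.v .nn + (b - σ.v .j) ≤ B) :
    WP E (appendKids x n) σ fun σ' t => t ≤ 13 * (b - σ.v .j) + 1 ∧ σ'.v .j = b ∧
      AppInv E Γ lo B g x σ σ' (σ.v .j) b := by
  have hSZ := hW.SZ_lt
  refine WP_while (fun m σ' => m = b - σ'.v .j ∧ AppInv E Γ lo B g x σ σ' (σ.v .j) b) 12 ?_ ?_
    (n := b - σ.v .j) ?_ ?_
  · rintro m σ' ⟨-, hI⟩
    obtain ⟨k1, k2⟩ := hn σ' hI.holds hI.vg hI.words.sz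
    have := hI.holds.chp_lt
    simp [k1, k2]
    omega
  · rintro m σ' ⟨rfl, hI⟩ hne
    obtain ⟨k1, k2⟩ := hn σ' hI.holds hI.vg hI.words.sz
    simp [k2] at hne
    have hch := hI.holds.chp_lt
    have hkj := hI.holds.kid (σ'.v .j) (by omega)
    have hkm := hΓ.kid_mem g h1 h2 (σ'.v .j) (by omega)
    have hfj := hI.fin (σ'.v .j) (by omega)
    have hglt := hI.holds.g_lt
    have hnn := hI.nn
    have hal := hI.a_le
    have hxu : x ≠ .u := by rcases hx with rfl | rfl <;> decide
    have hxv : x ≠ .v := by rcases hx with rfl | rfl <;> decide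
    have hxj : x ≠ .j := by rcases hx with rfl | rfl <;> decide
    simp only [wp, evs, tf, reduceCtorEq, hI.vg, hI.words.sz, hkj]
    refine ⟨by omega, ?_⟩
    have hsame : SameP σ' ((σ'.set .u (σ'.v x)).set .v (σ'.A .WL (Γ.kid g (σ'.v .j)))) := by
      constructor <;> simp
    refine WP_cut _ (catW_spec _ (hsame.words hI.words) (by simpa using hI.node)
      (by simpa using hfj.l) (by simp; omega)).frame ?_
    rintro σ1 t ⟨⟨ht, hW1, hE1, hn1, hp1, hr1, hw1⟩, hF⟩
    have e1 : σ1.v .j = σ'.v .j := by rw [hF.v _ rfl]; simp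
    have e2 : σ1.v .g = g := by rw [hF.v _ rfl]; simpa using hI.vg
    have e3 : ∀ a, (decide (a = .WL ∨ a = .WR ∨ a = .hp ∨ a = .kind ∨ a = .sym ∨ a = .nl ∨ a = .nch ∨
        a = .chp ∨ a = .ch)) = true → σ1.A a = σ'.A a := by
      intro a ha
      rcases of_decide_eq_true ha with rfl | rfl | rfl | rfl | rfl | rfl | rfl | rfl | rfl <;>
        rw [hF.A _ rfl] <;> simp
    have e4 : σ1.v x = σ'.v x := by
      rw [hF.v _ (by rcases hx with rfl | rfl <;> rfl)]; simp [hxu, hxv]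
    have hE2 : ExtS σ' σ1 := hsame.ext.trans hE1
    simp at hn1 hp1 hw1
    have hw1 : σ1.wd (σ1.v .res) = σ'.wd (σ'.v x) ++ σ'.wd (σ'.A .WL (Γ.kid g (σ'.v .j))) := hw1
    simp only [wp, evs, tf, if_neg hxj.symm, e1]
    refine ⟨by omega, by omega, b - (σ'.v .j + 1), by omega, by simp, ?_⟩
    have hsame2 : SameP σ1 ((σ1.set x (σ1.v .res)).set .j (σ'.v .j + 1)) := by
      rcases hx with rfl | rfl <;> constructor <;> simp
    have hE3 := hE2.trans hsame2.ext
    refine ⟨hsame2.words hW1, hI.ext.trans hE3, hI.holds.congr fun a ha => ?_, ?_, fun i hi =>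
      (hI.fin i hi).ext hE3 ?_ ?_ ?_, by simp; omega, by simp; omega, ?_, ?_, ?_, ?_⟩
    · simp only [evs]
      refine e3 a ?_
      have ha := of_decide_eq_true ha
      exact decide_eq_true (by tauto)
    · rcases hx with rfl | rfl <;> simpa using e2
    · simp [e3 .WL rfl]
    · simp [e3 .WR rfl]
    · simp [e3 .hp rfl]
    · rcases hx with rfl | rfl <;> simpa using hr1
    · have : ((σ1.set x (σ1.v .res)).set .j (σ'.v .j + 1)).wd
          (((σ1.set x (σ1.v .res)).set .j (σ'.v .j + 1)).v x) = σ1.wd (σ1.v .res) := by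
        simp [hxj, St.wd]
      rw [this, hw1, hI.wd, hfj.lw]
      simp
      rw [show σ'.v .j + 1 - σ.v .j = (σ'.v .j - σ.v .j) + 1 by omega, seg,
        show σ.v .j + (σ'.v .j - σ.v .j) = σ'.v .j by omega]
    · rcases hx with rfl | rfl <;> simp <;> omega
    · rcases hx with rfl | rfl <;> simp [hp1, hI.np]
  · exact ⟨rfl, hW, ExtS.refl σ, hH, hg, hfin, le_rfl, hj, hnode, by simp [seg], by omega, rfl⟩
  · rintro m σ' t ⟨rfl, hI⟩ hne ht
    obtain ⟨k1, k2⟩ := hn σ' hI.holds hI.vg hI.words.sz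
    simp [k2] at hne
    have := hI.j_le
    exact ⟨ht, by omega, hI⟩

/-- The result of the computation of the words of `g`: nodes for them are in `l`, `r` and `x`. -/
structure Made (E : Env) (Γ : Gr) (lo B g : ℕ) (σ0 σ : St) : Prop where
  words : Words E lo B σ
  ext : ExtS σ0 σ
  nn : σ.v .nn ≤ σ0.v .nn + Γ.nch g + 1
  np : σ.v .np ≤ σ0.v .np + 1
  l : Node lo (σ.v .nn) (σ.v .l)
  lw : σ.wd (σ.v .l) = Γ.lw g
  r : Node lo (σ.v .nn) (σ.v .r)
  rw : σ.wd (σ.v .r) = Γ.rw g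
  h : Node 0 (σ.v .np) (σ.v .x)
  hw : σ.pos (σ.v .x) = Γ.hw g

theorem finishApp_spec (hΓ : Γ.Ok) {g : ℕ} (h1 : Γ.lo ≤ g) (h2 : g < Γ.hi) (hi : Γ.hi ≤ E.SZ)
    (σ : St) (hW : Words E lo B σ) (hH : Holds E Γ σ g) (hg : σ.v .g = g)
    (hfin : ∀ j < Γ.nch g, Done Γ lo σ (Γ.kid g j)) (hk : Γ.kind g ≤ 1)
    (hB : σ.v .nn + Γ.nch g + 1 ≤ B) (hBp : σ.v .np + 1 ≤ B) :
    WP E finishApp σ fun σ' t => t ≤ 13 * Γ.nch g + 30 ∧ Made E Γ lo B g σ σ' := by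
  have hSZ := hW.SZ_lt
  have hglt := hH.g_lt
  have hnl := hΓ.nl_le g h1 h2
  have hnlt := hH.nl_lt
  simp only [wp, evs, tf, finishApp]
  obtain ⟨σ0, hσ0⟩ : ∃ σ0, σ0 = (((σ.set .l 0).set .r 0).set .x 0).set .j 0 := ⟨_, rfl⟩
  rw [← hσ0]
  have hs0 : SameP σ σ0 := by rw [hσ0]; constructor <;> simp
  have hA0 : σ0.A = σ.A := by rw [hσ0]; simp
  have hg0 : σ0.v .g = g := by rw [hσ0]; simpa using hg
  have hW0 := hs0.words hW
  have hH0 : Holds E Γ σ0 g := hH.congr fun a _ => by rw [hA0]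
  refine WP_cut (fun σ1 t => t ≤ 20 ∧ Words E lo B σ1 ∧ ExtS σ0 σ1 ∧
    σ1.v .nn ≤ σ.v .nn + 1 ∧ σ1.v .np ≤ σ.v .np + 1 ∧
    Node lo (σ1.v .nn) (σ1.v .l) ∧ σ1.wd (σ1.v .l) = (if Γ.kind g = 1 then [Γ.sym g] else []) ∧
    Node 0 (σ1.v .np) (σ1.v .x) ∧ σ1.pos (σ1.v .x) = (if Γ.kind g = 1 then [Γ.nl g + 1] else []) ∧
    σ1.v .r = 0 ∧ σ1.v .j = 0 ∧ σ1.v .g = g ∧ Holds E Γ σ1 g ∧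
    ∀ j < Γ.nch g, Done Γ lo σ1 (Γ.kid g j)) ?_ ?_
  · simp only [wp, evs, tf, hg0, hW0.sz, hA0, hH.kind]
    refine ⟨by omega, fun hne => ?_, fun hz => ?_⟩
    · have hk1 : Γ.kind g = 1 := by omega
      have assoc : ∀ {c d e : Cmd} {Q : St → ℕ → Prop} {s : St}, WP E ((c ;; d) ;; e) s Q →
          WP E (c ;; d ;; e) s Q := by
        intro c d e Q s h
        rw [WP_seq, WP_seq] at h
        rw [WP_seq]
        refine h.mono fun s1 t1 h1 => ?_
        rw [WP_seq]
        exact h1.mono fun s2 t2 h2 => h2.mono fun s3 t3 h3 => by rwa [Nat.add_assoc] at h3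
      refine assoc ?_
      refine WP_cut _ (letterW_spec (m := Γ.sym g) σ0 hW0 (by rw [hs0.nn]; omega) hH.sym_lt
        ?_).frame ?_
      · intro σ' hv hA
        have hv1 := hv .g (by decide)
        have hv2 := hv .sz (by decide)
        have hA1 := hA .sym (by decide)
        simp [hv1, hv2, hA1, hg0, hW0.sz, hH0.sym, hglt]
      rintro σ1 t ⟨⟨ht, hW1, hE1, hn1, hp1, hr1, hw1⟩, hF⟩
      simp only [wp, evs, tf]
      have hs1 : SameP σ1 (σ1.set .l (σ1.v .res)) := by constructor <;> simp
      have f0 : σ1.v .g = g := by rw [hF.v _ rfl, hg0]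
      have f1 : σ1.A .nl = σ.A .nl := by rw [hF.A _ rfl, hA0]
      have f2 : σ1.v .r = 0 := by rw [hF.v _ rfl, hσ0]; simp
      have f3 : σ1.v .j = 0 := by rw [hF.v _ rfl, hσ0]; simp
      have hH1 := hH0.frame hF rfl
      have hFin1 : ∀ j < Γ.nch g, Done Γ lo σ1 (Γ.kid g j) := fun j hj =>
        (hfin j hj).ext (hs0.ext.trans hE1) (by rw [hF.A _ rfl, hA0]) (by rw [hF.A _ rfl, hA0])
          (by rw [hF.A _ rfl, hA0])
      have hsz1 := hW1.sz
      have hnp0 : σ1.v .np = σ.v .np := by rw [hp1, hs0.np]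
      refine WP_cut _ (letterP_spec (m := Γ.nl g + 1) _ (hs1.words hW1) (by simp; omega) ?_).frame ?_
      · intro σ' hv hA
        have hv1 := hv .g (by decide)
        have hv2 := hv .sz (by decide)
        have hA1 := hA .nl (by decide)
        simp at hv1 hv2 hA1
        simp [hv1, hv2, hA1, f0, hsz1, f1, hH.nl, hglt]
        omega
      rintro σ2 t2 ⟨⟨ht2, hW2, hE2, hn2, hp2, hr2, hw2⟩, hF2⟩
      have hs2 : SameP σ2 (σ2.set .x (σ2.v .res)) := by constructor <;> simp
      have hE3 := (hs1.ext.trans hE2).trans hs2.ext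
      have hl2 : σ2.v .l = σ1.v .res := by rw [hF2.v _ rfl]; simp
      simp only [wp, evs, tf]
      simp at hn2 hp2
      refine ⟨by omega, hs2.words hW2, hE1.trans hE3, ?_, ?_, ?_, ?_, ?_, ?_, ?_, ?_, ?_, ?_, ?_⟩
      · simp; rw [hn2, hn1, hs0.nn]
      · simp; omega
      · simp; rw [hl2, hn2]; exact hr1
      · simp only [hk1, if_true]
        rw [if_neg (by decide), hl2, hE3.wd hr1.le, hw1]
      · simpa using hr2
      · simp only [hk1, if_true]
        exact hw2
      · simp; rw [hF2.v _ rfl]; simpa using f2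
      · simp; rw [hF2.v _ rfl]; simpa using f3
      · simp; rw [hF2.v _ rfl]; simpa using f0
      · exact (Holds.frame (σ := σ1.set .l (σ1.v .res)) (hH1.congr fun a _ => rfl) hF2 rfl).congr
          fun a _ => rfl
      · intro j hj
        exact (hFin1 j hj).ext hE3 (by simp; rw [hF2.A _ rfl]; simp) (by simp; rw [hF2.A _ rfl]; simp)
          (by simp; rw [hF2.A _ rfl]; simp)
    · refine ⟨by omega, hW0, ExtS.refl _, by rw [hs0.nn]; omega, by rw [hs0.np]; omega, .inl ?_, ?_,
        .inl ?_, ?_, ?_, ?_, hH0, fun j hj => (hfin j hj).ext hs0.ext (by rw [hA0]) (by rw [hA0])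
          (by rw [hA0])⟩
      · rw [hσ0]; simp
      · simp [hz]; rw [show σ0.v .l = 0 by rw [hσ0]; simp]; exact wd_zero
      · rw [hσ0]; simp
      · simp [hz]; rw [show σ0.v .x = 0 by rw [hσ0]; simp]; exact wd_zero
      · rw [hσ0]; simp
      · rw [hσ0]; simp
  rintro σ1 t₁ ⟨ht1, hW1, hE1, hn1, hp1, hl1, hlw1, hx1, hxw1, hr1, hj1, hg1, hH1, hF1⟩
  refine WP_cut _ (appendKids_spec hΓ h1 h2 (x := .l) (.inl rfl) hi (b := Γ.nl g) hnl σ1 ?_ hW1 hH1 hg1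
    hF1 (by omega) hl1 (by omega)).frame ?_
  · intro σ' hH' hg' hz'
    simp [hg', hz', hH'.nl, hglt]
  rintro σ2 t₂ ⟨⟨ht2, hj2, hI⟩, hFr2⟩
  have e1 : σ2.v .r = 0 := by rw [hFr2.v _ rfl, hr1]
  have e2 : σ2.v .x = σ1.v .x := hFr2.v _ rfl
  have hI1 := hI.nn
  have hI2 := hI.np
  refine (appendKids_spec hΓ h1 h2 (x := .r) (.inr rfl) hi (b := Γ.nch g) le_rfl σ2 ?_ hI.words hI.holds
    hI.vg hI.fin (by omega) (by rw [e1]; exact .inl rfl) (by omega)).frame.mono ?_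
  · intro σ' hH' hg' hz'
    simp [hg', hz', hH'.nch, hglt]
  rintro σ3 t₃ ⟨⟨ht3, hj3, hJ⟩, hFr3⟩
  have f1 : σ3.v .l = σ2.v .l := hFr3.v _ rfl
  have f2 : σ3.v .x = σ1.v .x := by rw [hFr3.v _ rfl, e2]
  have hJ1 := hJ.nn
  have hJ2 := hJ.np
  have hall := (hE1.trans hI.ext).trans hJ.ext
  refine ⟨by omega, hJ.words, hs0.ext.trans hall, by omega, by omega, ?_, ?_, hJ.node, ?_, ?_, ?_⟩
  · rw [f1]; exact hI.node.mono hJ.ext.w.le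
  · rw [f1, hJ.ext.wd hI.node.le, hI.wd, hlw1, hΓ.lw_app g h1 h2 hk, hj2, hj1, Nat.sub_zero]
  · rw [hJ.wd, e1, hj3, hj2, hΓ.rw_app g h1 h2 hk]
    have : σ2.wd 0 = [] := wd_zero
    rw [this, List.nil_append]
  · rw [f2]; exact hx1.mono (hI.ext.trans hJ.ext).p.le
  · rw [f2, (hI.ext.trans hJ.ext).pos hx1.le, hxw1, hΓ.hw_app g h1 h2 hk]

theorem finishPair_spec (hΓ : Γ.Ok) {g : ℕ} (h1 : Γ.lo ≤ g) (h2 : g < Γ.hi) (hi : Γ.hi ≤ E.SZ)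
    (σ : St) (hW : Words E lo B σ) (hH : Holds E Γ σ g) (hg : σ.v .g = g)
    (hfin : ∀ j < Γ.nch g, Done Γ lo σ (Γ.kid g j)) (hk : 2 ≤ Γ.kind g)
    (hB : σ.v .nn + Γ.nch g + 1 ≤ B) (hBp : σ.v .np + 1 ≤ B) :
    WP E finishPair σ fun σ' t => t ≤ 50 ∧ Made E Γ lo B g σ σ' := by
  have hSZ := hW.SZ_lt
  have hglt := hH.g_lt
  have hkle := hΓ.kind_le g h1 h2
  have hch := hH.chp_lt
  have hn2 := hΓ.two g h1 h2 hk
  have hk0 := hH.kid 0 (by omega)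
  have hk1 := hH.kid 1 (by omega)
  rw [Nat.add_zero] at hk0
  have hm0 := hΓ.kid_mem g h1 h2 0 (by omega)
  have hm1 := hΓ.kid_mem g h1 h2 1 (by omega)
  have hf0 := hfin 0 (by omega)
  have hf1 := hfin 1 (by omega)
  have hkg := hH.kind
  obtain ⟨a, ha⟩ : ∃ a, a = Γ.kid g 0 := ⟨_, rfl⟩
  obtain ⟨b, hb⟩ : ∃ b, b = Γ.kid g 1 := ⟨_, rfl⟩
  rw [← ha] at hk0 hm0 hf0
  rw [← hb] at hk1 hm1 hf1
  simp only [wp, evs, tf, finishPair, reduceCtorEq, hg, hW.sz, hk0, hk1]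
  refine ⟨by omega, by omega, by omega, by omega, ?_⟩
  obtain ⟨σ0, hσ0⟩ : ∃ σ0, σ0 = (((σ.set .c1 a).set .c2 b).set .u (σ.A .WL a)).set .v (σ.A .WL b) :=
    ⟨_, rfl⟩
  rw [← hσ0]
  have hs0 : SameP σ σ0 := by rw [hσ0]; constructor <;> simp
  refine WP_cut _ (catW_spec σ0 (hs0.words hW) ?_ ?_ (by rw [hs0.nn]; omega)).frame ?_
  · rw [hs0.nn, hσ0]; simpa using hf0.l
  · rw [hs0.nn, hσ0]; simpa using hf1.l
  rintro σ1 t1 ⟨⟨ht1, hW1, hE1, hn1, hp1, hr1, hw1⟩, hF1⟩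
  have e1 : σ1.v .c1 = a := by rw [hF1.v _ rfl, hσ0]; simp
  have e2 : σ1.v .c2 = b := by rw [hF1.v _ rfl, hσ0]; simp
  have e3 : σ1.v .g = g := by rw [hF1.v _ rfl, hσ0]; simpa using hg
  have e4 : σ1.A .WR = σ.A .WR := by rw [hF1.A _ rfl, hσ0]; simp
  have e5 : σ1.A .hp = σ.A .hp := by rw [hF1.A _ rfl, hσ0]; simp
  have e6 : σ1.A .kind = σ.A .kind := by rw [hF1.A _ rfl, hσ0]; simp
  have hw1 : σ1.wd (σ1.v .res) = Γ.lw a ++ Γ.lw b := by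
    rw [hw1, ← hf0.lw, ← hf1.lw, hσ0]; simp [St.wd]
  have hEE1 : ExtS σ σ1 := hs0.ext.trans hE1
  rw [hs0.nn] at hn1
  rw [hs0.np] at hp1
  clear hF1 hE1
  simp only [wp, evs, tf, reduceCtorEq, e1, e2, hW1.sz, e4]
  refine ⟨by omega, by omega, ?_⟩
  obtain ⟨σ2, hσ2⟩ : ∃ σ2, σ2 = ((σ1.set .l (σ1.v .res)).set .u (σ.A .WR b)).set .v (σ.A .WR a) :=
    ⟨_, rfl⟩
  rw [← hσ2]
  have hs2 : SameP σ1 σ2 := by rw [hσ2]; constructor <;> simp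
  refine WP_cut _ (catW_spec σ2 (hs2.words hW1) ?_ ?_ (by rw [hs2.nn]; omega)).frame ?_
  · rw [hs2.nn, hσ2]; simpa using hf1.r.mono hEE1.w.le
  · rw [hs2.nn, hσ2]; simpa using hf0.r.mono hEE1.w.le
  rintro σ3 t3 ⟨⟨ht3, hW3, hE3, hn3, hp3, hr3, hw3⟩, hF3⟩
  have g1 : σ3.v .c1 = a := by rw [hF3.v _ rfl, hσ2]; simpa using e1
  have g2 : σ3.v .c2 = b := by rw [hF3.v _ rfl, hσ2]; simpa using e2
  have g3 : σ3.v .g = g := by rw [hF3.v _ rfl, hσ2]; simpa using e3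
  have g5 : σ3.A .hp = σ.A .hp := by rw [hF3.A _ rfl, hσ2]; simpa using e5
  have g6 : σ3.A .kind = σ.A .kind := by rw [hF3.A _ rfl, hσ2]; simpa using e6
  have g7 : σ3.v .l = σ1.v .res := by rw [hF3.v _ rfl, hσ2]; simp
  have hEE3 : ExtS σ1 σ3 := hs2.ext.trans hE3
  have hw3 : σ3.wd (σ3.v .res) = Γ.rw b ++ Γ.rw a := by
    rw [hw3]
    have k1 : σ2.wd (σ2.v .u) = Γ.rw b := by
      rw [show σ2.v .u = σ.A .WR b by rw [hσ2]; simp, ← hf1.rw]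
      exact (hEE1.trans hs2.ext).wd hf1.r.le
    have k2 : σ2.wd (σ2.v .v) = Γ.rw a := by
      rw [show σ2.v .v = σ.A .WR a by rw [hσ2]; simp, ← hf0.rw]
      exact (hEE1.trans hs2.ext).wd hf0.r.le
    rw [k1, k2]
  have hl3 : Node lo (σ3.v .nn) (σ1.v .res) := hr1.mono hEE3.w.le
  have hlw3 : σ3.wd (σ1.v .res) = Γ.lw a ++ Γ.lw b := by rw [hEE3.wd hr1.le, hw1]
  rw [hs2.nn] at hn3
  rw [hs2.np] at hp3
  have hE03 := hEE1.trans hEE3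
  clear hF3 hE3 hEE1 hEE3
  simp only [wp, evs, tf, reduceCtorEq, g1, g2, g3, hW3.sz, g5, g6, g7, hkg]
  refine ⟨by omega, fun h3 => ⟨by omega, by omega, ?_⟩, fun h3 => ?_⟩
  · -- the composition of two contexts
    have hkind : Γ.kind g = 3 := by omega
    obtain ⟨σ4, hσ4⟩ : ∃ σ4, σ4 = ((σ3.set .r (σ3.v .res)).set .u (σ.A .hp a)).set .v (σ.A .hp b) :=
      ⟨_, rfl⟩
    rw [← hσ4]
    have hs4 : SameP σ3 σ4 := by rw [hσ4]; constructor <;> simp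
    refine WP_cut _ (catP_spec σ4 (hs4.words hW3) ?_ ?_ (by rw [hs4.np]; omega)).frame ?_
    · rw [hs4.np, hσ4]; simpa using hf0.h.mono hE03.p.le
    · rw [hs4.np, hσ4]; simpa using hf1.h.mono hE03.p.le
    rintro σ5 t5 ⟨⟨ht5, hW5, hE5, hn5, hp5, hr5, hw5⟩, hF5⟩
    have k1 : σ5.v .l = σ1.v .res := by rw [hF5.v _ rfl, hσ4]; simpa using g7
    have k2 : σ5.v .r = σ3.v .res := by rw [hF5.v _ rfl, hσ4]; simp
    have hs5 : SameP σ5 (σ5.set .x (σ5.v .res)) := by constructor <;> simp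
    have hE35 := (hs4.ext.trans hE5).trans hs5.ext
    simp only [wp, evs, tf]
    rw [hs4.nn] at hn5
    rw [hs4.np] at hp5
    refine ⟨by omega, hs5.words hW5, hE03.trans hE35, by simp; omega, by simp; omega, ?_, ?_, ?_,
      ?_, by simpa using hr5, ?_⟩
    · simp [k1]; exact hl3.mono hE35.w.le
    · rw [show (σ5.set .x (σ5.v .res)).v .l = σ1.v .res by simp [k1], hE35.wd hl3.le, hlw3,
        hΓ.lw_three g h1 h2 hkind, ha, hb]
    · simp [k2]; exact hr3.mono hE35.w.le
    · rw [show (σ5.set .x (σ5.v .res)).v .r = σ3.v .res by simp [k2], hE35.wd hr3.le, hw3,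
        hΓ.rw_three g h1 h2 hkind, ha, hb]
    · have k3 : (σ5.set .x (σ5.v .res)).pos ((σ5.set .x (σ5.v .res)).v .x) = σ5.pos (σ5.v .res) := rfl
      have k4 : σ4.pos (σ4.v .u) = Γ.hw a := by
        rw [show σ4.v .u = σ.A .hp a by rw [hσ4]; simp, ← hf0.hw]
        exact (hE03.trans hs4.ext).pos hf0.h.le
      have k5 : σ4.pos (σ4.v .v) = Γ.hw b := by
        rw [show σ4.v .v = σ.A .hp b by rw [hσ4]; simp, ← hf1.hw]
        exact (hE03.trans hs4.ext).pos hf1.h.le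
      rw [k3, hw5, k4, k5, hΓ.hw_three g h1 h2 hkind, ha, hb]
  · -- the composition of a context and a term
    have hkind : Γ.kind g = 2 := by omega
    obtain ⟨σ4, hσ4⟩ : ∃ σ4, σ4 = ((σ3.set .r (σ3.v .res)).set .u (σ1.v .res)).set .v (σ3.v .res) :=
      ⟨_, rfl⟩
    rw [← hσ4]
    have hs4 : SameP σ3 σ4 := by rw [hσ4]; constructor <;> simp
    refine WP_cut _ (catW_spec σ4 (hs4.words hW3) ?_ ?_ (by rw [hs4.nn]; omega)) ?_
    · rw [hs4.nn, hσ4]; simpa using hl3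
    · rw [hs4.nn, hσ4]; simpa using hr3
    rintro σ5 t5 ⟨ht5, hW5, hE5, hn5, hp5, hr5, hw5⟩
    have hs5 : SameP σ5 (((σ5.set .l (σ5.v .res)).set .r 0).set .x 0) := by constructor <;> simp
    have hE35 := (hs4.ext.trans hE5).trans hs5.ext
    simp only [wp, evs, tf]
    rw [hs4.nn] at hn5
    rw [hs4.np] at hp5
    refine ⟨by omega, hs5.words hW5, hE03.trans hE35, by simp; omega,
      by simp; omega, by simpa using hr5, ?_, .inl (by simp), ?_, .inl (by simp), ?_⟩
    · have k3 : (((σ5.set .l (σ5.v .res)).set .r 0).set .x 0).wd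
        ((((σ5.set .l (σ5.v .res)).set .r 0).set .x 0).v .l) = σ5.wd (σ5.v .res) := rfl
      have k4 : σ4.wd (σ4.v .u) = Γ.lw a ++ Γ.lw b := by
        rw [show σ4.v .u = σ1.v .res by rw [hσ4]; simp, ← hlw3]
        exact hs4.ext.wd hl3.le
      have k5 : σ4.wd (σ4.v .v) = Γ.rw b ++ Γ.rw a := by
        rw [show σ4.v .v = σ3.v .res by rw [hσ4]; simp, ← hw3]
        exact hs4.ext.wd hr3.le
      rw [k3, hw5, k4, k5, hΓ.lw_two g h1 h2 hkind, ha, hb]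
    · rw [hΓ.rw_two g h1 h2 hkind]; exact wd_zero
    · rw [hΓ.hw_two g h1 h2 hkind]; exact wd_zero

/-- A nonterminal with `n` children adds at most `n + 1` nodes to the pool of words, and at most one to
the pool of positions. -/
theorem finish_spec (hΓ : Γ.Ok) {g : ℕ} (h1 : Γ.lo ≤ g) (h2 : g < Γ.hi) (hi : Γ.hi ≤ E.SZ)
    (σ : St) (hW : Words E lo B σ) (hH : Holds E Γ σ g) (hg : σ.v .g = g)
    (hfin : ∀ j < Γ.nch g, Done Γ lo σ (Γ.kid g j))
    (hB : σ.v .nn + Γ.nch g + 1 ≤ B) (hBp : σ.v .np + 1 ≤ B) :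
    WP E finish σ fun σ' t => t ≤ 13 * Γ.nch g + 60 ∧ Words E lo B σ' ∧ ExtS σ σ' ∧
      σ'.v .nn ≤ σ.v .nn + Γ.nch g + 1 ∧ σ'.v .np ≤ σ.v .np + 1 ∧ Done Γ lo σ' g ∧
      ∀ k, k ≠ g → σ'.A .WL k = σ.A .WL k ∧ σ'.A .WR k = σ.A .WR k ∧ σ'.A .hp k = σ.A .hp k := by
  have hglt := hH.g_lt
  have hkle := hΓ.kind_le g h1 h2
  have hw32 := E.hw
  have hmid : WP E (.ite (Arr.kind Var.g - 1) finishPair finishApp) σ fun σ' t =>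
      t ≤ 13 * Γ.nch g + 51 ∧ Made E Γ lo B g σ σ' := by
    simp only [wp, evs, tf, hg, hW.sz, hH.kind]
    refine ⟨⟨hglt, by omega⟩, fun h => ?_, fun h => ?_⟩
    · exact (finishPair_spec hΓ h1 h2 hi σ hW hH hg hfin (by omega) hB hBp).mono
        fun σ' t h => ⟨by omega, h.2⟩
    · exact (finishApp_spec hΓ h1 h2 hi σ hW hH hg hfin (by omega) hB hBp).mono
        fun σ' t h => ⟨by omega, h.2⟩
  refine WP_cut _ hmid.frame ?_
  rintro σ1 t ⟨⟨ht, hM⟩, hF⟩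
  have e1 : σ1.v .g = g := by rw [hF.v _ rfl, hg]
  have e2 : σ1.A .WL = σ.A .WL := hF.A _ rfl
  have e3 : σ1.A .WR = σ.A .WR := hF.A _ rfl
  have e4 : σ1.A .hp = σ.A .hp := hF.A _ rfl
  clear hF
  simp only [wp, evs, tf, e1, hM.words.sz]
  refine ⟨hglt, hglt, hglt, by omega, ?_⟩
  have hs : SameP σ1 (((σ1.put .WL g (σ1.v .l)).put .WR g (σ1.v .r)).put .hp g (σ1.v .x)) := by
    constructor <;> simp
  refine ⟨hs.words hM.words, hM.ext.trans hs.ext, hM.nn, hM.np, ⟨?_, ?_, ?_, ?_, ?_, ?_⟩, fun k hk => ?_⟩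
  · simpa using hM.l
  · rw [← hM.lw]; simp [St.wd]
  · simpa using hM.r
  · rw [← hM.rw]; simp [St.wd]
  · simpa using hM.h
  · rw [← hM.hw]; simp [St.pos]
  · simp [hk, e2, e3, e4]

end Submatch

namespace Submatch

/-! ### Depth-first search -/

open Var Arr in
/-- Pushes the children of `g` on the stack. -/
def pushKids : Cmd :=
  q ≔ chp g ;; j ≔ 0 ;;
  .while (nch g - j) (.store stk sp (ch (q + j)) ;; sp ≔ sp + 1 ;; j ≔ j + 1)

open Var Arr in
/-- Visits the nonterminal `g` on top of the stack: a new one is followed by its children, one whose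
children are finished is finished, too. -/
def visit : Cmd :=
  g ≔ stk (sp - 1) ;;
  .ite (st g)
    (sp ≔ sp - 1 ;; .ite (st g - 1) .skip (finish ;; .store st g 2))
    (.store st g 1 ;; pushKids)

open Var Arr in
/-- Computes the words of all nonterminals that can be reached from `root`. -/
def dfs : Cmd := .store stk 0 root ;; sp ≔ 1 ;; .while sp visit

/-- `b` can be reached from `a` by passing to children. -/
def Gr.Reach (Γ : Gr) : ℕ → ℕ → Prop :=
  Relation.ReflTransGen fun a b => ∃ j < Γ.nch a, b = Γ.kid a j

open Classical in
/-- The total size of the productions of the nonterminals with the property `p`. -/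
noncomputable def Gr.weight (Γ : Gr) (p : ℕ → Prop) : ℕ :=
  ∑ g ∈ (Finset.Ico Γ.lo Γ.hi).filter p, (Γ.nch g + 1)

theorem Gr.weight_congr {Γ : Gr} {p p' : ℕ → Prop}
    (h : ∀ g, p g ↔ p' g) : Γ.weight p = Γ.weight p' := by
  unfold Gr.weight
  congr 1
  ext g
  simp [h]

open Classical in
theorem Gr.weight_remove {Γ : Gr} {p p' : ℕ → Prop} {g : ℕ}
    (h1 : Γ.lo ≤ g) (h2 : g < Γ.hi) (hp : p g) (hp' : ¬ p' g) (h : ∀ k, k ≠ g → (p k ↔ p' k)) :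
    Γ.weight p = Γ.weight p' + (Γ.nch g + 1) := by
  unfold Gr.weight
  rw [← Finset.add_sum_erase _ _ (show g ∈ (Finset.Ico Γ.lo Γ.hi).filter p by simp [*]), Nat.add_comm]
  congr 2
  ext k
  simp only [Finset.mem_erase, Finset.mem_filter]
  by_cases hk : k = g
  · subst hk; simp [hp']
  · simp [hk, h k hk]

variable {E : Env} {Γ : Gr} {lo B : ℕ}

theorem pushKids_spec {g : ℕ} (σ : St) (hH : Holds E Γ σ g) (hsz : σ.v .sz = E.SZ)
    (hSZ : E.SZ < E.M) (hg : σ.v .g = g) (hsp : σ.v .sp + Γ.nch g < E.SZ) :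
    WP E pushKids σ fun σ' t => t ≤ 4 * Γ.nch g + 3 ∧ σ'.v .sp = σ.v .sp + Γ.nch g ∧
      (∀ i < σ.v .sp, σ'.A .stk i = σ.A .stk i) ∧
      ∀ i < Γ.nch g, σ'.A .stk (σ.v .sp + i) = Γ.kid g i := by
  unfold pushKids
  have hch := hH.chp_lt
  have hgl := hH.g_lt
  simp only [wp, evs, tf, reduceCtorEq, hg, hsz]
  refine ⟨hgl, ?_⟩
  refine WP_while (fun m σ' => m = Γ.nch g - σ'.v .j ∧ σ'.v .j ≤ Γ.nch g ∧ σ'.v .g = g ∧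
    σ'.v .sz = E.SZ ∧ σ'.v .q = σ.A .chp g ∧ (∀ a, a ≠ .stk → σ'.A a = σ.A a) ∧
    σ'.v .sp = σ.v .sp + σ'.v .j ∧ (∀ i < σ.v .sp, σ'.A .stk i = σ.A .stk i) ∧
    ∀ i < σ'.v .j, σ'.A .stk (σ.v .sp + i) = Γ.kid g i) 3 ?_ ?_ (n := Γ.nch g) ?_ ?_
  · rintro m σ' ⟨-, h1, h2, h3, h4, h5, -⟩
    simp [h2, h3, h5, hH.nch, hgl]
    omega
  · rintro m σ' ⟨rfl, h1, h2, h3, h4, h5, h6, h7, h8⟩ hne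
    simp [h2, h5, hH.nch] at hne
    have hk := hH.kid (σ'.v .j) (by omega)
    simp only [wp, evs, tf, reduceCtorEq, h3, h4]
    refine ⟨by omega, by omega, by omega, by omega, Γ.nch g - (σ'.v .j + 1),
      by omega, rfl, by omega, h2, ?_, by omega, ?_, ?_⟩
    · intro a ha; simp [ha, h5 a ha]
    · intro i hi; simp [show i ≠ σ'.v .sp by omega, h7 i hi]
    · intro i hi
      simp at hi
      by_cases hij : i = σ'.v .j
      · subst hij; simp [← h6, h5, hk]
      · simp [show σ.v .sp + i ≠ σ'.v .sp by omega]; exact h8 i (by omega)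
  · simp_all
  · rintro m σ' t ⟨rfl, h1, h2, h3, h4, h5, h6, h7, h8⟩ h0 ht
    simp [h2, h5, hH.nch] at h0
    have hj : σ'.v .j = Γ.nch g := by omega
    rw [hj] at h6 h8
    exact ⟨by omega, h6, h7, h8⟩

/-- The invariant of the search, with at most `n` visits left. -/
structure Dfs (E : Env) (Γ : Gr) (lo B root : ℕ) (σ0 : St) (n : ℕ) (σ : St) : Prop where
  words : Words E lo B σ
  ext : ExtS σ0 σ
  holds : ∀ g, Γ.lo ≤ g → g < Γ.hi → Holds E Γ σ g
  stk : ∀ i < σ.v .sp, Γ.lo ≤ σ.A .stk i ∧ σ.A .stk i < Γ.hi ∧ Γ.Reach root (σ.A .stk i)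
  reach : ∀ g, Γ.lo ≤ g → g < Γ.hi → σ.A .st g ≠ 0 → Γ.Reach root g
  st_le : ∀ g, Γ.lo ≤ g → g < Γ.hi → σ.A .st g ≤ 2
  /-- An unfinished nonterminal is on the stack, with entries of smaller rank above, among them all
  its unfinished children. -/
  act : ∀ g, Γ.lo ≤ g → g < Γ.hi → σ.A .st g = 1 → ∃ i < σ.v .sp, σ.A .stk i = g ∧
    (∀ k, i < k → k < σ.v .sp → Γ.rk (σ.A .stk k) < Γ.rk g) ∧
    ∀ j < Γ.nch g, σ.A .st (Γ.kid g j) = 2 ∨ ∃ k, i < k ∧ k < σ.v .sp ∧ σ.A .stk k = Γ.kid g j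
  fin : ∀ g, Γ.lo ≤ g → g < Γ.hi → σ.A .st g = 2 →
    Done Γ lo σ g ∧ ∀ j < Γ.nch g, σ.A .st (Γ.kid g j) = 2
  root : (∃ i < σ.v .sp, σ.A .stk i = root) ∨ σ.A .st root = 2
  meas : n = σ.v .sp + Γ.weight fun g => σ.A .st g = 0
  n_le : n ≤ 1 + Γ.weight fun _ => True
  nn : σ.v .nn + (Γ.weight fun g => σ.A .st g ≠ 2) ≤ σ0.v .nn + Γ.weight fun _ => True
  np : σ.v .np + (Γ.weight fun g => σ.A .st g ≠ 2) ≤ σ0.v .np + Γ.weight fun _ => True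

/-- A visit either removes an entry from the stack, or turns a new nonterminal into an unfinished one
and pushes its children, whose number is included in the weight of new nonterminals. When an unfinished
nonterminal is on top of the stack, `Dfs.act` shows that its children are finished. -/
theorem visit_spec (hΓ : Γ.Ok) {root r n : ℕ} (hi : Γ.hi ≤ E.SZ)
    (hr : ∀ g, Γ.lo ≤ g → g < Γ.hi → Γ.nch g ≤ r)
    {σ0 : St} (hW : (Γ.weight fun _ => True) + 1 < E.SZ)
    (hB : σ0.v .nn + (Γ.weight fun _ => True) ≤ B) (hBp : σ0.v .np + (Γ.weight fun _ => True) ≤ B)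
    (σ : St) (hD : Dfs E Γ lo B root σ0 n σ) (hsp : σ.v .sp ≠ 0) :
    WP E visit σ fun σ' t => t ≤ 13 * r + 70 ∧ ∃ m < n, Dfs E Γ lo B root σ0 m σ' := by
  have hsz := hD.words.sz
  have hSZ := hD.words.SZ_lt
  have hmeas := hD.meas
  have hnle := hD.n_le
  obtain ⟨g, hg⟩ : ∃ g, g = σ.A .stk (σ.v .sp - 1) := ⟨_, rfl⟩
  obtain ⟨h1, h2, hreach⟩ := hD.stk (σ.v .sp - 1) (by omega)
  rw [← hg] at h1 h2 hreach
  have hH := hD.holds g h1 h2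
  have hgl := hH.g_lt
  have hrg := hr g h1 h2
  -- the entries below the top of the stack
  have hbelow : ∀ h i, i < σ.v .sp → σ.A .stk i = h → h ≠ g → i < σ.v .sp - 1 := by grind
  unfold visit
  simp only [wp, evs, tf, reduceCtorEq, ← hg, hsz]
  refine ⟨by omega, hgl, fun hst => ⟨by omega, ?_⟩, fun hst => ⟨hgl, ?_⟩⟩
  · -- pop
    have hle := hD.st_le g h1 h2
    refine ⟨⟨hgl, by omega⟩, fun hne => ?_, fun h0 => ?_⟩
    · have hst2 : σ.A .st g = 2 := by omega
      refine ⟨by omega, _, ?_, (?_ : SameP σ _).words hD.words, hD.ext.trans (?_ : SameP σ _).ext,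
        fun h k1 k2 => (hD.holds h k1 k2).congr fun a _ => by simp, ?_, by simpa using hD.reach,
        by simpa using hD.st_le, ?_, ?_, ?_, rfl, ?_, by simpa using hD.nn, by simpa using hD.np⟩
      · simp [hmeas]; omega
      · constructor <;> simp
      · constructor <;> simp
      · intro i hi'; simp at hi' ⊢; exact hD.stk i (by omega)
      · intro h k1 k2 k3
        simp at k3 ⊢
        obtain ⟨i, a1, a2, a3, a4⟩ := hD.act h k1 k2 k3
        refine ⟨i, hbelow h i a1 a2 (by rintro rfl; omega), a2, fun k b1 b2 => a3 k b1 (by omega),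
          fun j hj => ?_⟩
        rcases a4 j hj with a4 | ⟨k, b1, b2, b3⟩
        · exact .inl a4
        · grind
      · intro h k1 k2 k3
        simp at k3 ⊢
        obtain ⟨a1, a2⟩ := hD.fin h k1 k2 k3
        exact ⟨a1.ext (SameP.ext (by constructor <;> simp)) (by simp) (by simp) (by simp), a2⟩
      · simp
        rcases hD.root with ⟨i, a1, a2⟩ | h
        · grind
        · exact .inr h
      · simp at hmeas hnle ⊢; omega
    · have hst1 : σ.A .st g = 1 := by omega
      have hact : ∀ j < Γ.nch g, σ.A .st (Γ.kid g j) = 2 := by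
        intro j hj
        obtain ⟨i, a1, a2, a3, a4⟩ := hD.act g h1 h2 hst1
        have hi1 : i = σ.v .sp - 1 := by grind
        rcases a4 j hj with a4 | ⟨k, b1, b2, b3⟩
        · exact a4
        · omega
      obtain ⟨σ1, hσ1⟩ : ∃ σ1, σ1 = (σ.set .g g).set .sp (σ.v .sp - 1) := ⟨_, rfl⟩
      rw [← hσ1]
      have hs1 : SameP σ σ1 := by rw [hσ1]; constructor <;> simp
      have hA1 : σ1.A = σ.A := by rw [hσ1]; simp
      have hw : (Γ.weight fun h => σ.A .st h ≠ 2) =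
          (Γ.weight fun h => Function.update (σ.A .st) g 2 h ≠ 2) + (Γ.nch g + 1) :=
        Gr.weight_remove h1 h2 (by omega) (by simp) fun k hk => by simp [hk]
      have hnn := hD.nn
      have hnp := hD.np
      refine WP_cut _ (finish_spec hΓ h1 h2 hi σ1 (hs1.words hD.words) (hH.congr fun a _ => by rw [hA1])
        (by rw [hσ1]; simp) (fun j hj => ?_) (by rw [hs1.nn]; omega) (by rw [hs1.np]; omega)).frame ?_
      · obtain ⟨k1, k2⟩ := hΓ.kid_mem g h1 h2 j hj
        exact (hD.fin _ k1 k2 (hact j hj)).1.ext hs1.ext (by rw [hA1]) (by rw [hA1]) (by rw [hA1])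
      rintro σ2 t ⟨⟨ht, hW2, hE2, hn2, hp2, hd2, hk2⟩, hF⟩
      have e1 : σ2.v .g = g := by rw [hF.v _ rfl, hσ1]; simp
      have e2 : σ2.v .sp = σ.v .sp - 1 := by rw [hF.v _ rfl, hσ1]; simp
      have e3 : σ2.A .st = σ.A .st := by rw [hF.A _ rfl, hA1]
      have e4 : σ2.A .stk = σ.A .stk := by rw [hF.A _ rfl, hA1]
      have hh2 : ∀ h, Γ.lo ≤ h → h < Γ.hi → Holds E Γ σ2 h := fun h k1 k2 =>
        ((hD.holds h k1 k2).congr (σ' := σ1) fun a _ => by rw [hA1]).frame hF rfl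
      clear hF
      simp only [wp, evs, tf, e1, hW2.sz]
      have hs3 : SameP σ2 (σ2.put .st g 2) := by constructor <;> simp
      have hE3 := (hs1.ext.trans hE2).trans hs3.ext
      rw [hs1.nn] at hn2
      rw [hs1.np] at hp2
      refine ⟨hgl, by omega, _, ?_, hs3.words hW2, hD.ext.trans hE3,
        fun h k1 k2 => (hh2 h k1 k2).congr fun a ha => ?_, ?_, ?_, ?_, ?_, ?_, ?_, rfl, ?_, ?_, ?_⟩
      · simp [hmeas, e2, e3]
        rw [Gr.weight_congr (p' := fun h => σ.A .st h = 0)]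
        · omega
        · grind
      · rcases of_decide_eq_true ha with rfl | rfl | rfl | rfl | rfl | rfl <;> simp
      · intro i hi'; simp [e2, e4] at hi' ⊢; exact hD.stk i (by omega)
      · intro h k1 k2 k3
        by_cases hh : h = g
        · rw [hh]; exact hreach
        · simp [hh, e3] at k3; exact hD.reach h k1 k2 k3
      · intro h k1 k2
        by_cases hh : h = g
        · subst hh; simp
        · simp [hh, e3]; exact hD.st_le h k1 k2
      · intro h k1 k2 k3
        have hh : h ≠ g := by rintro rfl; simp at k3
        simp [hh, e3] at k3
        simp [e2, e3, e4]
        obtain ⟨i, a1, a2, a3, a4⟩ := hD.act h k1 k2 k3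
        refine ⟨i, hbelow h i a1 a2 hh, a2, fun k b1 b2 => a3 k b1 (by omega), fun j hj => ?_⟩
        by_cases hkg : Γ.kid h j = g
        · left; rw [hkg]; simp
        · grind
      · intro h k1 k2 k3
        by_cases hh : h = g
        · subst hh
          refine ⟨hd2.ext hs3.ext (by simp) (by simp) (by simp), fun j hj => ?_⟩
          by_cases hkg : Γ.kid h j = h
          · rw [hkg]; simp
          · simp [hkg, e3]; exact hact j hj
        · simp [hh, e3] at k3
          obtain ⟨a1, a2⟩ := hD.fin h k1 k2 k3
          obtain ⟨b1, b2, b3⟩ := hk2 h hh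
          rw [hA1] at b1 b2 b3
          refine ⟨a1.ext hE3 (by simp [b1]) (by simp [b2]) (by simp [b3]), fun j hj => ?_⟩
          by_cases hkg : Γ.kid h j = g
          · rw [hkg]; simp
          · simp [hkg, e3]; exact a2 j hj
      · simp [e2, e3, e4]
        by_cases hrt : root = g
        · right; rw [hrt]; simp
        · rcases hD.root with ⟨i, a1, a2⟩ | h
          · exact .inl ⟨i, hbelow root i a1 a2 hrt, a2⟩
          · right; rw [Function.update_of_ne hrt]; exact h
      · simp [e2, e3] at hmeas ⊢
        rw [Gr.weight_congr (p' := fun h => σ.A .st h = 0)]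
        · omega
        · grind
      · simp [e3] at hw hnn ⊢; omega
      · simp [e3] at hw hnp ⊢; omega
  · -- a new nonterminal
    have hw : (Γ.weight fun h => σ.A .st h = 0) =
        (Γ.weight fun h => Function.update (σ.A .st) g 1 h = 0) + (Γ.nch g + 1) :=
      Gr.weight_remove h1 h2 hst (by simp) fun k hk => by simp [hk]
    have hw2 : (Γ.weight fun h => σ.A .st h ≠ 2) =
        (Γ.weight fun h => Function.update (σ.A .st) g 1 h ≠ 2) :=
      Gr.weight_congr fun h => by
        by_cases hh : h = g
        · subst hh; simp [hst]
        · simp [hh]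
    obtain ⟨σ1, hσ1⟩ : ∃ σ1, σ1 = (σ.set .g g).put .st g 1 := ⟨_, rfl⟩
    rw [← hσ1]
    have hs1 : SameP σ σ1 := by rw [hσ1]; constructor <;> simp
    have hA1 : ∀ a, a ≠ .st → σ1.A a = σ.A a := by intro a ha; rw [hσ1]; simp [ha]
    have hst1 : σ1.A .st = Function.update (σ.A .st) g 1 := by rw [hσ1]; simp
    have hv1 : σ1.v .sp = σ.v .sp := by rw [hσ1]; simp
    have hh1 : ∀ h, Γ.lo ≤ h → h < Γ.hi → Holds E Γ σ1 h := fun h k1 k2 =>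
      (hD.holds h k1 k2).congr fun a ha => hA1 a (by rintro rfl; simp at ha)
    refine (pushKids_spec σ1 (hh1 g h1 h2) (by rw [hs1.sz, hsz]) hSZ (by rw [hσ1]; simp)
      (by rw [hv1]; omega)).frame.mono ?_
    rintro σ2 t ⟨⟨ht, hsp2, hlow, hnew⟩, hF⟩
    have e2 : ∀ a, a ≠ .stk → σ2.A a = σ1.A a := fun a ha => hF.A _ (by simp [pushKids, Cmd.modA, ha])
    have e3 : σ2.A .st = Function.update (σ.A .st) g 1 := by rw [e2 _ (by simp), hst1]
    have hs2 : SameP σ1 σ2 := SameP.frame hF rfl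
    have hE := hs1.ext.trans hs2.ext
    have hh2 : ∀ h, Γ.lo ≤ h → h < Γ.hi → Holds E Γ σ2 h := fun h k1 k2 => (hh1 h k1 k2).frame hF rfl
    clear hF
    rw [hv1] at hsp2 hlow hnew
    have hlow' : ∀ i < σ.v .sp, σ2.A .stk i = σ.A .stk i := fun i hi => by
      rw [hlow i hi, hA1 _ (by simp)]
    have hst2 : ∀ h, σ.A .st h = 2 → σ2.A .st h = 2 := by
      intro h hh; rw [e3, Function.update_of_ne (by rintro rfl; omega), hh]
    have hnew' : ∀ k, σ.v .sp ≤ k → k < σ2.v .sp → ∃ j < Γ.nch g, σ2.A .stk k = Γ.kid g j := by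
      intro k b1 b2
      refine ⟨k - σ.v .sp, by omega, ?_⟩
      rw [← hnew _ (by omega), show σ.v .sp + (k - σ.v .sp) = k by omega]
    have hnn := hD.nn
    have hnp := hD.np
    refine ⟨by omega, σ2.v .sp + Γ.weight fun h => σ2.A .st h = 0, ?_, hs2.words (hs1.words hD.words),
      hD.ext.trans hE, hh2, ?_, ?_, ?_, ?_, ?_, ?_, rfl, ?_, ?_, ?_⟩
    · simp only [e3]; omega
    · intro i hi'
      rcases Nat.lt_or_ge i (σ.v .sp) with hlt | hge
      · rw [hlow' i hlt]; exact hD.stk i hlt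
      · obtain ⟨j, hj, hk⟩ := hnew' i hge hi'
        obtain ⟨k1, k2⟩ := hΓ.kid_mem g h1 h2 j hj
        rw [hk]
        exact ⟨k1, k2, hreach.tail ⟨j, hj, rfl⟩⟩
    · intro h k1 k2 k3
      by_cases hh : h = g
      · rw [hh]; exact hreach
      · simp [hh, e3] at k3; exact hD.reach h k1 k2 k3
    · intro h k1 k2
      by_cases hh : h = g
      · subst hh; simp [e3]
      · simp [hh, e3]; exact hD.st_le h k1 k2
    · intro h k1 k2 k3
      by_cases hh : h = g
      · subst hh
        refine ⟨σ.v .sp - 1, by omega, by rw [hlow' _ (by omega), ← hg], fun k b1 b2 => ?_,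
          fun j hj => .inr ⟨σ.v .sp + j, by omega, by omega, hnew j hj⟩⟩
        obtain ⟨j, hj, hk⟩ := hnew' k (by omega) b2
        rw [hk]; exact hΓ.rk_lt h h1 h2 j hj
      · simp [hh, e3] at k3
        obtain ⟨i, a1, a2, a3, a4⟩ := hD.act h k1 k2 k3
        have hi1 := hbelow h i a1 a2 hh
        have hrkg := a3 (σ.v .sp - 1) hi1 (by omega)
        rw [← hg] at hrkg
        refine ⟨i, by omega, by rw [hlow' i a1, a2], fun k b1 b2 => ?_, fun j hj => ?_⟩
        · rcases Nat.lt_or_ge k (σ.v .sp) with hlt | hge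
          · rw [hlow' k hlt]; exact a3 k b1 hlt
          · obtain ⟨j, hj, hk⟩ := hnew' k hge b2
            rw [hk]; exact (hΓ.rk_lt g h1 h2 j hj).trans hrkg
        · rcases a4 j hj with a4 | ⟨k, b1, b2, b3⟩
          · exact .inl (hst2 _ a4)
          · exact .inr ⟨k, b1, by omega, by rw [hlow' k b2, b3]⟩
    · intro h k1 k2 k3
      have hh : h ≠ g := by rintro rfl; simp [e3] at k3
      simp [hh, e3] at k3
      obtain ⟨a1, a2⟩ := hD.fin h k1 k2 k3
      refine ⟨a1.ext hE ?_ ?_ ?_, fun j hj => hst2 _ (a2 j hj)⟩ <;>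
      rw [e2 _ (by simp), hA1 _ (by simp)]
    · rcases hD.root with ⟨i, a1, a2⟩ | h
      · exact .inl ⟨i, by omega, by rw [hlow' i a1, a2]⟩
      · exact .inr (hst2 _ h)
    · simp only [e3] at hnle ⊢; omega
    · simp only [e3, hs2.nn, hs1.nn]; omega
    · simp only [e3, hs2.np, hs1.np]; omega

/-- The nonterminals that can be reached from the root are exactly those with the state 2, since the finished ones
are closed under children. -/
theorem dfs_spec (hΓ : Γ.Ok) {r : ℕ} (hi : Γ.hi ≤ E.SZ)
    (hr : ∀ g, Γ.lo ≤ g → g < Γ.hi → Γ.nch g ≤ r)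
    (σ : St) (hW : (Γ.weight fun _ => True) + 1 < E.SZ)
    (hB : σ.v .nn + (Γ.weight fun _ => True) ≤ B) (hBp : σ.v .np + (Γ.weight fun _ => True) ≤ B)
    (hw : Words E lo B σ) (hH : ∀ g, Γ.lo ≤ g → g < Γ.hi → Holds E Γ σ g)
    (hst : ∀ g, Γ.lo ≤ g → g < Γ.hi → σ.A .st g = 0) (h1 : Γ.lo ≤ σ.v .root) (h2 : σ.v .root < Γ.hi) :
    WP E dfs σ fun σ' t => t ≤ (13 * r + 71) * ((Γ.weight fun _ => True) + 1) + 3 ∧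
      Words E lo B σ' ∧ ExtS σ σ' ∧
      σ'.v .nn ≤ σ.v .nn + (Γ.weight fun _ => True) ∧ σ'.v .np ≤ σ.v .np + (Γ.weight fun _ => True) ∧
      ∀ g, Γ.lo ≤ g → g < Γ.hi → (Γ.Reach (σ.v .root) g ∧ σ'.A .st g = 2 ∧ Done Γ lo σ' g) ∨
        (¬ Γ.Reach (σ.v .root) g ∧ σ'.A .st g = 0) := by
  have hsz := hw.sz
  unfold dfs
  simp only [wp, evs, tf]
  refine ⟨⟨by omega, hsz⟩, ?_⟩
  refine WP_while (Dfs E Γ lo B (σ.v .root) σ) (13 * r + 70) (by simp)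
    (fun n σ' hD hne => visit_spec hΓ hi hr hW hB hBp σ' hD (by simpa using hne))
    (n := 1 + Γ.weight fun _ => True) ?_ ?_
  · have hs : SameP σ ((σ.put .stk 0 (σ.v .root)).set .sp 1) := by constructor <;> simp
    refine ⟨hs.words hw, hs.ext, fun h k1 k2 => (hH h k1 k2).congr fun a ha => ?_, ?_, ?_, ?_, ?_, ?_, ?_,
      ?_, le_rfl, ?_, ?_⟩
    · rcases of_decide_eq_true ha with rfl | rfl | rfl | rfl | rfl | rfl <;> simp
    · intro i hi'
      simp at hi'
      subst hi'
      simp [h1, h2]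
      exact .refl
    · intro h k1 k2 k3; simp [hst h k1 k2] at k3
    · intro h k1 k2; simp [hst h k1 k2]
    · intro h k1 k2 k3; simp [hst h k1 k2] at k3
    · intro h k1 k2 k3; simp [hst h k1 k2] at k3
    · exact .inl ⟨0, by simp, by simp⟩
    · simp [Gr.weight]
      refine (Finset.sum_congr (Finset.filter_true_of_mem fun h hh => ?_) fun _ _ => rfl).symm
      simp at hh; exact hst h hh.1 hh.2
    · simp only [Gr.weight]
      refine Nat.add_le_add_left (Finset.sum_le_sum_of_subset fun h => ?_) _
      simp; tauto
    · simp only [Gr.weight]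
      refine Nat.add_le_add_left (Finset.sum_le_sum_of_subset fun h => ?_) _
      simp; tauto
  · rintro m σ' t hD h0 ht
    simp at h0
    have hroot : σ'.A .st (σ.v .root) = 2 := by
      rcases hD.root with ⟨i, a1, -⟩ | h
      · omega
      · exact h
    have hnn := hD.nn
    have hnp := hD.np
    refine ⟨by rw [Nat.add_comm (Γ.weight _) 1]; linarith, hD.words, ?_, by omega, by omega,
      fun g g1 g2 => ?_⟩
    · exact hD.ext
    · have hne : σ'.A .st g ≠ 1 := by
        intro h
        obtain ⟨i, a1, -⟩ := hD.act g g1 g2 h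
        omega
      have hle := hD.st_le g g1 g2
      by_cases h : σ'.A .st g = 0
      · refine .inr ⟨fun hre => ?_, h⟩
        have : (Γ.lo ≤ g ∧ g < Γ.hi) ∧ σ'.A .st g = 2 := by
          clear h hle hne g1 g2
          induction hre with
          | refl => exact ⟨⟨h1, h2⟩, hroot⟩
          | tail _ hab ih =>
            obtain ⟨j, hj, rfl⟩ := hab
            exact ⟨hΓ.kid_mem _ ih.1.1 ih.1.2 j hj, (hD.fin _ ih.1.1 ih.1.2 ih.2).2 j hj⟩
        omega
      · have h2 : σ'.A .st g = 2 := by omega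
        exact .inl ⟨hD.reach g g1 g2 h, h2, (hD.fin g g1 g2 h2).1⟩

end Submatch

namespace Submatch

/-! ### Preorder words of terms and contexts -/

variable {F : Sig}

/-- The preorder word of a term: its function symbols from left to right. -/
def pre : Term F → List ℕ
  | .app f args => f.val :: seg (fun j => if h : j < F.arity f then pre (args ⟨j, h⟩) else []) 0 (F.arity f)

/-- The preorder word of the arguments of `f` beside the argument `i`. -/
def side {f : Fin F.card} {i : Fin (F.arity f)} (args : {j // j ≠ i} → Term F) (j : ℕ) : List ℕ :=
  if h : ∃ h : j < F.arity f, (⟨j, h⟩ : Fin _) ≠ i then pre (args ⟨⟨j, h.1⟩, h.2⟩) else []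

/-- The preorder word of the part of a context before the hole. -/
def cl : Ctx F → List ℕ
  | .hole => []
  | .app f i args c => f.val :: (seg (side args) 0 i ++ cl c)

/-- The preorder word of the part of a context behind the hole. -/
def cr : Ctx F → List ℕ
  | .hole => []
  | .app f i args c => cr c ++ seg (side args) (i + 1) (F.arity f - (i + 1))

/-- The number of function symbols of a context. -/
def csize (c : Ctx F) : ℕ := (cl c).length + (cr c).length

theorem seg_congr {f g : ℕ → List ℕ} {a n : ℕ} (h : ∀ j, a ≤ j → j < a + n → f j = g j) :
    seg f a n = seg g a n := by
  induction n with
  | zero => rfl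
  | succ n ih => rw [seg, seg, ih fun j h1 h2 => h j h1 (by omega), h _ (by omega) (by omega)]

theorem seg_add (f : ℕ → List ℕ) (a m n : ℕ) : seg f a (m + n) = seg f a m ++ seg f (a + m) n := by
  induction n with
  | zero => simp [seg]
  | succ n ih => rw [← Nat.add_assoc, seg, ih, seg, List.append_assoc, Nat.add_assoc]

theorem seg_shift {f g : ℕ → List ℕ} {a b n : ℕ} (h : ∀ j < n, f (a + j) = g (b + j)) :
    seg f a n = seg g b n := by
  induction n with
  | zero => rfl
  | succ n ih => rw [seg, seg, ih fun j h1 => h j (by omega), h _ (by omega)]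

theorem pre_ne_nil (t : Term F) : pre t ≠ [] := by cases t; simp [pre]

theorem seg_split (f : ℕ → List ℕ) {i n : ℕ} (h : i < n) :
    seg f 0 n = seg f 0 i ++ (f i ++ seg f (i + 1) (n - (i + 1))) := by
  obtain ⟨m, rfl⟩ := Nat.exists_eq_add_of_lt h
  rw [show i + m + 1 = i + (m + 1) by omega, seg_add, seg_succ', Nat.zero_add,
    show i + (m + 1) - (i + 1) = m by omega]

theorem pre_fill (c : Ctx F) (t : Term F) : pre (c.fill t) = cl c ++ pre t ++ cr c := by
  induction c with
  | hole => simp [Ctx.fill, cl, cr]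
  | app f i args c ih =>
    simp only [Ctx.fill, pre, cl, cr]
    rw [seg_split _ i.2, dif_pos i.2, dif_pos rfl, ih]
    have key : ∀ j, j ≠ i.val → (if h : j < F.arity f then
        pre (if h' : (⟨j, h⟩ : Fin (F.arity f)) = i then c.fill t else args ⟨⟨j, h⟩, h'⟩) else []) =
        side args j := by
      intro j hj
      by_cases h : j < F.arity f
      · have h' : (⟨j, h⟩ : Fin (F.arity f)) ≠ i := fun h' => hj (by rw [← h'])
        rw [dif_pos h, dif_neg h', side, dif_pos ⟨h, h'⟩]
      · rw [dif_neg h, side, dif_neg fun h' => h h'.1]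
    rw [seg_congr (g := side args) fun j h1 h2 => key j (by omega),
      seg_congr (g := side args) (a := i.val + 1) fun j h1 h2 => key j (by omega)]
    simp

theorem cl_comp (c d : Ctx F) : cl (c.comp d) = cl c ++ cl d := by
  induction c with
  | hole => rfl
  | app f i args c ih => simp [Ctx.comp, cl, ih]

theorem cr_comp (c d : Ctx F) : cr (c.comp d) = cr d ++ cr c := by
  induction c with
  | hole => simp [Ctx.comp, cr]
  | app f i args c ih => simp [Ctx.comp, cr, ih]

theorem csize_comp (c d : Ctx F) : csize (c.comp d) = csize c + csize d := by
  simp [csize, cl_comp, cr_comp]; omega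

theorem holePos_comp (c d : Ctx F) : (c.comp d).holePos = c.holePos ++ d.holePos := by
  induction c with
  | hole => rfl
  | app f i args c ih => simp [Ctx.comp, Ctx.holePos, ih]

theorem comp_fill (c d : Ctx F) (t : Term F) : (c.comp d).fill t = c.fill (d.fill t) := by
  induction c with
  | hole => rfl
  | app f i args c ih => simp [Ctx.comp, Ctx.fill, ih]

theorem comp_assoc (c d e : Ctx F) : (c.comp d).comp e = c.comp (d.comp e) := by
  induction c with
  | hole => rfl
  | app f i args c ih => simp [Ctx.comp, ih]

theorem comp_hole (c : Ctx F) : c.comp .hole = c := by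
  induction c with
  | hole => rfl
  | app f i args c ih => simp [Ctx.comp, ih]

theorem csize_eq_zero {c : Ctx F} : csize c = 0 ↔ c = .hole := by
  cases c <;> simp [csize, cl, cr]

theorem length_pre_fill (c : Ctx F) (t : Term F) :
    (pre (c.fill t)).length = csize c + (pre t).length := by
  simp [pre_fill, csize]; omega

/-- Two decompositions of a context at positions of the path to the hole are comparable. -/
theorem comp_eq_comp {a b c d : Ctx F} (h : a.comp b = c.comp d) :
    (∃ x, a = c.comp x ∧ d = x.comp b) ∨ ∃ x, c = a.comp x ∧ b = x.comp d := by
  induction a generalizing c with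
  | hole => exact .inr ⟨c, rfl, h⟩
  | app f i args a ih =>
    cases c with
    | hole => exact .inl ⟨_, rfl, h.symm⟩
    | app f' i' args' c =>
      simp only [Ctx.comp, Ctx.app.injEq] at h
      obtain ⟨rfl, h2, h3, h4⟩ := h
      obtain rfl := eq_of_heq h2
      obtain rfl := eq_of_heq h3
      rcases ih h4 with ⟨x, rfl, hx⟩ | ⟨x, rfl, hx⟩
      · exact .inl ⟨x, rfl, hx⟩
      · exact .inr ⟨x, rfl, hx⟩

/-- A suffix context is determined by its size. -/
theorem comp_inj_of_csize {a b c d : Ctx F} (h : a.comp b = c.comp d) (hs : csize b = csize d) :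
    a = c ∧ b = d := by
  rcases comp_eq_comp h with ⟨x, rfl, rfl⟩ | ⟨x, rfl, rfl⟩ <;>
  · rw [csize_comp] at hs
    obtain rfl := csize_eq_zero.1 (show csize x = 0 by omega)
    exact ⟨by rw [comp_hole], rfl⟩

/-- No suffix context has a size between those of two consecutive ones. -/
theorem not_csize_between {a b c z : Ctx F} {f : Fin F.card} {i : Fin (F.arity f)}
    {args : {j // j ≠ i} → Term F} (h : a.comp b = c.comp ((Ctx.app f i args .hole).comp z)) :
    ¬ (csize z < csize b ∧ csize b < csize ((Ctx.app f i args .hole).comp z)) := by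
  rintro ⟨h1, h2⟩
  rcases comp_eq_comp h with ⟨x, rfl, hx⟩ | ⟨x, rfl, rfl⟩
  · cases x with
    | hole => rw [hx] at h2; exact absurd h2 (lt_irrefl _)
    | app f' i' args' x =>
      simp only [Ctx.comp, Ctx.app.injEq] at hx
      obtain ⟨rfl, -, -, rfl⟩ := hx
      rw [csize_comp] at h1
      omega
  · rw [csize_comp] at h2
    omega

/-- No preorder word is a proper prefix of another one. -/
theorem pre_append_inj {s t : Term F} {x y : List ℕ} (h : pre s ++ x = pre t ++ y) :
    s = t ∧ x = y := by
  induction s generalizing t x y with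
  | app f args ih =>
    obtain ⟨g, args'⟩ := t
    simp only [pre, List.cons_append, List.cons.injEq] at h
    obtain ⟨h1, h⟩ := h
    obtain rfl := Fin.ext h1
    have key : ∀ n (a : ℕ), a + n = F.arity f →
        seg (fun j => if h : j < F.arity f then pre (args ⟨j, h⟩) else []) a n ++ x =
          seg (fun j => if h : j < F.arity f then pre (args' ⟨j, h⟩) else []) a n ++ y →
        (∀ j : Fin (F.arity f), a ≤ j.val → args j = args' j) ∧ x = y := by
      intro n
      induction n with
      | zero => intro a ha h; exact ⟨fun j hj => absurd j.2 (by omega), by simpa [seg] using h⟩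
      | succ n ihn =>
        intro a ha h
        rw [seg_succ', seg_succ', dif_pos (by omega), dif_pos (by omega), List.append_assoc,
          List.append_assoc] at h
        obtain ⟨h1, h2⟩ := ih _ h
        obtain ⟨h3, h4⟩ := ihn (a + 1) (by omega) h2
        refine ⟨fun j hj => ?_, h4⟩
        by_cases hja : j.val = a
        · grind
        · exact h3 j (by omega)
    obtain ⟨h2, h3⟩ := key _ 0 (by omega) h
    exact ⟨by congr 1; funext j; exact h2 j (by omega), h3⟩

theorem pre_inj {s t : Term F} (h : pre s = pre t) : s = t :=
  (pre_append_inj (x := []) (y := []) (by rw [h])).1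

/-! ### Positions -/

theorem subtermAt_append (t : Term F) (p q : List ℕ) :
    t.subtermAt (p ++ q) = (t.subtermAt p).bind fun u => u.subtermAt q := by
  induction p generalizing t with
  | nil => simp [Term.subtermAt]
  | cons i p ih =>
    cases t
    simp only [List.cons_append, Term.subtermAt]
    split_ifs <;> simp [ih]

theorem subtermAt_nil (t : Term F) : t.subtermAt [] = some t := by simp [Term.subtermAt]

theorem subtermAt_fill (c : Ctx F) (t : Term F) : (c.fill t).subtermAt c.holePos = some t := by
  induction c with
  | hole => exact subtermAt_nil t
  | app f i args c ih => simp [Ctx.fill, Ctx.holePos, Term.subtermAt, ih]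

theorem subtermAt_app {f : Fin F.card} {args : Fin (F.arity f) → Term F} {i : ℕ} {p : List ℕ}
    {s : Term F} (h : (Term.app f args).subtermAt (i :: p) = some s) :
    ∃ j : Fin (F.arity f), i = j.val + 1 ∧ (args j).subtermAt p = some s := by
  simp only [Term.subtermAt] at h
  grind

/-- A position on the path to the hole splits the context. -/
theorem exists_comp {c : Ctx F} {p : List ℕ} (h : p <+: c.holePos) :
    ∃ c1 c2 : Ctx F, c = c1.comp c2 ∧ c1.holePos = p := by
  induction c generalizing p with
  | hole => exact ⟨.hole, .hole, rfl, (List.prefix_nil.1 h).symm⟩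
  | app f i args c ih =>
    cases p with
    | nil => exact ⟨.hole, _, rfl, rfl⟩
    | cons j p =>
      rw [Ctx.holePos, List.cons_prefix_cons] at h
      obtain ⟨rfl, h⟩ := h
      obtain ⟨c1, c2, rfl, rfl⟩ := ih h
      exact ⟨.app f i args c1, c2, rfl, rfl⟩

section STG
variable {G : STG F}

theorem valT_app {A : Fin G.nT} {f : Fin F.card} {args : Fin (F.arity f) → Fin G.nT}
    (h : G.termProd A = .app f args) : G.valT A = .app f fun j => G.valT (args j) := by
  rw [STG.valT]; split <;> simp_all
  obtain ⟨rfl, h⟩ := ‹_ ∧ _›; obtain rfl := eq_of_heq h; simp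

theorem valT_comp {A B : Fin G.nT} {C : Fin G.nC} (h : G.termProd A = .comp C B) :
    G.valT A = (G.valC C).fill (G.valT B) := by
  rw [STG.valT]; split <;> simp_all

theorem valT_lam {A B : Fin G.nT} (h : G.termProd A = .lam B) : G.valT A = G.valT B := by
  rw [STG.valT]; split <;> simp_all

theorem valC_hole {C : Fin G.nC} (h : G.ctxProd C = .hole) : G.valC C = .hole := by
  rw [STG.valC]; split <;> simp_all

theorem valC_comp {C C1 C2 : Fin G.nC} (h : G.ctxProd C = .comp C1 C2) :
    G.valC C = (G.valC C1).comp (G.valC C2) := by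
  rw [STG.valC]; split <;> simp_all

theorem valC_app {C : Fin G.nC} {f : Fin F.card} {i : Fin (F.arity f)}
    {args : {j // j ≠ i} → Fin G.nT} (h : G.ctxProd C = .app f i args) :
    G.valC C = .app f i (fun j => G.valT (args j)) .hole := by
  rw [STG.valC]; split <;> simp_all
  obtain ⟨rfl, h1, h⟩ := ‹_ ∧ _›; obtain rfl := eq_of_heq h1; obtain rfl := eq_of_heq h; simp

theorem reach_of_occursAt {X : G.NT} {q : List ℕ} {N : Fin G.nT} (h : G.OccursAt X q N) :
    Relation.ReflTransGen G.Uses X (.inl N) := by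
  induction h with
  | refl A => exact .refl
  | app j h _ ih => exact .head (show (G.termProd _).Uses _ by rw [h]; constructor) ih
  | compCtx h _ ih => exact .head (show (G.termProd _).Uses _ by rw [h]; constructor) ih
  | compTerm h _ ih => exact .head (show (G.termProd _).Uses _ by rw [h]; constructor) ih
  | lam h _ ih => exact .head (show (G.termProd _).Uses _ by rw [h]; constructor) ih
  | ctxFst h _ ih => exact .head (show (G.ctxProd _).Uses _ by rw [h]; constructor) ih
  | ctxSnd h _ ih => exact .head (show (G.ctxProd _).Uses _ by rw [h]; constructor) ih
  | ctxApp j h _ ih => exact .head (show (G.ctxProd _).Uses _ by rw [h]; constructor) ih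

/-- The terms that the nonterminal `X` stands for: its value, with any term in the hole. -/
def Vals (G : STG F) (X : G.NT) : Set (Term F) :=
  match X with
  | .inl A => {G.valT A}
  | .inr C => Set.range (G.valC C).fill

/-- For a context nonterminal, the occurrences outside the hole do not depend on the term in the hole.
-/
theorem subtermAt_of_occursAt {X : G.NT} {q : List ℕ} {N : Fin G.nT} (h : G.OccursAt X q N) :
    ∀ t ∈ Vals G X, t.subtermAt q = some (G.valT N) := by
  induction h with
  | refl A => rintro t rfl; exact subtermAt_nil _
  | app j h _ ih => rintro t rfl; rw [valT_app h]; simpa [Term.subtermAt] using ih _ rfl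
  | compCtx h _ ih => rintro t rfl; rw [valT_comp h]; exact ih _ ⟨_, rfl⟩
  | compTerm h _ ih =>
    rintro t rfl; rw [valT_comp h, subtermAt_append, subtermAt_fill]; exact ih _ rfl
  | lam h _ ih => rintro t rfl; rw [valT_lam h]; exact ih _ rfl
  | ctxFst h _ ih => rintro _ ⟨t, rfl⟩; rw [valC_comp h, comp_fill]; exact ih _ ⟨_, rfl⟩
  | ctxSnd h _ ih =>
    rintro _ ⟨t, rfl⟩
    rw [valC_comp h, comp_fill, subtermAt_append, subtermAt_fill]; exact ih _ ⟨_, rfl⟩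
  | ctxApp j h _ ih =>
    rintro _ ⟨t, rfl⟩
    rw [valC_app h]
    simpa [Term.subtermAt, Ctx.fill, j.2] using ih _ rfl

/-- The position `p` in the context of the production of `N` splits off the term `s`. -/
def SplitAt (G : STG F) (s : Term F) (N : Fin G.nT) (p : List ℕ) : Prop :=
  ∃ C N', G.termProd N = .comp C N' ∧ ∃ c1 c2 : Ctx F, G.valC C = c1.comp c2 ∧ c1 ≠ .hole ∧
    c2 ≠ .hole ∧ c1.holePos = p ∧ c2.fill (G.valT N') = s

/-- The nonterminal `N` represents occurrences of `s`, by its value or by splitting the context of its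
production; `q` is the position of `s` in its value. -/
def Represents (G : STG F) (s : Term F) (N : Fin G.nT) (q : List ℕ) : Prop :=
  (G.valT N = s ∧ q = []) ∨ SplitAt G s N q

theorem SplitAt.subtermAt {s : Term F} {N : Fin G.nT} {p : List ℕ} (h : SplitAt G s N p) :
    (G.valT N).subtermAt p = some s := by
  obtain ⟨C, N', h, c1, c2, hC, -, -, rfl, rfl⟩ := h
  rw [valT_comp h, hC, comp_fill, subtermAt_fill]

theorem SplitAt.length_lt {s : Term F} {N : Fin G.nT} {p : List ℕ} (h : SplitAt G s N p) :
    (pre s).length < (pre (G.valT N)).length := by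
  obtain ⟨C, N', h, c1, c2, hC, h1, -, -, rfl⟩ := h
  rw [valT_comp h, hC, comp_fill, length_pre_fill c1]
  have := mt csize_eq_zero.1 h1
  omega

/-- Every occurrence of `s` in the value of a nonterminal is represented, except those on the path to
the hole or in the hole. -/
theorem exists_represents (s : Term F) (X : G.NT) : match X with
    | .inl A => ∀ q, (G.valT A).subtermAt q = some s →
      ∃ N q' p, G.OccursAt X q' N ∧ Represents G s N p ∧ q = q' ++ p
    | .inr C => ∀ q t, ((G.valC C).fill t).subtermAt q = some s → ¬ q <+: (G.valC C).holePos →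
      ¬ (G.valC C).holePos <+: q →
      ∃ N q' p, G.OccursAt X q' N ∧ Represents G s N p ∧ q = q' ++ p := by
  induction X using G.wf.induction with
  | _ X ih =>
  match X, ih with
  | .inl A, ih =>
    intro q hq
    by_cases hq0 : q = []
    · subst hq0
      rw [subtermAt_nil] at hq
      exact ⟨A, [], [], .refl A, .inl ⟨Option.some.inj hq, rfl⟩, rfl⟩
    cases h : G.termProd A with
    | app f args =>
      rw [valT_app h] at hq
      obtain ⟨i, q, rfl⟩ := List.exists_cons_of_ne_nil hq0
      obtain ⟨j, rfl, hj⟩ := subtermAt_app hq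
      obtain ⟨N, q', p, h1, h2, rfl⟩ := ih (.inl (args j))
        (show (G.termProd A).Uses _ by rw [h]; constructor) q hj
      exact ⟨N, _, p, .app j h h1, h2, rfl⟩
    | lam B =>
      rw [valT_lam h] at hq
      obtain ⟨N, q', p, h1, h2, rfl⟩ := ih (.inl B)
        (show (G.termProd A).Uses _ by rw [h]; constructor) q hq
      exact ⟨N, _, p, .lam h h1, h2, rfl⟩
    | comp C B =>
      rw [valT_comp h] at hq
      by_cases hp2 : (G.valC C).holePos <+: q
      · obtain ⟨q, rfl⟩ := hp2
        rw [subtermAt_append, subtermAt_fill] at hq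
        obtain ⟨N, q', p, h1, h2, rfl⟩ := ih (.inl B)
          (show (G.termProd A).Uses _ by rw [h]; constructor) q hq
        exact ⟨N, _, p, .compTerm h h1, h2, by simp⟩
      by_cases hp1 : q <+: (G.valC C).holePos
      · obtain ⟨c1, c2, hc, rfl⟩ := exists_comp hp1
        rw [hc, comp_fill, subtermAt_fill] at hq
        refine ⟨A, [], _, .refl A, .inr ⟨C, B, h, c1, c2, hc, ?_, ?_, rfl, Option.some.inj hq⟩, rfl⟩
        · rintro rfl; exact hq0 rfl
        · rintro rfl; rw [hc, comp_hole] at hp2; exact hp2 (List.prefix_refl _)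
      · obtain ⟨N, q', p, h1, h2, rfl⟩ := ih (.inr C)
          (show (G.termProd A).Uses _ by rw [h]; constructor) q _ hq hp1 hp2
        exact ⟨N, _, p, .compCtx h h1, h2, rfl⟩
  | .inr C, ih =>
    intro q t hq hp1 hp2
    cases h : G.ctxProd C with
    | hole => rw [valC_hole h] at hp2; exact absurd (List.nil_prefix) hp2
    | comp C1 C2 =>
      rw [valC_comp h, comp_fill] at hq
      rw [valC_comp h, holePos_comp] at hp1 hp2
      by_cases hq2 : (G.valC C1).holePos <+: q
      · obtain ⟨q, rfl⟩ := hq2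
        rw [subtermAt_append, subtermAt_fill] at hq
        rw [List.prefix_append_right_inj] at hp1 hp2
        obtain ⟨N, q', p, h1, h2, rfl⟩ := ih (.inr C2)
          (show (G.ctxProd C).Uses _ by rw [h]; constructor) q t hq hp1 hp2
        exact ⟨N, _, p, .ctxSnd h h1, h2, by simp⟩
      · obtain ⟨N, q', p, h1, h2, rfl⟩ := ih (.inr C1)
          (show (G.ctxProd C).Uses _ by rw [h]; constructor) q _ hq
          (fun h => hp1 (h.trans (List.prefix_append _ _))) hq2
        exact ⟨N, _, p, .ctxFst h h1, h2, rfl⟩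
    | app f i args =>
      rw [valC_app h] at hq hp1 hp2
      cases q with
      | nil => exact absurd List.nil_prefix hp1
      | cons k q =>
        obtain ⟨j, rfl, hj⟩ := subtermAt_app hq
        have hji : j ≠ i := by
          rintro rfl
          exact hp2 (by simp [Ctx.holePos])
        rw [dif_neg hji] at hj
        obtain ⟨N, q', p, h1, h2, rfl⟩ := ih (.inl (args ⟨j, hji⟩))
          (show (G.ctxProd C).Uses _ by rw [h]; exact .app f i args ⟨j, hji⟩) q hj
        exact ⟨N, _, p, .ctxApp ⟨j, hji⟩ h h1, h2, rfl⟩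

/-- Lists of the nonterminals that represent occurrences of `s` form a correct output. -/
theorem correct_of_lists {O : SubmatchOutput G} {s : Term F} {T : Fin G.nT} (h1 : O.full.Nodup)
    (h2 : (O.split.map Prod.fst).Nodup)
    (h3 : ∀ N, N ∈ O.full ↔ G.Contributes T N ∧ G.valT N = s)
    (h4 : ∀ N p, (∃ P, (N, P) ∈ O.split ∧ O.pos.val P = p) ↔ G.Contributes T N ∧ SplitAt G s N p) :
    O.Correct s T := by
  refine ⟨List.nodup_append'.2 ⟨h1, h2, fun N hN hN' => ?_⟩, h3, h4, fun q => ⟨fun h => ?_, ?_⟩⟩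
  · obtain ⟨⟨N', P⟩, hP, rfl⟩ := List.mem_map.1 hN'
    have ha := ((h3 _).1 hN).2
    have hb := ((h4 N' _).1 ⟨P, hP, rfl⟩).2.length_lt
    rw [← ha] at hb
    exact absurd hb (lt_irrefl _)
  · obtain ⟨N, q', p, a1, a2, rfl⟩ := exists_represents s (.inl T) q h
    have hc : G.Contributes T N := reach_of_occursAt a1
    rcases a2 with ⟨a2, rfl⟩ | a2
    · exact .inl ⟨N, (h3 N).2 ⟨hc, a2⟩, by simpa using a1⟩
    · obtain ⟨P, hP, rfl⟩ := (h4 N p).2 ⟨hc, a2⟩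
      exact .inr ⟨(N, P), hP, q', a1, rfl⟩
  · rintro (⟨N, hN, ha⟩ | ⟨⟨N, P⟩, hP, q', ha, rfl⟩)
    · rw [← ((h3 N).1 hN).2]; exact subtermAt_of_occursAt ha _ rfl
    · rw [subtermAt_append, subtermAt_of_occursAt ha _ rfl]
      exact ((h4 N _).1 ⟨P, hP, rfl⟩).2.subtermAt

end STG

end Submatch

namespace Submatch

/-! ### Singleton tree grammars in uniform format -/

variable {F : Sig} {G : STG F}

/-- The number of a nonterminal; term nonterminals come first. -/
def idx (N : G.NT) : ℕ := (finSumFinEquiv N).val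

theorem idx_inl (A : Fin G.nT) : idx (.inl A : G.NT) = A.val := by simp [idx]

theorem idx_inr (C : Fin G.nC) : idx (.inr C : G.NT) = G.nT + C.val := by simp [idx]

theorem idx_lt (N : G.NT) : idx N < G.size := (finSumFinEquiv N).2

theorem idx_inj {N M : G.NT} (h : idx N = idx M) : N = M := finSumFinEquiv.injective (Fin.ext h)

theorem exists_idx {k : ℕ} (h : k < G.size) : ∃ N : G.NT, idx N = k :=
  ⟨finSumFinEquiv.symm ⟨k, h⟩, by simp [idx]⟩

/-- The nonterminals in the production of `N`, with repetitions, in the order of their occurrence. -/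
def kids (N : G.NT) : List G.NT :=
  match N with
  | .inl A => match G.termProd A with
    | .app _ args => List.ofFn fun j => .inl (args j)
    | .comp C B => [.inr C, .inl B]
    | .lam B => [.inl B]
  | .inr C => match G.ctxProd C with
    | .hole => []
    | .comp C1 C2 => [.inr C1, .inr C2]
    | .app f i args => List.ofFn (n := F.arity f - 1) fun j =>
        .inl (args ⟨⟨if j.val < i.val then j.val else j.val + 1, by split_ifs <;> omega⟩,
          fun h => by have := congr_arg Fin.val h; dsimp only at this; split_ifs at this <;> omega⟩)

/-- The kind of the production of `N`. -/
def kindOf (N : G.NT) : ℕ :=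
  match N with
  | .inl A => match G.termProd A with
    | .app _ _ => 1
    | .comp _ _ => 2
    | .lam _ => 0
  | .inr C => match G.ctxProd C with
    | .hole => 0
    | .comp _ _ => 3
    | .app _ _ _ => 1

/-- The function symbol in the production of `N`, if there is one. -/
def symOf (N : G.NT) : ℕ :=
  match N with
  | .inl A => match G.termProd A with
    | .app f _ => f.val
    | _ => 0
  | .inr C => match G.ctxProd C with
    | .app f _ _ => f.val
    | _ => 0

/-- The number of children in the production of `N` to the left of the hole. -/
def nlOf (N : G.NT) : ℕ :=
  match N with
  | .inl _ => (kids N).length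
  | .inr C => match G.ctxProd C with
    | .hole => 0
    | .comp _ _ => 2
    | .app _ i _ => i.val

/-- The part of the preorder word of the value of `N` before the hole. -/
def lwOf (N : G.NT) : List ℕ :=
  match N with
  | .inl A => pre (G.valT A)
  | .inr C => cl (G.valC C)

/-- The part of the preorder word of the value of `N` behind the hole. -/
def rwOf (N : G.NT) : List ℕ :=
  match N with
  | .inl _ => []
  | .inr C => cr (G.valC C)

/-- The position of the hole in the value of `N`. -/
def hwOf (N : G.NT) : List ℕ :=
  match N with
  | .inl A => match G.termProd A with
    | .app f _ => [F.arity f + 1]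
    | _ => []
  | .inr C => (G.valC C).holePos

theorem mem_kids {N M : G.NT} : M ∈ kids N ↔ G.Uses N M := by
  match N with
  | .inl A =>
    change _ ↔ (G.termProd A).Uses M
    cases h : G.termProd A with
    | app f args =>
      simp only [kids, h, List.mem_ofFn]
      exact ⟨fun ⟨j, hj⟩ => hj ▸ .app f args j, fun h => by cases h; exact ⟨_, rfl⟩⟩
    | comp C B =>
      simp only [kids, h, List.mem_cons, List.not_mem_nil, or_false]
      exact ⟨by rintro (rfl | rfl) <;> constructor, fun h => by cases h <;> simp⟩
    | lam B =>
      simp only [kids, h, List.mem_cons, List.not_mem_nil, or_false]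
      exact ⟨by rintro rfl; constructor, fun h => by cases h; rfl⟩
  | .inr C =>
    change _ ↔ (G.ctxProd C).Uses M
    cases h : G.ctxProd C with
    | hole =>
      simp only [kids, h, List.not_mem_nil, false_iff]
      intro h; cases h
    | comp C B =>
      simp only [kids, h, List.mem_cons, List.not_mem_nil, or_false]
      exact ⟨by rintro (rfl | rfl) <;> constructor, fun h => by cases h <;> simp⟩
    | app f i args =>
      simp only [kids, h, List.mem_ofFn]
      constructor
      · rintro ⟨j, rfl⟩
        constructor
      · intro h
        cases h with
        | app _ _ _ j =>
          obtain ⟨j, hj⟩ := j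
          have hi := i.2
          have hj' := j.2
          have hne : j.val ≠ i.val := fun h => hj (Fin.ext h)
          refine ⟨⟨if j.val < i.val then j.val else j.val - 1, by split_ifs <;> omega⟩, ?_⟩
          congr 3
          apply Fin.ext
          dsimp only
          split_ifs <;> omega

/-- The number of nonterminals below `N`. -/
noncomputable def rank (N : G.NT) : ℕ := {M | Relation.TransGen G.Uses N M}.ncard

theorem rank_lt {N M : G.NT} (h : G.Uses N M) : rank M < rank N :=
  Set.ncard_lt_ncard ⟨fun _ hK => .head h hK, fun hK => G.acyclic M (hK (.single h))⟩ (Set.toFinite _)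

theorem rank_le (N : G.NT) : rank N ≤ G.size := by
  refine (Set.ncard_le_card _).trans ?_
  simp [STG.size]

/-- The function on numbers that corresponds to `φ`, for nonterminals numbered from `go` on. -/
noncomputable def lift {α : Type} (d : α) (go : ℕ) (φ : G.NT → α) (g : ℕ) : α :=
  if h : g - go < G.size then φ (finSumFinEquiv.symm ⟨g - go, h⟩) else d

theorem lift_idx {α : Type} (d : α) (go : ℕ) (φ : G.NT → α) (N : G.NT) :
    lift d go φ (go + idx N) = φ N := by
  have h : go + idx N - go < G.size := by have := idx_lt N; omega
  rw [lift, dif_pos h]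
  congr 1
  rw [Equiv.symm_apply_eq]
  apply Fin.ext
  simp [idx]

/-- The number of the child number `j` of `N`. -/
def kidOf (go : ℕ) (N : G.NT) (j : ℕ) : ℕ :=
  if h : j < (kids N).length then go + idx (kids N)[j] else 0

/-- The grammar `G` in uniform format, with its nonterminals numbered from `go` on. -/
noncomputable def gr (G : STG F) (go : ℕ) : Gr where
  lo := go
  hi := go + G.size
  kind := lift (G := G) 0 go kindOf
  sym := lift (G := G) 0 go symOf
  nl := lift (G := G) 0 go nlOf
  nch := lift (G := G) 0 go fun N => (kids N).length
  kid := lift (G := G) (fun _ => 0) go (kidOf go)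
  rk := lift (G := G) 0 go rank
  lw := lift (G := G) [] go lwOf
  rw := lift (G := G) [] go rwOf
  hw := lift (G := G) [] go hwOf

section
variable {go : ℕ} (N : G.NT)
theorem gr_kind : (gr G go).kind (go + idx N) = kindOf N := lift_idx ..
theorem gr_sym : (gr G go).sym (go + idx N) = symOf N := lift_idx ..
theorem gr_nl : (gr G go).nl (go + idx N) = nlOf N := lift_idx ..
theorem gr_nch : (gr G go).nch (go + idx N) = (kids N).length :=
  lift_idx (G := G) 0 go (fun N => (kids N).length) N
theorem gr_kid : (gr G go).kid (go + idx N) = kidOf go N := lift_idx ..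
theorem gr_rk : (gr G go).rk (go + idx N) = rank N := lift_idx ..
theorem gr_lw : (gr G go).lw (go + idx N) = lwOf N := lift_idx ..
theorem gr_rw : (gr G go).rw (go + idx N) = rwOf N := lift_idx ..
theorem gr_hw : (gr G go).hw (go + idx N) = hwOf N := lift_idx ..
end

theorem gr_forall {go : ℕ} {P : ℕ → Prop} (h : ∀ N : G.NT, P (go + idx N)) :
    ∀ g, (gr G go).lo ≤ g → g < (gr G go).hi → P g := by
  intro g h1 h2
  obtain ⟨N, hN⟩ := exists_idx (G := G) (k := g - go) (by simp [gr] at h1 h2; omega)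
  have := h N
  rwa [hN, Nat.add_sub_cancel' (show go ≤ g from h1)] at this

theorem kidOf_eq {go j : ℕ} {N : G.NT} (h : j < (kids N).length) : kidOf go N j = go + idx (kids N)[j] :=
  dif_pos h

theorem kidOf_mem {go j : ℕ} {N : G.NT} (h : j < (kids N).length) :
    ∃ M, G.Uses N M ∧ kidOf go N j = go + idx M :=
  ⟨_, mem_kids.1 (List.getElem_mem h), kidOf_eq h⟩

theorem kids_ctx {C : Fin G.nC} {f : Fin F.card} {i : Fin (F.arity f)}
    {args : {j // j ≠ i} → Fin G.nT} (h : G.ctxProd C = .app f i args) :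
    (kids (.inr C : G.NT)).length = F.arity f - 1 ∧ ∀ j (hj : j < (kids (.inr C : G.NT)).length),
      ∃ k : {j // j ≠ i}, k.val.val = (if j < i.val then j else j + 1) ∧
        (kids (.inr C : G.NT))[j] = .inl (args k) := by
  constructor
  · simp [kids, h]
  · intro j hj
    simp only [kids, h] at hj ⊢
    rw [List.getElem_ofFn]
    exact ⟨_, rfl, rfl⟩

theorem lw_kid {go j : ℕ} {N : G.NT} (h : j < (kids N).length) :
    (gr G go).lw ((gr G go).kid (go + idx N) j) = lwOf (kids N)[j] := by
  rw [gr_kid, kidOf_eq h, gr_lw]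

theorem seg_side {go : ℕ} {C : Fin G.nC} {f : Fin F.card} {i : Fin (F.arity f)}
    {args : {j // j ≠ i} → Fin G.nT} (h : G.ctxProd C = .app f i args) {j k : ℕ}
    (hj : j < F.arity f - 1) (hk : k = if j < i.val then j else j + 1) :
    side (fun j => G.valT (args j)) k =
      (gr G go).lw ((gr G go).kid (go + idx (.inr C : G.NT)) j) := by
  obtain ⟨h1, h2⟩ := kids_ctx h
  obtain ⟨m, hm1, hm2⟩ := h2 j (by omega)
  rw [lw_kid (by omega), hm2]
  have hmk : m.val.val = k := by rw [hm1, hk]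
  have hmk' : (⟨k, hmk ▸ m.val.2⟩ : Fin (F.arity f)) = m.val := Fin.ext hmk.symm
  rw [side, dif_pos ⟨hmk ▸ m.val.2, by rw [hmk']; exact m.2⟩]
  simp only [lwOf, hmk']

theorem gr_ok (G : STG F) (go : ℕ) : (gr G go).Ok where
  kid_mem := gr_forall fun N j hj => by
    rw [gr_nch] at hj
    obtain ⟨M, -, h⟩ := kidOf_mem (go := go) hj
    have := idx_lt M
    rw [gr_kid, h]
    simp only [gr]
    omega
  rk_lt := gr_forall fun N j hj => by
    rw [gr_nch] at hj
    obtain ⟨M, hM, h⟩ := kidOf_mem (go := go) hj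
    rw [gr_kid, h, gr_rk, gr_rk]
    exact rank_lt hM
  nl_le := gr_forall fun N => by
    rw [gr_nl, gr_nch]
    match N with
    | .inl A => exact le_rfl
    | .inr C =>
      cases h : G.ctxProd C with
      | app f i args =>
        have hi := i.2
        rw [(kids_ctx h).1]
        simp only [nlOf, h]
        omega
      | _ => simp [nlOf, kids, h]
  kind_le := gr_forall fun N => by
    rw [gr_kind]
    match N with
    | .inl A => cases h : G.termProd A <;> simp [kindOf, h]
    | .inr C => cases h : G.ctxProd C <;> simp [kindOf, h]
  two := gr_forall fun N => by
    rw [gr_kind, gr_nch]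
    match N with
    | .inl A => cases h : G.termProd A <;> simp [kindOf, kids, h]
    | .inr C => cases h : G.ctxProd C <;> simp [kindOf, kids, h]
  lw_app := gr_forall fun N => by
    rw [gr_kind, gr_nl, gr_lw, gr_sym]
    intro hk
    match N with
    | .inl A =>
      cases h : G.termProd A with
      | app f args =>
        have hl : (kids (.inl A : G.NT)).length = F.arity f := by simp [kids, h]
        simp only [kindOf, lwOf, symOf, nlOf, h, valT_app h, pre, hl, if_true]
        refine congr_arg (List.cons _) (seg_congr fun j h1 h2 => ?_)
        rw [dif_pos (by omega), lw_kid (by omega)]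
        simp [kids, h, lwOf]
      | comp C B => simp [kindOf, h] at hk
      | lam B =>
        have hl : (kids (.inl A : G.NT)).length = 1 := by simp [kids, h]
        simp only [kindOf, lwOf, nlOf, h, hl, valT_lam h, seg]
        rw [lw_kid (by omega)]
        simp [kids, h, lwOf]
    | .inr C =>
      cases h : G.ctxProd C with
      | hole => simp [kindOf, lwOf, nlOf, h, valC_hole h, cl, seg]
      | comp => simp [kindOf, h] at hk
      | app f i args =>
        have hi := i.2
        simp only [kindOf, lwOf, symOf, nlOf, h, valC_app h, cl, if_true, List.append_nil]
        refine congr_arg (List.cons _) (seg_congr fun j h1 h2 => ?_)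
        exact seg_side h (by omega) (by rw [if_pos (by omega)])
  rw_app := gr_forall fun N => by
    rw [gr_kind, gr_nl, gr_rw, gr_nch]
    intro hk
    match N with
    | .inl A => simp [rwOf, nlOf, seg]
    | .inr C =>
      cases h : G.ctxProd C with
      | hole => simp [rwOf, nlOf, h, valC_hole h, cr, seg, kids]
      | comp => simp [kindOf, h] at hk
      | app f i args =>
        have hi := i.2
        rw [(kids_ctx h).1]
        simp only [rwOf, nlOf, h, valC_app h, cr, List.nil_append]
        rw [show F.arity f - 1 - i.val = F.arity f - (i.val + 1) by omega]
        refine seg_shift fun j hj => ?_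
        exact seg_side h (by omega) (by rw [if_neg (by omega)]; omega)
  hw_app := gr_forall fun N => by
    rw [gr_kind, gr_nl, gr_hw]
    intro hk
    match N with
    | .inl A => cases h : G.termProd A <;> simp [kindOf, h, hwOf, nlOf, kids] at hk ⊢
    | .inr C =>
      cases h : G.ctxProd C with
      | hole => simp [kindOf, hwOf, h, valC_hole h, Ctx.holePos]
      | comp => simp [kindOf, h] at hk
      | app f i args => simp [kindOf, hwOf, nlOf, h, valC_app h, Ctx.holePos]
  lw_two := gr_forall fun N => by
    rw [gr_kind, gr_lw, gr_kid]
    match N with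
    | .inl A =>
      cases h : G.termProd A with
      | comp C B =>
        simp [kidOf, kids, h, gr_lw, gr_rw, lwOf, rwOf, valT_comp h, pre_fill]
      | _ => simp [kindOf, h]
    | .inr C => cases h : G.ctxProd C <;> simp [kindOf, h]
  rw_two := gr_forall fun N => by
    rw [gr_kind, gr_rw]
    match N with
    | .inl A => simp [rwOf]
    | .inr C => cases h : G.ctxProd C <;> simp [kindOf, h]
  hw_two := gr_forall fun N => by
    rw [gr_kind, gr_hw]
    match N with
    | .inl A => cases h : G.termProd A <;> simp [kindOf, hwOf, h]
    | .inr C => cases h : G.ctxProd C <;> simp [kindOf, h]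
  lw_three := gr_forall fun N => by
    rw [gr_kind, gr_lw, gr_kid]
    match N with
    | .inl A => cases h : G.termProd A <;> simp [kindOf, h]
    | .inr C =>
      cases h : G.ctxProd C with
      | comp C1 C2 => simp [kidOf, kids, h, gr_lw, lwOf, valC_comp h, cl_comp]
      | _ => simp [kindOf, h]
  rw_three := gr_forall fun N => by
    rw [gr_kind, gr_rw, gr_kid]
    match N with
    | .inl A => cases h : G.termProd A <;> simp [kindOf, h]
    | .inr C =>
      cases h : G.ctxProd C with
      | comp C1 C2 => simp [kidOf, kids, h, gr_rw, rwOf, valC_comp h, cr_comp]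
      | _ => simp [kindOf, h]
  hw_three := gr_forall fun N => by
    rw [gr_kind, gr_hw, gr_kid]
    match N with
    | .inl A => cases h : G.termProd A <;> simp [kindOf, h]
    | .inr C =>
      cases h : G.ctxProd C with
      | comp C1 C2 => simp [kidOf, kids, h, gr_hw, hwOf, valC_comp h, holePos_comp]
      | _ => simp [kindOf, h]

/-- Contributing to a nonterminal is reachability in the uniform format. -/
theorem gr_reach {go : ℕ} {N M : G.NT} :
    (gr G go).Reach (go + idx N) (go + idx M) ↔ Relation.ReflTransGen G.Uses N M := by
  constructor
  · intro h
    obtain ⟨M', hM', h⟩ : ∃ M', go + idx M = go + idx M' ∧ Relation.ReflTransGen G.Uses N M' := by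
      generalize go + idx M = m at h
      induction h with
      | refl => exact ⟨N, rfl, .refl⟩
      | tail _ hab ih =>
        obtain ⟨K, rfl, hK⟩ := ih
        obtain ⟨j, hj, rfl⟩ := hab
        rw [gr_nch] at hj
        obtain ⟨M', hM', he⟩ := kidOf_mem (go := go) hj
        exact ⟨M', by rw [gr_kid, he], hK.tail hM'⟩
    rwa [idx_inj (show idx M = idx M' by omega)]
  · intro h
    induction h with
    | refl => exact .refl
    | tail _ hab ih =>
      obtain ⟨j, hj, he⟩ := List.mem_iff_getElem.1 (mem_kids.2 hab)
      exact ih.tail ⟨j, by rwa [gr_nch], by rw [gr_kid, kidOf_eq hj, he]⟩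

end Submatch

namespace Submatch

/-! ### Reading the grammars -/

open Var Arr in
/-- The format of the production at the address `p`: the formats of term nonterminals are numbered from
0 on, those of context nonterminals from 3 on. -/
def readTag : Cmd := tag ≔ inp p ;; .ite (tEnd - g) .skip (tag ≔ tag + 3)

open Var Arr in
/-- Decodes the production at the address `p` of the nonterminal `g`: its kind, its function symbol, its
numbers of children before the hole and in all, and its length. The children are listed from the address
`b` on; the offset `o1` belongs to the first child and `o2` to the others. -/
def decode : Cmd :=
  kd ≔ 0 ;; sy ≔ 0 ;; nlv ≔ 0 ;; nc ≔ 0 ;; b ≔ p + 1 ;; o1 ≔ go ;; o2 ≔ go ;; ln ≔ 3 ;;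
  .ite tag (.ite (tag - 1) (.ite (tag - 2) (.ite (tag - 3) (.ite (tag - 4)
    (kd ≔ 1 ;; sy ≔ inp (p + 1) ;; nlv ≔ inp (p + 3) ;; nc ≔ inp (p + 2) - 1 ;; b ≔ p + 4 ;;
      ln ≔ inp (p + 2) + 4)
    (kd ≔ 3 ;; nlv ≔ 2 ;; nc ≔ 2 ;; o1 ≔ tEnd ;; o2 ≔ tEnd))
    (ln ≔ 1))
    (nlv ≔ 1 ;; nc ≔ 1 ;; ln ≔ 2))
    (kd ≔ 2 ;; nlv ≔ 2 ;; nc ≔ 2 ;; o1 ≔ tEnd))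
    (kd ≔ 1 ;; sy ≔ inp (p + 1) ;; nlv ≔ inp (p + 2) ;; nc ≔ nlv ;; b ≔ p + 3 ;; ln ≔ inp (p + 2) + 3)

open Var Arr in
/-- The address of the child number `j`; the entry for the hole is left out. -/
def kidAddr : Ex := b + j + (1 - (nlv - j))

open Var Arr in
/-- Stores the decoded production of `g`. -/
def storeProd : Cmd :=
  .store kind g kd ;; .store sym g sy ;; .store nl g nlv ;; .store nch g nc ;; .store chp g q ;;
  .store st g 0 ;; j ≔ 0 ;;
  .while (nc - j) (.ite j (.store ch q (inp kidAddr + o2)) (.store ch q (inp kidAddr + o1)) ;;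
    q ≔ q + 1 ;; j ≔ j + 1)

open Var Arr in
/-- Executes `body` for all productions of the grammar that is encoded from the address `p` on; its
nonterminals are numbered from `go` on. -/
def traverse (body : Cmd) : Cmd :=
  root ≔ inp p + go ;; tEnd ≔ inp (p + 1) + go ;; gEnd ≔ inp (p + 2) + tEnd ;; p ≔ p + 3 ;; g ≔ go ;;
  .while (gEnd - g) (readTag ;; decode ;; body ;; p ≔ p + ln ;; g ≔ g + 1)

/-- The list `l` is stored in the input from the address `k` on. -/
def Reads (σ : St) (k : ℕ) (l : List ℕ) : Prop := ∀ i v, l[i]? = some v → σ.A .inp (k + i) = v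

theorem reads_cons {σ : St} {k a : ℕ} {l : List ℕ} :
    Reads σ k (a :: l) ↔ σ.A .inp k = a ∧ Reads σ (k + 1) l := by
  constructor
  · intro h
    refine ⟨h 0 a rfl, fun i v hi => ?_⟩
    rw [← h (i + 1) v (by simpa using hi)]
    congr 1
    omega
  · rintro ⟨h1, h2⟩ i v hi
    cases i with
    | zero => simp at hi; simpa [hi] using h1
    | succ i => rw [← h2 i v (by simpa using hi)]; congr 1; omega

theorem reads_append {σ : St} {k : ℕ} {l l' : List ℕ} :
    Reads σ k (l ++ l') ↔ Reads σ k l ∧ Reads σ (k + l.length) l' := by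
  induction l generalizing k with
  | nil => simp [Reads]
  | cons a l ih =>
    rw [List.cons_append, reads_cons, reads_cons, ih, List.length_cons, and_assoc]
    rw [show k + 1 + l.length = k + (l.length + 1) by omega]

theorem Reads.ofFn {σ : St} {k n : ℕ} {φ : Fin n → ℕ} (h : Reads σ k (List.ofFn φ)) (j : Fin n) :
    σ.A .inp (k + j) = φ j := h j _ (by simp)

theorem Reads.congr {σ σ' : St} {k : ℕ} {l : List ℕ} (h : Reads σ k l) (hA : σ'.A .inp = σ.A .inp) :
    Reads σ' k l := fun i v hi => by rw [hA]; exact h i v hi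

variable {F : Sig} {G : STG F} {E : Env}

/-- The encoded production of a nonterminal. -/
def encOf (N : G.NT) : List ℕ :=
  match N with
  | .inl A => (G.termProd A).encode
  | .inr C => (G.ctxProd C).encode

/-- The encoded productions of a grammar. -/
def encs (G : STG F) : List (List ℕ) :=
  List.ofFn (n := G.nT + G.nC) fun k => encOf (finSumFinEquiv.symm k)

theorem encode_eq (A : Fin G.nT) : G.encode A = A.val :: G.nT :: G.nC :: (encs G).flatten := by
  have h1 : ∀ B : Fin G.nT, finSumFinEquiv.symm (Fin.castAdd G.nC B) = Sum.inl B := fun B => by simp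
  have h2 : ∀ C : Fin G.nC, finSumFinEquiv.symm (Fin.natAdd G.nT C) = Sum.inr C := fun C => by simp
  rw [STG.encode, encs, List.ofFn_add, List.flatten_append]
  have h3 : (fun i : Fin G.nT => encOf (finSumFinEquiv.symm (Fin.castAdd G.nC i) : G.NT)) =
      fun B => (G.termProd B).encode := by funext B; rw [h1]; rfl
  have h4 : (fun i : Fin G.nC => encOf (finSumFinEquiv.symm (Fin.natAdd G.nT i) : G.NT)) =
      fun C => (G.ctxProd C).encode := by funext B; rw [h2]; rfl
  rw [← h3, ← h4]
  rfl

/-- The encodings of the productions follow each other in the order of the numbers of the nonterminals.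
-/
theorem encs_drop (N : G.NT) : (encs G).drop (idx N) = encOf N :: (encs G).drop (idx N + 1) := by
  rw [List.drop_eq_getElem_cons (by simp only [encs, List.length_ofFn]; exact idx_lt N)]
  simp [encs, idx]

/-- The production of the nonterminal `N` has been decoded. -/
structure Decoded (go : ℕ) (N : G.NT) (σ : St) : Prop where
  kd : σ.v .kd = kindOf N
  sy : σ.v .sy = symOf N
  nlv : σ.v .nlv = nlOf N
  nc : σ.v .nc = (kids N).length
  ln : σ.v .ln = (encOf N).length
  nc_lt : (kids N).length < (encOf N).length
  nl_lt : nlOf N < (encOf N).length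
  addr : ∀ j < (kids N).length, σ.v .b + j + (1 - (nlOf N - j)) < σ.v .p + (encOf N).length
  kid : ∀ j < (kids N).length, σ.A .inp (σ.v .b + j + (1 - (nlOf N - j))) +
    (if j = 0 then σ.v .o1 else σ.v .o2) = kidOf go N j

/-- The number of the format of the production of `N`. -/
def tagOf (N : G.NT) : ℕ :=
  match N with
  | .inl A => match G.termProd A with
    | .app _ _ => 0
    | .comp _ _ => 1
    | .lam _ => 2
  | .inr C => match G.ctxProd C with
    | .hole => 3
    | .comp _ _ => 4
    | .app _ _ _ => 5

/-- The number of a nonterminal tells whether it is a term or a context nonterminal. -/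
theorem readTag_spec {go : ℕ} (N : G.NT) (σ : St) (hg : σ.v .g = go + idx N)
    (hT : σ.v .tEnd = go + G.nT) (hR : Reads σ (σ.v .p) (encOf N))
    (hp : σ.v .p + (encOf N).length ≤ E.SZ) (hgl : go + G.size ≤ E.SZ) :
    WP E readTag σ fun σ' t => t ≤ 3 ∧ σ'.v .tag = tagOf N := by
  have hw := E.hw
  have hSZ := E.hSZ
  have hlen : 0 < (encOf N).length := by
    match N with
    | .inl A => cases h : G.termProd A <;> simp [encOf, h, TermRhs.encode]
    | .inr C => cases h : G.ctxProd C <;> simp [encOf, h, CtxRhs.encode]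
  have h0 := hR 0 (encOf N)[0] (by simp [hlen])
  rw [Nat.add_zero] at h0
  unfold readTag
  have hsize : G.size = G.nT + G.nC := rfl
  match N with
  | .inl A =>
    rw [idx_inl] at hg
    have e : (encOf (.inl A : G.NT))[0] = tagOf (.inl A : G.NT) := by
      cases h : G.termProd A <;> simp [encOf, h, TermRhs.encode, tagOf]
    rw [e] at h0
    simp only [wp, evs, tf, reduceCtorEq, h0, hg, hT]
    exact ⟨by omega, by omega, fun _ => by omega, fun h => by omega⟩
  | .inr C =>
    rw [idx_inr] at hg
    have e : (encOf (.inr C : G.NT))[0] + 3 = tagOf (.inr C : G.NT) := by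
      cases h : G.ctxProd C <;> simp [encOf, h, CtxRhs.encode, tagOf]
    have e5 : tagOf (.inr C : G.NT) ≤ 5 := by
      cases h : G.ctxProd C <;> simp [h, tagOf]
    simp only [wp, evs, tf, reduceCtorEq, h0, hg, hT, e]
    exact ⟨by omega, by omega, fun h => by omega, fun _ => by omega⟩

set_option maxHeartbeats 1000000 in
theorem decode_spec {go : ℕ} (N : G.NT) (σ : St) (hgo : σ.v .go = go) (htag : σ.v .tag = tagOf N)
    (hT : σ.v .tEnd = go + G.nT) (hR : Reads σ (σ.v .p) (encOf N))
    (hp : σ.v .p + (encOf N).length ≤ E.SZ) :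
    WP E decode σ fun σ' t => t ≤ 20 ∧ Decoded go N σ' := by
  have hw := E.hw
  have hSZ := E.hSZ
  unfold decode
  -- the six forms of productions are decoded alike; only the nonterminals on the right differ
  rcases N with A | C
  · cases h : G.termProd A
    all_goals
      simp [encOf, h, TermRhs.encode, reads_cons, Nat.add_assoc] at hR hp
      simp [WP_seq, htag, tagOf, h, hR, hT]
      repeat refine ⟨by omega, ?_⟩
      refine ⟨by simp [kindOf, h], by simp [symOf, h], by simp [nlOf, kids, h], by simp [kids, h],
        by simp [encOf, h, TermRhs.encode], by simp [kids, encOf, h, TermRhs.encode]; try omega,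
        by simp [nlOf, kids, encOf, h, TermRhs.encode]; try omega, fun j hj => by
          simp [kids, h] at hj; simp [nlOf, kids, encOf, h, TermRhs.encode]; omega, fun j hj => ?_⟩
      rw [kidOf_eq hj]
      simp [kids, h] at hj
    · rename_i f args _
      simp [nlOf, kids, h, hgo, idx_inl]
      rw [show 1 - (F.arity f - j) = 0 by omega, Nat.add_zero, Nat.add_comm go]
      exact congr_arg (· + go) (hR.2.2.2.ofFn ⟨j, hj⟩)
    · interval_cases j <;> simp [nlOf, kids, h, hgo, idx_inl, idx_inr, hR] <;> omega
    · subst hj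
      simp [nlOf, kids, h, hgo, idx_inl, hR]
      omega
  · cases h : G.ctxProd C
    all_goals
      simp [encOf, h, CtxRhs.encode, reads_cons, Nat.add_assoc] at hR hp
      simp [WP_seq, htag, tagOf, h, hR, hT]
      repeat refine ⟨by omega, ?_⟩
      refine ⟨by simp [kindOf, h], by simp [symOf, h], by simp [nlOf, h], by simp [kids, h],
        by simp [encOf, h, CtxRhs.encode], by simp [kids, encOf, h, CtxRhs.encode]; try omega,
        by simp [nlOf, encOf, h, CtxRhs.encode]; try omega, fun j hj => by
          simp [kids, h] at hj <;> simp [nlOf, encOf, h, CtxRhs.encode] <;> omega, fun j hj => ?_⟩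
      try simp [kids, h] at hj
    · rw [kidOf_eq (by simpa [kids, h] using hj)]
      interval_cases j <;> simp [nlOf, kids, h, hgo, idx_inr, hR] <;> omega
    · rename_i f i args
      have hj' : j < (kids (.inr C : G.NT)).length := by simpa [kids, h] using hj
      obtain ⟨k, hka, hkb⟩ := (kids_ctx h).2 j hj'
      rw [kidOf_eq hj', hkb, idx_inl]
      have := hR.2.2.2.2.ofFn k.val
      rw [dif_neg k.2] at this
      simp [nlOf, h, hgo]
      rw [Nat.add_comm go, ← this]
      congr 2
      rw [hka]
      split_ifs <;> omega

/-- The rule for traversals: `I m n` is the invariant when the first `m` productions have been treated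
and the next one begins at the address `n`. -/
theorem traverse_spec {body : Cmd} (k : ℕ) (I : ℕ → ℕ → St → Prop) {go : ℕ} (A : Fin G.nT) (σ : St)
    (hbody : ∀ (N : G.NT) (σ' : St), I (idx N) (σ'.v .p) σ' → Decoded go N σ' → σ'.v .g = go + idx N →
      σ'.v .p + (encOf N).length ≤ E.SZ →
      WP E body σ' fun σ'' t => t ≤ k ∧ I (idx N + 1) (σ'.v .p + (encOf N).length) σ'')
    (hmod : (body.modV .p || body.modV .ln || body.modV .g || body.modV .go || body.modV .tEnd ||
      body.modV .gEnd || body.modV .root || body.modA .inp) = false)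
    (hI : ∀ m n σ σ', I m n σ → σ'.v .q = σ.v .q → σ'.v .sz = σ.v .sz → σ'.A = σ.A → I m n σ')
    (hgo : σ.v .go = go) (hR : Reads σ (σ.v .p) (G.encode A))
    (hp : σ.v .p + (G.encode A).length ≤ E.SZ) (hgl : go + G.size ≤ E.SZ) (h0 : I 0 (σ.v .p + 3) σ) :
    WP E (traverse body) σ fun σ' t => t ≤ (k + 29) * G.size + 6 ∧ σ'.v .root = go + A.val ∧
      σ'.v .tEnd = go + G.nT ∧ σ'.v .gEnd = go + G.size ∧ σ'.v .go = go ∧ σ'.A .inp = σ.A .inp ∧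
      σ'.v .p = σ.v .p + (G.encode A).length ∧ I G.size (σ'.v .p) σ' := by
  have hw := E.hw
  have hSZ := E.hSZ
  simp only [Bool.or_eq_false_iff] at hmod
  obtain ⟨⟨⟨⟨⟨⟨⟨m1, m2⟩, m3⟩, m4⟩, m5⟩, m6⟩, m7⟩, m8⟩ := hmod
  rw [encode_eq] at hR hp ⊢
  simp only [List.length_cons] at hp ⊢
  obtain ⟨ℓ, hℓ⟩ : ∃ ℓ, ℓ = (encs G).flatten.length := ⟨_, rfl⟩
  rw [← hℓ] at hp ⊢
  simp only [reads_cons] at hR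
  obtain ⟨r0, r1, r2, r3⟩ := hR
  have e2 : σ.A .inp (σ.v .p + 2) = G.nC := r2
  have hsize : G.size = G.nT + G.nC := rfl
  unfold traverse
  simp only [wp, evs, tf, reduceCtorEq, hgo, r0, r1, e2]
  refine ⟨by omega, by omega, by omega, by omega, ?_⟩
  refine WP_while (fun n σ' => σ'.v .g + n = go + G.size ∧ σ'.v .root = go + A.val ∧
    σ'.v .tEnd = go + G.nT ∧ σ'.v .gEnd = go + G.size ∧ σ'.v .go = go ∧ σ'.A .inp = σ.A .inp ∧
    ∃ m, m + n = G.size ∧ Reads σ' (σ'.v .p) ((encs G).drop m).flatten ∧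
      σ'.v .p + ((encs G).drop m).flatten.length = σ.v .p + (ℓ + 1 + 1 + 1) ∧
      I m (σ'.v .p) σ') (k + 28) ?_ ?_ (n := G.size) ?_ ?_
  · rintro n σ' ⟨hg, hr, hT, hE, hgo', hi, m, hm, hre, hpp, hI'⟩
    simp [hE]
    omega
  · rintro n σ' ⟨hg, hr, hT, hE, hgo', hi, m, hm, hre, hpp, hI'⟩ hne
    simp [hE] at hne
    obtain ⟨N, rfl⟩ := exists_idx (G := G) (k := m) (by omega)
    rw [encs_drop, List.flatten_cons] at hre hpp
    obtain ⟨hre1, hre2⟩ := reads_append.1 hre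
    rw [List.length_append] at hpp
    refine WP_cut _ (readTag_spec N σ' (by omega) hT hre1 (by omega) hgl).frame ?_
    rintro σ0 t0 ⟨⟨ht0, htag⟩, hF0⟩
    have f0 : ∀ x, x ≠ .tag → σ0.v x = σ'.v x := fun x hx => hF0.v _ (by simp [readTag, Cmd.modV, hx])
    have fA0 : σ0.A = σ'.A := by funext a; exact hF0.A a rfl
    refine WP_cut _ (decode_spec N σ0 (by rw [f0 _ (by simp), hgo']) htag (by rw [f0 _ (by simp), hT])
      (by rw [f0 _ (by simp)]; exact hre1.congr (by rw [fA0])) (by rw [f0 _ (by simp)]; omega)).frame ?_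
    rintro σ1 t1 ⟨⟨ht1, hD⟩, hF⟩
    have f1 : σ1.v .p = σ'.v .p := by rw [hF.v _ rfl, f0 _ (by simp)]
    have f2 : σ1.v .g = σ'.v .g := by rw [hF.v _ rfl, f0 _ (by simp)]
    have f3 : σ1.v .root = σ'.v .root := by rw [hF.v _ rfl, f0 _ (by simp)]
    have f4 : σ1.v .tEnd = σ'.v .tEnd := by rw [hF.v _ rfl, f0 _ (by simp)]
    have f5 : σ1.v .gEnd = σ'.v .gEnd := by rw [hF.v _ rfl, f0 _ (by simp)]
    have f6 : σ1.v .go = σ'.v .go := by rw [hF.v _ rfl, f0 _ (by simp)]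
    have f7 : σ1.A = σ'.A := by rw [← fA0]; funext a; exact hF.A a rfl
    have hI1 : I (idx N) (σ1.v .p) σ1 := by
      rw [f1]; exact hI _ _ _ _ hI' (by rw [hF.v _ rfl, f0 _ (by simp)]) (by rw [hF.v _ rfl, f0 _ (by simp)])
        f7
    clear hF
    refine WP_cut _ (hbody N σ1 hI1 hD (by omega) (by omega)).frame ?_
    rintro σ2 t2 ⟨⟨ht2, hI2⟩, hF⟩
    simp only [wp, evs, tf, reduceCtorEq]
    have g1 := hF.v _ m1
    have g2 := hF.v _ m2
    have g3 := hF.v _ m3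
    have hln := hD.ln
    refine ⟨by omega, by omega, by omega, n - 1, by omega, ?_, ?_, ?_,
      ?_, ?_, ?_, idx N + 1, by omega, ?_, ?_, ?_⟩
    · omega
    · simp [hF.v _ m7, f3, hr]
    · simp [hF.v _ m5, f4, hT]
    · simp [hF.v _ m6, f5, hE]
    · simp [hF.v _ m4, f6, hgo']
    · simp [hF.A _ m8, f7, hi]
    · have : σ2.v .p + σ2.v .ln = σ'.v .p + (encOf N).length := by omega
      simp [this]
      exact hre2.congr (by simp [hF.A _ m8, f7])
    · omega
    · have : σ2.v .p + σ2.v .ln = σ1.v .p + (encOf N).length := by omega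
      simp [this]
      exact hI _ _ _ _ hI2 (by simp) (by simp) (by simp)
  · refine ⟨by simp, by simp; omega, by simp; omega, by simp; omega, by simp [hgo], by simp, 0, by simp, ?_,
    ?_, ?_⟩
    · simp; exact r3.congr (by simp)
    · simp only [List.drop_zero, ← hℓ]; simp; omega
    · simp; exact hI _ _ _ _ h0 (by simp) (by simp) (by simp)
  · rintro n σ' t ⟨hg, hr, hT, hE, hgo', hi, m, hm, hre, hpp, hI'⟩ hne ht
    simp [hE] at hne
    obtain rfl : m = G.size := by omega
    rw [List.drop_eq_nil_of_le (by simp [encs, STG.size])] at hpp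
    simp at hpp
    refine ⟨?_, hr, hT, hE, hgo', hi, hpp, hI'⟩
    have : (k + 28 + 1) * G.size = (k + 29) * G.size := rfl
    omega

/-- The productions of the nonterminals before number `k` have been stored; `p` bounds the number of
cells that their children take. -/
structure Stored (E : Env) (G : STG F) (go k p : ℕ) (σ : St) : Prop where
  sz : σ.v .sz = E.SZ
  q_le : σ.v .q ≤ p
  holds : ∀ N : G.NT, idx N < k → Holds E (gr G go) σ (go + idx N) ∧
    σ.A .chp (go + idx N) + (kids N).length ≤ σ.v .q ∧ σ.A .st (go + idx N) = 0

theorem storeProd_spec {go r : ℕ} (hSZ : E.SZ < E.M) (hcard : F.card ≤ E.M)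
    (hgl : go + G.size ≤ E.SZ) (hr : ∀ N : G.NT, (kids N).length ≤ r) (N : G.NT) (σ : St)
    (hS : Stored E G go (idx N) (σ.v .p) σ) (hD : Decoded go N σ) (hg : σ.v .g = go + idx N)
    (hp : σ.v .p + (encOf N).length ≤ E.SZ) :
    WP E storeProd σ fun σ' t => t ≤ 5 * r + 10 ∧
      Stored E G go (idx N + 1) (σ.v .p + (encOf N).length) σ' := by
  have hM := E.hSZ
  have hw := E.hw
  obtain ⟨hsz, hq, hH⟩ := hS
  have hN := idx_lt N
  have hrN := hr N
  have hncl := hD.nc_lt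
  have hnll := hD.nl_lt
  have hsym : symOf N < E.M := by
    match N with
    | .inl A => cases h : G.termProd A <;> simp [symOf, h] <;> omega
    | .inr C => cases h : G.ctxProd C <;> simp [symOf, h] <;> omega
  unfold storeProd
  simp only [wp, evs, tf, hsz, hg, hD.kd, hD.sy, hD.nlv, hD.nc]
  have hgS : go + idx N < E.SZ := by omega
  refine ⟨hgS, hgS, hgS, hgS, hgS, hgS, ?_⟩
  obtain ⟨σ1, hσ1⟩ : ∃ σ1, σ1 = (((((((σ.put .kind (go + idx N) (kindOf N)).put .sym (go + idx N)
    (symOf N)).put .nl (go + idx N) (nlOf N)).put .nch (go + idx N) (kids N).length).put .chp (go + idx N)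
    (σ.v .q)).put .st (go + idx N) 0).set .j 0) := ⟨_, rfl⟩
  rw [← hσ1]
  have hv : ∀ x, x ≠ .j → σ1.v x = σ.v x := by intro x hx; rw [hσ1]; simp [hx]
  have hj : σ1.v .j = 0 := by rw [hσ1]; simp
  have hinp : σ1.A .inp = σ.A .inp := by rw [hσ1]; simp
  have hch : σ1.A .ch = σ.A .ch := by rw [hσ1]; simp
  refine WP_while (fun n σ' => σ'.v .j + n = (kids N).length ∧ (∀ x, x ≠ .j → x ≠ .q → σ'.v x = σ.v x) ∧
    (∀ a, a ≠ .ch → σ'.A a = σ1.A a) ∧ σ'.v .q = σ.v .q + σ'.v .j ∧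
    (∀ i < σ.v .q, σ'.A .ch i = σ.A .ch i) ∧
    ∀ i < σ'.v .j, σ'.A .ch (σ.v .q + i) = kidOf go N i) 4 ?_ ?_ (n := (kids N).length) ?_ ?_
  · rintro n σ' ⟨h1, h2, h3, h4, h5, h6⟩
    simp [h2 .nc (by simp) (by simp), hD.nc]
    omega
  · rintro n σ' ⟨h1, h2, h3, h4, h5, h6⟩ hne
    simp [h2 .nc (by simp) (by simp), hD.nc] at hne
    have hne : σ'.v .j < (kids N).length := by omega
    have hadr := hD.addr (σ'.v .j) hne
    have hkid := hD.kid (σ'.v .j) hne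
    have hkl : kidOf go N (σ'.v .j) < E.M := by
      obtain ⟨M, -, h⟩ := kidOf_mem (go := go) hne
      have := idx_lt M
      omega
    have e1 : kidAddr.ev σ' = σ.v .b + σ'.v .j + (1 - (nlOf N - σ'.v .j)) := by
      simp [kidAddr, h2 .b (by simp) (by simp), h2 .nlv (by simp) (by simp), hD.nlv]
    have e2 : kidAddr.ok E σ' := by
      simp [kidAddr, h2 .b (by simp) (by simp), h2 .nlv (by simp) (by simp), hD.nlv]
      omega
    have e3 : σ'.A .inp = σ.A .inp := by rw [h3 _ (by simp), hinp]
    have e4 : σ'.v .sz = E.SZ := by rw [h2 _ (by simp) (by simp), hsz]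
    have hput : ∀ e : Ex, e.ok E σ' ∧ e.ev σ' = kidOf go N (σ'.v .j) →
        WP E (.store .ch Var.q e ;; .q ≔ Var.q + 1 ;; .j ≔ Var.j + 1) σ' fun σ'' t => t ≤ 3 ∧
          ∃ m < n, σ''.v .j + m = (kids N).length ∧ (∀ x, x ≠ .j → x ≠ .q → σ''.v x = σ.v x) ∧
          (∀ a, a ≠ .ch → σ''.A a = σ1.A a) ∧ σ''.v .q = σ.v .q + σ''.v .j ∧
          (∀ i < σ.v .q, σ''.A .ch i = σ.A .ch i) ∧
          ∀ i < σ''.v .j, σ''.A .ch (σ.v .q + i) = kidOf go N i := by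
      rintro e ⟨he1, he2⟩
      simp only [wp, evs, tf, reduceCtorEq, he2, e4]
      refine ⟨⟨he1, by omega⟩, by omega, by omega,
        by omega, n - 1, by omega, ?_, ?_, ?_, ?_, ?_, ?_⟩
      · omega
      · intro x hx1 hx2; simp [hx1, hx2, h2]
      · intro a ha; simp [ha, h3]
      · omega
      · intro i hi; simp [show i ≠ σ'.v .q by omega, h5 i hi]
      · intro i hi
        simp at hi
        by_cases hij : i = σ'.v .j
        · subst hij; simp [h4]
        · simp [show σ.v .q + i ≠ σ'.v .q by omega, h6 i (by omega)]
    refine WP_seq.2 (WP_ite.2 ⟨trivial, fun hj0 => ?_, fun hj0 => ?_⟩)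
    · rw [if_neg (by simpa using hj0)] at hkid
      refine (WP_seq.1 (hput (Arr.inp kidAddr + Var.o2) ?_)).mono fun σ2 t2 h => h.mono fun σ3 t3 h =>
        ⟨by omega, h.2⟩
      simp only [wp, evs, tf, e1, e3, h2 .o2 (by simp) (by simp), hkid]
      exact ⟨⟨e2, by omega⟩, hkl⟩
    · rw [if_pos (by simpa using hj0)] at hkid
      refine (WP_seq.1 (hput (Arr.inp kidAddr + Var.o1) ?_)).mono fun σ2 t2 h => h.mono fun σ3 t3 h =>
        ⟨by omega, h.2⟩
      simp only [wp, evs, tf, e1, e3, h2 .o1 (by simp) (by simp), hkid]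
      exact ⟨⟨e2, by omega⟩, hkl⟩
  · grind
  · rintro n σ' t ⟨h1, h2, h3, h4, h5, h6⟩ h0 ht
    simp [h2 .nc (by simp) (by simp), hD.nc] at h0
    have hjn : σ'.v .j = (kids N).length := by omega
    refine ⟨by omega, by rw [h2 _ (by simp) (by simp), hsz], by omega, fun M hM => ?_⟩
    by_cases hMN : M = N
    · subst hMN
      refine ⟨⟨?_, ?_, ?_, ?_, ?_, hgS, ?_, ?_, ?_⟩, ?_, ?_⟩
      · rw [h3 _ (by simp), gr_kind, hσ1]; simp
      · rw [h3 _ (by simp), gr_sym, hσ1]; simp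
      · rw [h3 _ (by simp), gr_nl, hσ1]; simp
      · rw [h3 _ (by simp), gr_nch, hσ1]; simp
      · intro j hj
        rw [gr_nch] at hj
        have hc : σ'.A .chp (go + idx M) = σ.v .q := by rw [h3 _ (by simp), hσ1]; simp
        rw [hc, gr_kid]
        exact h6 j (by omega)
      · have hc : σ'.A .chp (go + idx M) = σ.v .q := by rw [h3 _ (by simp), hσ1]; simp
        rw [hc, gr_nch]; omega
      · rw [gr_sym]; exact hsym
      · rw [gr_nl]; omega
      · simp_all
      · rw [h3 _ (by simp), hσ1]; simp
    · have hne : idx M ≠ idx N := fun h => hMN (idx_inj h)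
      obtain ⟨a1, a2, a3⟩ := hH M (by omega)
      have hA : ∀ a, a ≠ .ch → σ'.A a (go + idx M) = σ.A a (go + idx M) := by
        intro a ha
        rw [h3 a ha, hσ1]
        simp only [evs, St.put_A]
        split_ifs <;> simp_all
      refine ⟨⟨?_, ?_, ?_, ?_, ?_, a1.g_lt, ?_, a1.sym_lt, a1.nl_lt⟩, ?_, ?_⟩
      · rw [hA _ (by simp), a1.kind]
      · rw [hA _ (by simp), a1.sym]
      · rw [hA _ (by simp), a1.nl]
      · rw [hA _ (by simp), a1.nch]
      · intro j hj
        rw [hA _ (by simp), ← a1.kid j hj]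
        rw [gr_nch] at hj
        exact h5 _ (by omega)
      · rw [hA _ (by simp)]; exact a1.chp_lt
      · rw [hA _ (by simp)]; omega
      · rw [hA _ (by simp), a3]

end Submatch

namespace Submatch

/-! ### Finding the nonterminals that represent the pattern -/

open Var Arr in
/-- The number of function symbols of the context nonterminal `cur`. -/
def curSize : Ex := len (WL cur) + len (WR cur)

open Var Arr in
/-- Descends from the context nonterminal `cur` to a context nonterminal where a suffix context of the
original one with `kk` function symbols begins. In `bx` and `path` the length of the preorder word and the
position of the part in front are computed. -/
def descend : Cmd :=
  bx ≔ 0 ;; path ≔ 0 ;; x ≔ 1 ;;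
  .while x (.ite (curSize - kk)
    (.ite (kind cur - 2)
      (c1 ≔ ch (chp cur) ;; c2 ≔ ch (chp cur + 1) ;; l ≔ len (WL c2) + len (WR c2) ;;
        .ite (kk - l) (kk ≔ kk - l ;; cur ≔ c1)
          (bx ≔ bx + len (WL c1) ;; u ≔ path ;; v ≔ hp c1 ;; catP ;; path ≔ res ;; cur ≔ c2))
      (x ≔ 0))
    (x ≔ 0))

open Var Arr in
/-- Treats the nonterminal `g` with a composition as its production. -/
def trySplit : Cmd :=
  cur ≔ ch (chp g) ;; kk ≔ len (WL (ch (chp g + 1))) ;;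
  .ite (w - kk)
    (kk ≔ w - kk ;; descend ;;
      .ite (curSize - kk) .skip
        (occ ;; .ite ok (.store spN ns (g - go) ;; .store spP ns path ;; ns ≔ ns + 1) .skip))
    .skip

open Var Arr in
/-- Decides whether the nonterminal `g` represents the pattern. -/
def report : Cmd :=
  tj ≔ WL g ;; w ≔ len pu ;;
  .ite (w - len tj) .skip
    (.ite (len tj - w) (.ite (kind g - 1) trySplit .skip)
      (bx ≔ 0 ;; occ ;; .ite ok (.store full nf (g - go) ;; nf ≔ nf + 1) .skip))

open Var Arr in
/-- Lists the nonterminals that represent the pattern. -/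
def reportAll : Cmd :=
  nf ≔ 0 ;; ns ≔ 0 ;; g ≔ go ;;
  .while (tEnd - g) (.ite (st g) report .skip ;; g ≔ g + 1)

variable {F : Sig} {G : STG F} {E : Env}

/-- A decomposition of the context of `N` with the right number of function symbols behind decides
which position splits off `s`. -/
theorem splitAt_iff {s : Term F} {N N' : Fin G.nT} {C : Fin G.nC} (h : G.termProd N = .comp C N')
    (h1 : (pre (G.valT N')).length < (pre s).length) (h2 : (pre s).length < (pre (G.valT N)).length)
    {a b : Ctx F} (hab : G.valC C = a.comp b)
    (hb : csize b + (pre (G.valT N')).length = (pre s).length) (p : List ℕ) :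
    SplitAt G s N p ↔ p = a.holePos ∧ Occ (pre (G.valT N)) (pre s) (cl a).length := by
  have hv : G.valT N = a.fill (b.fill (G.valT N')) := by rw [valT_comp h, hab, comp_fill]
  have hocc : Occ (pre (G.valT N)) (pre s) (cl a).length ↔ b.fill (G.valT N') = s := by
    rw [hv, pre_fill a, occ_iff_eq (by rw [length_pre_fill, hb])]
    exact ⟨pre_inj, fun h => by rw [h]⟩
  rw [hocc]
  constructor
  · rintro ⟨C', N'', h', c1, c2, hc, -, -, rfl, hs⟩
    rw [h] at h'
    obtain ⟨rfl, rfl⟩ := TermRhs.comp.inj h'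
    have hl : csize c2 + (pre (G.valT N')).length = (pre s).length := by rw [← hs, length_pre_fill]
    obtain ⟨rfl, rfl⟩ := comp_inj_of_csize (hab.symm.trans hc) (by omega)
    exact ⟨rfl, hs⟩
  · rintro ⟨rfl, hs⟩
    refine ⟨C, N', h, a, b, hab, ?_, ?_, rfl, hs⟩
    · rintro rfl
      rw [hv, hs, Ctx.fill] at h2
      exact absurd h2 (lt_irrefl _)
    · rintro rfl
      rw [csize_eq_zero.2 rfl] at hb
      omega

/-- A term can be split off only by a suffix context of the right size. -/
theorem not_splitAt {s : Term F} {N N' : Fin G.nT} {C : Fin G.nC} (h : G.termProd N = .comp C N')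
    (hab : ∀ a b : Ctx F, G.valC C = a.comp b → b ≠ .hole →
      csize b + (pre (G.valT N')).length ≠ (pre s).length) (p : List ℕ) : ¬ SplitAt G s N p := by
  rintro ⟨C', N'', h', c1, c2, hc, -, h2, rfl, hs⟩
  rw [h] at h'
  obtain ⟨rfl, rfl⟩ := TermRhs.comp.inj h'
  exact hab _ _ hc h2 (by rw [← hs, length_pre_fill])

/-- The data that the search for the representing nonterminals relies on: the filled table, the words of
all nonterminals of `G` that contribute to `T`, and the node `pu` for the preorder word of `s`. -/
structure Ready (E : Env) (G : STG F) (T : Fin G.nT) (s : Term F) (go V : ℕ) (σ : St) : Prop where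
  sz : σ.v .sz = E.SZ
  vgo : σ.v .go = go
  tEnd : σ.v .tEnd = go + G.nT
  tab : TabC E (σ.A .L) (σ.A .R) (σ.A .len) (σ.v .ps) (σ.v .nn) V
  rows : RowOK (σ.A .L) (σ.A .R) (σ.v .ps) (σ.v .nn) V (σ.v .pu) σ
  pu_pos : 0 < σ.v .pu
  pu_le : σ.v .pu ≤ σ.v .ps
  pu : σ.wd (σ.v .pu) = pre s
  ppool : Pool 0 (σ.A .PL) (σ.A .PR) (σ.v .np)
  holds : ∀ N : G.NT, Holds E (gr G go) σ (go + idx N)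
  done : ∀ N : G.NT, (Relation.ReflTransGen G.Uses (.inl T) N ∧ σ.A .st (go + idx N) = 2 ∧
    Done (gr G go) (σ.v .ps) σ (go + idx N)) ∨
    (¬ Relation.ReflTransGen G.Uses (.inl T) N ∧ σ.A .st (go + idx N) = 0)

/-- The variables that the search must not change. -/
def fixedV : Var → Bool
  | .sz | .go | .tEnd | .ps | .nn | .pu => true
  | _ => false

/-- The arrays that the search may change. -/
def freeA : Arr → Bool
  | .full | .spN | .spP | .PL | .PR => true
  | _ => false

/-- The second state differs from the first one at most in the data that the search may change, and
has possibly more nodes for positions. -/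
structure Keep (σ σ' : St) : Prop where
  v : ∀ x, fixedV x = true → σ'.v x = σ.v x
  A : ∀ a, freeA a = false → σ'.A a = σ.A a
  p : Ext (σ.A .PL) (σ.A .PR) (σ.v .np) (σ'.A .PL) (σ'.A .PR) (σ'.v .np)

theorem Keep.refl (σ : St) : Keep σ σ := ⟨fun _ _ => rfl, fun _ _ => rfl, Ext.refl _ _ _⟩

theorem Keep.trans {σ σ' σ'' : St} (h : Keep σ σ') (h' : Keep σ' σ'') : Keep σ σ'' :=
  ⟨fun x hx => by rw [h'.v x hx, h.v x hx], fun a ha => by rw [h'.A a ha, h.A a ha], h.p.trans h'.p⟩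

theorem Keep.ext {σ σ' : St} (h : Keep σ σ') : ExtS σ σ' := by
  refine ⟨?_, h.p⟩
  rw [h.v _ rfl, h.A _ rfl, h.A _ rfl]
  exact Ext.refl _ _ _

theorem Keep.frame {c : Cmd} {σ σ' : St} (hF : Frame c σ σ')
    (h1 : c.modV .np = false) (h2 : (c.modV .sz || c.modV .go || c.modV .tEnd || c.modV .ps || c.modV .nn ||
      c.modV .pu) = false) (h3 : ∀ a, freeA a = false → c.modA a = false) (h4 : c.modA .PL = false)
    (h5 : c.modA .PR = false) : Keep σ σ' := by
  simp only [Bool.or_eq_false_iff] at h2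
  obtain ⟨⟨⟨⟨⟨k1, k2⟩, k3⟩, k4⟩, k5⟩, k6⟩ := h2
  refine ⟨fun x hx => ?_, fun a ha => hF.A a (h3 a ha), ?_⟩
  · refine hF.v x ?_
    cases x <;> first | assumption | simp [fixedV] at hx
  · rw [hF.v _ h1, hF.A _ h4, hF.A _ h5]; exact Ext.refl _ _ _

theorem keep_set {σ : St} {x : Var} {n : ℕ} (h : fixedV x = false) (hx : x ≠ .np) : Keep σ (σ.set x n) := by
  refine ⟨fun y hy => ?_, fun _ _ => rfl, ?_⟩
  · have : y ≠ x := by rintro rfl; rw [h] at hy; simp at hy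
    simp [this]
  · simp [hx.symm]; exact Ext.refl _ _ _

theorem keep_put {σ : St} {a : Arr} {k n : ℕ} (h : freeA a = true) (h1 : a ≠ .PL) (h2 : a ≠ .PR) :
    Keep σ (σ.put a k n) := by
  refine ⟨fun _ _ => rfl, fun b hb => ?_, ?_⟩
  · have : b ≠ a := by rintro rfl; rw [h] at hb; simp at hb
    simp [this]
  · simp [h1.symm, h2.symm]; exact Ext.refl _ _ _

variable {T : Fin G.nT} {s : Term F} {go V : ℕ}

theorem Ready.keep {σ σ' : St} (h : Ready E G T s go V σ) (hK : Keep σ σ')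
    (hP : Pool 0 (σ'.A .PL) (σ'.A .PR) (σ'.v .np)) : Ready E G T s go V σ' := by
  obtain ⟨h1, h2, h3, h4, h5, h6, h7, h8, h9, h10, h11⟩ := h
  refine ⟨by rw [hK.v _ rfl, h1], by rw [hK.v _ rfl, h2], by rw [hK.v _ rfl, h3], ?_, ?_, ?_, ?_, ?_, hP,
    fun N => (h10 N).congr fun a ha => hK.A a ?_, fun N => ?_⟩
  · rw [hK.v _ rfl, hK.v _ rfl, hK.A _ rfl, hK.A _ rfl, hK.A _ rfl]; exact h4
  · rw [hK.v _ rfl, hK.v _ rfl, hK.v _ rfl, hK.A _ rfl, hK.A _ rfl]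
    exact h5.congr (hK.A _ rfl) (hK.A _ rfl) (hK.A _ rfl)
  · rw [hK.v _ rfl]; exact h6
  · rw [hK.v _ rfl, hK.v _ rfl]; exact h7
  · rw [St.wd, hK.v _ rfl, hK.A _ rfl, hK.A _ rfl]; exact h8
  · rcases of_decide_eq_true ha with rfl | rfl | rfl | rfl | rfl | rfl <;> rfl
  · rw [hK.A .st rfl, hK.v .ps rfl]
    rcases h11 N with ⟨a1, a2, a3⟩ | h
    · exact .inl ⟨a1, a2, a3.ext hK.ext (by rw [hK.A _ rfl]) (by rw [hK.A _ rfl]) (by rw [hK.A _ rfl])⟩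
    · exact .inr h

/-- What the state holds for the nonterminal `N` with number `g` that contributes to `T`. -/
structure NodeAt (E : Env) (go V g : ℕ) (N : G.NT) (σ : St) : Prop where
  lt : g < E.SZ
  WL_lt : σ.A .WL g < E.SZ
  WR_lt : σ.A .WR g < E.SZ
  WL_node : Node (σ.v .ps) (σ.v .nn) (σ.A .WL g)
  wd : σ.wd (σ.A .WL g) = lwOf N
  lenL : σ.A .len (σ.A .WL g) = (lwOf N).length
  lenR : σ.A .len (σ.A .WR g) = (rwOf N).length
  lwV : (lwOf N).length ≤ V
  rwV : (rwOf N).length ≤ V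
  node : Node 0 (σ.v .np) (σ.A .hp g)
  pos : σ.pos (σ.A .hp g) = hwOf N
  kind : σ.A .kind g = kindOf N
  chp_lt : σ.A .chp g + (kids N).length < E.SZ
  kid : ∀ j (hj : j < (kids N).length), σ.A .ch (σ.A .chp g + j) = go + idx (kids N)[j]

/-- The stored data of a nonterminal that contributes to `T`. -/
theorem Ready.node {σ : St} (h : Ready E G T s go V σ) {N : G.NT}
    (hN : Relation.ReflTransGen G.Uses (.inl T) N) : NodeAt E go V (go + idx N) N σ := by
  obtain ⟨-, -, hD⟩ := (h.done N).resolve_right fun h => h.1 hN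
  have hH := h.holds N
  have hSZ := h.tab.idx_lt (Nat.zero_le _) (le_refl (σ.v .nn))
  have h1 := hD.l.le
  have h2 := hD.r.le
  have e1 := hD.lw
  have e2 := hD.rw
  have e3 := hD.hw
  rw [gr_lw] at e1
  rw [gr_rw] at e2
  rw [gr_hw] at e3
  refine ⟨hH.g_lt, by omega, by omega, hD.l, e1, ?_, ?_, ?_, ?_, hD.h, e3, ?_, ?_, ?_⟩
  · rw [h.tab.len _ h1, ← e1]; rfl
  · rw [h.tab.len _ h2, ← e2]; rfl
  · rw [← e1]; exact h.tab.lenV _ h1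
  · rw [← e2]; exact h.tab.lenV _ h2
  · rw [hH.kind, gr_kind]
  · have := hH.chp_lt; rwa [gr_nch] at this
  · intro j hj
    rw [hH.kid j (by rwa [gr_nch]), gr_kid, kidOf_eq hj]

theorem Ready.occ {σ : St} (h : Ready E G T s go V σ) {N : Fin G.nT} (hN : G.Contributes T N)
    (htj : σ.v .tj = σ.A .WL (go + N.val)) (hx : σ.v .bx ≤ 8 * V + 8) :
    WP E occ σ fun σ' t => t ≤ 21 * (σ.v .nn - σ.v .ps) + 20 ∧
      Flag (σ'.v .ok) (Occ (pre (G.valT N)) (pre s) (σ.v .bx)) ∧ Frame Submatch.occ σ σ' ∧ Keep σ σ' := by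
  have hn := h.node hN
  rw [← idx_inl N] at htj
  have hnode := hn.WL_node
  have hwd := hn.wd
  rw [← htj] at hnode hwd
  have h0 : σ.v .tj ≠ 0 := by
    intro h0
    rw [h0, St.wd, wd_zero] at hwd
    exact pre_ne_nil _ hwd.symm
  obtain ⟨h1, h2⟩ := hnode.resolve_left h0
  refine (occ_spec h.tab σ ⟨h.sz, rfl, rfl, rfl, rfl, rfl⟩ h.rows h.pu_pos h.pu_le h1 h2 hx).frame.mono ?_
  rintro σ' t ⟨⟨ht, hf⟩, hF⟩
  have e1 : wd (σ.A .L) (σ.A .R) (σ.v .tj) = pre (G.valT N) := hwd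
  have e2 : wd (σ.A .L) (σ.A .R) (σ.v .pu) = pre s := h.pu
  rw [e1, e2] at hf
  exact ⟨ht, hf, hF, Keep.frame hF rfl rfl (fun a ha => rfl) rfl rfl⟩

/-- The invariant of the descent in the context of `C`, for suffix contexts with `K` function symbols.
With `x = 1` it goes on at the context nonterminal `D`, where at most `n - 1` levels are left; with
`x = 0` it has ended. -/
structure DescInv (E : Env) (G : STG F) (T : Fin G.nT) (s : Term F) (go V K m : ℕ) (C : Fin G.nC)
    (σ0 : St) (n : ℕ) (σ : St) : Prop where
  ready : Ready E G T s go V σ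
  keep : Keep σ0 σ
  np : σ.v .np + n ≤ m
  node : Node 0 (σ.v .np) (σ.v .path)
  dec : ∃ (D : Fin G.nC) (a z : Ctx F), σ.v .cur = go + idx (.inr D : G.NT) ∧
    Relation.ReflTransGen G.Uses (.inl T) (.inr D) ∧ G.valC C = a.comp ((G.valC D).comp z) ∧
    σ.v .kk + csize z = K ∧ 0 < σ.v .kk ∧ σ.v .kk ≤ csize (G.valC D) ∧ σ.v .bx = (cl a).length ∧
    σ.pos (σ.v .path) = a.holePos ∧
    ((σ.v .x = 1 ∧ n = rank (.inr D : G.NT) + 1) ∨ (σ.v .x = 0 ∧ n = 0 ∧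
      (σ.v .kk < csize (G.valC D) → ∀ a' b' : Ctx F, G.valC C = a'.comp b' → csize b' ≠ K)))

theorem csize_valC (D : Fin G.nC) :
    (lwOf (.inr D : G.NT)).length + (rwOf (.inr D : G.NT)).length = csize (G.valC D) := rfl

theorem curSize_spec {σ : St} (hr : Ready E G T s go V σ) {D : Fin G.nC}
    (hc : σ.v .cur = go + idx (.inr D : G.NT)) (hD : Relation.ReflTransGen G.Uses (.inl T) (.inr D)) :
    curSize.ok E σ ∧ curSize.ev σ = csize (G.valC D) := by
  have hV := hr.tab.hV
  obtain ⟨lt, WL_lt, WR_lt, -, -, lenL, lenR, lwV, rwV, -, -, -, -, -⟩ := hr.node hD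
  have hcs := csize_valC D
  simp only [wp, evs, tf, curSize, hc, lenL, lenR, hr.sz]
  omega

theorem csize_le {σ : St} (hr : Ready E G T s go V σ) {D : Fin G.nC}
    (hD : Relation.ReflTransGen G.Uses (.inl T) (.inr D)) : csize (G.valC D) ≤ 2 * V := by
  have h := hr.node hD
  have h1 := h.lwV
  have h2 := h.rwV
  have := csize_valC D
  omega

/-- A suffix context of a composition `c1 c2` that is larger than `c2` begins in `c1`, the other ones
begin in `c2`. If the descent ends at the application of a function symbol with more symbols than
required, no suffix context has the required size (`not_csize_between`). -/
theorem descend_spec {K : ℕ} {C : Fin G.nC} (σ : St) (hσ : Ready E G T s go V σ)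
    (hC : Relation.ReflTransGen G.Uses (.inl T) (.inr C)) (hcur : σ.v .cur = go + idx (.inr C : G.NT))
    (hkk : σ.v .kk = K) (hK : 0 < K) (hKC : K ≤ csize (G.valC C)) (hnp : σ.v .np + G.size + 3 < E.SZ) :
    WP E descend σ fun σ' t => t ≤ 19 * G.size + 23 ∧ Ready E G T s go V σ' ∧
      Keep σ σ' ∧ σ'.v .np ≤ σ.v .np + G.size + 1 ∧ curSize.ok E σ' ∧ curSize.ev σ' < E.M ∧
      ((curSize.ev σ' - σ'.v .kk = 0 ∧
          Node 0 (σ'.v .np) (σ'.v .path) ∧ ∃ a b : Ctx F, G.valC C = a.comp b ∧ csize b = K ∧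
            σ'.v .bx = (cl a).length ∧ σ'.pos (σ'.v .path) = a.holePos) ∨
        (curSize.ev σ' - σ'.v .kk ≠ 0 ∧ ∀ a b : Ctx F, G.valC C = a.comp b → csize b ≠ K)) := by
  have hw := E.hw
  have hV := hσ.tab.hV
  have hSZ := hσ.tab.SZ_lt
  have hrk := rank_le (.inr C : G.NT)
  have hCV := csize_le hσ hC
  unfold descend
  simp only [wp, evs, tf]
  refine WP_while (DescInv E G T s go V K (σ.v .np + G.size + 1) C σ) 18 (by simp)
    ?_ (n := rank (.inr C : G.NT) + 1) ?_ ?_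
  · rintro n σ1 ⟨hr, hk, hn, hnode, D, a, z, hc, hD, hdec, hkz, hk0, hkD, hbx, hpos, hx⟩ hne
    obtain ⟨hx1, hnr⟩ : σ1.v .x = 1 ∧ n = rank (.inr D : G.NT) + 1 := by simp_all
    clear hx
    obtain ⟨c1, c2⟩ := curSize_spec hr hc hD
    have hN := hr.node hD
    have hDV := csize_le hr hD
    have hlt := hN.lt
    have hchl := hN.chp_lt
    have hr' : ∀ n, Ready E G T s go V (σ1.set .x n) := fun n =>
      hr.keep (keep_set rfl (by simp)) (by simpa using hr.ppool)
    have hend : (σ1.v .kk < csize (G.valC D) →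
        ∀ a' b' : Ctx F, G.valC C = a'.comp b' → csize b' ≠ K) →
        ∃ m < n, DescInv E G T s go V K (σ.v .np + G.size + 1) C σ m (σ1.set .x 0) := by
      intro h
      refine ⟨0, by omega, hr' 0, hk.trans (keep_set rfl (by simp)), by simp; omega,
        by simpa using hnode, D, a, z, by simpa using hc, hD, hdec, by simpa using hkz, by simpa using hk0,
        by simpa using hkD, by simpa using hbx, by simpa [St.pos] using hpos, .inr ⟨by simp, rfl, ?_⟩⟩
      simpa using h
    simp only [wp, evs, tf, c2]
    refine ⟨⟨c1, by omega⟩, fun hlt' => ?_, fun hge => ?_⟩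
    swap
    · exact ⟨by omega, hend fun h => by omega⟩
    have hkind := hN.kind
    simp only [tf, hc, hr.sz, hkind]
    cases hp : G.ctxProd D with
    | hole =>
      rw [valC_hole hp, csize_eq_zero.2 rfl] at hkD
      omega
    | app f i args =>
      have e : kindOf (.inr D : G.NT) = 1 := by simp [kindOf, hp]
      rw [e]
      refine ⟨⟨hlt, by omega⟩, fun h => absurd rfl h, fun _ => ?_⟩
      refine ⟨by omega, hend fun h a' b' hab hb => ?_⟩
      rw [hab, valC_app hp] at hdec
      -- a suffix context of the required size would begin between the two levels of this application
      refine not_csize_between hdec ⟨by omega, ?_⟩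
      rw [← valC_app hp, csize_comp]
      omega
    | comp D1 D2 =>
      have e : kindOf (.inr D : G.NT) = 3 := by simp [kindOf, hp]
      have hkids : kids (.inr D : G.NT) = [.inr D1, .inr D2] := by simp [kids, hp]
      have u1 : G.Uses (.inr D) (.inr D1) := mem_kids.1 (by simp [hkids])
      have u2 : G.Uses (.inr D) (.inr D2) := mem_kids.1 (by simp [hkids])
      have hr1 := rank_lt u1
      have hr2 := rank_lt u2
      have hD1 := hD.tail u1
      have hD2 := hD.tail u2
      have hN1 := hr.node hD1
      have hN2 := hr.node hD2
      have k1 : σ1.A .ch (σ1.A .chp (go + idx (.inr D : G.NT))) = go + idx (.inr D1 : G.NT) := by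
        have := hN.kid 0 (by simp [hkids])
        simpa [hkids] using this
      have k2 : σ1.A .ch (σ1.A .chp (go + idx (.inr D : G.NT)) + 1) = go + idx (.inr D2 : G.NT) := by
        have := hN.kid 1 (by simp [hkids])
        simpa [hkids] using this
      have hl2 : (kids (.inr D : G.NT)).length = 2 := by simp [hkids]
      have cs1 := csize_valC D1
      have cs2 := csize_valC D2
      have hV1 := csize_le hr hD1
      have hV2 := csize_le hr hD2
      have hcs : csize (G.valC D) = csize (G.valC D1) + csize (G.valC D2) := by
        rw [valC_comp hp, csize_comp]
      rw [e]
      refine ⟨⟨hlt, by omega⟩, fun _ => ?_, fun h => absurd h (by decide)⟩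
      simp only [tf, reduceCtorEq, k1, k2, hN2.lenL, hN2.lenR, hN1.lenL, cs2]
      refine ⟨⟨hlt, by omega⟩, ⟨⟨hlt, by omega⟩, by omega⟩, ⟨⟨hN2.lt, hN2.WL_lt⟩,
          ⟨hN2.lt, hN2.WR_lt⟩, by omega⟩,
        by omega, fun hgt => ⟨by omega, by omega, ?_⟩,
        fun hle => ⟨⟨⟨hN1.lt, hN1.WL_lt⟩, ?_⟩, hN1.lt, ?_⟩⟩
      · obtain ⟨σ2, hσ2⟩ : ∃ σ2, σ2 = (((((σ1.set .c1 (go + idx (.inr D1 : G.NT))).set .c2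
          (go + idx (.inr D2 : G.NT))).set .l (csize (G.valC D2))).set .kk
          (σ1.v .kk - csize (G.valC D2))).set .cur (go + idx (.inr D1 : G.NT))) := ⟨_, rfl⟩
        rw [← hσ2]
        have hK2 : Keep σ1 σ2 := by
          rw [hσ2]
          exact ((((keep_set rfl (by simp)).trans (keep_set rfl (by simp))).trans
            (keep_set rfl (by simp))).trans (keep_set rfl (by simp))).trans (keep_set rfl (by simp))
        refine ⟨rank (.inr D1 : G.NT) + 1, by omega, hr.keep hK2 ?_, hk.trans hK2, ?_, ?_, D1, a,
          (G.valC D2).comp z, ?_, hD1, ?_, ?_, ?_, ?_, ?_, ?_, .inl ⟨?_, rfl⟩⟩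
        · rw [hσ2]; simpa using hr.ppool
        · rw [hσ2]; simp; omega
        · rw [hσ2]; simpa using hnode
        · rw [hσ2]; simp
        · rw [hdec, valC_comp hp, comp_assoc]
        · rw [hσ2, csize_comp]; simp; omega
        · rw [hσ2]; simp; omega
        · rw [hσ2]; simp; omega
        · rw [hσ2]; simpa using hbx
        · rw [hσ2]; simpa [St.pos] using hpos
        · rw [hσ2]; simpa using hx1
      · have hCa : csize (G.valC C) = csize a + (csize (G.valC D) + csize z) := by
          rw [hdec, csize_comp, csize_comp]
        have : (cl a).length ≤ csize a := by simp [csize]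
        omega
      · obtain ⟨σ2, hσ2⟩ : ∃ σ2, σ2 = ((((((σ1.set .c1 (go + idx (.inr D1 : G.NT))).set .c2
          (go + idx (.inr D2 : G.NT))).set .l (csize (G.valC D2))).set .bx
          (σ1.v .bx + (lwOf (.inr D1 : G.NT)).length)).set .u (σ1.v .path)).set .v
          (σ1.A .hp (go + idx (.inr D1 : G.NT)))) := ⟨_, rfl⟩
        rw [← hσ2]
        have hK2 : Keep σ1 σ2 := by
          rw [hσ2]
          exact (((((keep_set rfl (by simp)).trans (keep_set rfl (by simp))).trans
            (keep_set rfl (by simp))).trans (keep_set rfl (by simp))).trans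
            (keep_set rfl (by simp))).trans (keep_set rfl (by simp))
        have hA2 : σ2.A = σ1.A := by rw [hσ2]; simp
        have hn2 : σ2.v .np = σ1.v .np := by rw [hσ2]; simp
        have hu2 : σ2.v .u = σ1.v .path := by rw [hσ2]; simp
        have hv2 : σ2.v .v = σ1.A .hp (go + idx (.inr D1 : G.NT)) := by rw [hσ2]; simp
        have hr2 := hr.keep hK2 (by rw [hA2, hn2]; exact hr.ppool)
        refine WP_cut _ (cat_spec (E := E) (by decide) (by decide) σ2 hr2.sz hSZ hr2.ppool
          (by rw [hn2, hu2]; exact hnode) (by rw [hn2, hv2]; exact hN1.node) (by omega) (by omega)).frame ?_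
        rintro σ3 t3 ⟨⟨ht3, hP3, hE3, hnp3, hnode3, hwd3, -⟩, hF3⟩
        have hK3 : Keep σ2 σ3 := by
          refine ⟨fun x hx => hF3.v x ?_, fun b hb => hF3.A b ?_, hE3⟩
          · cases x <;> first | rfl | simp [fixedV] at hx
          · cases b <;> first | rfl | simp [freeA] at hb
        have h3 : ∀ x, (cat .np .PL .PR).modV x = false → σ3.v x = σ2.v x := hF3.v
        have hpos3 : σ3.pos (σ3.v .res) = a.holePos ++ (G.valC D1).holePos := by
          have : σ3.pos (σ3.v .res) = σ2.pos (σ2.v .u) ++ σ2.pos (σ2.v .v) := hwd3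
          rw [this, hu2, hv2, St.pos, St.pos, hA2]
          exact congr_arg₂ _ hpos hN1.pos
        have e2 : σ3.v .c2 = go + idx (.inr D2 : G.NT) := by rw [h3 _ rfl, hσ2]; simp
        have e3 : σ3.v .kk = σ1.v .kk := by rw [h3 _ rfl, hσ2]; simp
        have e4 : σ3.v .bx = σ1.v .bx + (lwOf (.inr D1 : G.NT)).length := by rw [h3 _ rfl, hσ2]; simp
        have e5 : σ3.v .x = 1 := by rw [h3 _ rfl, hσ2]; simpa using hx1
        simp only [wp, evs, tf, reduceCtorEq, e2]
        have hK4 : Keep σ3 ((σ3.set .path (σ3.v .res)).set .cur (go + idx (.inr D2 : G.NT))) :=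
          (keep_set rfl (by simp)).trans (keep_set rfl (by simp))
        refine ⟨by omega, rank (.inr D2 : G.NT) + 1, by omega, (hr2.keep hK3 hP3).keep hK4
          ?_,
          ((hk.trans hK2).trans hK3).trans hK4, ?_, ?_, D2, a.comp (G.valC D1), z, ?_, hD2, ?_, ?_, ?_, ?_,
            ?_, ?_,
          .inl ⟨?_, rfl⟩⟩
        · simpa using hP3
        · simp; omega
        · simpa using hnode3
        · simp
        · rw [hdec, valC_comp hp, comp_assoc, comp_assoc]
        · simp; omega
        · simp; omega
        · simp; omega
        · simp [e4, cl_comp, hbx, lwOf]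
        · simp [St.pos] at hpos3 ⊢; rw [hpos3, holePos_comp]
        · simpa using e5
  · have hK2 : Keep σ (((σ.set .bx 0).set .path 0).set .x 1) :=
      ((keep_set rfl (by simp)).trans (keep_set rfl (by simp))).trans (keep_set rfl (by simp))
    refine ⟨hσ.keep hK2 (by simpa using hσ.ppool), hK2, by simp; omega, .inl (by simp), C, .hole, .hole,
      by simpa using hcur, hC, ?_, ?_, ?_, ?_, ?_, ?_, .inl ⟨by simp, rfl⟩⟩
    · simp [Ctx.comp, comp_hole]
    · simp [hkk, csize_eq_zero.2]
    · simpa [hkk] using hK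
    · simpa [hkk] using hKC
    · simp [cl]
    · simp [St.pos, Ctx.holePos, wd_zero]
  · rintro n σ1 t ⟨hr, hk, hn, hnode, D, a, z, hc, hD, hdec, hkz, hk0, hkD, hbx, hpos, hx⟩ h0 ht
    simp at h0
    obtain ⟨-, -, hx⟩ := hx.resolve_left (by omega)
    obtain ⟨c1, c2⟩ := curSize_spec hr hc hD
    have hDV := csize_le hr hD
    refine ⟨by omega, hr, hk, by omega, c1, by omega, ?_⟩
    rw [c2]
    by_cases h : σ1.v .kk < csize (G.valC D)
    · exact .inr ⟨by omega, hx h⟩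
    · exact .inl ⟨by omega, hnode, a, _, hdec, by rw [csize_comp]; omega, hbx, hpos⟩

end Submatch

namespace Submatch

/-! ### The lists of representing nonterminals -/

variable {F : Sig} {G : STG F} {E : Env} {T : Fin G.nT} {s : Term F} {go V : ℕ}

/-- The lists in the state are complete for the nonterminals before number `k`. -/
structure Lists (G : STG F) (T : Fin G.nT) (s : Term F) (k : ℕ) (fl : List (Fin G.nT))
    (sl : List (Fin G.nT × ℕ)) (σ : St) : Prop where
  nf : σ.v .nf = fl.length
  ns : σ.v .ns = sl.length
  full : ∀ i (h : i < fl.length), σ.A .full i = fl[i].val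
  spN : ∀ i (h : i < sl.length), σ.A .spN i = sl[i].1.val
  spP : ∀ i (h : i < sl.length), σ.A .spP i = sl[i].2
  fl_nodup : fl.Nodup
  sl_nodup : (sl.map Prod.fst).Nodup
  len : fl.length + sl.length ≤ k
  node : ∀ x ∈ sl, 0 < x.2 ∧ x.2 ≤ σ.v .np
  mem_full : ∀ N, N ∈ fl ↔ N.val < k ∧ G.Contributes T N ∧ G.valT N = s
  mem_split : ∀ N p, (∃ j, (N, j) ∈ sl ∧ σ.pos j = p) ↔ N.val < k ∧ G.Contributes T N ∧ SplitAt G s N p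

theorem Lists.keep {k : ℕ} {fl : List (Fin G.nT)} {sl : List (Fin G.nT × ℕ)} {σ σ' : St}
    (h : Lists G T s k fl sl σ) (hK : Keep σ σ') (h1 : σ'.v .nf = σ.v .nf) (h2 : σ'.v .ns = σ.v .ns)
    (h3 : σ'.A .full = σ.A .full) (h4 : σ'.A .spN = σ.A .spN) (h5 : σ'.A .spP = σ.A .spP) :
    Lists G T s k fl sl σ' := by
  obtain ⟨a1, a2, a3, a4, a5, a6, a7, a8, a9, a10, a11⟩ := h
  refine ⟨by rw [h1, a1], by rw [h2, a2], by rw [h3]; exact a3, by rw [h4]; exact a4,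
    by rw [h5]; exact a5, a6, a7, a8, fun x hx => ?_, a10, fun N p => ?_⟩
  · have := hK.p.le
    have := a9 x hx
    omega
  · rw [← a11 N p]
    refine exists_congr fun j => and_congr_right fun hj => ?_
    rw [St.pos, hK.p.wd (a9 _ hj).2, St.pos]

theorem Lists.skip {k : ℕ} {fl : List (Fin G.nT)} {sl : List (Fin G.nT × ℕ)} {σ : St}
    (h : Lists G T s k fl sl σ) {N : Fin G.nT} (hN : N.val = k)
    (hn : G.Contributes T N → G.valT N ≠ s ∧ ∀ p, ¬ SplitAt G s N p) : Lists G T s (k + 1) fl sl σ := by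
  obtain ⟨a1, a2, a3, a4, a5, a6, a7, a8, a9, a10, a11⟩ := h
  have key : ∀ M : Fin G.nT, M.val < k ∨ M = N ↔ M.val < k + 1 := by
    intro M; rw [Fin.ext_iff]; omega
  refine ⟨a1, a2, a3, a4, a5, a6, a7, by omega, a9, fun M => ?_, fun M p => ?_⟩
  · grind
  · grind

theorem Lists.addFull {k : ℕ} {fl : List (Fin G.nT)} {sl : List (Fin G.nT × ℕ)} {σ : St}
    (h : Lists G T s k fl sl σ) {N : Fin G.nT} (hN : N.val = k) (hc : G.Contributes T N)
    (hs : G.valT N = s) : Lists G T s (k + 1) (fl ++ [N]) sl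
      ((σ.put .full (σ.v .nf) N.val).set .nf (σ.v .nf + 1)) := by
  obtain ⟨a1, a2, a3, a4, a5, a6, a7, a8, a9, a10, a11⟩ := h
  have key : ∀ M : Fin G.nT, M.val < k ∨ M = N ↔ M.val < k + 1 := by
    intro M; rw [Fin.ext_iff]; omega
  refine ⟨by simp [a1], by simp [a2], fun i hi => ?_, by simpa using a4, by simpa using a5,
    List.nodup_append'.2 ⟨a6, by simp, fun M hM hM' => ?_⟩, a7, by simp; omega, by simpa using a9,
    fun M => ?_, fun M p => ?_⟩
  · rw [List.length_append, List.length_singleton] at hi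
    simp only [evs, St.put_A_same, a1]
    by_cases hil : i = fl.length
    · subst hil; simp
    · grind
  · have := ((a10 M).1 hM).1
    simp at hM'
    subst hM'
    omega
  · grind
  · have : ∀ j, ((σ.put .full (σ.v .nf) N.val).set .nf (σ.v .nf + 1)).pos j = σ.pos j := by
      intro j; simp [St.pos]
    simp only [this]
    rw [a11, ← key]
    refine ⟨fun h => ⟨.inl h.1, h.2⟩, ?_⟩
    rintro ⟨h | rfl, h2, h3⟩
    · exact ⟨h, h2, h3⟩
    · have := h3.length_lt
      rw [hs] at this
      exact absurd this (lt_irrefl _)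

theorem Lists.addSplit {k : ℕ} {fl : List (Fin G.nT)} {sl : List (Fin G.nT × ℕ)} {σ : St}
    (h : Lists G T s k fl sl σ) {N : Fin G.nT} (hN : N.val = k) (hc : G.Contributes T N) {j : ℕ}
    (hj : 0 < j ∧ j ≤ σ.v .np) (hp : ∀ p, SplitAt G s N p ↔ p = σ.pos j) :
    Lists G T s (k + 1) fl (sl ++ [(N, j)])
      (((σ.put .spN (σ.v .ns) N.val).put .spP (σ.v .ns) j).set .ns (σ.v .ns + 1)) := by
  obtain ⟨a1, a2, a3, a4, a5, a6, a7, a8, a9, a10, a11⟩ := h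
  have key : ∀ M : Fin G.nT, M.val < k ∨ M = N ↔ M.val < k + 1 := by
    intro M; rw [Fin.ext_iff]; omega
  refine ⟨by simp [a1], by simp [a2], by simpa using a3, fun i hi => ?_, fun i hi => ?_, a6, ?_,
    by simp; omega, fun x hx => ?_, fun M => ?_, fun M p => ?_⟩
  · rw [List.length_append, List.length_singleton] at hi
    simp only [evs, St.put_A_same, St.put_A_ne _ _ _ (show Arr.spN ≠ Arr.spP by simp), a2]
    by_cases hil : i = sl.length
    · subst hil; simp
    · grind
  · rw [List.length_append, List.length_singleton] at hi
    simp only [evs, St.put_A_same, St.put_A_ne _ _ _ (show Arr.spP ≠ Arr.spN by simp), a2]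
    by_cases hil : i = sl.length
    · subst hil; simp
    · grind
  · rw [List.map_append]
    refine List.nodup_append'.2 ⟨a7, by simp, fun M hM hM' => ?_⟩
    obtain ⟨⟨M', i⟩, hi, rfl⟩ := List.mem_map.1 hM
    have := ((a11 M' (σ.pos i)).1 ⟨i, hi, rfl⟩).1
    simp at hM'
    subst hM'
    omega
  · simp at hx
    rcases hx with hx | rfl
    · simpa using a9 x hx
    · simpa using hj
  · rw [a10, ← key]
    refine ⟨fun h => ⟨.inl h.1, h.2⟩, ?_⟩
    rintro ⟨h | rfl, h2, h3⟩
    · exact ⟨h, h2, h3⟩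
    · have := ((hp _).2 rfl).length_lt
      rw [h3] at this
      exact absurd this (lt_irrefl _)
  · have : ∀ i, (((σ.put .spN (σ.v .ns) N.val).put .spP (σ.v .ns) j).set .ns (σ.v .ns + 1)).pos i =
        σ.pos i := by intro i; simp [St.pos]
    simp only [this]
    rw [← key, show (∃ i, (M, i) ∈ sl ++ [(N, j)] ∧ σ.pos i = p) ↔
      (∃ i, (M, i) ∈ sl ∧ σ.pos i = p) ∨ (M = N ∧ σ.pos j = p) by
        simp only [List.mem_append, List.mem_singleton, Prod.mk.injEq]
        constructor
        · grind
        · grind]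
    constructor
    · grind
    · grind

/-- The result of the treatment of the nonterminal number `k`. -/
structure Reported (E : Env) (G : STG F) (T : Fin G.nT) (s : Term F) (go V k : ℕ) (σ σ' : St) : Prop where
  ready : Ready E G T s go V σ'
  keep : Keep σ σ'
  np : σ'.v .np ≤ σ.v .np + G.size + 1
  lists : ∃ fl sl, Lists G T s (k + 1) fl sl σ'

/-- By `splitAt_iff` the sizes determine the only candidate for the position, which a query then tests.
-/
theorem trySplit_spec {N N' : Fin G.nT} {C : Fin G.nC} (hp : G.termProd N = .comp C N')
    {fl : List (Fin G.nT)} {sl : List (Fin G.nT × ℕ)} (σ : St) (hr : Ready E G T s go V σ)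
    (hl : Lists G T s N.val fl sl σ) (hc : G.Contributes T N) (hg : σ.v .g = go + N.val)
    (htj : σ.v .tj = σ.A .WL (go + N.val)) (hw : σ.v .w = (pre s).length)
    (hlt : (pre s).length < (pre (G.valT N)).length) (hnp : σ.v .np + G.size + 3 < E.SZ) :
    WP E trySplit σ fun σ' t => t ≤ 21 * (σ.v .nn - σ.v .ps) + 19 * G.size + 60 ∧
      Reported E G T s go V N.val σ σ' := by
  have hM := E.hw
  have hV := hr.tab.hV
  have hSZ := hr.tab.SZ_lt
  have hN := hr.node hc
  rw [idx_inl] at hN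
  have hlt0 := hN.lt
  have hchl := hN.chp_lt
  have hkids : kids (.inl N : G.NT) = [.inr C, .inl N'] := by simp [kids, hp]
  have u1 : G.Uses (.inl N) (.inr C) := mem_kids.1 (by simp [hkids])
  have u2 : G.Uses (.inl N) (.inl N') := mem_kids.1 (by simp [hkids])
  have hC : Relation.ReflTransGen G.Uses (.inl T) (.inr C) := .tail hc u1
  have hN' := hr.node (.tail hc u2)
  rw [idx_inl] at hN'
  have hl2 : (kids (.inl N : G.NT)).length = 2 := by simp [hkids]
  have k1 : σ.A .ch (σ.A .chp (go + N.val)) = go + idx (.inr C : G.NT) := by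
    have := hN.kid 0 (by simp [hkids])
    simpa [hkids] using this
  have k2 : σ.A .ch (σ.A .chp (go + N.val) + 1) = go + N'.val := by
    have := hN.kid 1 (by simp [hkids])
    simpa [hkids, idx_inl] using this
  have hNV : (pre (G.valT N)).length ≤ V := hN.lwV
  have hlen' : σ.A .len (σ.A .WL (go + N'.val)) = (pre (G.valT N')).length := hN'.lenL
  have hvN : (pre (G.valT N)).length = csize (G.valC C) + (pre (G.valT N')).length := by
    rw [valT_comp hp, length_pre_fill]
  have hCV := csize_le hr hC
  have hKfix : ∀ a b, Keep σ ((σ.set .cur a).set .kk b) := fun a b =>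
    (keep_set rfl (by simp)).trans (keep_set rfl (by simp))
  unfold trySplit
  simp only [wp, evs, tf, reduceCtorEq, hg, hr.sz, k1, k2, hlen', hw]
  refine ⟨⟨hlt0, by omega⟩, ⟨⟨⟨⟨hlt0, by omega⟩, by omega⟩, hN'.lt⟩,
      hN'.WL_lt⟩, by omega, fun hpos => ?_, fun hle => ?_⟩
  swap
  · refine ⟨by omega, hr.keep (hKfix _ _) (by simpa using hr.ppool), hKfix _ _, by simp; omega, fl, sl, ?_⟩
    refine (hl.keep (hKfix _ _) (by simp) (by simp) (by simp) (by simp) (by simp)).skip rfl fun _ => ⟨?_, ?_⟩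
    · rintro h; rw [h] at hlt; exact lt_irrefl _ hlt
    · refine not_splitAt hp fun a b _ hb h => ?_
      have := mt csize_eq_zero.1 hb
      omega
  refine ⟨by omega, ?_⟩
  obtain ⟨K, hK⟩ : ∃ K, K = (pre s).length - (pre (G.valT N')).length := ⟨_, rfl⟩
  rw [St.set_set, ← hK]
  obtain ⟨σ1, hσ1⟩ : ∃ σ1, σ1 = (σ.set .cur (go + idx (.inr C : G.NT))).set .kk K := ⟨_, rfl⟩
  rw [← hσ1]
  have hK1 : Keep σ σ1 := hσ1 ▸ hKfix _ _
  have hr1 := hr.keep hK1 (by rw [hσ1]; simpa using hr.ppool)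
  refine WP_cut _ (descend_spec (K := K) σ1 hr1 hC (by rw [hσ1]; simp) (by rw [hσ1]; simp) (by omega)
    (by omega) (by rw [hσ1]; simpa using hnp)).frame ?_
  rintro σ2 t2 ⟨⟨ht2, hr2, hk2, hnp2, hcok, hclt, hcase⟩, hF2⟩
  have hA2 : ∀ a, descend.modA a = false → σ2.A a = σ.A a := fun a ha => by
    rw [hF2.A a ha, hσ1]; simp
  have hv2 : ∀ x, descend.modV x = false → x ≠ .cur → x ≠ .kk → σ2.v x = σ.v x := fun x hx h1 h2 => by
    rw [hF2.v x hx, hσ1]; simp [h1, h2]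
  have hK2 := hK1.trans hk2
  have hl2' := hl.keep hK2 (hv2 _ rfl (by simp) (by simp)) (hv2 _ rfl (by simp) (by simp)) (hA2 _ rfl)
    (hA2 _ rfl) (hA2 _ rfl)
  have e_nn : σ2.v .nn = σ.v .nn := hv2 _ rfl (by simp) (by simp)
  have e_ps : σ2.v .ps = σ.v .ps := hv2 _ rfl (by simp) (by simp)
  have e_np : σ1.v .np = σ.v .np := by rw [hσ1]; simp
  have hnp2' : σ2.v .np ≤ σ.v .np + G.size + 1 := by omega
  simp only [wp, evs, tf]
  refine ⟨⟨hcok, by omega⟩, fun hne => ?_, fun heq => ?_⟩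
  · rcases hcase with h | ⟨-, hno⟩
    · exact absurd h.1 hne
    refine ⟨by omega, hr2, hK2, hnp2', fl, sl, hl2'.skip rfl fun _ => ⟨?_, ?_⟩⟩
    · rintro h; rw [h] at hlt; exact lt_irrefl _ hlt
    · exact not_splitAt hp fun a b hab _ h => hno a b hab (by omega)
  · rcases hcase with ⟨-, hnode, a, b, hab, hb, hbx, hpos2⟩ | h
    swap
    · exact absurd heq h.1
    have hsplit := splitAt_iff hp (by omega) hlt hab (by omega)
    have hca : csize (G.valC C) = csize a + csize b := by rw [hab, csize_comp]
    have hcla : (cl a).length ≤ csize a := by simp [csize]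
    refine WP_cut _ (hr2.occ hc (by rw [hv2 _ rfl (by simp) (by simp), htj, hA2 _ rfl])
      (by omega)) ?_
    rintro σ3 t3 ⟨ht3, hflag, hF3, hk3⟩
    have hK3 := hK2.trans hk3
    have e_np3 : σ3.v .np = σ2.v .np := hF3.v _ rfl
    have hr3 := hr2.keep hk3 (by rw [e_np3, hF3.A _ rfl, hF3.A _ rfl]; exact hr2.ppool)
    have hl3 := hl2'.keep hk3 (hF3.v _ rfl) (hF3.v _ rfl) (hF3.A _ rfl) (hF3.A _ rfl) (hF3.A _ rfl)
    rw [hbx] at hflag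
    simp only [wp, evs, tf]
    refine ⟨fun hok => ?_, fun hok => ?_⟩
    · rw [hflag.ne_zero] at hok
      have e_g : σ3.v .g = go + N.val := by rw [hF3.v _ rfl, hv2 _ rfl (by simp) (by simp), hg]
      have e_ns := hl3.ns
      have hlen := hl3.len
      have hposa : σ3.pos (σ3.v .path) = a.holePos := by
        rw [← hpos2, St.pos, St.pos, hF3.v _ rfl, hF3.A _ rfl, hF3.A _ rfl]
      have hpath : Node 0 (σ3.v .np) (σ3.v .path) := by rw [e_np3, hF3.v _ rfl]; exact hnode
      have hpath0 : σ3.v .path ≠ 0 := by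
        intro h0
        rw [h0, St.pos, wd_zero] at hposa
        have ha0 : a = .hole := by cases a <;> simp [Ctx.holePos] at hposa ⊢
        rw [csize_eq_zero.2 ha0] at hca
        omega
      simp only [tf, e_g, hr3.vgo, hr3.sz]
      rw [show go + N.val - go = N.val by omega]
      have hKp : Keep σ3 (((σ3.put .spN (σ3.v .ns) N.val).put .spP (σ3.v .ns) (σ3.v .path)).set .ns
          (σ3.v .ns + 1)) :=
        ((keep_put rfl (by simp) (by simp)).trans (keep_put rfl (by simp) (by simp))).trans
          (keep_set rfl (by simp))
      refine ⟨by omega, by omega, by omega, by omega, hr3.keep hKp (by simpa using hr3.ppool),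
        hK3.trans hKp, by simp; omega, fl, sl ++ [(N, σ3.v .path)],
        hl3.addSplit rfl hc (by have := hpath.resolve_left hpath0; omega) fun p => ?_⟩
      rw [hsplit p, hposa]
      exact and_iff_left hok
    · rw [hflag.eq_zero] at hok
      refine ⟨by omega, hr3, hK3, by omega, fl, sl, hl3.skip rfl fun _ => ⟨?_, fun p h => ?_⟩⟩
      · rintro h; rw [h] at hlt; exact lt_irrefl _ hlt
      · exact hok ((hsplit p).1 h).2

/-- The number of function symbols of the value tells in which of the two ways the nonterminal can
represent the pattern. With equal numbers an occurrence at `0` means equality. -/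
theorem report_spec {N : Fin G.nT} {fl : List (Fin G.nT)} {sl : List (Fin G.nT × ℕ)} (σ : St)
    (hr : Ready E G T s go V σ) (hl : Lists G T s N.val fl sl σ) (hc : G.Contributes T N)
    (hg : σ.v .g = go + N.val) (hnp : σ.v .np + G.size + 3 < E.SZ) :
    WP E report σ fun σ' t => t ≤ 21 * (σ.v .nn - σ.v .ps) + 19 * G.size + 70 ∧
      Reported E G T s go V N.val σ σ' := by
  have hM := E.hw
  have hV := hr.tab.hV
  have hSZ := hr.tab.SZ_lt
  have hN := hr.node hc
  rw [idx_inl] at hN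
  have hlt0 := hN.lt
  have hlenN : σ.A .len (σ.A .WL (go + N.val)) = (pre (G.valT N)).length := hN.lenL
  have hNV : (pre (G.valT N)).length ≤ V := hN.lwV
  have hpuV := hr.tab.lenV (σ.v .pu) (by have := hr.pu_le; have := hr.tab.ps_le; omega)
  have hpul := hr.tab.len (σ.v .pu) (by have := hr.pu_le; have := hr.tab.ps_le; omega)
  have hpuw : wd (σ.A .L) (σ.A .R) (σ.v .pu) = pre s := hr.pu
  rw [hpuw] at hpuV hpul
  have hpuS : σ.v .pu < E.SZ := by
    have := hr.tab.idx_lt (Nat.zero_le _) (le_refl (σ.v .nn))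
    have := hr.pu_le
    have := hr.tab.ps_le
    omega
  unfold report
  simp only [wp, evs, tf, reduceCtorEq, hg, hr.sz, hlenN, hpul]
  obtain ⟨σ1, hσ1⟩ : ∃ σ1, σ1 = (σ.set .tj (σ.A .WL (go + N.val))).set .w (pre s).length := ⟨_, rfl⟩
  rw [← hσ1]
  have hK1 : Keep σ σ1 := by
    rw [hσ1]; exact (keep_set rfl (by simp)).trans (keep_set rfl (by simp))
  have hA1 : σ1.A = σ.A := by rw [hσ1]; simp
  have hv1 : ∀ x, x ≠ .tj → x ≠ .w → σ1.v x = σ.v x := by intro x h1 h2; rw [hσ1]; simp [h1, h2]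
  have e_np : σ1.v .np = σ.v .np := hv1 _ (by simp) (by simp)
  have hr1 := hr.keep hK1 (by rw [hA1, e_np]; exact hr.ppool)
  have hl1 := hl.keep hK1 (hv1 _ (by simp) (by simp)) (hv1 _ (by simp) (by simp)) (by rw [hA1])
    (by rw [hA1]) (by rw [hA1])
  have hskip : (G.valT N ≠ s ∧ ∀ p, ¬ SplitAt G s N p) → Reported E G T s go V N.val σ σ1 := fun h =>
    ⟨hr1, hK1, by omega, fl, sl, hl1.skip rfl fun _ => h⟩
  refine ⟨hlt0, hpuS, ⟨hN.WL_lt, by omega⟩, fun hlong => ?_, fun hshort =>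
    ⟨⟨hN.WL_lt, by omega⟩, fun hlt =>
      ⟨⟨hlt0, ?_⟩, ?_, ?_⟩,
      fun heq => ?_⟩⟩
  · refine ⟨by omega, hskip ⟨?_, fun p h => ?_⟩⟩
    · rintro h; rw [h] at hlong; omega
    · have := h.length_lt; omega
  · have hkind := hN.kind
    rw [hkind]
    cases h : G.termProd N <;> simp [kindOf, h] <;> omega
  · intro hk
    cases hp : G.termProd N with
    | comp C N' =>
      refine (trySplit_spec hp σ1 hr1 hl1 hc (by rw [hv1 _ (by simp) (by simp), hg])
        (by rw [hA1, hσ1]; simp) (by rw [hσ1]; simp) (by omega) (by rw [e_np]; exact hnp)).mono ?_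
      rintro σ2 t ⟨ht, h1, h2, h3, h4⟩
      rw [hv1 _ (by simp) (by simp), hv1 _ (by simp) (by simp)] at ht
      exact ⟨by omega, h1, hK1.trans h2, by omega, h4⟩
    | _ => rw [hN.kind] at hk; simp [kindOf, hp] at hk
  · intro hk
    refine ⟨by omega, hskip ⟨?_, ?_⟩⟩
    · rintro h; rw [h] at hlt; omega
    · rintro p ⟨C, N', hp, -⟩
      rw [hN.kind] at hk
      simp [kindOf, hp] at hk
  · have hl0 : (pre (G.valT N)).length = (pre s).length := by omega
    obtain ⟨σ2, hσ2⟩ : ∃ σ2, σ2 = σ1.set .bx 0 := ⟨_, rfl⟩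
    rw [← hσ2]
    have hK2 : Keep σ1 σ2 := by rw [hσ2]; exact keep_set rfl (by simp)
    have hA2 : σ2.A = σ.A := by rw [hσ2, St.set_A, hA1]
    have hv2 : ∀ x, x ≠ .bx → x ≠ .tj → x ≠ .w → σ2.v x = σ.v x := by
      intro x h1 h2 h3; rw [hσ2]; simp [h1, hv1 x h2 h3]
    have hr2 := hr1.keep hK2 (by rw [hσ2]; simpa using hr1.ppool)
    have hl2 := hl1.keep hK2 (by rw [hσ2]; simp) (by rw [hσ2]; simp) (by rw [hσ2]; simp)
      (by rw [hσ2]; simp) (by rw [hσ2]; simp)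
    have hb0 : σ2.v .bx = 0 := by rw [hσ2]; simp
    refine WP_cut _ (hr2.occ hc (by rw [hA2, hσ2, hσ1]; simp) (by omega)) ?_
    rintro σ3 t3 ⟨ht3, hflag, hF3, hk3⟩
    rw [hv2 _ (by simp) (by simp) (by simp), hv2 _ (by simp) (by simp) (by simp)] at ht3
    have hK3 := (hK1.trans hK2).trans hk3
    have e_np3 : σ3.v .np = σ.v .np := by rw [hF3.v _ rfl, hv2 _ (by simp) (by simp) (by simp)]
    have hr3 := hr2.keep hk3 (by rw [hF3.v .np rfl, hF3.A _ rfl, hF3.A _ rfl]; exact hr2.ppool)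
    have hl3 := hl2.keep hk3 (hF3.v _ rfl) (hF3.v _ rfl) (hF3.A _ rfl) (hF3.A _ rfl) (hF3.A _ rfl)
    have hval : Occ (pre (G.valT N)) (pre s) (σ2.v .bx) ↔ G.valT N = s := by
      rw [hb0]
      have := occ_iff_eq (a := []) (b := []) hl0
      simp only [List.nil_append, List.append_nil, List.length_nil] at this
      rw [this]
      exact ⟨pre_inj, fun h => by rw [h]⟩
    replace hflag := hflag.congr hval
    simp only [wp, evs, tf]
    refine ⟨fun hok => ?_, fun hok => ?_⟩
    · rw [hflag.ne_zero] at hok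
      have e_g : σ3.v .g = go + N.val := by
        rw [hF3.v _ rfl, hv2 _ (by simp) (by simp) (by simp), hg]
      have e_nf := hl3.nf
      have hlen := hl3.len
      simp only [tf, e_g, hr3.vgo, hr3.sz]
      rw [show go + N.val - go = N.val by omega]
      have hKp : Keep σ3 ((σ3.put .full (σ3.v .nf) N.val).set .nf (σ3.v .nf + 1)) :=
        (keep_put rfl (by simp) (by simp)).trans (keep_set rfl (by simp))
      exact ⟨by omega, by omega, by omega, hr3.keep hKp (by simpa using hr3.ppool),
        hK3.trans hKp, by simp; omega, fl ++ [N], sl, hl3.addFull rfl hc hok⟩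
    · rw [hflag.eq_zero] at hok
      refine ⟨by omega, hr3, hK3, by omega, fl, sl, hl3.skip rfl fun _ => ⟨hok, fun p h => ?_⟩⟩
      have := h.length_lt
      omega

/-- Each nonterminal adds at most `G.size + 1` nodes for positions, which leads to the quadratic bound
for the straight line program. -/
theorem reportAll_spec (σ : St) (hr : Ready E G T s go V σ)
    (hnp : σ.v .np + G.nT * (G.size + 1) + G.size + 3 < E.SZ) (hgo : go + G.nT < E.SZ) :
    WP E reportAll σ fun σ' t =>
      t ≤ (21 * (σ.v .nn - σ.v .ps) + 19 * G.size + 75) * G.nT + 4 ∧ Ready E G T s go V σ' ∧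
      Keep σ σ' ∧ σ'.v .np ≤ σ.v .np + G.nT * (G.size + 1) ∧ ∃ fl sl, Lists G T s G.nT fl sl σ' := by
  have hSZ := hr.tab.SZ_lt
  unfold reportAll
  simp only [wp, evs, tf, reduceCtorEq, hr.vgo]
  obtain ⟨σ1, hσ1⟩ : ∃ σ1, σ1 = (((σ.set .nf 0).set .ns 0).set .g go) := ⟨_, rfl⟩
  rw [← hσ1]
  have hK1 : Keep σ σ1 := by
    rw [hσ1]
    exact ((keep_set rfl (by simp)).trans (keep_set rfl (by simp))).trans (keep_set rfl (by simp))
  refine WP_while (fun n σ' => ∃ k, k + n = G.nT ∧ σ'.v .g = go + k ∧ Ready E G T s go V σ' ∧ Keep σ σ' ∧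
      σ'.v .np ≤ σ.v .np + k * (G.size + 1) ∧ ∃ fl sl, Lists G T s k fl sl σ')
    (21 * (σ.v .nn - σ.v .ps) + 19 * G.size + 74) ?_ ?_ (n := G.nT) ?_ ?_
  · rintro n σ' ⟨k, hk, hg, hr', -⟩
    simp [hg, hr'.tEnd]
    omega
  · rintro n σ' ⟨k, hk, hg, hr', hK', hnp', fl, sl, hl⟩ hne
    simp [hg, hr'.tEnd] at hne
    obtain ⟨N, rfl⟩ : ∃ N : Fin G.nT, N.val = k := ⟨⟨k, by omega⟩, rfl⟩
    have hmul := Nat.mul_le_mul_right (G.size + 1) (show N.val + 1 ≤ G.nT by omega)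
    rw [Nat.succ_mul] at hmul
    have hdone := hr'.done (.inl N)
    rw [idx_inl] at hdone
    have hmid : WP E (.ite (Arr.st Var.g) report .skip) σ' fun σ'' t =>
        t ≤ 21 * (σ.v .nn - σ.v .ps) + 19 * G.size + 71 ∧ Reported E G T s go V N.val σ' σ'' := by
      simp only [wp, evs, tf, hg, hr'.sz]
      refine ⟨by omega, fun h0 => ?_, fun h0 => ?_⟩
      · obtain ⟨hc, -⟩ := hdone.resolve_right fun h => h0 h.2
        refine (report_spec σ' hr' hl hc hg (by omega)).mono fun σ'' t h => ⟨?_, h.2⟩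
        rw [← hK'.v .nn rfl, ← hK'.v .ps rfl]
        omega
      · obtain ⟨hc, -⟩ := hdone.resolve_left fun h => by omega
        exact ⟨by omega, hr', .refl _, by omega, fl, sl, hl.skip rfl fun h => absurd h hc⟩
    refine WP_cut _ hmid.frame ?_
    rintro σ2 t2 ⟨⟨ht2, hr2, hk2, hnp2, fl', sl', hl2⟩, hF⟩
    have e_g : σ2.v .g = go + N.val := by rw [hF.v _ rfl, hg]
    simp only [wp, evs, tf, e_g]
    have hKs : Keep σ2 (σ2.set .g (go + N.val + 1)) := keep_set rfl (by simp)
    refine ⟨by omega, by omega, n - 1, by omega, N.val + 1, by omega, by omega,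
      hr2.keep hKs (by simpa using hr2.ppool), (hK'.trans hk2).trans hKs, ?_, fl', sl',
      hl2.keep hKs (by simp) (by simp) (by simp) (by simp) (by simp)⟩
    simp [Nat.succ_mul]
    omega
  · refine ⟨0, by omega, by rw [hσ1]; simp, hr.keep hK1 (by rw [hσ1]; simpa using hr.ppool), hK1,
      by rw [hσ1]; simp, [], [], ?_⟩
    refine ⟨by rw [hσ1]; simp, by rw [hσ1]; simp, by simp, by simp, by simp, by simp, by simp, by simp,
      by simp, by simp, by simp⟩
  · rintro n σ' t ⟨k, hk, hg, hr', hK', hnp', fl, sl, hl⟩ h0 ht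
    simp [hg, hr'.tEnd] at h0
    obtain rfl : k = G.nT := by omega
    rw [Nat.add_assoc _ 74 1, show 74 + 1 = 75 from rfl] at ht
    exact ⟨by omega, hr', hK', hnp', fl, sl, hl⟩

end Submatch

namespace Submatch

/-! ### The output -/

open Var Arr in
/-- Appends the value of `e` to the output. -/
def emit (e : Ex) : Cmd := .store out oo e ;; oo ≔ oo + 1

open Var Arr in
/-- Executes `body` with the values `0, …, n - 1` of `k`. -/
def forEach (n : Var) (body : Cmd) : Cmd := k ≔ 0 ;; .while (n - k) (body ;; k ≔ k + 1)

open Var Arr in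
/-- Writes the output. The nodes of positions are numbered from `1` on, the productions of a straight
line program from `0` on. -/
def output : Cmd :=
  oo ≔ 0 ;; emit nf ;; emit ns ;; emit np ;; forEach nf (emit (full k)) ;;
  forEach ns (emit (spN k) ;; emit (spP k - 1)) ;;
  forEach np (.ite (PL (k + 1)) (emit 1 ;; emit (PL (k + 1) - 1) ;; emit (PR (k + 1) - 1))
    (emit 0 ;; emit (PR (k + 1)))) ;;
  ret ≔ sz * Ex.lit Arr.out.idx

variable {F : Sig} {G : STG F} {E : Env}

/-- The list `l` has been written, and apart from that the state is `σ`. -/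
structure Wrote (E : Env) (σ : St) (l : List ℕ) (σ' : St) : Prop where
  v : ∀ x, x ≠ .oo → x ≠ .k → σ'.v x = σ.v x
  A : ∀ a, a ≠ .out → σ'.A a = σ.A a
  sz : σ.v .sz = E.SZ
  oo : σ'.v .oo = l.length
  out : ∀ i (h : i < l.length), σ'.A .out i = l[i]

theorem emit_spec {e : Ex} {σ σ' : St} {l : List ℕ} {a : ℕ} (h : Wrote E σ l σ') (hok : e.ok E σ')
    (he : e.ev σ' = a) (hl : l.length < E.SZ) :
    WP E (emit e) σ' fun σ'' t => t ≤ 2 ∧ Wrote E σ (l ++ [a]) σ'' ∧ σ''.v .k = σ'.v .k := by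
  have hM := E.hSZ
  have hoo := h.oo
  simp only [wp, evs, tf, emit, h.v .sz (by simp) (by simp), h.sz, he]
  refine ⟨⟨hok, by omega⟩, by omega, le_rfl,
    ⟨fun x h1 h2 => by simp [h1, h.v x h1 h2], fun a ha => by simp [ha, h.A a ha], h.sz, by simp [hoo],
      fun i hi => ?_⟩, by simp⟩
  rw [List.length_append, List.length_singleton] at hi
  simp only [evs, St.put_A_same, hoo]
  by_cases hil : i = l.length
  · subst hil; simp
  · rw [Function.update_of_ne hil, List.getElem_append_left (by omega), h.out i (by omega)]

/-- The value number `k` contributes the list `f k` to the output. -/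
theorem forEach_spec {n : Var} (hn : n ≠ .oo ∧ n ≠ .k) {body : Cmd} {c : ℕ} {f : ℕ → List ℕ} {σ σ' : St}
    {l : List ℕ} (h : Wrote E σ l σ') (hf : ∀ k, (f k).length ≤ 3) (hl : l.length + 3 * σ.v n ≤ E.SZ)
    (hb : ∀ l σ', Wrote E σ l σ' → σ'.v .k < σ.v n → l.length + 3 ≤ E.SZ →
      WP E body σ' fun σ'' t => t ≤ c ∧ Wrote E σ (l ++ f (σ'.v .k)) σ'' ∧ σ''.v .k = σ'.v .k) :
    WP E (forEach n body) σ' fun σ'' t => t ≤ (c + 2) * σ.v n + 2 ∧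
      Wrote E σ (l ++ (List.range (σ.v n)).flatMap f) σ'' ∧
      (l ++ (List.range (σ.v n)).flatMap f).length ≤ E.SZ := by
  have hM := E.hSZ
  have hw := E.hw
  have hset : ∀ {l σ'} (m : ℕ), Wrote E σ l σ' → Wrote E σ l (σ'.set .k m) := fun m h =>
    ⟨fun x h1 h2 => by simp [h2, h.v x h1 h2], fun a ha => by simp [h.A a ha], h.sz, by simp [h.oo],
      by simpa using h.out⟩
  simp only [wp, evs, tf, forEach]
  refine WP_while (fun m σ'' => σ''.v .k + m = σ.v n ∧
    (l ++ (List.range (σ''.v .k)).flatMap f).length + 3 * m ≤ E.SZ ∧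
    Wrote E σ (l ++ (List.range (σ''.v .k)).flatMap f) σ'') (c + 1) ?_ ?_ (n := σ.v n) ?_ ?_
  · rintro m σ'' ⟨h1, h2, h3⟩
    simp [h3.v n hn.1 hn.2]; omega
  · rintro m σ'' ⟨h1, h2, h3⟩ hne
    simp [h3.v n hn.1 hn.2] at hne
    refine WP_cut _ (hb _ σ'' h3 (by omega) (by omega)) ?_
    rintro σ1 t ⟨ht, h4, hk⟩
    simp only [wp, evs, tf, hk]
    refine ⟨by omega, by omega, m - 1, by omega, by omega, ?_, ?_⟩
    · have := hf (σ''.v .k)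
      simp only [List.range_succ, List.flatMap_append, List.flatMap_singleton,
        List.length_append] at h2 ⊢
      omega
    · simp only [List.range_succ, List.flatMap_append, List.flatMap_singleton]
      rw [← List.append_assoc]
      exact hset _ h4
  · exact ⟨by simp, by simpa using hl, by simpa using hset 0 h⟩
  · rintro m σ'' t ⟨h1, h2, h3⟩ h0 ht
    simp [h3.v n hn.1 hn.2] at h0
    grind

/-- The production of the node number `k + 1` of a pool of positions. -/
def slpRhs {L R : ℕ → ℕ} {n : ℕ} (h : Pool 0 L R n) (k : Fin n) : SLPRhs ℕ n :=
  if hk : L (k + 1) = 0 then .letter (R (k + 1)) else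
    have h' := (h (k + 1) (by omega) (by omega)).resolve_left hk
    .pair ⟨L (k + 1) - 1, by omega⟩ ⟨R (k + 1) - 1, by omega⟩

theorem lt_of_uses {L R : ℕ → ℕ} {n : ℕ} {h : Pool 0 L R n} {A B : Fin n} (hAB : (slpRhs h A).Uses B) :
    B < A := by
  rw [slpRhs] at hAB
  split_ifs at hAB with hk
  · cases hAB
  · have h' := (h (A + 1) (by omega) (by omega)).resolve_left hk
    cases hAB <;> (rw [Fin.lt_def]; simp only; omega)

/-- The straight line program of the nodes `1, …, n` of positions. -/
def slp {L R : ℕ → ℕ} {n : ℕ} (h : Pool 0 L R n) : SLP ℕ where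
  n := n
  prod := slpRhs h
  acyclic A hA := by
    have key : ∀ B, Relation.TransGen (fun A B => (slpRhs h A).Uses B) A B → B < A := by
      intro B hAB
      induction hAB with
      | single h => exact lt_of_uses h
      | tail _ h ih => exact (lt_of_uses h).trans ih
    exact lt_irrefl _ (key A hA)

theorem slp_val {L R : ℕ → ℕ} {n : ℕ} (h : Pool 0 L R n) (k : ℕ) (hk : k < n) :
    (slp h).val ⟨k, hk⟩ = wd L R (k + 1) := by
  induction k using Nat.strong_induction_on with
  | _ k ih =>
    rw [SLP.val]
    by_cases hL : L (k + 1) = 0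
    · rw [wd_letter (by omega) hL]
      split
      · next a ha => simp [slp, slpRhs, hL] at ha; rw [ha]
      · next a b ha => simp [slp, slpRhs, hL] at ha
    · have h' := (h (k + 1) (by omega) (by omega)).resolve_left hL
      rw [h.wd_pair (by omega) (by omega) hL]
      split
      · next a ha => simp [slp, slpRhs, hL] at ha
      · next a b ha =>
        simp [slp, slpRhs, hL] at ha
        obtain ⟨rfl, rfl⟩ := ha
        have e1 := ih (L (k + 1) - 1) (by omega) (by omega)
        have e2 := ih (R (k + 1) - 1) (by omega) (by omega)
        rw [show L (k + 1) - 1 + 1 = L (k + 1) by omega] at e1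
        rw [show R (k + 1) - 1 + 1 = R (k + 1) by omega] at e2
        exact congr_arg₂ (· ++ ·) e1 e2

/-- The output that a state represents. -/
def outputOf {fl : List (Fin G.nT)} {sl : List (Fin G.nT × ℕ)} {L R : ℕ → ℕ} {n : ℕ} (h : Pool 0 L R n)
    (hs : ∀ x ∈ sl, 0 < x.2 ∧ x.2 ≤ n) : SubmatchOutput G where
  pos := slp h
  full := fl
  split := sl.pmap (fun x hx => (x.1, (⟨x.2 - 1, by omega⟩ : Fin n))) hs

/-- Complete lists for all nonterminals form a correct output. -/
theorem Lists.correct {T : Fin G.nT} {s : Term F} {fl : List (Fin G.nT)} {sl : List (Fin G.nT × ℕ)}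
    {σ : St} (h : Lists G T s G.nT fl sl σ) (hP : Pool 0 (σ.A .PL) (σ.A .PR) (σ.v .np)) :
    (outputOf (fl := fl) hP h.node).Correct s T := by
  refine correct_of_lists h.fl_nodup ?_ (fun N => ?_) fun N p => ?_
  · have := h.sl_nodup
    simpa [outputOf, List.map_pmap] using this
  · exact (h.mem_full N).trans (and_iff_right N.2)
  · refine Iff.trans ?_ ((h.mem_split N p).trans (and_iff_right N.2))
    constructor
    · rintro ⟨P, hP', rfl⟩
      obtain ⟨x, hx, e⟩ := List.mem_pmap.1 hP'
      obtain ⟨rfl, rfl⟩ := Prod.ext_iff.1 e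
      have := h.node x hx
      refine ⟨x.2, hx, ?_⟩
      have e := slp_val hP (x.2 - 1) (by omega)
      rw [show x.2 - 1 + 1 = x.2 by omega] at e
      exact e.symm
    · rintro ⟨j, hj, rfl⟩
      have := h.node _ hj
      refine ⟨⟨j - 1, show j - 1 < σ.v .np by omega⟩, List.mem_pmap.2 ⟨_, hj, rfl⟩, ?_⟩
      have e := slp_val hP (j - 1) (by omega)
      rwa [show j - 1 + 1 = j by omega] at e

theorem range_flatMap {α β : Type*} (l : List α) (f : ℕ → List β) (g : α → List β)
    (h : ∀ i (hi : i < l.length), f i = g l[i]) : (List.range l.length).flatMap f = l.flatMap g := by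
  rw [List.flatMap_def, List.flatMap_def]
  congr 1
  exact List.ext_getElem (by simp) fun i h1 h2 => by simpa using h i (by simpa using h2)

theorem output_spec {T : Fin G.nT} {s : Term F} {fl : List (Fin G.nT)} {sl : List (Fin G.nT × ℕ)}
    (σ : St) (h : Lists G T s G.nT fl sl σ) (hP : Pool 0 (σ.A .PL) (σ.A .PR) (σ.v .np))
    (hsz : σ.v .sz = E.SZ) (hl : 3 + 3 * G.nT + 3 * σ.v .np ≤ E.SZ) :
    WP E output σ fun σ' t => t ≤ 6 * G.nT + 10 * σ.v .np + 20 ∧ σ'.v .ret = Arr.out.idx * E.SZ ∧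
      (outputOf (fl := fl) hP h.node).encode.length ≤ E.SZ ∧ ∀ i (hi : i < (outputOf (fl := fl) hP
        h.node).encode.length),
        σ'.A .out i = (outputOf (fl := fl) hP h.node).encode[i] := by
  have hM := E.hSZ
  have hw := E.hw
  have hnf := h.nf
  have hns := h.ns
  have hlen := h.len
  simp only [wp, evs, tf, output]
  have h0 : Wrote E σ [] (σ.set .oo 0) :=
    ⟨fun x hx _ => by simp [hx], fun _ _ => rfl, hsz, by simp, by simp⟩
  refine WP_cut _ (emit_spec h0 (a := σ.v .nf) trivial (by simp) (by simp; omega)) ?_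
  rintro σ1 t1 ⟨ht1, h1, -⟩
  refine WP_cut _ (emit_spec h1 (a := σ.v .ns) trivial (h1.v _ (by simp) (by simp)) (by simp; omega)) ?_
  rintro σ2 t2 ⟨ht2, h2, -⟩
  refine WP_cut _ (emit_spec h2 (a := σ.v .np) trivial (h2.v _ (by simp) (by simp)) (by simp; omega)) ?_
  rintro σ3 t3 ⟨ht3, h3, -⟩
  refine WP_cut _ (forEach_spec (n := .nf) (by simp) (c := 2) (f := fun k => [σ.A .full k]) h3 (by simp)
    (by simp; omega) ?_) ?_
  · intro l σ' hl' hk hl3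
    refine emit_spec hl' ⟨trivial, ?_, .inr ?_⟩ (by simp [hl'.A]) (by omega)
    · simp; omega
    · rw [hl'.v _ (by simp) (by simp), hsz]
  rintro σ4 t4 ⟨ht4, h4, -⟩
  refine WP_cut _ (forEach_spec (n := .ns) (by simp) (c := 4) (f := fun k => [σ.A .spN k, σ.A .spP k - 1])
    h4 (by simp) (by simp [List.length_flatMap]; omega) ?_) ?_
  · intro l σ' hl' hk hl3
    have hs' : σ'.v .sz = E.SZ := by rw [hl'.v _ (by simp) (by simp), hsz]
    refine WP_cut _ (emit_spec hl' (a := σ.A .spN (σ'.v .k)) ⟨trivial, by simp; omega, .inr hs'⟩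
      (by simp [hl'.A]) (by omega)) ?_
    rintro σ'' t ⟨ht, hl'', hk'⟩
    have hs'' : σ''.v .sz = E.SZ := by rw [hl''.v _ (by simp) (by simp), hsz]
    have hx := h.node _ (List.getElem_mem (show σ'.v .k < sl.length by omega))
    rw [← h.spP] at hx
    refine (emit_spec hl'' (a := σ.A .spP (σ'.v .k) - 1) ?_ (by simp [hl''.A, hk']) (by simp; omega)).mono ?_
    · simp [hl''.A, hk', hs'']; omega
    · grind
  rintro σ5 t5 ⟨ht5, h5, -⟩
  refine WP_cut _ (forEach_spec (n := .np) (by simp) (c := 7)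
    (f := fun k => if σ.A .PL (k + 1) = 0 then [0, σ.A .PR (k + 1)] else
      [1, σ.A .PL (k + 1) - 1, σ.A .PR (k + 1) - 1]) h5 (fun k => by split_ifs <;> simp)
    (by simp [List.length_flatMap]; omega) ?_) ?_
  · intro l σ' hl' hk hl3
    have hs' : σ'.v .sz = E.SZ := by rw [hl'.v _ (by simp) (by simp), hsz]
    have hPk := hP (σ'.v .k + 1) (by omega) (by omega)
    simp only [wp, evs, tf, hs', hl'.A .PL (by simp)]
    refine ⟨by omega, fun hL => ?_, fun hL => ?_⟩
    · have hPk := hPk.resolve_left hL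
      rw [if_neg hL]
      refine WP_cut _ (emit_spec hl' (a := 1) (by simp) (by simp) (by omega)) ?_
      rintro σ'' t ⟨ht, hl'', hk'⟩
      have hs'' : σ''.v .sz = E.SZ := by rw [hl''.v _ (by simp) (by simp), hsz]
      refine WP_cut _ (emit_spec hl'' (a := σ.A .PL (σ'.v .k + 1) - 1) ?_ (by simp [hl''.A, hk'])
        (by simp; omega)) ?_
      · simp [hl''.A, hk', hs'']; omega
      rintro σ2 t' ⟨ht', hl2, hk2⟩
      have hs2 : σ2.v .sz = E.SZ := by rw [hl2.v _ (by simp) (by simp), hsz]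
      refine (emit_spec hl2 (a := σ.A .PR (σ'.v .k + 1) - 1) ?_ (by simp [hl2.A, hk', hk2])
        (by simp; omega)).mono ?_
      · simp [hl2.A, hk', hk2, hs2]; omega
      · grind
    · rw [if_pos hL]
      refine WP_cut _ (emit_spec hl' (a := 0) (by simp) (by simp) (by omega)) ?_
      rintro σ'' t ⟨ht, hl'', hk'⟩
      have hs'' : σ''.v .sz = E.SZ := by rw [hl''.v _ (by simp) (by simp), hsz]
      refine (emit_spec hl'' (a := σ.A .PR (σ'.v .k + 1)) ?_ (by simp [hl''.A, hk'])
        (by simp; omega)).mono ?_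
      · simp [hk', hs'']; omega
      · grind
  rintro σ6 t6 ⟨ht6, h6, hl6⟩
  have hb := Arr.out.base_lt (E := E)
  simp only [wp, evs, tf, h6.v .sz (by simp) (by simp), hsz]
  rw [Nat.mul_comm E.SZ]
  have h32 := Arr.out.idx_lt
  refine ⟨by omega, by omega, by simp, ?_⟩
  have key : (outputOf (fl := fl) hP h.node).encode = [] ++ [σ.v .nf] ++ [σ.v .ns] ++ [σ.v .np] ++
      (List.range (σ.v .nf)).flatMap (fun k => [σ.A .full k]) ++
      (List.range (σ.v .ns)).flatMap (fun k => [σ.A .spN k, σ.A .spP k - 1]) ++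
      (List.range (σ.v .np)).flatMap (fun k => if σ.A .PL (k + 1) = 0 then [0, σ.A .PR (k + 1)] else
        [1, σ.A .PL (k + 1) - 1, σ.A .PR (k + 1) - 1]) := by
    rw [hnf, hns, range_flatMap fl _ (fun x => [x.val]) (fun i hi => by rw [h.full i hi]),
      range_flatMap sl _ (fun x => [x.1.val, x.2 - 1]) (fun i hi => by rw [h.spN i hi, h.spP i hi])]
    have e3 : (List.range (σ.v .np)).flatMap (fun k => if σ.A .PL (k + 1) = 0 then
        [0, σ.A .PR (k + 1)] else [1, σ.A .PL (k + 1) - 1, σ.A .PR (k + 1) - 1]) =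
        (List.ofFn fun P => (slpRhs hP P).encode).flatten := by
      rw [List.flatMap_def]
      congr 1
      refine List.ext_getElem (by simp) fun i h1 h2 => ?_
      simp only [List.getElem_map, List.getElem_range, List.getElem_ofFn, slpRhs]
      split_ifs <;> rfl
    rw [e3]
    simp [SubmatchOutput.encode, outputOf, slp, List.map_pmap, List.flatMap]
    rw [List.map_eq_flatMap, List.flatMap_def]
  simp only [key]
  exact ⟨hl6, by simpa using h6.out⟩

end Submatch

namespace Submatch

/-! ### The program -/

open Var Arr in
/-- Reads a grammar and computes the words of the nonterminals that contribute to its start symbol. -/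
def load : Cmd := traverse storeProd ;; dfs

open Var Arr in
/-- The program for ground compressed submatching. The first two traversals find the length of the
input, on which the size of the memory blocks depends. -/
def main : Cmd :=
  p ≔ 0 ;; go ≔ 0 ;; traverse .skip ;; go ≔ gEnd ;; traverse .skip ;; sz ≔ Ex.lit 100 * p * p ;;
  p ≔ 0 ;; go ≔ 0 ;; q ≔ 0 ;; load ;; sR ≔ WL root ;; ps ≔ nn ;; go ≔ gEnd ;; np ≔ 0 ;; q ≔ 0 ;; load ;;
  table ;; pu ≔ sR ;; reportAll ;; output

variable {F : Sig} {G : STG F} {E : Env}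

theorem kids_length_le {r : ℕ} (hF : ∀ f, F.arity f ≤ r) (N : G.NT) : (kids N).length ≤ r + 2 := by
  match N with
  | .inl A =>
    cases h : G.termProd A with
    | app f args => have := hF f; simp [kids, h]; omega
    | _ => simp [kids, h]
  | .inr C =>
    cases h : G.ctxProd C with
    | app f i args => have := hF f; simp [kids, h]; omega
    | _ => simp [kids, h]

theorem encOf_length {r : ℕ} (hF : ∀ f, F.arity f ≤ r) (N : G.NT) :
    (kids N).length < (encOf N).length ∧ (encOf N).length ≤ r + 4 := by
  match N with
  | .inl A =>
    cases h : G.termProd A with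
    | app f args => have := hF f; simp [kids, h, encOf, TermRhs.encode]; omega
    | _ => simp [kids, h, encOf, TermRhs.encode]
  | .inr C =>
    cases h : G.ctxProd C with
    | app f i args => have := hF f; simp [kids, h, encOf, CtxRhs.encode]; omega
    | _ => simp [kids, h, encOf, CtxRhs.encode]

theorem encode_length (A : Fin G.nT) :
    (G.encode A).length = 3 + ∑ k : Fin (G.nT + G.nC), (encOf (finSumFinEquiv.symm k : G.NT)).length := by
  rw [encode_eq]
  simp [encs, List.length_flatten, List.sum_ofFn]
  omega

theorem encode_length_le {r : ℕ} (hF : ∀ f, F.arity f ≤ r) (A : Fin G.nT) :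
    (G.encode A).length ≤ 3 + (r + 4) * G.size := by
  rw [encode_length]
  have := Finset.sum_le_card_nsmul Finset.univ
    (fun k : Fin (G.nT + G.nC) => (encOf (finSumFinEquiv.symm k : G.NT)).length) (r + 4)
    fun k _ => (encOf_length hF _).2
  simp at this
  rw [STG.size, Nat.mul_comm]
  omega

theorem weight_gr (go : ℕ) :
    ((gr G go).weight fun _ => True) =
      ∑ k : Fin (G.nT + G.nC), ((kids (finSumFinEquiv.symm k : G.NT)).length + 1) := by
  have h : ∀ k : Fin (G.nT + G.nC), (gr G go).nch (go + k) = (kids (finSumFinEquiv.symm k : G.NT)).length :=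
    by
    intro k
    rw [← gr_nch (go := go)]
    simp [idx]
  simp only [← h]
  rw [Finset.sum_fin_eq_sum_range, Gr.weight, Finset.filter_true]
  change ∑ g ∈ Finset.Ico go (go + G.size), _ = _
  rw [Finset.sum_Ico_eq_sum_range, Nat.add_sub_cancel_left]
  exact Finset.sum_congr rfl fun k hk => by rw [dif_pos (Finset.mem_range.1 hk)]

/-- The encoding of a production is longer than the list of its children, so that the length of the
input bounds the numbers of nodes. The program can compute this bound; it does not know `r`. -/
theorem weight_le_encode {r : ℕ} (hF : ∀ f, F.arity f ≤ r) (go : ℕ) (A : Fin G.nT) :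
    ((gr G go).weight fun _ => True) + 3 ≤ (G.encode A).length := by
  rw [weight_gr, encode_length, Nat.add_comm]
  exact Nat.add_le_add_left (Finset.sum_le_sum fun k _ => (encOf_length hF _).1) 3

theorem weight_le {r : ℕ} (hF : ∀ f, F.arity f ≤ r) (go : ℕ) :
    ((gr G go).weight fun _ => True) ≤ (r + 3) * G.size := by
  rw [weight_gr, STG.size, Nat.mul_comm]
  have := Finset.sum_le_card_nsmul Finset.univ
    (fun k : Fin (G.nT + G.nC) => (kids (finSumFinEquiv.symm k : G.NT)).length + 1) (r + 3)
    fun k _ => Nat.succ_le_succ (kids_length_le hF _)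
  simpa using this

theorem size_le_weight (go : ℕ) : G.size ≤ (gr G go).weight fun _ => True := by
  rw [weight_gr]
  have := Finset.card_nsmul_le_sum Finset.univ
    (fun k : Fin (G.nT + G.nC) => (kids (finSumFinEquiv.symm k : G.NT)).length + 1) 1 fun k _ => by simp
  simpa [STG.size] using this

/-- The entries of the input fit into words. -/
theorem mem_encode {m r : ℕ} (hF : ∀ f, F.arity f ≤ r) (hm : r < m ∧ F.card ≤ m ∧ G.size < m ∧ 2 < m)
    (A : Fin G.nT) : ∀ x ∈ G.encode A, x < m := by
  have hs : G.size = G.nT + G.nC := rfl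
  have hA := A.2
  have hT : ∀ B : Fin G.nT, B.val < m := fun B => by have := B.2; omega
  have hC : ∀ B : Fin G.nC, B.val < m := fun B => by have := B.2; omega
  rw [encode_eq]
  intro x hx
  simp only [List.mem_cons, List.mem_flatten, encs, List.mem_ofFn] at hx
  rcases hx with rfl | rfl | rfl | ⟨l, ⟨k, rfl⟩, hx⟩
  · omega
  · omega
  · omega
  · generalize finSumFinEquiv.symm k = N at hx
    match N with
    | .inl A =>
      cases h : G.termProd A with
      | app f args =>
        have := hF f
        simp only [encOf, h, TermRhs.encode, List.mem_cons, List.mem_ofFn] at hx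
        rcases hx with rfl | rfl | rfl | ⟨j, rfl⟩
        · omega
        · have := f.2; omega
        · omega
        · exact hT _
      | comp C B =>
        simp [encOf, h, TermRhs.encode] at hx
        rcases hx with rfl | rfl | rfl
        · omega
        · exact hC _
        · exact hT _
      | lam B =>
        simp [encOf, h, TermRhs.encode] at hx
        rcases hx with rfl | rfl
        · omega
        · exact hT _
    | .inr C =>
      cases h : G.ctxProd C with
      | hole => simp [encOf, h, CtxRhs.encode] at hx; omega
      | comp C1 C2 =>
        simp [encOf, h, CtxRhs.encode] at hx
        rcases hx with rfl | rfl | rfl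
        · omega
        · exact hC _
        · exact hC _
      | app f i args =>
        have := hF f
        simp only [encOf, h, CtxRhs.encode, List.mem_cons, List.mem_ofFn] at hx
        rcases hx with rfl | rfl | rfl | rfl | ⟨j, rfl⟩
        · omega
        · have := f.2; omega
        · omega
        · have := i.2; omega
        · split_ifs
          · omega
          · exact hT _

/-- The grammar has been read, and the words of the nonterminals that contribute to `A` have been
computed. -/
structure Loaded (E : Env) (G : STG F) (A : Fin G.nT) (go lo B : ℕ) (σ σ' : St) : Prop where
  words : Words E lo B σ'
  ext : ExtS σ σ'
  nn : σ'.v .nn ≤ σ.v .nn + (gr G go).weight fun _ => True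
  np : σ'.v .np ≤ σ.v .np + (gr G go).weight fun _ => True
  root : σ'.v .root = go + A.val
  tEnd : σ'.v .tEnd = go + G.nT
  gEnd : σ'.v .gEnd = go + G.size
  vgo : σ'.v .go = go
  p : σ'.v .p = σ.v .p + (G.encode A).length
  inp : σ'.A .inp = σ.A .inp
  holds : ∀ N : G.NT, Holds E (gr G go) σ' (go + idx N)
  done : ∀ N : G.NT, (Relation.ReflTransGen G.Uses (.inl A) N ∧ σ'.A .st (go + idx N) = 2 ∧
    Done (gr G go) lo σ' (go + idx N)) ∨
    (¬ Relation.ReflTransGen G.Uses (.inl A) N ∧ σ'.A .st (go + idx N) = 0)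

/-- At most as many nodes are added as the encoding has entries. -/
theorem load_spec {go lo B r : ℕ} (A : Fin G.nT) (σ : St) (hF : ∀ f, F.arity f ≤ r) (hcard : F.card ≤ E.M)
    (hgl : go + G.size ≤ E.SZ) (hgo : σ.v .go = go) (hR : Reads σ (σ.v .p) (G.encode A))
    (hp : σ.v .p + (G.encode A).length ≤ E.SZ) (hq : σ.v .q ≤ σ.v .p + 3) (hw : Words E lo B σ)
    (hB : σ.v .nn + (G.encode A).length ≤ B) (hBp : σ.v .np + (G.encode A).length ≤ B) :
    WP E load σ fun σ' t =>
      t ≤ (5 * (r + 2) + 39) * G.size + 6 + ((13 * (r + 2) + 71) * ((r + 3) * G.size + 1) + 3) ∧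
      Loaded E G A go lo B σ σ' := by
  have hW := weight_le_encode hF go A
  have hW' := weight_le (G := G) hF go
  have hk := kids_length_le (G := G) hF
  have hA := A.2
  refine WP_cut _ (traverse_spec (5 * (r + 2) + 10) (fun m n σ' => Stored E G go m n σ') A σ
    (fun N σ' hS hD hg hp => storeProd_spec hw.SZ_lt hcard hgl hk N σ' hS hD hg hp) rfl ?_ hgo hR hp hgl
    ⟨hw.sz, hq, fun N h => absurd h (by omega)⟩).frame ?_
  · rintro m n σ1 σ2 ⟨h1, h2, h3⟩ hq hsz hA
    refine ⟨by rw [hsz, h1], by rw [hq]; exact h2, fun N hN => ?_⟩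
    obtain ⟨a1, a2, a3⟩ := h3 N hN
    exact ⟨a1.congr fun a _ => by rw [hA], by rw [hA, hq]; exact a2, by rw [hA, a3]⟩
  rintro σ1 t1 ⟨⟨ht1, hroot, hT, hE, hgo', hinp, hp', hS⟩, hF1⟩
  have hs := SameP.frame hF1 rfl
  have hroot' : σ1.v .root = go + idx (.inl A : G.NT) := by rw [hroot, idx_inl]
  have hsize : G.size = G.nT + G.nC := rfl
  refine (dfs_spec (gr_ok G go) (r := r + 2) (lo := lo) (B := B) hgl
    (gr_forall fun N => by rw [gr_nch]; exact hk N) σ1 (by omega)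
    (by rw [hs.nn]; omega) (by rw [hs.np]; omega) (hs.words hw)
    (gr_forall fun N => (hS.holds N (idx_lt N)).1)
    (gr_forall fun N => (hS.holds N (idx_lt N)).2.2) (by rw [hroot]; exact Nat.le_add_right ..)
    (by rw [hroot]; change _ < go + G.size; omega)).frame.mono ?_
  rintro σ2 t2 ⟨⟨ht2, hw2, hx, hnn, hnp, hD⟩, hF2⟩
  rw [hs.nn] at hnn
  rw [hs.np] at hnp
  refine ⟨?_, hw2, hs.ext.trans hx, hnn, hnp, by rw [hF2.v _ rfl, hroot], by rw [hF2.v _ rfl, hT],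
    by rw [hF2.v _ rfl, hE], by rw [hF2.v _ rfl, hgo'], by rw [hF2.v _ rfl, hp'],
    by rw [hF2.A _ rfl, hinp],
    fun N => (hS.holds N (idx_lt N)).1.frame hF2 rfl, fun N => ?_⟩
  · have := Nat.mul_le_mul_left (13 * (r + 2) + 71) (Nat.succ_le_succ hW')
    grind
  · have := hD (go + idx N) (Nat.le_add_right ..) (Nat.add_lt_add_left (idx_lt N) go)
    rw [hroot', gr_reach] at this
    exact this

/-- A traversal that only finds the end of the encoded grammar. -/
theorem scan_spec {go : ℕ} (A : Fin G.nT) (σ : St) (hgo : σ.v .go = go)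
    (hR : Reads σ (σ.v .p) (G.encode A)) (hp : σ.v .p + (G.encode A).length ≤ E.SZ)
    (hgl : go + G.size ≤ E.SZ) :
    WP E (traverse .skip) σ fun σ' t => t ≤ 30 * G.size + 6 ∧ σ'.v .gEnd = go + G.size ∧
      σ'.v .p = σ.v .p + (G.encode A).length ∧ σ'.A = σ.A ∧ σ'.v .nn = σ.v .nn ∧ σ'.v .np = σ.v .np :=
  (traverse_spec 1 (fun _ _ _ => True) A σ (fun _ _ _ _ _ _ => WP_skip.2 ⟨le_rfl, trivial⟩) rfl
    (fun _ _ _ _ _ _ _ _ => trivial) hgo hR hp hgl trivial).frame.mono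
    fun _ _ ⟨⟨h1, _, _, h2, _, _, h3, _⟩, hF⟩ =>
      ⟨h1, h2, h3, funext fun a => hF.A a rfl, hF.v _ rfl, hF.v _ rfl⟩

/-- The factor in the bound for the number of elementary steps. -/
def stepFactor (r : ℕ) : ℕ :=
  (30 + (5 * (r + 2) + 39) + (13 * (r + 2) + 71) * (r + 3) + 10 * (r + 3)) +
  (121 + (5 * (r + 2) + 39) + (13 * (r + 2) + 71) * (r + 3) + 10 * (r + 3)) +
  (21 * (r + 3) + 29) + 800 * (r + 3) ^ 2 + 302 * (r + 3) ^ 3 + (84 + 2 * (13 * (r + 2) + 71))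

/-- The sum of the bounds for the parts of the program; `a` and `b` are the sizes of the two grammars,
`u` and `v` the numbers of nodes for patterns and texts, `n` is the number of term nonterminals and `p`
that of nodes for positions. -/
theorem steps_le {r a b u v n p : ℕ} (ha : 0 < a) (hb : 0 < b) (hu : u ≤ (r + 3) * a)
    (hv : v ≤ (r + 3) * b) (hn : n ≤ b) (hp : p ≤ (r + 3) * b + n * (b + 1)) :
    (30 * a + 6) + (30 * b + 6) +
      ((5 * (r + 2) + 39) * a + 6 + ((13 * (r + 2) + 71) * ((r + 3) * a + 1) + 3)) +
      ((5 * (r + 2) + 39) * b + 6 + ((13 * (r + 2) + 71) * ((r + 3) * b + 1) + 3)) +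
      (u * (v * (302 * v + 800) + 10) + 10) + ((21 * v + 19 * b + 75) * n + 4) + (6 * n + 10 * p + 20) + 20 ≤
    stepFactor r * (b ^ 2 * a) := by
  have hp' : p ≤ (r + 3) * b + b * (b + 1) := hp.trans (by gcongr)
  have h1 : a ≤ b ^ 2 * a := Nat.le_mul_of_pos_left _ (by positivity)
  have h2 : b ^ 2 ≤ b ^ 2 * a := Nat.le_mul_of_pos_right _ ha
  have h3 : b ≤ b ^ 2 * a := (Nat.le_self_pow two_ne_zero b).trans h2
  have h4 : b * a ≤ b ^ 2 * a := Nat.mul_le_mul_right _ (Nat.le_self_pow two_ne_zero b)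
  have h5 : 1 ≤ b ^ 2 * a := Nat.one_le_iff_ne_zero.2 (by positivity)
  -- the bounds for `u`, `v`, `n` and `p` are inserted, and every monomial is at most `b ^ 2 * a`
  calc _ ≤ (30 * a + 6) + (30 * b + 6) +
      ((5 * (r + 2) + 39) * a + 6 + ((13 * (r + 2) + 71) * ((r + 3) * a + 1) + 3)) +
      ((5 * (r + 2) + 39) * b + 6 + ((13 * (r + 2) + 71) * ((r + 3) * b + 1) + 3)) +
      ((r + 3) * a * ((r + 3) * b * (302 * ((r + 3) * b) + 800) + 10) + 10) +
      ((21 * ((r + 3) * b) + 19 * b + 75) * b + 4) + (6 * b + 10 * ((r + 3) * b + b * (b + 1)) + 20) + 20 :=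
        by
        gcongr
    _ = (30 + (5 * (r + 2) + 39) + (13 * (r + 2) + 71) * (r + 3) + 10 * (r + 3)) * a +
      (121 + (5 * (r + 2) + 39) + (13 * (r + 2) + 71) * (r + 3) + 10 * (r + 3)) * b +
      (21 * (r + 3) + 29) * b ^ 2 + 800 * (r + 3) ^ 2 * (b * a) + 302 * (r + 3) ^ 3 * (b ^ 2 * a) +
      (84 + 2 * (13 * (r + 2) + 71)) * 1 := by ring
    _ ≤ (30 + (5 * (r + 2) + 39) + (13 * (r + 2) + 71) * (r + 3) + 10 * (r + 3)) * (b ^ 2 * a) +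
      (121 + (5 * (r + 2) + 39) + (13 * (r + 2) + 71) * (r + 3) + 10 * (r + 3)) * (b ^ 2 * a) +
      (21 * (r + 3) + 29) * (b ^ 2 * a) + 800 * (r + 3) ^ 2 * (b ^ 2 * a) + 302 * (r + 3) ^ 3 * (b ^ 2 * a) +
      (84 + 2 * (13 * (r + 2) + 71)) * (b ^ 2 * a) := by gcongr
    _ = _ := by rw [stepFactor]; ring

end Submatch

namespace Submatch

/-! ### The specification of the program -/

variable {F : Sig} {G : STG F} {E : Env}

set_option maxHeartbeats 400000 in
/-- The words of `S` are nodes of the pool before those of `T`: the nodes up to `ps` are the patterns,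
the later ones the texts. The lengths of words are at most `2 ^ e`, where `e` is the length of the
input, as each node at most doubles them. -/
theorem main_spec {r e : ℕ} {GS GT : STG F} (S : Fin GS.nT) (T : Fin GT.nT) (hF : ∀ f, F.arity f ≤ r)
    (he : e = (GS.encode S).length + (GT.encode T).length) (hSZ : E.SZ = 100 * e * e)
    (hV : 16 * 2 ^ e + 16 < E.M) (hcard : F.card ≤ E.M) (σ : St) (hv : ∀ x, σ.v x = 0)
    (hA : ∀ a, a ≠ .inp → ∀ k, σ.A a k = 0) (hR : Reads σ 0 (GS.encode S ++ GT.encode T)) :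
    WP E main σ fun σ' t => ∃ O : SubmatchOutput GT, O.Correct (GS.valT S) T ∧
      O.full.length + O.split.length ≤ GT.size ∧ O.pos.n ≤ (r + 3) * GT.size + GT.nT * (GT.size + 1) ∧
      t ≤ stepFactor r * (GT.size ^ 2 * GS.size) ∧ σ'.v .ret = Arr.out.idx * E.SZ ∧
      O.encode.length ≤ E.SZ ∧ ∀ i (hi : i < O.encode.length), σ'.A .out i = O.encode[i] := by
  have hM := E.hSZ
  have hw := E.hw
  have hS := S.2
  have hT := T.2
  have hGS : GS.size = GS.nT + GS.nC := rfl
  have hGT : GT.size = GT.nT + GT.nC := rfl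
  obtain ⟨ℓS, hℓS⟩ : ∃ ℓ, ℓ = (GS.encode S).length := ⟨_, rfl⟩
  obtain ⟨ℓT, hℓT⟩ : ∃ ℓ, ℓ = (GT.encode T).length := ⟨_, rfl⟩
  have hWS := weight_le_encode hF 0 S
  have hWT := weight_le_encode hF GS.size T
  have hWS' := weight_le (G := GS) hF 0
  have hWT' := weight_le (G := GT) hF GS.size
  have hsS : GS.size ≤ (gr GS 0).weight fun _ => True := size_le_weight 0
  have hsT : GT.size ≤ (gr GT GS.size).weight fun _ => True := size_le_weight _
  rw [← hℓS] at hWS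
  rw [← hℓT] at hWT
  rw [← hℓS, ← hℓT] at he
  obtain ⟨hRS, hRT⟩ := reads_append.1 hR
  rw [← hℓS, Nat.zero_add] at hRT
  -- the length of a block exceeds all numbers of nodes
  have hq : 100 * e ≤ 100 * e * e := Nat.le_mul_of_pos_right _ (by omega)
  have hsq : GT.nT * (GT.size + 1) ≤ e * e := Nat.mul_le_mul (by omega) (by omega)
  have hsq2 : (e + 1) * (e + 1) ≤ (2 * e) * (2 * e) := Nat.mul_le_mul (by omega) (by omega)
  have hee : 100 * e * e = 100 * (e * e) := Nat.mul_assoc ..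
  have hee2 : (2 * e) * (2 * e) = 4 * (e * e) := by ring
  simp only [wp, evs, tf, main]
  refine WP_cut _ (scan_spec (go := 0) S _ (by simp) (by simp; exact hRS.congr (by simp)) (by simp [← hℓS]; omega)
    (by omega)) ?_
  rintro σ1 t1 ⟨ht1, hgE1, hp1, hA1, hnn1, hnp1⟩
  simp [hv, ← hℓS] at hgE1 hp1 hA1 hnn1 hnp1
  simp only [wp, evs, tf, hgE1]
  refine WP_cut _ (scan_spec (go := GS.size) T _ (by simp)
    (by simp [hp1]; exact hRT.congr (by simp [hA1])) (by simp [hp1, ← hℓT]; omega) (by omega)) ?_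
  rintro σ2 t2 ⟨ht2, -, hp2, hA2, hnn2, hnp2⟩
  simp [hp1, ← hℓT] at hp2
  simp [hA1] at hA2
  simp [hnn1, hnp1] at hnn2 hnp2
  -- the two traversals have found the length of the input, hence the length of a block
  simp only [wp, evs, tf, hp2, ← he]
  refine ⟨by omega, ?_⟩
  obtain ⟨σ3, hσ3⟩ : ∃ σ3, σ3 = ((((σ2.set .sz (100 * e * e)).set .p 0).set .go 0).set .q 0) := ⟨_, rfl⟩
  rw [← hσ3]
  have hA3 : σ3.A = σ.A := by rw [hσ3]; simp [hA2]
  have hnn3 : σ3.v .nn = 0 := by rw [hσ3]; simp [hnn2]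
  have hnp3 : σ3.v .np = 0 := by rw [hσ3]; simp [hnp2]
  have hp3 : σ3.v .p = 0 := by rw [hσ3]; simp
  have hW3 : Words E 0 e σ3 := by
    refine ⟨by rw [hσ3]; simp [hSZ], by omega, by omega, by rw [pow_succ]; omega, by omega, by omega, by
      omega,
      by rw [hA3, hA _ (by simp)], fun k h1 h2 => by omega, fun k hk => ?_, fun k hk => ?_,
      fun k h1 h2 => by omega⟩
    · simp_all
    · rw [hA3, hA _ (by simp)]; omega
  refine WP_cut _ (load_spec (go := 0) S σ3 hF hcard (by omega) (by rw [hσ3]; simp)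
    (by rw [hp3]; exact hRS.congr (by rw [hA3])) (by rw [hp3, ← hℓS]; omega) (by rw [hσ3]; simp) hW3
    (by rw [hnn3, ← hℓS]; omega) (by rw [hnp3, ← hℓS]; omega)) ?_
  rintro σ4 t4 ⟨ht4, h4⟩
  have hSS : σ4.A .WL (σ4.v .root) = σ4.A .WL (0 + idx (.inl S : GS.NT)) := by rw [h4.root, idx_inl]
  obtain ⟨-, -, hDS⟩ := (h4.done (.inl S)).resolve_right fun h => h.1 .refl
  have hnnS := h4.nn
  have hpS := h4.p
  rw [hp3, ← hℓS] at hpS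
  rw [hnn3] at hnnS
  simp only [wp, evs, tf, reduceCtorEq, h4.gEnd, h4.words.sz, h4.root]
  refine ⟨by omega, ?_⟩
  rw [← h4.root, hSS]
  obtain ⟨sR, hsR⟩ : ∃ sR, sR = σ4.A .WL (0 + idx (.inl S : GS.NT)) := ⟨_, rfl⟩
  rw [← hsR]
  obtain ⟨σ5, hσ5⟩ : ∃ σ5, σ5 = (((((σ4.set .sR sR).set .ps (σ4.v .nn)).set .go (0 + GS.size)).set .np 0).set
    .q 0) := ⟨_, rfl⟩
  rw [← hσ5]
  have hA5 : σ5.A = σ4.A := by rw [hσ5]; simp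
  have hnn5 : σ5.v .nn = σ4.v .nn := by rw [hσ5]; simp
  have hps5 : σ5.v .ps = σ4.v .nn := by rw [hσ5]; simp
  have hp5 : σ5.v .p = ℓS := by rw [hσ5]; simp [hpS]
  have hW5 : Words E (σ4.v .nn) e σ5 := by
    obtain ⟨a1, a2, a3, a4, a5, a6, a7, a8, a9, a10, a11, a12⟩ := h4.words
    exact ⟨by rw [hσ5]; simpa using a1, a2, a3, a4, hnn5.ge, by rw [hnn5]; exact a6, by rw [hσ5]; simp,
      by rw [hA5, a8], fun k h1 h2 => by omega, by rw [hnn5, hA5]; exact a10, by rw [hnn5, hA5]; exact a11,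
      fun k h1 h2 => by rw [hσ5] at h2; simp at h2; omega⟩
  refine WP_cut _ (load_spec (go := GS.size) T σ5 hF hcard (by omega) (by rw [hσ5]; simp)
    (by rw [hp5]; exact hRT.congr (by rw [hA5, h4.inp, hA3]))
    (by rw [hp5, ← hℓT]; omega) (by rw [hσ5]; simp) hW5
    (by rw [hnn5, ← hℓT]; omega) (by rw [hσ5]; simp [← hℓT]; omega)).frame ?_
  rintro σ6 t6 ⟨⟨ht6, h6⟩, hF6⟩
  have hps6 : σ6.v .ps = σ4.v .nn := by rw [hF6.v _ rfl, hps5]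
  have hsR6 : σ6.v .sR = sR := by rw [hF6.v _ rfl, hσ5]; simp
  have hnnT := h6.nn
  have hnpT := h6.np
  have hx := h6.ext.w
  rw [hnn5, hA5] at hx
  rw [hnn5] at hnnT
  rw [show σ5.v .np = 0 by rw [hσ5]; simp] at hnpT
  have hW6 := h6.words
  -- loading the text grammar has left the nodes of the pattern grammar alone
  have hC : TabC E (σ6.A .L) (σ6.A .R) (σ6.A .len) (σ6.v .ps) (σ6.v .nn) (2 ^ e) := by
    refine ⟨hW6.L0, fun k h1 h2 => ?_, by rw [hps6]; exact hW6.pool, by rw [hps6]; exact hW6.lo_le, hW6.len,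
      fun k hk => hW6.length_le hk, hV, ?_, hW6.R_lt⟩
    · rw [hx.L k (by omega), hx.R k (by omega)]
      exact h4.words.pool k h1 (by omega)
    · have := Nat.mul_le_mul (Nat.succ_le_succ hW6.nn_le) (Nat.succ_le_succ hW6.nn_le)
      simp only [Nat.succ_eq_add_one] at this
      omega
  refine WP_cut _ (table_spec hC σ6 ⟨hW6.sz, rfl, rfl, rfl, rfl, rfl⟩).frame ?_
  rintro σ7 t7 ⟨⟨ht7, hrow⟩, hF7⟩
  simp only [wp, evs, tf]
  have hsR7 : σ7.v .sR = sR := by rw [hF7.v _ rfl, hsR6]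
  rw [hsR7]
  obtain ⟨σ8, hσ8⟩ : ∃ σ8, σ8 = σ7.set .pu sR := ⟨_, rfl⟩
  rw [← hσ8]
  have hv8 : ∀ x, table.modV x = false → x ≠ .pu → σ8.v x = σ6.v x := fun x hx hx' => by
    rw [hσ8, ← hF7.v x hx]; simp [hx']
  have hA8 : ∀ a, table.modA a = false → σ8.A a = σ6.A a := fun a ha => by
    rw [hσ8, ← hF7.A a ha]; simp
  have hs8 : SameP σ6 σ8 := ⟨hv8 _ rfl (by simp), hv8 _ rfl (by simp), hv8 _ rfl (by simp), hA8 _ rfl, hA8 _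
    rfl,
    hA8 _ rfl, hA8 _ rfl, hA8 _ rfl⟩
  have hps8 : σ8.v .ps = σ6.v .ps := hv8 _ rfl (by simp)
  have hpu8 : σ8.v .pu = sR := by rw [hσ8]; simp
  have hW8 := hs8.words hW6
  have hsRw : σ6.wd sR = pre (GS.valT S) := by
    have := hDS.lw
    rw [← hsR, gr_lw] at this
    rw [St.wd, hx.wd (by rw [hsR]; exact hDS.l.le)]
    exact this
  have hsR0 : 0 < sR := by
    rw [Nat.pos_iff_ne_zero]
    rintro h0
    rw [h0, St.wd, wd_zero] at hsRw
    exact pre_ne_nil _ hsRw.symm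
  have hsRps : sR ≤ σ6.v .ps := by rw [hps6, hsR]; exact hDS.l.le
  have hready : Ready E GT T (GS.valT S) GS.size (2 ^ e) σ8 := by
    refine ⟨hW8.sz, by rw [hv8 _ rfl (by simp), h6.vgo], by rw [hv8 _ rfl (by simp), h6.tEnd], ?_, ?_,
      by rw [hpu8]; exact hsR0, by rw [hpu8, hps8]; exact hsRps, ?_, hW8.ppool, fun N => ?_, fun N => ?_⟩
    · rw [hs8.L, hs8.R, hs8.len, hps8, hs8.nn]; exact hC
    · rw [hs8.L, hs8.R, hps8, hs8.nn, hpu8]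
      intro k h1 h2
      rw [hσ8]
      exact hrow sR hsR0 hsRps k h1 h2
    · rw [hpu8, St.wd, hs8.L, hs8.R]; exact hsRw
    · refine (h6.holds N).congr fun a ha => ?_
      rcases of_decide_eq_true ha with rfl | rfl | rfl | rfl | rfl | rfl <;> exact hA8 _ rfl
    · rw [hA8 .st rfl]
      refine (h6.done N).imp_left fun h => ⟨h.1, h.2.1, ?_⟩
      rw [hps8, hps6]
      exact h.2.2.ext hs8.ext (by rw [hA8 _ rfl]) (by rw [hA8 _ rfl]) (by rw [hA8 _ rfl])
  refine WP_cut _ (reportAll_spec σ8 hready (by rw [hs8.np]; omega) (by omega)) ?_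
  rintro σ9 t9 ⟨ht9, hr9, -, hnp9, fl, sl, hl⟩
  refine (output_spec σ9 hl hr9.ppool hr9.sz (by rw [hs8.np] at hnp9; omega)).mono ?_
  rintro σ' t ⟨ht, hret, hlen, hout⟩
  have hll := hl.len
  rw [hs8.np] at hnp9
  rw [hs8.nn, hps8] at ht9
  refine ⟨_, hl.correct hr9.ppool, by simp [outputOf]; omega, by change σ9.v .np ≤ _; omega, ?_, hret, hlen,
    hout⟩
  have hst := steps_le (r := r) (a := GS.size) (b := GT.size) (u := σ6.v .ps) (v := σ6.v .nn - σ6.v .ps)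
    (n := GT.nT) (p := σ9.v .np) (by omega) (by omega) (by omega) (by omega) (by omega) (by omega)
  refine le_trans ?_ hst
  clear hst
  linarith only [ht1, ht2, ht4, ht6, ht7, ht9, ht]

end Submatch

namespace Submatch

/-! ### The initial state and the length of words -/

variable {F : Sig} {G : STG F} {E : Env}

/-- The initial state of the structured program. -/
def initSt (input : List ℕ) : St := ⟨fun _ => 0, fun a k => if a = .inp then input.getD k 0 else 0⟩

/-- The input is stored in the block number 0, which is that of the array `inp`; all other cells contain
0. -/
theorem rel_init {input : List ℕ} (h : input.length ≤ E.SZ) (hlt : ∀ x ∈ input, x < E.M) :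
    Rel E (RAMState.init input) (initSt input) := by
  have hw := E.hw
  refine ⟨fun _ => rfl, fun a k hk => ?_, fun _ => by simp [initSt]; omega, fun a k hk => ?_⟩
  · by_cases ha : a = .inp
    · subst ha
      have h0 : Arr.inp.idx = 0 := rfl
      simp [RAMState.init, initSt, h0]
    · have h0 : 0 < a.idx := Nat.pos_of_ne_zero fun h0 => ha (Arr.idx_inj h0)
      have := Nat.le_mul_of_pos_left E.SZ h0
      simp only [RAMState.init, initSt, if_neg ha]
      exact List.getD_eq_default _ _ (by omega)
  · simp only [initSt]
    split_ifs
    · rcases lt_or_ge k input.length with h' | h'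
      · simp_all
      · rw [List.getD_eq_default _ _ h']; omega
    · omega

theorem reads_init (input : List ℕ) : Reads (initSt input) 0 input := by
  intro i v h
  simp [initSt, List.getD, h]

/-- Words of `3 e + 20` bits are enough for the lengths of words, up to `2 ^ e`, and for the addresses
of 32 blocks with `100 e²` cells each. -/
theorem pow_bounds {e w : ℕ} (h : 3 * e + 20 ≤ w) :
    32 < 2 ^ w ∧ 32 * (100 * e * e) ≤ 2 ^ w ∧ 16 * 2 ^ e + 16 < 2 ^ w := by
  have h1 : 2 ^ (3 * e + 20) ≤ 2 ^ w := Nat.pow_le_pow_right (by norm_num) h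
  obtain ⟨x, hx⟩ : ∃ x, x = 2 ^ e := ⟨_, rfl⟩
  have he : e ≤ x := hx ▸ Nat.lt_two_pow_self.le
  have hx0 : 0 < x := hx ▸ by positivity
  have e1 : 2 ^ (3 * e + 20) = 1048576 * (x * x * x) := by rw [hx]; ring
  have hxx : x * x ≤ x * x * x := Nat.le_mul_of_pos_right _ hx0
  have hx1 : x ≤ x * x := Nat.le_mul_of_pos_right _ hx0
  have hee : e * e ≤ x * x := Nat.mul_le_mul he he
  rw [← hx]
  refine ⟨by omega, ?_, by omega⟩
  rw [Nat.mul_assoc 100]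
  omega

end Submatch

open Submatch in
theorem mainTheorem6 :
    ∃ prog : RAMProg, ∀ r : ℕ, ∃ c : ℕ, ∀ F : Sig, (∀ f, F.arity f ≤ r) →
      ∀ (GS GT : STG F) (S : Fin GS.nT) (T : Fin GT.nT),
        ∃ (O : SubmatchOutput GT) (time : ℕ) (σ : RAMState),
          RAMExec (c * (GS.size + GT.size + Nat.size F.card)) prog
            (RAMState.init (GS.encode S ++ GT.encode T)) time σ ∧
          time ≤ c * (GT.size ^ 2 * GS.size) ∧
          σ.HasOutput O.encode ∧
          O.Correct (GS.valT S) T ∧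
          O.full.length + O.split.length ≤ GT.size ∧
          O.pos.n ≤ c * GT.size ^ 2 := by
  refine ⟨main.compile, fun r => ⟨main.cost * stepFactor r + (3 * (r + 7) + 20), fun F hF GS GT S T => ?_⟩⟩
  obtain ⟨c, hc⟩ : ∃ c, c = main.cost * stepFactor r + (3 * (r + 7) + 20) := ⟨_, rfl⟩
  rw [← hc]
  obtain ⟨w, hw⟩ : ∃ w, w = c * (GS.size + GT.size + Nat.size F.card) := ⟨_, rfl⟩
  rw [← hw]
  have hS : 0 < GS.size := Nat.lt_of_lt_of_le (Nat.zero_lt_of_lt S.2) (Nat.le_add_right ..)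
  have hT : 0 < GT.size := Nat.lt_of_lt_of_le (Nat.zero_lt_of_lt T.2) (Nat.le_add_right ..)
  obtain ⟨e, he⟩ : ∃ e, e = (GS.encode S).length + (GT.encode T).length := ⟨_, rfl⟩
  have heS := encode_length_le hF S
  have heT := encode_length_le hF T
  have hew : 3 * e + 20 ≤ w := by
    have h1 : 3 * (r + 7) + 20 ≤ c := by omega
    have h2 : (3 * (r + 7) + 20) * (GS.size + GT.size) ≤ w := by
      rw [hw]; exact Nat.mul_le_mul h1 (Nat.le_add_right ..)
    nlinarith
  have hcw : ∀ n, n ≤ GS.size + GT.size + Nat.size F.card → n < 2 ^ w := fun n hn => by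
    have h1 : 1 * (GS.size + GT.size + Nat.size F.card) ≤ w := by
      rw [hw]; exact Nat.mul_le_mul_right _ (by omega)
    exact Nat.lt_two_pow_self.trans_le (Nat.pow_le_pow_right (by norm_num) (by omega))
  have hcard : F.card ≤ 2 ^ w := by
    have h1 : 1 * Nat.size F.card ≤ w := by
      rw [hw]; exact Nat.mul_le_mul (by omega) (Nat.le_add_left ..)
    exact (Nat.lt_size_self _).le.trans (Nat.pow_le_pow_right (by norm_num) (by omega))
  have hr : r < 2 ^ w := by
    have h1 : c * 1 ≤ w := by rw [hw]; exact Nat.mul_le_mul_left _ (by omega)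
    exact Nat.lt_two_pow_self.trans_le (Nat.pow_le_pow_right (by norm_num) (by omega))
  obtain ⟨b1, b2, b3⟩ := pow_bounds hew
  obtain ⟨E, hE⟩ : ∃ E : Env, E = ⟨w, 100 * e * e, 2 ^ w, rfl, b1, b2⟩ := ⟨_, rfl⟩
  have hEw : E.w = w := by rw [hE]
  have hEM : E.M = 2 ^ w := by rw [hE]
  have hESZ : E.SZ = 100 * e * e := by rw [hE]
  -- both encodings have three entries in front of the productions, so that blocks are longer than the input
  have he1 : 3 ≤ e := by rw [he, encode_eq]; simp; omega
  have hq : 100 * e ≤ 100 * e * e := Nat.le_mul_of_pos_right _ (by omega)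
  have hrel : Rel E (RAMState.init (GS.encode S ++ GT.encode T)) (initSt (GS.encode S ++ GT.encode T)) := by
    refine rel_init (by rw [List.length_append]; omega) fun x hx => ?_
    rw [hEM]
    rcases List.mem_append.1 hx with hx | hx
    · exact mem_encode hF ⟨hr, hcard, hcw _ (by omega), by omega⟩ S x hx
    · exact mem_encode hF ⟨hr, hcard, hcw _ (by omega), by omega⟩ T x hx
  obtain ⟨t, σ', hrun, O, h1, h2, h3, h4, h5, h6, h7⟩ := main_spec (E := E) S T hF he hESZ
    (by rw [hEM]; exact b3) (by rw [hEM]; exact hcard) (initSt (GS.encode S ++ GT.encode T)) (fun _ => rfl)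
    (fun a ha _ => if_neg ha) (reads_init _)
  obtain ⟨t', ρ, hexec, hR, ht'⟩ := hrun.compile _ hrel
  rw [hEw] at hexec
  refine ⟨O, t', ρ, hexec, ?_, fun i hi => ?_, h1, h2, ?_⟩
  · calc t' ≤ main.cost * t := ht'
      _ ≤ main.cost * (stepFactor r * (GT.size ^ 2 * GS.size)) := Nat.mul_le_mul_left _ h4
      _ = main.cost * stepFactor r * (GT.size ^ 2 * GS.size) := (Nat.mul_assoc ..).symm
      _ ≤ c * (GT.size ^ 2 * GS.size) := Nat.mul_le_mul_right _ (by omega)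
  -- the output is stored from the address in register 0 on, the register of `ret`
  · have hreg : ρ.reg 0 = Arr.out.idx * E.SZ := (hR.reg .ret).trans h5
    rw [hreg, hR.mem .out i (by omega), h7 i hi]
  · have hn : GT.nT ≤ GT.size := Nat.le_add_right ..
    have h8 : (r + 5) * GT.size ^ 2 ≤ c * GT.size ^ 2 := Nat.mul_le_mul_right _ (by omega)
    have h9 : GT.nT * (GT.size + 1) ≤ GT.size * (GT.size + 1) := Nat.mul_le_mul_right _ hn
    have h10 : (r + 4) * GT.size ≤ (r + 4) * GT.size ^ 2 :=
      Nat.mul_le_mul_left _ (Nat.le_self_pow two_ne_zero _)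
    nlinarith
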